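/- **Setting.** Let $n\ge 1$ and $d\ge 0$. A circuit of depth $d$ on $n$ qubits has layers $U_1,\dots,U_d$ (numbered in reverse time order), each $U_t$ being a tensor product of arbitrary two-qubit unitary gates on disjoint pairs of qubits and of the identity on the remaining (idle) qubits. For a rate $0<\gamma_s\le 4/7$, spontaneous emission on a qubit in direction $+$ or $-$ is the map $$\mathcal A_+\{\rho\}=\rho+\gamma_s\,|0\rangle\langle 1|\rho|1\rangle\langle 0|-\tfrac{\gamma_s}{2}|1\rangle\langle 1|\rho-\tfrac{\gamma_s}{2}\rho|1\rangle\langle 1|,\qquad \mathcal A_-\{\rho\}=\rho+\gamma_s\,|1\rangle\langle 0|\rho|0\rangle\langle 1|-\tfrac{\gamma_s}{2}|0\rangle\langle 0|\rho-\tfrac{\gamma_s}{2}\rho|0\rangle\langle 0|.$$ The noisy circuit with directions $s\in\{+,-\}^{\{0,\dots,d\}\times\{1,\dots,n\}}$ is $$\mathcal C_s\{\rho\}=\mathcal N_0\{U_1\,\mathcal N_1\{\cdots U_d\,\mathcal N_d\{\rho\}\,U_d^\dagger\cdots\}\,U_1^\dagger\},$$ where $\mathcal N_0$ applies $\mathcal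 A_{s_{0,j}}$ to every qubit $j$ (read-out noise), and $\mathcal N_t$, for $t\ge 1$, applies $\mathcal A_{s_{t,j}}$ to every qubit $j$ (*uniform noise*), respectively to every qubit $j$ that belongs to a gate of $U_t$ (*gate-based noise*). Put $\gamma=\log\bigl(1/(1-\gamma_s/2)\bigr)$. Let $O$ be a normalized observable, $O=O^\dagger$ and $2^{-n}\operatorname{tr}(O^\dagger O)=1$, and let $\mathcal E=\{\rho_1,\dots,\rho_N\}$, $N\ge1$, be a low-average ensemble of states with purity $c$, that is, $\lVert\frac1N\sum_i\rho_i\rVert_\infty\le c/2^n$. The task is to compute $\operatorname{tr}(\mathcal C_s\{\rho_i\}O)$ when the circuit, the directions $s$, the numbers $\gamma_s$ and $0<\varepsilon<1$, the observable and the state are given; the Pauli coefficients $2^{-n}\operatorname{tr}(OP)$ and $\operatorname{tr}(\rho_i P)$, the gate positions and the gate entries can each be read in unit time. Running time is the number of steps of a uniform real-RAM program (unit-cost exact real field operations and comparisons; addition and subtraction of natural numbers; indirect addressing). It is bounded for every $s$ and every $\rho_i$. An algorithm has *error $\delta$* if its root-mean-square error is at most $\delta$, where the mean is taken over the states of $\mathcal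 E$ and over independent uniformly random directions $s$. All constants implied by $\mathcal O(\cdot)$ and $\mathrm{poly}(\cdot)$ below are universal. **Theorem.** There are classical algorithms with error $\sqrt c\,\varepsilon$ and the following running times. 1. *(Uniform noise.)* For all circuits with uniform noise, * $\mathrm{poly}(n,m)\cdot(1/\varepsilon)^{\mathcal O(\log(1/\gamma)/\gamma^2)}$ if $O$ is given as a sum of $m$ real multiples of Pauli operators (hence $\mathrm{poly}(n)\cdot(1/\varepsilon)^{\mathcal O(\log(1/\gamma)/\gamma^2)}$ if $m=\mathrm{poly}(n)$); * $n^{\mathcal O(\log(1/\gamma)/\gamma)+\mathcal O(\log(1/\varepsilon)/\gamma)}\cdot(1/\varepsilon)^{\mathcal O(\log(1/\gamma)/\gamma^2)}$ for any $O$. 2. *(Gate-based noise.)* For all circuits with gate-based noise and $d\ge1$, and any $O$, $\ \mathcal O\bigl(d\cdot n^{\frac1\gamma\log(\sqrt{d+1}/\varepsilon)-1}\bigr)$. 3. *(Random circuits, uniform noise.)* Let the positions of the gates be arbitrary and fixed, and let the gates be independent and random, each with a law that is invariant under left and right multiplication by two-qubit Pauli operators (for example Haar-random). If the mean in the error is taken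 over the gates too, the running times improve to * $\mathrm{poly}(n,m)\cdot(1/\varepsilon)^{\mathcal O(1/\gamma)}$ if $O$ is given as a sum of $m$ real multiples of Pauli operators; * $\mathcal O\bigl(n^{\frac1\gamma\log(1/\varepsilon)}\cdot(1/\varepsilon)^{\mathcal O(1/\gamma)}\bigr)$ for any $O$. Here the directions $s_{t,j}$ for which $t\ge1$ and qubit $j$ belongs to a gate of $U_t$ may even be prescribed arbitrarily (independently of the gates); only the directions at read-out and on idle qubits need to be random. -/

import Mathlib

open scoped Matrix Kronecker ComplexOrder
open MeasureTheory

/-! ## Qubits, Pauli strings, circuits and noise -/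

namespace NoisyCircuit

/-- Complex matrices on `n` qubits, indexed by bit strings (`0` is `|0⟩`, `1` is `|1⟩`). -/
abbrev QMat (n : ℕ) := Matrix (Fin n → Fin 2) (Fin n → Fin 2) ℂ

/-- The single-qubit Pauli matrices `1, X, Y, Z`, numbered `0, 1, 2, 3`. -/
noncomputable def sigma : Fin 4 → Matrix (Fin 2) (Fin 2) ℂ :=
  ![1, !![0, 1; 1, 0], !![0, -Complex.I; Complex.I, 0], !![1, 0; 0, -1]]

/-- The `n`-qubit Pauli string `⨂ⱼ σ_{P j}`. -/
noncomputable def pauli {n : ℕ} (P : Fin n → Fin 4) : QMat n :=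
  Matrix.of fun x y => ∏ j, sigma (P j) (x j) (y j)

/-- The operator `|a⟩⟨b|` on qubit `j`, and the identity on all other qubits. -/
noncomputable def siteUnit {n : ℕ} (j : Fin n) (a b : Fin 2) : QMat n :=
  Matrix.of fun x y => if x j = a ∧ y j = b ∧ ∀ k, k ≠ j → x k = y k then 1 else 0

/-- Spontaneous emission with rate `g` on qubit `j`, emitting into the state `|s⟩` from the other
state `|s + 1⟩`: `s = 0` is `𝒜₊` (from 1 to 0), `s = 1` is `𝒜₋` (from 0 to 1). -/
noncomputable def emission {n : ℕ} (g : ℝ) (j : Fin n) (s : Fin 2) (ρ : QMat n) : QMat n :=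
  ρ + (g : ℂ) • (siteUnit j s (s + 1) * ρ * siteUnit j (s + 1) s)
    - ((g : ℂ) / 2) • (siteUnit j (s + 1) (s + 1) * ρ)
    - ((g : ℂ) / 2) • (ρ * siteUnit j (s + 1) (s + 1))

/-- Spontaneous emission on each qubit of `S`, in the direction `s j` on qubit `j`. (Maps on
different qubits commute.) -/
noncomputable def noise {n : ℕ} (g : ℝ) (S : Finset (Fin n)) (s : Fin n → Fin 2) (ρ : QMat n) :
    QMat n :=
  (List.finRange n).foldr (fun j σ => if j ∈ S then emission g j (s j) σ else σ) ρ

/-- A two-qubit gate. -/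
abbrev TwoQubitGate := ↥(Matrix.unitaryGroup (Fin 2 × Fin 2) ℂ)

/-- The placement of two-qubit gates in a circuit of depth `d` on `n` qubits. In layer `t` (layers
are numbered in reverse time order, `t = 0` being applied last) there is a gate on the qubits `j`
and `partner t j` whenever these are different; a qubit with `partner t j = j` is idle. -/
structure Architecture (n d : ℕ) where
  partner : Fin d → Fin n → Fin n
  involutive : ∀ t, Function.Involutive (partner t)

/-- A choice of gates: the gate on the pair `{j, partner t j}` is the one listed at its smaller
qubit, which is also the first tensor factor; all other entries are ignored. -/
abbrev Gates (n d : ℕ) := Fin d → Fin n → TwoQubitGate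

/-- Directions of all noise channels. Index `0` is the read-out noise, index `t + 1` the noise
attached to layer `t`. -/
abbrev Directions (n d : ℕ) := Fin (d + 1) → Fin n → Fin 2

/-- The depth-one unitary of layer `t`: the tensor product of its gates, and of the identity on
the idle qubits. -/
noncomputable def layerUnitary {n d : ℕ} (A : Architecture n d) (U : Gates n d) (t : Fin d) :
    QMat n :=
  Matrix.of fun x y => ∏ j,
    if j < A.partner t j then
      (U t j : Matrix (Fin 2 × Fin 2) (Fin 2 × Fin 2) ℂ)
        (x j, x (A.partner t j)) (y j, y (A.partner t j))
    else if A.partner t j = j then (if x j = y j then 1 else 0)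
    else 1

/-- Uniform noise acts on every qubit at every layer, gate-based noise only on the qubits that
take part in a gate of the layer. Read-out noise acts on all qubits in both models. -/
inductive NoiseModel
  | uniform
  | gateBased

/-- The qubits affected by the noise of layer `t`. -/
def noisyQubits {n d : ℕ} (A : Architecture n d) (t : Fin d) : NoiseModel → Finset (Fin n)
  | .uniform => Finset.univ
  | .gateBased => Finset.univ.filter fun j => A.partner t j ≠ j

/-- The noisy circuit
`𝒞{ρ} = 𝒜₀{U₁ 𝒜₁{ ⋯ U_d 𝒜_d{ρ} U_dᴴ ⋯ } U₁ᴴ}` with noise rate `g` and noise directions `s`. -/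
noncomputable def circuit {n d : ℕ} (model : NoiseModel) (A : Architecture n d) (U : Gates n d)
    (g : ℝ) (s : Directions n d) (ρ : QMat n) : QMat n :=
  noise g Finset.univ (s 0) <|
    (List.finRange d).foldr
      (fun t σ => layerUnitary A U t * noise g (noisyQubits A t model) (s t.succ) σ
        * (layerUnitary A U t)ᴴ) ρ

/-- The strength `γ = log (1 / (1 - γ_s / 2))` attached to the emission rate `γ_s`. -/
noncomputable def strength (g : ℝ) : ℝ := Real.log (1 / (1 - g / 2))

/-- An observable of normalized Frobenius norm one, `2⁻ⁿ tr (Oᴴ O) = 1`. -/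
def IsNormalizedObservable {n : ℕ} (O : QMat n) : Prop :=
  O.IsHermitian ∧ (Oᴴ * O).trace / 2 ^ n = 1

/-- A nonempty finite ensemble of quantum states which is low-average with purity `c`, that is
`‖(1/N) ∑ᵢ ρᵢ‖_∞ ≤ c / 2ⁿ` in operator norm. -/
def IsLowAverage {n N : ℕ} (ρ : Fin N → QMat n) (c : ℝ) : Prop :=
  0 < N ∧ (∀ i, (ρ i).PosSemidef ∧ (ρ i).trace = 1) ∧
    ‖Matrix.toEuclideanCLM (𝕜 := ℂ) ((1 / (N : ℂ)) • ∑ i, ρ i)‖ ≤ c / 2 ^ n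

/-! ## Random gates -/

noncomputable instance : MeasurableSpace TwoQubitGate := borel _

instance : BorelSpace TwoQubitGate := ⟨rfl⟩

/-- A law on two-qubit gates that is invariant under left and right multiplication by two-qubit
Pauli matrices. The Haar measure is an example. -/
def IsPauliInvariant (ν : Measure TwoQubitGate) : Prop :=
  ∀ (V : TwoQubitGate) (a b : Fin 4),
    (V : Matrix (Fin 2 × Fin 2) (Fin 2 × Fin 2) ℂ) = sigma a ⊗ₖ sigma b →
      ν.map (fun W => V * W) = ν ∧ ν.map (fun W => W * V) = ν

/-- The law of independent gates. -/
noncomputable def gatesLaw {n d : ℕ} (ν : Fin d → Fin n → Measure TwoQubitGate) :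
    Measure (Gates n d) :=
  Measure.pi fun t => Measure.pi fun j => ν t j

/-- Prescribe the noise direction to be `s₀` at every noise location that directly follows a gate
in the Heisenberg picture (the noise of layer `t` on a qubit in a gate of layer `t`), and keep
`s` at all others (read-out and idle qubits). -/
def prescribe {n d : ℕ} (A : Architecture n d) (s₀ s : Directions n d) : Directions n d :=
  Fin.cons (s 0) fun t j => if A.partner t j ≠ j then s₀ t.succ j else s t.succ j

/-! ## The machine model: a real RAM with unit-cost instructions

Programs handle natural numbers and real numbers, each in numbered registers and in an
indirectly addressed memory. Natural numbers can only be added and subtracted; real numbers are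
exact and admit the four field operations and comparison; there is no rounding of real numbers.
The input is read through unit-cost queries. -/

structure State where
  /-- Registers for natural numbers. -/
  N : ℕ → ℕ
  /-- Memory for natural numbers. -/
  M : ℕ → ℕ
  /-- Registers for real numbers. -/
  R : ℕ → ℝ
  /-- Memory for real numbers. -/
  S : ℕ → ℝ

/-- The read-only input: numbered tables, whose arguments are read from consecutive memory
cells. -/
structure Oracle where
  nat : ℕ → (ℕ → ℕ) → ℕ
  real : ℕ → (ℕ → ℕ) → ℝ

inductive Instr
  /-- `N[x] := k` -/
  | constN (x k : ℕ)
  /-- `N[x] := N[y] + N[z]` -/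
  | addN (x y z : ℕ)
  /-- `N[x] := N[y] - N[z]`, truncated at zero -/
  | subN (x y z : ℕ)
  /-- `N[x] := M[N[y]]` -/
  | loadN (x y : ℕ)
  /-- `M[N[x]] := N[y]` -/
  | storeN (x y : ℕ)
  /-- `R[x] := N[y]` -/
  | castR (x y : ℕ)
  /-- `R[x] := R[y] + R[z]` -/
  | addR (x y z : ℕ)
  /-- `R[x] := R[y] - R[z]` -/
  | subR (x y z : ℕ)
  /-- `R[x] := R[y] * R[z]` -/
  | mulR (x y z : ℕ)
  /-- `R[x] := R[y] / R[z]` -/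
  | divR (x y z : ℕ)
  /-- `R[x] := S[N[y]]` -/
  | loadR (x y : ℕ)
  /-- `S[N[x]] := R[y]` -/
  | storeR (x y : ℕ)
  /-- `N[x] :=` entry of the `k`-th natural table at the arguments `M[N[y]], M[N[y] + 1], …` -/
  | queryN (x k y : ℕ)
  /-- `R[x] :=` entry of the `k`-th real table at the arguments `M[N[y]], M[N[y] + 1], …` -/
  | queryR (x k y : ℕ)

noncomputable def Instr.step (Q : Oracle) (σ : State) : Instr → State
  | .constN x k => { σ with N := Function.update σ.N x k }
  | .addN x y z => { σ with N := Function.update σ.N x (σ.N y + σ.N z) }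
  | .subN x y z => { σ with N := Function.update σ.N x (σ.N y - σ.N z) }
  | .loadN x y => { σ with N := Function.update σ.N x (σ.M (σ.N y)) }
  | .storeN x y => { σ with M := Function.update σ.M (σ.N x) (σ.N y) }
  | .castR x y => { σ with R := Function.update σ.R x (σ.N y : ℝ) }
  | .addR x y z => { σ with R := Function.update σ.R x (σ.R y + σ.R z) }
  | .subR x y z => { σ with R := Function.update σ.R x (σ.R y - σ.R z) }
  | .mulR x y z => { σ with R := Function.update σ.R x (σ.R y * σ.R z) }
  | .divR x y z => { σ with R := Function.update σ.R x (σ.R y / σ.R z) }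
  | .loadR x y => { σ with R := Function.update σ.R x (σ.S (σ.N y)) }
  | .storeR x y => { σ with S := Function.update σ.S (σ.N x) (σ.R y) }
  | .queryN x k y => { σ with N := Function.update σ.N x (Q.nat k fun i => σ.M (σ.N y + i)) }
  | .queryR x k y => { σ with R := Function.update σ.R x (Q.real k fun i => σ.M (σ.N y + i)) }

inductive Test
  /-- `N[x] < N[y]` -/
  | ltN (x y : ℕ)
  /-- `R[x] < R[y]` -/
  | ltR (x y : ℕ)

def Test.holds (σ : State) : Test → Prop
  | .ltN x y => σ.N x < σ.N y
  | .ltR x y => σ.R x < σ.R y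

inductive Program
  | skip
  | instr (i : Instr)
  | seq (p q : Program)
  | ite (b : Test) (p q : Program)
  | while (b : Test) (p : Program)

/-- `Exec Q p σ τ k`: on input `Q`, the program `p` started in the state `σ` halts in the state
`τ` after exactly `k` steps, each instruction and each evaluation of a test being one step. -/
inductive Exec (Q : Oracle) : Program → State → State → ℕ → Prop
  | skip (σ : State) : Exec Q .skip σ σ 0
  | instr (i : Instr) (σ : State) : Exec Q (.instr i) σ (i.step Q σ) 1
  | seq {p q : Program} {σ τ υ : State} {k l : ℕ} :
      Exec Q p σ τ k → Exec Q q τ υ l → Exec Q (.seq p q) σ υ (k + l)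
  | ite_true {b : Test} {p q : Program} {σ τ : State} {k : ℕ} :
      b.holds σ → Exec Q p σ τ k → Exec Q (.ite b p q) σ τ (k + 1)
  | ite_false {b : Test} {p q : Program} {σ τ : State} {k : ℕ} :
      ¬ b.holds σ → Exec Q q σ τ k → Exec Q (.ite b p q) σ τ (k + 1)
  | while_true {b : Test} {p : Program} {σ τ υ : State} {k l : ℕ} :
      b.holds σ → Exec Q p σ τ k → Exec Q (.while b p) τ υ l →
        Exec Q (.while b p) σ υ (k + l + 1)
  | while_false {b : Test} {p : Program} {σ : State} :
      ¬ b.holds σ → Exec Q (.while b p) σ σ 1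

/-- Initially `n`, `d`, `m` and the reals `ε`, `γ_s` are in the first registers, and everything
else is zero. -/
def start (n d m : ℕ) (ε g : ℝ) : State where
  N := fun x => if x = 0 then n else if x = 1 then d else if x = 2 then m else 0
  M := fun _ => 0
  R := fun x => if x = 0 then ε else if x = 1 then g else 0
  S := fun _ => 0

/-- The program halts within `T` steps and leaves the real number `r` in `R[0]`. -/
def Computes (p : Program) (Q : Oracle) (σ : State) (T r : ℝ) : Prop :=
  ∃ (τ : State) (k : ℕ), Exec Q p σ τ k ∧ (k : ℝ) ≤ T ∧ τ.R 0 = r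

/-- The Pauli string written in the cells `a 0, …, a (n - 1)`. -/
def readString (n : ℕ) (a : ℕ → ℕ) : Fin n → Fin 4 := fun j => Fin.ofNat 4 (a j)

/-- The tables through which a program reads an instance: the architecture, the noise directions,
an explicitly given list of weighted Pauli strings (possibly empty), the entries of the gates, and
the Pauli coefficients `2⁻ⁿ tr (O P)` of the observable and `tr (ρ P)` of the state. Arguments out
of range give `0`. -/
noncomputable def tables {n d m : ℕ} (A : Architecture n d) (U : Gates n d) (s : Directions n d)
    (O : QMat n) (w : Fin m → ℝ) (P : Fin m → Fin n → Fin 4) (ρ : QMat n) : Oracle where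
  nat := fun k a => match k with
    | 0 => if h : a 0 < d ∧ a 1 < n then (A.partner ⟨a 0, h.1⟩ ⟨a 1, h.2⟩ : ℕ) else 0
    | 1 => if h : a 0 < d + 1 ∧ a 1 < n then (s ⟨a 0, h.1⟩ ⟨a 1, h.2⟩ : ℕ) else 0
    | 2 => if h : a 0 < m ∧ a 1 < n then (P ⟨a 0, h.1⟩ ⟨a 1, h.2⟩ : ℕ) else 0
    | _ => 0
  real := fun k a => match k with
    | 0 => if h : a 0 < d ∧ a 1 < n then
        ((U ⟨a 0, h.1⟩ ⟨a 1, h.2⟩ : Matrix (Fin 2 × Fin 2) (Fin 2 × Fin 2) ℂ)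
          (Fin.ofNat 2 (a 2), Fin.ofNat 2 (a 3)) (Fin.ofNat 2 (a 4), Fin.ofNat 2 (a 5))).re else 0
    | 1 => if h : a 0 < d ∧ a 1 < n then
        ((U ⟨a 0, h.1⟩ ⟨a 1, h.2⟩ : Matrix (Fin 2 × Fin 2) (Fin 2 × Fin 2) ℂ)
          (Fin.ofNat 2 (a 2), Fin.ofNat 2 (a 3)) (Fin.ofNat 2 (a 4), Fin.ofNat 2 (a 5))).im else 0
    | 2 => ((O * pauli (readString n a)).trace / 2 ^ n).re
    | 3 => (ρ * pauli (readString n a)).trace.re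
    | 4 => if h : a 0 < m then w ⟨a 0, h⟩ else 0
    | _ => 0

/-! ## Success criteria -/

/-- The squared error `|out - tr (𝒞{ρᵢ} O)|²` averaged over the ensemble. -/
noncomputable def ensembleError {n d N : ℕ} (model : NoiseModel) (A : Architecture n d)
    (U : Gates n d) (g : ℝ) (s : Directions n d) (O : QMat n) (ρ : Fin N → QMat n)
    (out : Fin N → ℝ) : ℝ :=
  (1 / (N : ℝ)) * ∑ i, ‖(out i : ℂ) - (circuit model A U g s (ρ i) * O).trace‖ ^ 2

/-- For every instance of the noise directions and every state of the ensemble the program halts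
within `T` steps, and the root-mean-square error of its outputs, over the ensemble and over
independent uniformly random noise directions, is at most `δ`. -/
def Solves {n d m N : ℕ} (p : Program) (model : NoiseModel) (A : Architecture n d)
    (U : Gates n d) (g : ℝ) (O : QMat n) (w : Fin m → ℝ) (P : Fin m → Fin n → Fin 4)
    (ρ : Fin N → QMat n) (ε T δ : ℝ) : Prop :=
  ∃ out : Directions n d → Fin N → ℝ,
    (∀ s i, Computes p (tables A U s O w P (ρ i)) (start n d m ε g) T (out s i)) ∧
    Real.sqrt ((1 / (Fintype.card (Directions n d) : ℝ)) *
      ∑ s, ensembleError model A U g s O ρ (out s)) ≤ δ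

/-- The same for uniform noise and random gates of law `gatesLaw ν`. The error is averaged over
the gates too, and it is at most `δ` for every prescription of the noise directions at the noise
locations that are covered by a gate, the others being independent and uniformly random. -/
def SolvesRandom {n d m N : ℕ} (p : Program) (A : Architecture n d)
    (ν : Fin d → Fin n → Measure TwoQubitGate) (g : ℝ) (O : QMat n) (w : Fin m → ℝ)
    (P : Fin m → Fin n → Fin 4) (ρ : Fin N → QMat n) (ε T δ : ℝ) : Prop :=
  ∃ out : Gates n d → Directions n d → Fin N → ℝ,
    (∀ U s i, Computes p (tables A U s O w P (ρ i)) (start n d m ε g) T (out U s i)) ∧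
    ∀ s₀ : Directions n d,
      ∫⁻ U, ENNReal.ofReal ((1 / (Fintype.card (Directions n d) : ℝ)) *
        ∑ s, ensembleError .uniform A U g (prescribe A s₀ s) O ρ (out U (prescribe A s₀ s)))
          ∂(gatesLaw ν) ≤ ENNReal.ofReal (δ ^ 2)

end NoisyCircuit

namespace NoisyCircuit

open Finset Function Matrix Real

noncomputable section

variable {n d : ℕ} {g : ℝ} {O : QMat n} {j : Fin n} {q : Fin n → Fin n} {p : ℕ → Fin n → Fin n}

/-! ## Products over the pairs of an involution -/

theorem prod_eq_prod_pairs {R : Type*} [CommMonoid R] {p : Fin n → Fin n}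
    (hp : Involutive p) (φ : Fin n → R) :
    ∏ j, φ j = ∏ j, if j < p j then φ j * φ (p j) else if p j = j then φ j else 1 := by
  have h1 : ∀ j, φ j = (if j < p j then φ j else 1) * (if p j = j then φ j else 1)
      * (if p j < j then φ j else 1) := by
    intro j
    rcases lt_trichotomy j (p j) with h | h | h
    · simp [h, h.ne', h.not_gt]
    · simp [← h]
    simp [h, h.ne, h.not_gt]
  have h2 : ∏ j, (if p j < j then φ j else 1) = ∏ j, (if j < p j then φ (p j) else 1) := by
    rw [← Equiv.prod_comp hp.toPerm]
    refine prod_congr rfl fun j _ => ?_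
    simp [hp j]
  rw [prod_congr rfl fun j _ => h1 j, prod_mul_distrib, prod_mul_distrib, h2,
    ← prod_mul_distrib, ← prod_mul_distrib]
  refine prod_congr rfl fun j _ => ?_
  rcases lt_trichotomy j (p j) with h | h | h
  · simp [h, h.ne']
  · simp [← h]
  simp [h.ne, h.not_gt]

theorem sum_prod_pairs {R α : Type*} [CommSemiring R] [Fintype α] [DecidableEq α]
    [Inhabited α] {p : Fin n → Fin n} (hp : Involutive p) (F : Fin n → α → α → R)
    (G : Fin n → α → R) : (∑ x : Fin n → α, ∏ j, if j < p j then F j (x j) (x (p j)) else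
      if p j = j then G j (x j) else 1) =
    ∏ j, if j < p j then ∑ a, ∑ b, F j a b else if p j = j then ∑ a, G j a else 1 := by
  let t : Fin n → Finset (α × α) := fun j =>
    if j < p j then univ else if p j = j then univ.filter (fun y => y.1 = y.2)
    else {default}
  let f : Fin n → α × α → R := fun j y =>
    if j < p j then F j y.1 y.2 else if p j = j then G j y.1 else 1
  have hR : (∏ j, if j < p j then ∑ a, ∑ b, F j a b else if p j = j then ∑ a, G j a else 1)
      = ∏ j, ∑ y ∈ t j, f j y := by
    refine prod_congr rfl fun j _ => ?_
    by_cases h1 : j < p j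
    · simp [t, f, h1, Fintype.sum_prod_type]
    by_cases h2 : p j = j
    · simp [t, f, h2, sum_filter, Fintype.sum_prod_type]
    simp [t, f, h1, h2]
  rw [hR, prod_univ_sum]
  refine sum_bij' (fun x _ j => if j < p j ∨ p j = j then (x j, x (p j)) else default)
    (fun y _ j => if j < p j ∨ p j = j then (y j).1 else (y (p j)).2) ?_ ?_ ?_ ?_ ?_
  · intro x _
    rw [Fintype.mem_piFinset]
    intro j
    by_cases h1 : j < p j
    · simp [t, h1]
    by_cases h2 : p j = j
    · simp [t, h2]
    simp [t, h1, h2]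
  · simp_all
  · intro x _
    funext j
    by_cases h : j < p j ∨ p j = j
    · simp [h]
    have h' : p j < j := by
      push Not at h
      exact lt_of_le_of_ne h.1 h.2
    simp [h, h', hp j]
  · intro y hy
    rw [Fintype.mem_piFinset] at hy
    funext j
    have hyj := hy j
    by_cases h1 : j < p j
    · have : ¬ (p j < j ∨ j = p j) := by
        rintro (h | h)
        · exact absurd h h1.not_gt
        exact absurd h h1.ne
      simp [h1, hp j, this]
    by_cases h2 : p j = j
    · simp only [t, h2, lt_irrefl, if_false, if_true, mem_filter] at hyj
      simp [h2, hyj.2, Prod.ext_iff]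
    simp only [t, h1, h2, if_false, mem_singleton] at hyj
    simp_all
  intro x _
  refine prod_congr rfl fun j _ => ?_
  aesop

/-! ## Pauli matrices -/

abbrev Str (n : ℕ) := Fin n → Fin 4

/-- Real functions of Pauli strings. -/
abbrev Vec (n : ℕ) := Str n → ℝ

/-- Real kernels on Pauli strings. -/
abbrev Ker (n : ℕ) := Str n → Str n → ℝ

abbrev Mat4 := Matrix (Fin 2 × Fin 2) (Fin 2 × Fin 2) ℂ

variable {P : Str n} {K : Ker n} {gk : ℕ → Ker n}

theorem sigma_hermitian (a : Fin 4) : (sigma a)ᴴ = sigma a := by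
  fin_cases a <;> ext i j <;> fin_cases i <;> fin_cases j <;> simp [sigma]

theorem star_sigma (a : Fin 4) (x y : Fin 2) : star (sigma a x y) = sigma a y x := by
  conv_rhs => rw [← sigma_hermitian a]
  rfl

theorem sigma_complete (x y z w : Fin 2) :
    ∑ a, sigma a x y * sigma a z w = if x = w ∧ y = z then 2 else 0 := by
  fin_cases x <;> fin_cases y <;> fin_cases z <;> fin_cases w <;>
    simp [sigma, Fin.sum_univ_four] <;> norm_num

theorem sigma_trace (a b : Fin 4) :
    ∑ x, ∑ y, sigma a x y * sigma b y x = if a = b then 2 else 0 := by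
  fin_cases a <;> fin_cases b <;> simp [sigma, Fin.sum_univ_two] <;> norm_num

theorem pauli_hermitian (P : Str n) : (pauli P)ᴴ = pauli P := by
  ext x y
  simp only [pauli, conjTranspose_apply, of_apply, star_prod, star_sigma]

theorem sum_pauli_mul_pauli (x y z w : Fin n → Fin 2) :
    ∑ P : Str n, pauli P x y * pauli P z w = if x = w ∧ y = z then 2 ^ n else 0 := by
  have h : ∀ P : Str n, pauli P x y * pauli P z w
      = ∏ j, sigma (P j) (x j) (y j) * sigma (P j) (z j) (w j) := by
    intro P
    simp [pauli, prod_mul_distrib]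
  have h2 := prod_univ_sum (fun _ : Fin n => (univ : Finset (Fin 4)))
    (fun j a => sigma a (x j) (y j) * sigma a (z j) (w j))
  rw [Fintype.piFinset_univ] at h2
  rw [sum_congr rfl fun P _ => h P, ← h2]
  simp only [sigma_complete]
  split_ifs with hxy
  · simp_all
  have : ∃ j, ¬ (x j = w j ∧ y j = z j) := by
    by_contra hc
    push Not at hc
    exact hxy ⟨funext fun j => (hc j).1, funext fun j => (hc j).2⟩
  obtain ⟨j, hj⟩ := this
  exact prod_eq_zero (mem_univ j) (by simp [hj])

theorem trace_pauli_mul_pauli (P Q : Str n) :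
    (pauli P * pauli Q).trace = if P = Q then 2 ^ n else 0 := by
  have h1 : (pauli P * pauli Q).trace = ∑ x : Fin n → Fin 2, ∑ y : Fin n → Fin 2,
      ∏ j, sigma (P j) (x j) (y j) * sigma (Q j) (y j) (x j) := by
    simp [trace, mul_apply, pauli, prod_mul_distrib]
  have h2 := fun x : Fin n → Fin 2 =>
    prod_univ_sum (fun _ : Fin n => (univ : Finset (Fin 2)))
    (fun j y => sigma (P j) (x j) y * sigma (Q j) y (x j))
  have h3 := prod_univ_sum (fun _ : Fin n => (univ : Finset (Fin 2)))
    (fun j x => ∑ y, sigma (P j) x y * sigma (Q j) y x)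
  simp only [Fintype.piFinset_univ] at h2 h3
  rw [h1, sum_congr rfl fun x _ => (h2 x).symm, ← h3]
  simp only [sigma_trace]
  split_ifs with h
  · simp_all
  obtain ⟨j, hj⟩ := ne_iff.mp h
  exact prod_eq_zero (mem_univ j) (by simp [hj])

theorem pauli_expansion (O : QMat n) :
    O = ∑ P : Str n, ((O * pauli P).trace / 2 ^ n) • pauli P := by
  ext x y
  have h : ∀ P : Str n, (O * pauli P).trace / 2 ^ n * pauli P x y
      = ∑ z, ∑ w, O z w / 2 ^ n * (pauli P w z * pauli P x y) := by
    intro P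
    simp only [trace, Matrix.diag, mul_apply, sum_div, sum_mul]
    refine sum_congr rfl fun z _ => sum_congr rfl fun w _ => ?_
    ring
  simp only [Matrix.sum_apply, Matrix.smul_apply, smul_eq_mul, h]
  rw [sum_comm]
  simp_rw [sum_comm (s := (univ : Finset (Str n))), ← mul_sum, sum_pauli_mul_pauli]
  have h2 : ∀ z w : Fin n → Fin 2, O z w / 2 ^ n * (if w = y ∧ z = x then (2 : ℂ) ^ n else 0)
      = if z = x then (if w = y then O z w else 0) else 0 := by
    intro z w
    have : (2 : ℂ) ^ n ≠ 0 := by positivity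
    by_cases h1 : z = x <;> by_cases h2 : w = y <;> simp [h1, h2, this]
  simp [h2]

theorem trace_mul_real {ι : Type*} [Fintype ι] [DecidableEq ι] {A B : Matrix ι ι ℂ} (hA : Aᴴ = A)
    (hB : Bᴴ = B) : (((A * B).trace.re : ℝ) : ℂ) = (A * B).trace := by
  apply Complex.conj_eq_iff_re.mp
  have : (starRingEnd ℂ) (A * B).trace = ((A * B)ᴴ).trace := by
    rw [trace_conjTranspose]; rfl
  rw [this, conjTranspose_mul, hA, hB, trace_mul_comm]

/-- The Pauli coefficients `2⁻ⁿ tr (O P)` of an observable. -/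
def coef (O : QMat n) (P : Str n) : ℝ := ((O * pauli P).trace / 2 ^ n).re

/-- The Pauli coefficients `tr (ρ P)` of a state. -/
def expect (ρ : QMat n) (P : Str n) : ℝ := (ρ * pauli P).trace.re

theorem coef_coe (hO : O.IsHermitian) (P : Str n) :
    (coef O P : ℂ) = (O * pauli P).trace / 2 ^ n := by
  have h := trace_mul_real hO.eq (pauli_hermitian P)
  have h2 : (O * pauli P).trace / 2 ^ n = (((O * pauli P).trace.re / 2 ^ n : ℝ) : ℂ) := by
    simp_all
  rw [coef, h2, Complex.ofReal_re]

theorem expect_coe {ρ : QMat n} (hρ : ρ.IsHermitian) (P : Str n) :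
    (expect ρ P : ℂ) = (ρ * pauli P).trace := trace_mul_real hρ.eq (pauli_hermitian P)

theorem pauli_expansion_real (hO : O.IsHermitian) : O = ∑ P : Str n, (coef O P : ℂ) • pauli P := by
  simp only [coef_coe hO]
  exact pauli_expansion O

/-- The operator with given real Pauli coefficients. -/
def ofCoef (δ : Vec n) : QMat n := ∑ P, (δ P : ℂ) • pauli P

theorem ofCoef_hermitian (δ : Vec n) : (ofCoef δ)ᴴ = ofCoef δ := by
  simp only [ofCoef, conjTranspose_sum, conjTranspose_smul, pauli_hermitian]
  simp

theorem trace_ofCoef_mul_ofCoef (δ : Vec n) :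
    (ofCoef δ * ofCoef δ).trace = ((2 ^ n * ∑ P, δ P ^ 2 : ℝ) : ℂ) := by
  simp only [ofCoef, sum_mul_sum, trace_sum, smul_mul_assoc, mul_smul_comm,
    trace_smul, trace_pauli_mul_pauli, smul_eq_mul]
  simp only [mul_ite, mul_zero, sum_ite_eq, mem_univ, if_true]
  push_cast
  rw [mul_sum]
  exact sum_congr rfl fun P _ => by ring

theorem sum_coef_sq (hO : IsNormalizedObservable O) : ∑ P, coef O P ^ 2 = 1 := by
  have h := pauli_expansion_real hO.1
  change O = ofCoef (coef O) at h
  have h2 := hO.2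
  have h4 : (O * O).trace = _ := (congrArg (fun X => (X * X).trace) h).trans
    (trace_ofCoef_mul_ofCoef _)
  rw [hO.1.eq, h4] at h2
  have h3 : ((2 : ℂ) ^ n) ≠ 0 := by positivity
  push_cast at h2
  rw [mul_div_cancel_left₀ _ h3] at h2
  exact_mod_cast h2

theorem trace_mul_ofCoef {ρ : QMat n} (hρ : ρ.IsHermitian) (δ : Vec n) :
    (ρ * ofCoef δ).trace = ((∑ P, δ P * expect ρ P : ℝ) : ℂ) := by
  simp only [ofCoef, mul_sum, trace_sum, mul_smul_comm, trace_smul, smul_eq_mul]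
  push_cast
  exact sum_congr rfl fun P _ => by rw [expect_coe hρ]

variable {P : Str n} {K : Ker n} {gk : ℕ → Ker n}

/-! ## Low-average ensembles -/

theorem sq_trace_le {ι : Type*} [Fintype ι] [DecidableEq ι] {ρ Δ : Matrix ι ι ℂ}
    (hρ : ρ.PosSemidef) (h1 : ρ.trace = 1) (hΔ : Δᴴ = Δ) :
    (ρ * Δ).trace.re ^ 2 ≤ (ρ * (Δ * Δ)).trace.re := by
  set μ : ℝ := (ρ * Δ).trace.re with hμ
  have hμ' : (ρ * Δ).trace = (μ : ℂ) := (trace_mul_real hρ.1.eq hΔ).symm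
  set B : Matrix ι ι ℂ := Δ - (μ : ℂ) • 1 with hB
  have hBh : Bᴴ = B := by
    simp_all
  have h := (hρ.conjTranspose_mul_mul_same B).trace_nonneg
  rw [hBh, trace_mul_comm, ← mul_assoc, trace_mul_comm] at h
  have h2 : ρ * (B * B) = ρ * (Δ * Δ) - (2 * μ : ℂ) • (ρ * Δ) + (μ ^ 2 : ℂ) • ρ := by
    simp only [hB, sub_mul, mul_sub, smul_mul_assoc, mul_smul_comm, one_mul, mul_one, smul_sub,
      smul_smul]
    module
  rw [h2, trace_add, trace_sub, trace_smul, trace_smul, hμ', h1] at h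
  have h3 := (Complex.le_def.mp h).1
  have h4 : ((ρ * (Δ * Δ)).trace - (2 * μ : ℂ) • (μ : ℂ) + (μ ^ 2 : ℂ) • (1 : ℂ)).re
      = (ρ * (Δ * Δ)).trace.re - μ ^ 2 := by
    have : (2 * μ : ℂ) • (μ : ℂ) = ((2 * μ * μ : ℝ) : ℂ) := by simp_all
    rw [this]
    have : (μ ^ 2 : ℂ) • (1 : ℂ) = ((μ ^ 2 : ℝ) : ℂ) := by simp_all
    rw [this, Complex.add_re, Complex.sub_re, Complex.ofReal_re, Complex.ofReal_re]
    ring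
  simp_all

theorem trace_mul_sq_le {ι : Type*} [Fintype ι] [DecidableEq ι] (A Δ : Matrix ι ι ℂ) (hΔ : Δᴴ = Δ) :
    (A * (Δ * Δ)).trace.re ≤ ‖toEuclideanCLM (𝕜 := ℂ) A‖ * (Δ * Δ).trace.re := by
  set T := toEuclideanCLM (𝕜 := ℂ) A with hT
  let v : ι → EuclideanSpace ℂ ι := fun y => WithLp.toLp 2 fun x => Δ x y
  have hv : ∀ y, ((Δ * A * Δ) y y).re ≤ ‖T‖ * ((Δ * Δ) y y).re := by
    intro y
    have h1 : inner ℂ (v y) (T (v y)) = (Δ * A * Δ) y y := by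
      have : T (v y) = WithLp.toLp 2 (A *ᵥ fun x => Δ x y) := by
        aesop
      rw [this, EuclideanSpace.inner_eq_star_dotProduct, mul_assoc, mul_apply]
      simp only [v, dotProduct, mulVec, Pi.star_apply]
      refine sum_congr rfl fun i _ => ?_
      have : star (Δ i y) = Δ y i := by
        conv_rhs => rw [← hΔ]
        rfl
      rw [this, mul_apply, mul_comm]
    have h2 : inner ℂ (v y) (v y) = (Δ * Δ) y y := by
      rw [EuclideanSpace.inner_eq_star_dotProduct]
      simp only [v, mul_apply, dotProduct, Pi.star_apply]
      refine sum_congr rfl fun i _ => ?_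
      have : star (Δ i y) = Δ y i := by
        conv_rhs => rw [← hΔ]
        rfl
      rw [this, mul_comm]
    have h3 : ((Δ * Δ) y y).re = ‖v y‖ ^ 2 := by
      rw [← h2, inner_self_eq_norm_sq_to_K]
      norm_cast
    rw [h3, ← h1]
    calc (inner ℂ (v y) (T (v y))).re ≤ ‖inner ℂ (v y) (T (v y))‖ := Complex.re_le_norm _
      _ ≤ ‖v y‖ * ‖T (v y)‖ := norm_inner_le_norm _ _
      _ ≤ ‖v y‖ * (‖T‖ * ‖v y‖) := by gcongr; exact T.le_opNorm _
      _ = ‖T‖ * ‖v y‖ ^ 2 := by ring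
  have h4 : (A * (Δ * Δ)).trace = (Δ * A * Δ).trace := by
    rw [← mul_assoc, trace_mul_comm, ← mul_assoc]
  rw [h4, trace, trace, Complex.re_sum, Complex.re_sum, mul_sum]
  exact sum_le_sum fun y _ => hv y

theorem IsLowAverage.nonneg {N : ℕ} {ρ : Fin N → QMat n} {c : ℝ} (h : IsLowAverage ρ c) :
    0 ≤ c := by
  have h1 := (norm_nonneg _).trans h.2.2
  have h2 : (0 : ℝ) < 2 ^ n := by positivity
  by_contra hc
  exact absurd h1 (not_le.mpr (div_neg_of_neg_of_pos (not_le.mp hc) h2))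

theorem IsLowAverage.sum_sq_le {N : ℕ} {ρ : Fin N → QMat n} {c : ℝ} (h : IsLowAverage ρ c)
    (δ : Vec n) : (1 / (N : ℝ)) * ∑ i, (∑ P, δ P * expect (ρ i) P) ^ 2 ≤ c * ∑ P, δ P ^ 2 := by
  have h1 : ∀ i, (∑ P, δ P * expect (ρ i) P) ^ 2 ≤ (ρ i * (ofCoef δ * ofCoef δ)).trace.re := by
    intro i
    have := sq_trace_le (h.2.1 i).1 (h.2.1 i).2 (ofCoef_hermitian δ)
    rwa [trace_mul_ofCoef (h.2.1 i).1.1, Complex.ofReal_re] at this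
  have h2 : (1 / (N : ℝ)) * ∑ i, (ρ i * (ofCoef δ * ofCoef δ)).trace.re
      = (((1 / (N : ℂ)) • ∑ i, ρ i) * (ofCoef δ * ofCoef δ)).trace.re := by
    rw [smul_mul_assoc, trace_smul, sum_mul, trace_sum, smul_eq_mul]
    simp_all
  have h3 := trace_mul_sq_le ((1 / (N : ℂ)) • ∑ i, ρ i) (ofCoef δ) (ofCoef_hermitian δ)
  rw [trace_ofCoef_mul_ofCoef, Complex.ofReal_re] at h3
  calc _ ≤ (1 / (N : ℝ)) * ∑ i, (ρ i * (ofCoef δ * ofCoef δ)).trace.re := by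
        gcongr; exact h1 _
    _ ≤ _ := h2.le.trans h3
    _ ≤ c / 2 ^ n * (2 ^ n * ∑ P, δ P ^ 2) := by
        exact mul_le_mul_of_nonneg_right h.2.2
          (mul_nonneg (by positivity) (sum_nonneg fun _ _ => sq_nonneg _))
    _ = c * ∑ P, δ P ^ 2 := by field_simp

/-! ## Noise in the Heisenberg picture -/

/-- The coefficient of `σ_b` in the image of `σ_a` under the adjoint of spontaneous emission. -/
def nu (g : ℝ) (s : Fin 2) (b a : Fin 4) : ℝ := if a = 0 then (if b = 0 then 1 else 0)
  else if a = 3 then (if b = 3 then 1 - g else if b = 0 then (if s = 0 then g else -g) else 0)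
  else if b = a then 1 - g / 2 else 0

theorem nu_spec (g : ℝ) (s : Fin 2) (a : Fin 4) (x y : Fin 2) :
    sigma a x y + (g : ℂ) * (if x = s + 1 ∧ y = s + 1 then sigma a s s else 0)
      - (g : ℂ) / 2 * (if y = s + 1 then sigma a x (s + 1) else 0)
      - (g : ℂ) / 2 * (if x = s + 1 then sigma a (s + 1) y else 0)
    = ∑ b, (nu g s b a : ℂ) * sigma b x y := by
  fin_cases a <;> fin_cases s <;> fin_cases x <;> fin_cases y <;>
    simp [sigma, nu, Fin.sum_univ_four] <;> ring

/-- `h` lists the real Pauli coefficients of `ρ`. -/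
def Rep (ρ : QMat n) (h : Vec n) : Prop := ∀ P, (ρ * pauli P).trace = (h P : ℂ)

theorem siteUnit_mul (j : Fin n) (a b : Fin 2) (A : QMat n) (x y : Fin n → Fin 2) :
    (siteUnit j a b * A) x y = if x j = a then A (update x j b) y else 0 := by
  rw [mul_apply]
  split_ifs with h
  · rw [sum_eq_single (update x j b)]
    · simp only [siteUnit, of_apply]
      simp_all
    · intro z _ hz
      simp only [siteUnit, of_apply]
      rw [if_neg, zero_mul]
      rintro ⟨-, h1, h2⟩
      apply hz
      funext k
      by_cases hk : k = j
      · simp_all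
      simp_all
    simp
  refine sum_eq_zero fun z _ => ?_
  simp [siteUnit, h]

theorem mul_siteUnit (j : Fin n) (a b : Fin 2) (A : QMat n) (x y : Fin n → Fin 2) :
    (A * siteUnit j a b) x y = if y j = b then A x (update y j a) else 0 := by
  rw [mul_apply]
  split_ifs with h
  · rw [sum_eq_single (update y j a)]
    · simp only [siteUnit, of_apply]
      simp_all
    · intro z _ hz
      simp only [siteUnit, of_apply]
      rw [if_neg, mul_zero]
      rintro ⟨h1, -, h2⟩
      apply hz
      funext k
      by_cases hk : k = j
      · simp_all
      simp_all
    simp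
  refine sum_eq_zero fun z _ => ?_
  simp [siteUnit, h]

/-- The factor of a Pauli string away from qubit `j`. -/
def pauliOff (j : Fin n) (P : Str n) (x y : Fin n → Fin 2) : ℂ :=
  ∏ k ∈ univ.erase j, sigma (P k) (x k) (y k)

theorem pauli_eq_mul_off (j : Fin n) (P : Str n) (x y : Fin n → Fin 2) :
    pauli P x y = sigma (P j) (x j) (y j) * pauliOff j P x y :=
  (mul_prod_erase _ (fun k => sigma (P k) (x k) (y k)) (mem_univ j)).symm

theorem pauliOff_congr (j : Fin n) {P' : Str n} {x x' y y' : Fin n → Fin 2}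
    (h : ∀ k, k ≠ j → P k = P' k ∧ x k = x' k ∧ y k = y' k) :
    pauliOff j P x y = pauliOff j P' x' y' := by
  refine prod_congr rfl fun k hk => ?_
  simp_all

theorem emission_adjoint (g : ℝ) (j : Fin n) (s : Fin 2) (P : Str n) :
    pauli P + (g : ℂ) • (siteUnit j (s + 1) s * pauli P * siteUnit j s (s + 1))
      - ((g : ℂ) / 2) • (pauli P * siteUnit j (s + 1) (s + 1))
      - ((g : ℂ) / 2) • (siteUnit j (s + 1) (s + 1) * pauli P)
    = ∑ b, (nu g s b (P j) : ℂ) • pauli (update P j b) := by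
  ext x y
  simp only [Matrix.sub_apply, Matrix.add_apply, Matrix.smul_apply, siteUnit_mul, mul_siteUnit,
    Matrix.sum_apply, smul_eq_mul]
  have e1 : pauli P (update x j s) (update y j s) = sigma (P j) s s * pauliOff j P x y := by
    rw [pauli_eq_mul_off j, pauliOff_congr j (P' := P) (x' := x) (y' := y)]
    · simp
    simp_all
  have e2 : pauli P x (update y j (s + 1)) = sigma (P j) (x j) (s + 1) * pauliOff j P x y := by
    rw [pauli_eq_mul_off j, pauliOff_congr j (P' := P) (x' := x) (y' := y)]
    · simp
    simp_all
  have e3 : pauli P (update x j (s + 1)) y = sigma (P j) (s + 1) (y j) * pauliOff j P x y := by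
    rw [pauli_eq_mul_off j, pauliOff_congr j (P' := P) (x' := x) (y' := y)]
    · simp
    simp_all
  have e4 : ∀ b, pauli (update P j b) x y = sigma b (x j) (y j) * pauliOff j P x y := by
    intro b
    rw [pauli_eq_mul_off j, pauliOff_congr j (P' := P) (x' := x) (y' := y)]
    · simp
    simp_all
  simp only [e1, e2, e3, e4, pauli_eq_mul_off j P x y]
  have h := congrArg (· * pauliOff j P x y) (nu_spec g s (P j) (x j) (y j))
  simp only [sum_mul, sub_mul, add_mul] at h
  simp only [← mul_assoc, ← h]
  by_cases h1 : x j = s + 1 <;> by_cases h2 : y j = s + 1 <;> simp [h1, h2] <;> ring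

theorem Rep.emission {ρ : QMat n} {h : Vec n} (hr : Rep ρ h) (g : ℝ) (j : Fin n) (s : Fin 2) :
    Rep (emission g j s ρ) fun P => ∑ b, nu g s b (P j) * h (update P j b) := by
  intro P
  have h1 : (NoisyCircuit.emission g j s ρ * pauli P).trace = (ρ * (pauli P
      + (g : ℂ) • (siteUnit j (s + 1) s * pauli P * siteUnit j s (s + 1))
      - ((g : ℂ) / 2) • (pauli P * siteUnit j (s + 1) (s + 1))
      - ((g : ℂ) / 2) • (siteUnit j (s + 1) (s + 1) * pauli P))).trace := by
    simp only [NoisyCircuit.emission, add_mul, sub_mul, mul_add, mul_sub, smul_mul_assoc,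
      mul_smul_comm, trace_add, trace_sub, trace_smul]
    have t1 : (siteUnit j s (s + 1) * ρ * siteUnit j (s + 1) s * pauli P).trace
        = (ρ * (siteUnit j (s + 1) s * pauli P * siteUnit j s (s + 1))).trace := by
      rw [mul_assoc, mul_assoc, trace_mul_comm]
      simp only [mul_assoc]
    have t2 : (siteUnit j (s + 1) (s + 1) * ρ * pauli P).trace
        = (ρ * (pauli P * siteUnit j (s + 1) (s + 1))).trace := by
      rw [mul_assoc, trace_mul_comm, mul_assoc]
    rw [t1, t2, mul_assoc ρ]
  rw [h1, emission_adjoint, mul_sum, trace_sum]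
  push_cast
  exact sum_congr rfl fun b _ => by
    rw [mul_smul_comm, trace_smul, hr, smul_eq_mul]

/-- The transition kernel on Pauli strings of noise on the qubits of `S`. -/
def siteK (g : ℝ) (S : Finset (Fin n)) (s : Fin n → Fin 2) (Q R : Str n) : ℝ :=
  ∏ j, if j ∈ S then nu g (s j) (Q j) (R j) else if Q j = R j then 1 else 0

theorem siteK_empty (g : ℝ) (s : Fin n → Fin 2) (Q R : Str n) :
    siteK g ∅ s Q R = if Q = R then 1 else 0 := by
  simp [siteK, prod_ite_zero, funext_iff]

theorem sum_siteK_insert (g : ℝ) {S : Finset (Fin n)} (s : Fin n → Fin 2)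
    (hj : j ∉ S) (R : Str n) (h : Vec n) : ∑ Q, siteK g (insert j S) s Q R * h Q =
      ∑ b, nu g (s j) b (R j) * ∑ Q, siteK g S s Q (update R j b) * h Q := by
  simp only [mul_sum]
  rw [sum_comm]
  refine sum_congr rfl fun Q _ => ?_
  have h1 : ∀ b, siteK g S s Q (update R j b) = (if Q j = b then 1 else 0) * ∏ k ∈ univ.erase j,
        (if k ∈ S then nu g (s k) (Q k) (R k) else if Q k = R k then 1 else 0) := by
    intro b
    rw [siteK, ← mul_prod_erase _ _ (mem_univ j)]
    congr 1
    · simp [hj]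
    refine prod_congr rfl fun k hk => ?_
    simp_all
  have h2 : siteK g (insert j S) s Q R = nu g (s j) (Q j) (R j) * ∏ k ∈ univ.erase j,
        (if k ∈ S then nu g (s k) (Q k) (R k) else if Q k = R k then 1 else 0) := by
    rw [siteK, ← mul_prod_erase _ _ (mem_univ j)]
    congr 1
    · simp
    refine prod_congr rfl fun k hk => ?_
    simp_all
  simp only [h1, h2, ite_mul, one_mul, zero_mul, mul_ite, mul_zero, sum_ite_eq, mem_univ, if_true]
  ring

theorem Rep.noise {ρ : QMat n} {h : Vec n} (hr : Rep ρ h) (g : ℝ)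
    (S : Finset (Fin n)) (s : Fin n → Fin 2) :
    Rep (noise g S s ρ) fun P => ∑ Q, siteK g S s Q P * h Q := by
  have key : ∀ l : List (Fin n), l.Nodup →
      Rep (l.foldr (fun j σ => if j ∈ S then NoisyCircuit.emission g j (s j) σ else σ) ρ)
        fun P => ∑ Q, siteK g (l.toFinset ∩ S) s Q P * h Q := by
    intro l
    induction l with
    | nil =>
      intro _
      simpa [siteK_empty] using hr
    | cons j l ih =>
      intro hl
      rw [List.nodup_cons] at hl
      have h1 := ih hl.2
      by_cases hj : j ∈ S
      · have h2 := h1.emission g j (s j)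
        have h3 : (j :: l).toFinset ∩ S = insert j (l.toFinset ∩ S) := by
          simp_all
        have h4 : j ∉ l.toFinset ∩ S := by simp [hl.1]
        simp only [List.foldr_cons, if_pos hj, h3, sum_siteK_insert g s h4]
        exact h2
      simp_all
  have h1 := key (List.finRange n) (List.nodup_finRange n)
  aesop

/-! ## Gates in the Heisenberg picture -/

/-- The coefficient of `σ_b` in `Wᴴ σ_a W`, for two-qubit Pauli matrices. -/
def ptm (W : TwoQubitGate) (b a : Fin 4 × Fin 4) : ℝ :=
  (((W : Mat4)ᴴ * (sigma a.1 ⊗ₖ sigma a.2) *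
    (W : Mat4)) * (sigma b.1 ⊗ₖ sigma b.2)).trace.re / 4

theorem kron_sigma_hermitian (a b : Fin 4) : (sigma a ⊗ₖ sigma b)ᴴ = sigma a ⊗ₖ sigma b := by
  rw [conjTranspose_kronecker, sigma_hermitian, sigma_hermitian]

theorem two_qubit_expansion {M : Mat4} (hM : Mᴴ = M)
    (x y : Fin 2 × Fin 2) : M x y = ∑ a, ∑ b, (((M * (sigma a ⊗ₖ sigma b)).trace.re / 4 : ℝ) : ℂ)
      * (sigma a x.1 y.1 * sigma b x.2 y.2) := by
  have h1 : ∀ a b, (((M * (sigma a ⊗ₖ sigma b)).trace.re / 4 : ℝ) : ℂ)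
      * (sigma a x.1 y.1 * sigma b x.2 y.2) = ∑ z, ∑ w, M z w / 4 *
        ((sigma a w.1 z.1 * sigma a x.1 y.1) * (sigma b w.2 z.2 * sigma b x.2 y.2)) := by
    intro a b
    push_cast
    rw [trace_mul_real hM (kron_sigma_hermitian a b)]
    simp only [trace, Matrix.diag, mul_apply, sum_div, sum_mul, kroneckerMap_apply]
    refine sum_congr rfl fun z _ => sum_congr rfl fun w _ => ?_
    ring
  simp only [h1]
  have h2 : ∀ z w : Fin 2 × Fin 2, ∑ a, ∑ b, M z w / 4 *
        ((sigma a w.1 z.1 * sigma a x.1 y.1) * (sigma b w.2 z.2 * sigma b x.2 y.2))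
      = if z = x then (if w = y then M z w else 0) else 0 := by
    intro z w
    simp only [← mul_sum, ← sum_mul, sigma_complete]
    obtain ⟨z1, z2⟩ := z
    obtain ⟨w1, w2⟩ := w
    obtain ⟨x1, x2⟩ := x
    obtain ⟨y1, y2⟩ := y
    simp only [Prod.mk.injEq]
    by_cases a1 : z1 = x1 <;> by_cases a2 : z2 = x2 <;> by_cases a3 : w1 = y1 <;>
      by_cases a4 : w2 = y2 <;> simp [a1, a2, a3, a4]
    ring
  calc M x y = ∑ z, ∑ w, if z = x then (if w = y then M z w else 0) else 0 := by simp
    _ = ∑ z, ∑ w, ∑ a, ∑ b, M z w / 4 *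
        ((sigma a w.1 z.1 * sigma a x.1 y.1) * (sigma b w.2 z.2 * sigma b x.2 y.2)) := by
      simp only [h2]
    _ = _ := by
      simp only [sum_comm (s := (univ : Finset (Fin 4))) (t := (univ : Finset (Fin 2 × Fin 2)))]

theorem ptm_spec (W : TwoQubitGate) (a : Fin 4 × Fin 4) (x y : Fin 2 × Fin 2) :
    (∑ b, ∑ c, star ((W : Mat4) b x) *
      (sigma a.1 b.1 c.1 * sigma a.2 b.2 c.2) * (W : Mat4) c y)
    = ∑ b1, ∑ b2, (ptm W (b1, b2) a : ℂ) * (sigma b1 x.1 y.1 * sigma b2 x.2 y.2) := by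
  have hM : ((W : Mat4)ᴴ * (sigma a.1 ⊗ₖ sigma a.2) *
    (W : Mat4))ᴴ =
      (W : Mat4)ᴴ * (sigma a.1 ⊗ₖ sigma a.2) *
    (W : Mat4) := by
    rw [conjTranspose_mul, conjTranspose_mul, kron_sigma_hermitian,
      conjTranspose_conjTranspose, ← mul_assoc]
  have h := two_qubit_expansion hM x y
  unfold ptm
  rw [← h, mul_apply]
  simp only [mul_apply, sum_mul, conjTranspose_apply, kroneckerMap_apply]
  rw [sum_comm]

/-- The transition kernel on Pauli strings of one layer of gates. -/
def gateK (A : Architecture n d) (U : Gates n d) (t : Fin d) (R P : Str n) : ℝ :=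
  ∏ j, if j < A.partner t j then ptm (U t j) (R j, R (A.partner t j)) (P j, P (A.partner t j))
    else if A.partner t j = j then (if R j = P j then 1 else 0) else 1

theorem layer_adjoint (A : Architecture n d) (U : Gates n d) (t : Fin d) (P : Str n) :
    (layerUnitary A U t)ᴴ * pauli P * layerUnitary A U t = ∑ R, (gateK A U t R P : ℂ) • pauli R := by
  have hp := A.involutive t
  set p := A.partner t with hpdef
  ext x y
  let F₁ : Fin n → Fin 2 × Fin 2 → Fin 2 × Fin 2 → ℂ := fun j a b =>
    star ((U t j : Mat4) (a.1, b.1) (x j, x (p j))) *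
      (sigma (P j) a.1 a.2 * sigma (P (p j)) b.1 b.2) *
      (U t j : Mat4) (a.2, b.2) (y j, y (p j))
  let G₁ : Fin n → Fin 2 × Fin 2 → ℂ := fun j a =>
    (if a.1 = x j then 1 else 0) * sigma (P j) a.1 a.2 * (if a.2 = y j then 1 else 0)
  let F₂ : Fin n → Fin 4 → Fin 4 → ℂ := fun j a b =>
    (ptm (U t j) (a, b) (P j, P (p j)) : ℂ) * (sigma a (x j) (y j) * sigma b (x (p j)) (y (p j)))
  let G₂ : Fin n → Fin 4 → ℂ := fun j a => (if a = P j then 1 else 0) * sigma a (x j) (y j)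
  have hL : ((layerUnitary A U t)ᴴ * pauli P * layerUnitary A U t) x y =
      ∑ v : Fin n → Fin 2 × Fin 2, ∏ j, if j < p j then F₁ j (v j) (v (p j))
        else if p j = j then G₁ j (v j) else 1 := by
    have e : ∀ z w : Fin n → Fin 2, star (layerUnitary A U t z x) * pauli P z w *
        layerUnitary A U t w y = ∏ j, if j < p j then F₁ j (z j, w j) (z (p j), w (p j))
        else if p j = j then G₁ j (z j, w j) else 1 := by
      intro z w
      simp only [layerUnitary, pauli, of_apply, star_prod]
      rw [prod_eq_prod_pairs hp (fun j => sigma (P j) (z j) (w j)), ← prod_mul_distrib,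
        ← prod_mul_distrib]
      refine prod_congr rfl fun j _ => ?_
      aesop
    rw [← Equiv.sum_comp (Equiv.arrowProdEquivProdArrow (Fin n) (fun _ => Fin 2)
      (fun _ => Fin 2)).symm, Fintype.sum_prod_type]
    rw [mul_apply]
    simp only [mul_apply, sum_mul, conjTranspose_apply]
    rw [sum_comm]
    simp_all
  have hR : (∑ R, (gateK A U t R P : ℂ) • pauli R) x y =
      ∑ R : Str n, ∏ j, if j < p j then F₂ j (R j) (R (p j))
        else if p j = j then G₂ j (R j) else 1 := by
    rw [Matrix.sum_apply]
    refine sum_congr rfl fun R _ => ?_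
    rw [Matrix.smul_apply, smul_eq_mul, gateK, pauli, of_apply,
      prod_eq_prod_pairs hp (fun j => sigma (R j) (x j) (y j)), Complex.ofReal_prod,
      ← prod_mul_distrib]
    refine prod_congr rfl fun j _ => ?_
    by_cases h1 : j < p j
    · simp only [← hpdef, h1, if_true, F₂]
    by_cases h2 : p j = j
    · simp only [← hpdef, h2, lt_irrefl, if_true, if_false, G₂]
      split_ifs <;> simp
    simp [← hpdef, h1, h2]
  rw [hL, hR, sum_prod_pairs hp F₁ G₁, sum_prod_pairs hp F₂ G₂]
  refine prod_congr rfl fun j _ => ?_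
  by_cases h1 : j < p j
  · simp only [h1, if_true, F₁, F₂]
    refine Eq.trans ?_ (ptm_spec (U t j) (P j, P (p j)) (x j, x (p j)) (y j, y (p j)))
    simp only [Fintype.sum_prod_type]
    refine sum_congr rfl fun a _ => ?_
    rw [sum_comm]
  by_cases h2 : p j = j
  · simp [h2, Fintype.sum_prod_type, G₁, G₂]
  simp [h1, h2]

theorem Rep.layer {ρ : QMat n} {h : Vec n} (hr : Rep ρ h) (A : Architecture n d)
    (U : Gates n d) (t : Fin d) : Rep (layerUnitary A U t * ρ * (layerUnitary A U t)ᴴ)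
      fun P => ∑ R, gateK A U t R P * h R := by
  intro P
  have : (layerUnitary A U t * ρ * (layerUnitary A U t)ᴴ * pauli P).trace
      = (ρ * ((layerUnitary A U t)ᴴ * pauli P * layerUnitary A U t)).trace := by
    rw [mul_assoc, mul_assoc, trace_mul_comm]
    simp only [mul_assoc]
  rw [this, layer_adjoint, mul_sum, trace_sum]
  push_cast
  exact sum_congr rfl fun R _ => by
    rw [mul_smul_comm, trace_smul, hr, smul_eq_mul]

/-! ## The transition kernels -/

/-- The weight of a Pauli string. -/
def wt (P : Str n) : ℕ := (univ.filter fun j => P j ≠ 0).card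

theorem wt_le (P : Str n) : wt P ≤ n := (card_le_univ _).trans_eq (Fintype.card_fin n)

theorem wt_eq_zero : wt P = 0 ↔ P = 0 := by
  simp [wt, filter_eq_empty_iff, funext_iff]

theorem wt_pos (h : P ≠ 0) : 1 ≤ wt P := Nat.one_le_iff_ne_zero.mpr fun h0 => h (wt_eq_zero.mp h0)

theorem sum_ptm_mul_ptm (W : TwoQubitGate) (a a' : Fin 4 × Fin 4) :
    ∑ b₁, ∑ b₂, ptm W (b₁, b₂) a * ptm W (b₁, b₂) a' = if a = a' then 1 else 0 := by
  set V := (W : Mat4) with hV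
  have hVV : V * Vᴴ = 1 := (mem_unitaryGroup_iff).mp W.2
  have hh : ∀ a : Fin 4 × Fin 4, (Vᴴ * (sigma a.1 ⊗ₖ sigma a.2) * V)ᴴ =
      Vᴴ * (sigma a.1 ⊗ₖ sigma a.2) * V := by
    intro a
    rw [conjTranspose_mul, conjTranspose_mul, kron_sigma_hermitian,
      conjTranspose_conjTranspose, ← mul_assoc]
  have key : ((∑ b₁, ∑ b₂, ptm W (b₁, b₂) a * ptm W (b₁, b₂) a' : ℝ) : ℂ) =
      ((Vᴴ * (sigma a.1 ⊗ₖ sigma a.2) * V) * (Vᴴ * (sigma a'.1 ⊗ₖ sigma a'.2) * V)).trace / 4 := by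
    conv_rhs => rw [trace]
    simp only [Matrix.diag, mul_apply (M := Vᴴ * (sigma a.1 ⊗ₖ sigma a.2) * V)]
    have h1 : ∀ x y, (Vᴴ * (sigma a'.1 ⊗ₖ sigma a'.2) * V) y x = ∑ b₁, ∑ b₂,
        (ptm W (b₁, b₂) a' : ℂ) * (sigma b₁ y.1 x.1 * sigma b₂ y.2 x.2) := fun x y =>
      two_qubit_expansion (hh a') y x
    simp only [h1, mul_sum, sum_div]
    simp only [sum_comm (s := (univ : Finset (Fin 2 × Fin 2))) (t := (univ : Finset (Fin 4)))]
    push_cast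
    refine sum_congr rfl fun b₁ _ => sum_congr rfl fun b₂ _ => ?_
    have h2 : (ptm W (b₁, b₂) a : ℂ) = ∑ x, ∑ y, (Vᴴ * (sigma a.1 ⊗ₖ sigma a.2) * V) x y *
        (sigma b₁ y.1 x.1 * sigma b₂ y.2 x.2) / 4 := by
      rw [ptm]
      push_cast
      rw [trace_mul_real (hh a) (kron_sigma_hermitian b₁ b₂)]
      rw [trace]
      simp only [Matrix.diag, mul_apply (M := Vᴴ * (sigma a.1 ⊗ₖ sigma a.2) * V),
        kroneckerMap_apply, sum_div]
    rw [h2]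
    simp only [sum_mul]
    refine sum_congr rfl fun x _ => sum_congr rfl fun y _ => ?_
    ring
  have h3 : (Vᴴ * (sigma a.1 ⊗ₖ sigma a.2) * V) * (Vᴴ * (sigma a'.1 ⊗ₖ sigma a'.2) * V)
      = Vᴴ * ((sigma a.1 * sigma a'.1) ⊗ₖ (sigma a.2 * sigma a'.2)) * V := by
    rw [mul_kronecker_mul]
    calc _ = Vᴴ * (sigma a.1 ⊗ₖ sigma a.2) * (V * Vᴴ) * (sigma a'.1 ⊗ₖ sigma a'.2) * V := by
          simp only [mul_assoc]
      _ = _ := by rw [hVV]; simp only [mul_one, mul_assoc]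
  have h4 : ∀ a a' : Fin 4, (sigma a * sigma a').trace = if a = a' then 2 else 0 := by
    intro a a'
    rw [← sigma_trace a a']
    simp [trace, mul_apply]
  rw [h3, trace_mul_comm, ← mul_assoc, hVV, one_mul, trace_kronecker, h4, h4] at key
  have h5 : ((if a = a' then 1 else 0 : ℝ) : ℂ) =
      (if a.1 = a'.1 then 2 else 0) * (if a.2 = a'.2 then 2 else 0) / 4 := by
    by_cases h1 : a.1 = a'.1 <;> by_cases h2 : a.2 = a'.2 <;> simp [h1, h2, Prod.ext_iff]
    norm_num
  rw [← h5] at key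
  exact_mod_cast key

theorem kron_sigma_zero : sigma 0 ⊗ₖ sigma 0 = 1 := by
  have : sigma 0 = 1 := rfl
  simp_all

theorem trace_kron_sigma (a : Fin 4 × Fin 4) :
    (sigma a.1 ⊗ₖ sigma a.2).trace.re / 4 = if a = (0, 0) then 1 else 0 := by
  rw [trace_kronecker]
  obtain ⟨a, b⟩ := a
  have h : ∀ a, (sigma a).trace = if a = 0 then 2 else 0 := by
    intro a; fin_cases a <;> simp [sigma, trace, Fin.sum_univ_two]
  rw [h, h]
  by_cases h1 : a = 0 <;> by_cases h2 : b = 0 <;> simp [h1, h2]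
  linarith

theorem ptm_zero_right (W : TwoQubitGate) (b : Fin 4 × Fin 4) :
    ptm W b (0, 0) = if b = (0, 0) then 1 else 0 := by
  have hVV : (W : Mat4)ᴴ * W = 1 :=
    (mem_unitaryGroup_iff').mp W.2
  rw [ptm, kron_sigma_zero, mul_one, hVV, one_mul, trace_kron_sigma]

theorem ptm_zero_left (W : TwoQubitGate) (a : Fin 4 × Fin 4) :
    ptm W (0, 0) a = if a = (0, 0) then 1 else 0 := by
  have hVV : (W : Mat4) * (W : Matrix _ _ ℂ)ᴴ = 1 :=
    (mem_unitaryGroup_iff).mp W.2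
  rw [ptm, kron_sigma_zero, mul_one, trace_mul_comm, ← mul_assoc, hVV, one_mul, trace_kron_sigma]

/-- The strings `P` that a layer with pairing `p` leaves alone. -/
def GateTrivial (p : Fin n → Fin n) (P : Str n) : Prop := ∀ j, p j ≠ j → P j = 0

/-- The properties of the transition kernel of a layer of gates that matter for error bounds. -/
structure IsLayer (p : Fin n → Fin n) (K : Ker n) : Prop where
  orth : ∀ P P', ∑ R, K R P * K R P' = if P = P' then 1 else 0
  idle : ∀ R P, K R P ≠ 0 → ∀ j, p j = j → R j = P j
  trivial_iff : ∀ R P, K R P ≠ 0 → (GateTrivial p R ↔ GateTrivial p P)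
  trivial_eq : ∀ R P, GateTrivial p R → K R P = if R = P then 1 else 0

abbrev Layers (p : ℕ → Fin n → Fin n) (gk : ℕ → Ker n) : Prop := ∀ t, IsLayer (p t) (gk t)

theorem gateK_isLayer (A : Architecture n d) (U : Gates n d) (t : Fin d) :
    IsLayer (A.partner t) (gateK A U t) := by
  have hp := A.involutive t
  have orth : ∀ P P', ∑ R, gateK A U t R P * gateK A U t R P' = if P = P' then 1 else 0 := by
    intro P P'
    set p := A.partner t with hpdef
    let F : Fin n → Fin 4 → Fin 4 → ℝ := fun j a b =>
      ptm (U t j) (a, b) (P j, P (p j)) * ptm (U t j) (a, b) (P' j, P' (p j))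
    let G : Fin n → Fin 4 → ℝ := fun j a =>
      (if a = P j then 1 else 0) * (if a = P' j then 1 else 0)
    have h1 : ∀ R : Str n, gateK A U t R P * gateK A U t R P' = ∏ j,
        if j < p j then F j (R j) (R (p j)) else if p j = j then G j (R j) else 1 := by
      intro R
      rw [gateK, gateK, ← prod_mul_distrib]
      aesop
    rw [sum_congr rfl fun R _ => h1 R, sum_prod_pairs hp F G]
    have h2 : (∏ j, if j < p j then ∑ a, ∑ b, F j a b else if p j = j then ∑ a, G j a else 1)
        = ∏ j, if j < p j then (if P j = P' j then 1 else 0) * (if P (p j) = P' (p j) then 1 else 0)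
          else if p j = j then (if P j = P' j then 1 else 0) else (1 : ℝ) := by
      refine prod_congr rfl fun j _ => ?_
      by_cases h3 : j < p j
      · simp only [h3, if_true, F, sum_ptm_mul_ptm, Prod.mk.injEq]
        by_cases h4 : P j = P' j <;> by_cases h5 : P (p j) = P' (p j) <;> simp [h4, h5]
      simp [h3, G, eq_comm]
    rw [h2, ← prod_eq_prod_pairs hp (fun j => if P j = P' j then (1 : ℝ) else 0)]
    simp [prod_ite_zero, funext_iff]
  have idle : ∀ R P, gateK A U t R P ≠ 0 → ∀ j, A.partner t j = j → R j = P j := by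
    intro R P h j hj
    have := prod_ne_zero_iff.mp h j (mem_univ j)
    simp_all
  have pair : ∀ R P, gateK A U t R P ≠ 0 → ∀ j, j < A.partner t j →
      ((R j = 0 ∧ R (A.partner t j) = 0) ↔ (P j = 0 ∧ P (A.partner t j) = 0)) := by
    intro R P h j hj
    have h1 := prod_ne_zero_iff.mp h j (mem_univ j)
    rw [if_pos hj] at h1
    constructor
    · rintro ⟨h2, h3⟩
      rw [h2, h3, ptm_zero_left] at h1
      simp_all
    rintro ⟨h2, h3⟩
    rw [h2, h3, ptm_zero_right] at h1
    simp_all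
  have triv : ∀ R : Str n, GateTrivial (A.partner t) R ↔
      ∀ j, j < A.partner t j → (R j = 0 ∧ R (A.partner t j) = 0) := by
    intro R
    constructor
    · intro h j hj
      exact ⟨h j hj.ne', h _ (by rw [hp j]; exact hj.ne)⟩
    intro h j hj
    rcases lt_or_gt_of_ne hj with h1 | h1
    · have := (h (A.partner t j) (by rw [hp j]; exact h1)).2
      rwa [hp j] at this
    simp_all
  have tiff : ∀ R P, gateK A U t R P ≠ 0 →
      (GateTrivial (A.partner t) R ↔ GateTrivial (A.partner t) P) := by
    intro R P h
    rw [triv, triv]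
    exact forall_congr' fun j => forall_congr' fun hj => pair R P h j hj
  refine ⟨orth, idle, tiff, ?_⟩
  intro R P hR
  split_ifs with h
  · subst h
    rw [gateK]
    refine prod_eq_one fun j _ => ?_
    by_cases h1 : j < A.partner t j
    · have h2 := (triv R).mp hR j h1
      rw [if_pos h1, h2.1, h2.2, ptm_zero_left, if_pos rfl]
    simp [h1]
  by_contra hc
  have hP := (tiff R P hc).mp hR
  apply h
  funext j
  by_cases hj : A.partner t j = j
  · exact idle R P hc j hj
  rw [hR j hj, hP j hj]

theorem one_isLayer : IsLayer (n := n) id (fun R P => if R = P then 1 else 0) := by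
  refine ⟨fun P P' => ?_, fun R P h j _ => ?_, fun R P h => ?_, fun R P _ => rfl⟩
  · aesop
  · simp_all
  simp_all

theorem IsLayer.sum_mul_sq {p : Fin n → Fin n}
    (hK : IsLayer p K) (f : Vec n) (hf : ∀ R P, K R P ≠ 0 → f R = f P) (o : Vec n) :
    ∑ R, f R * (∑ P, K R P * o P) ^ 2 = ∑ P, f P * o P ^ 2 := by
  have h1 : ∀ R, f R * (∑ P, K R P * o P) ^ 2 = ∑ P, ∑ P', f P * o P * o P' * (K R P * K R P') := by
    intro R
    rw [sq, sum_mul_sum, mul_sum]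
    refine sum_congr rfl fun P _ => ?_
    rw [mul_sum]
    refine sum_congr rfl fun P' _ => ?_
    by_cases h : K R P = 0
    · simp [h]
    rw [hf R P h]; ring
  rw [sum_congr rfl fun R _ => h1 R, sum_comm]
  refine sum_congr rfl fun P _ => ?_
  rw [sum_comm]
  simp only [← mul_sum, hK.orth]
  simp [sq, mul_assoc]

theorem IsLayer.zero_iff {p : Fin n → Fin n}
    (hK : IsLayer p K) {R : Str n} (h : K R P ≠ 0) : R = 0 ↔ P = 0 := by
  have h1 := hK.trivial_iff R P h
  have h2 := hK.idle R P h
  have key : ∀ R : Str n, R = 0 ↔ GateTrivial p R ∧ ∀ j, p j = j → R j = 0 := by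
    intro R
    constructor
    · rintro rfl
      exact ⟨fun _ _ => rfl, fun _ _ => rfl⟩
    rintro ⟨h3, h4⟩
    funext j
    by_cases hj : p j = j
    · exact h4 j hj
    aesop
  simp_all

/-! ## Averages -/

/-- The mean of a function on a finite type. -/
def avg {α : Type*} [Fintype α] (f : α → ℝ) : ℝ := (1 / (Fintype.card α : ℝ)) * ∑ a, f a

theorem avg_mono {α : Type*} [Fintype α] {f g : α → ℝ} (h : ∀ a, f a ≤ g a) : avg f ≤ avg g := by
  unfold avg
  gcongr with a
  exact h a

theorem avg_const {α : Type*} [Fintype α] [Nonempty α] (c : ℝ) : avg (fun _ : α => c) = c := by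
  have : (Fintype.card α : ℝ) ≠ 0 := by simp_all
  simp [avg]

theorem avg_add {α : Type*} [Fintype α] (f g : α → ℝ) :
    avg (fun a => f a + g a) = avg f + avg g := by
  simp [avg, sum_add_distrib, mul_add]

theorem avg_mul_left {α : Type*} [Fintype α] (c : ℝ) (f : α → ℝ) :
    avg (fun a => c * f a) = c * avg f := by
  simp [avg, mul_sum]; simp only [mul_left_comm]

theorem avg_mul_right {α : Type*} [Fintype α] (c : ℝ) (f : α → ℝ) :
    avg (fun a => f a * c) = avg f * c := by
  simp only [mul_comm _ c, avg_mul_left]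

theorem avg_sum {α ι : Type*} [Fintype α] (s : Finset ι) (f : ι → α → ℝ) :
    avg (fun a => ∑ i ∈ s, f i a) = ∑ i ∈ s, avg (f i) := by
  simp only [avg, mul_sum]
  rw [sum_comm]

theorem avg_comm {α β : Type*} [Fintype α] [Fintype β] (f : α → β → ℝ) :
    avg (fun a => avg fun b => f a b) = avg fun b => avg fun a => f a b := by
  simp only [avg, mul_sum]
  rw [sum_comm]
  simp only [mul_left_comm]

/-- A coordinate is independent of a function of the other coordinates. -/
theorem avg_coord {ι β : Type*} [Fintype ι] [DecidableEq ι] [Fintype β] [Nonempty β] (i : ι)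
    (F : β → (ι → β) → ℝ) (hF : ∀ b s c, F b (update s i c) = F b s) :
    avg (fun s => F (s i) s) = avg fun b => avg fun s => F b s := by
  have hc : (Fintype.card β : ℝ) ≠ 0 := by simp_all
  have key : ∑ s : ι → β, ∑ b : β, F b s = Fintype.card β * ∑ s : ι → β, F (s i) s := by
    have h1 : ∑ x : (ι → β) × β, F x.2 x.1 = ∑ x : (ι → β) × β, F (x.1 i) x.1 := by
      refine sum_bij' (fun x _ => (update x.1 i x.2, x.1 i))
        (fun x _ => (update x.1 i x.2, x.1 i)) ?_ ?_ ?_ ?_ ?_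
      · simp
      · simp
      · simp_all
      · simp_all
      simp_all
    rw [Fintype.sum_prod_type, Fintype.sum_prod_type] at h1
    rw [h1]
    simp [mul_sum]
  rw [avg_comm]
  simp only [avg, ← mul_sum]
  simp_all

/-- The mean over independent coordinates is multiplicative. -/
theorem avg_prod {ι β : Type*} [Fintype ι] [DecidableEq ι] [Fintype β] (f : ι → β → ℝ) :
    avg (fun s : ι → β => ∏ i, f i (s i)) = ∏ i, avg (f i) := by
  have h := prod_univ_sum (fun _ : ι => (univ : Finset β)) f
  rw [Fintype.piFinset_univ] at h
  simp only [avg, prod_mul_distrib, h]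
  simp

/-! ## Second moments of the noise -/

/-- The product of a factor `y` for each qubit of `S` on which `P` is nontrivial. -/
def pw (y : ℝ) (S : Finset (Fin n)) (P : Str n) : ℝ := ∏ j, if j ∈ S ∧ P j ≠ 0 then y else 1

theorem pw_univ (y : ℝ) (P : Str n) : pw y univ P = y ^ wt P := by
  simp only [pw, mem_univ, true_and, wt]
  rw [prod_ite]
  simp

theorem pw_nonneg {y : ℝ} (hy : 0 ≤ y) (S : Finset (Fin n)) (P : Str n) : 0 ≤ pw y S P :=
  prod_nonneg fun j _ => by aesop

theorem pw_le_one {y : ℝ} (hy : 0 ≤ y) (hy1 : y ≤ 1) (S : Finset (Fin n)) (P : Str n) :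
    pw y S P ≤ 1 := prod_le_one (fun j _ => by aesop) (fun j _ => by aesop)

theorem pw_le {y : ℝ} (hy : 0 ≤ y) (hy1 : y ≤ 1) {S : Finset (Fin n)} (hj : j ∈ S) (hP : P j ≠ 0) :
    pw y S P ≤ y := by
  rw [pw, ← mul_prod_erase _ _ (mem_univ j), if_pos ⟨hj, hP⟩]
  refine mul_le_of_le_one_right hy (prod_le_one (fun j _ => ?_) (fun j _ => ?_)) <;>
    split_ifs <;> simp [hy, hy1]

theorem nu_sq (g : ℝ) (s : Fin 2) (b a : Fin 4) : nu g s b a ^ 2 = nu g 0 b a ^ 2 := by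
  unfold nu
  simp_all

theorem sum_nu_sq_le (h0 : 0 < g) (h1 : g ≤ 4 / 7) (a : Fin 4) :
    ∑ b, nu g 0 b a ^ 2 ≤ if a ≠ 0 then (1 - g / 2) ^ 2 else 1 := by
  fin_cases a <;> simp [nu, Fin.sum_univ_four]
  nlinarith

theorem sum_nu_sq_star_le (h0 : 0 < g) (h1 : g ≤ 4 / 7) (a : Fin 4) :
    ∑ b, (if b ≠ 0 then ((1 - g / 2) ^ 2)⁻¹ else 1) * nu g 0 b a ^ 2 ≤ 1 := by
  have hq : (0 : ℝ) < 1 - g / 2 := by linarith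
  fin_cases a <;> simp [nu, Fin.sum_univ_four]
  · rw [inv_mul_cancel₀ (by positivity)]
  · rw [inv_mul_cancel₀ (by positivity)]
  have h2 : (1 - g) ^ 2 ≤ (1 - g ^ 2) * (1 - g / 2) ^ 2 := by
    have h3 : (1 - g) ≤ (1 + g) * (1 - g / 2) ^ 2 := by nlinarith [mul_pos h0 h0]
    nlinarith
  have h3 : ((1 - g / 2) ^ 2)⁻¹ * (1 - g) ^ 2 ≤ 1 - g ^ 2 := by
    rw [inv_mul_le_iff₀ (by positivity)]
    linarith
  linarith

theorem sum_prod_eq (f : Fin n → Fin 4 → ℝ) : ∑ Q : Str n, ∏ j, f j (Q j) = ∏ j, ∑ b, f j b := by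
  have h := prod_univ_sum (fun _ : Fin n => (univ : Finset (Fin 4))) f
  simp_all

theorem siteK_sq (g : ℝ) (S : Finset (Fin n)) (s : Fin n → Fin 2) (Q R : Str n) :
    siteK g S s Q R ^ 2 = ∏ j, if j ∈ S then nu g 0 (Q j) (R j) ^ 2
      else if Q j = R j then 1 else 0 := by
  rw [siteK, ← prod_pow]
  refine prod_congr rfl fun j _ => ?_
  by_cases h1 : j ∈ S
  · simp only [h1, if_true]; exact nu_sq _ _ _ _
  simp_all

theorem sum_siteK_sq_le (h0 : 0 < g) (h1 : g ≤ 4 / 7) (S : Finset (Fin n))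
    (s : Fin n → Fin 2) (R : Str n) : ∑ Q, siteK g S s Q R ^ 2 ≤ pw ((1 - g / 2) ^ 2) S R := by
  simp only [siteK_sq]
  rw [sum_prod_eq (fun j b => if j ∈ S then nu g 0 b (R j) ^ 2 else if b = R j then 1 else 0)]
  refine prod_le_prod (fun j _ => sum_nonneg fun b _ => ?_) (fun j _ => ?_)
  · positivity
  by_cases h2 : j ∈ S
  · simpa [h2] using sum_nu_sq_le h0 h1 (R j)
  simp [h2]

theorem sum_siteK_sq_star_le (h0 : 0 < g) (h1 : g ≤ 4 / 7) (S : Finset (Fin n))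
    (s : Fin n → Fin 2) (R : Str n) : ∑ Q, pw ((1 - g / 2) ^ 2)⁻¹ univ Q * siteK g S s Q R ^ 2
      ≤ pw ((1 - g / 2) ^ 2)⁻¹ Sᶜ R := by
  have e : ∀ Q : Str n, pw ((1 - g / 2) ^ 2)⁻¹ univ Q * siteK g S s Q R ^ 2 =
      ∏ j, (if Q j ≠ 0 then ((1 - g / 2) ^ 2)⁻¹ else 1) *
        (if j ∈ S then nu g 0 (Q j) (R j) ^ 2 else if Q j = R j then 1 else 0) := by
    intro Q
    rw [siteK_sq, pw, prod_mul_distrib]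
    simp
  rw [sum_congr rfl fun Q _ => e Q, sum_prod_eq (fun j b =>
    (if b ≠ 0 then ((1 - g / 2) ^ 2)⁻¹ else 1) *
        (if j ∈ S then nu g 0 b (R j) ^ 2 else if b = R j then 1 else 0))]
  refine prod_le_prod (fun j _ => sum_nonneg fun b _ => ?_) (fun j _ => ?_)
  · positivity
  by_cases h2 : j ∈ S
  · simpa [h2] using sum_nu_sq_star_le h0 h1 (R j)
  simp [h2]

theorem siteK_of_trivial (g : ℝ) {S : Finset (Fin n)} (s : Fin n → Fin 2) {R : Str n}
    (hR : ∀ j ∈ S, R j = 0) (Q : Str n) : siteK g S s Q R = if Q = R then 1 else 0 := by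
  have : ∀ j, (if j ∈ S then nu g (s j) (Q j) (R j) else if Q j = R j then 1 else 0)
      = if Q j = R j then (1 : ℝ) else 0 := by
    aesop
  rw [siteK, prod_congr rfl fun j _ => this j]
  simp [prod_ite_zero, funext_iff]

theorem avg_fin_two (f : Fin 2 → ℝ) : avg f = (f 0 + f 1) / 2 := by
  simp [avg, Fin.sum_univ_two]; ring

theorem avg_siteK_mul (g : ℝ) (S : Finset (Fin n)) (Q R R' : Str n) :
    avg (fun s => siteK g S s Q R * siteK g S s Q R') =
      if R = R' then siteK g S 0 Q R ^ 2 else 0 := by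
  split_ifs with h
  · subst h
    simp only [← sq]
    have : ∀ s, siteK g S s Q R ^ 2 = siteK g S 0 Q R ^ 2 := fun s => by
      rw [siteK_sq, siteK_sq]
    simp only [this]
    exact avg_const _
  simp only [siteK, ← prod_mul_distrib]
  rw [avg_prod (fun j (σ : Fin 2) =>
    (if j ∈ S then nu g σ (Q j) (R j) else if Q j = R j then 1 else 0) *
    (if j ∈ S then nu g σ (Q j) (R' j) else if Q j = R' j then 1 else 0))]
  obtain ⟨j, hj⟩ := ne_iff.mp h
  refine prod_eq_zero (mem_univ j) ?_
  rw [avg_fin_two]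
  by_cases h1 : j ∈ S
  · simp only [h1, if_true, nu]
    generalize R j = a at hj ⊢
    generalize R' j = a' at hj ⊢
    generalize Q j = b
    revert hj
    fin_cases a <;> fin_cases a' <;> fin_cases b <;> simp
  aesop

theorem avg_siteK_of_ne (g : ℝ) (S : Finset (Fin n)) {Q R : Str n} (h : Q ≠ R) :
    avg (fun s => siteK g S s Q R) = 0 := by
  simp only [siteK]
  rw [avg_prod (fun j (σ : Fin 2) =>
      (if j ∈ S then nu g σ (Q j) (R j) else if Q j = R j then 1 else 0))]
  obtain ⟨j, hj⟩ := ne_iff.mp h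
  refine prod_eq_zero (mem_univ j) ?_
  rw [avg_fin_two]
  by_cases h1 : j ∈ S
  · simp only [h1, if_true, nu]
    generalize R j = a at hj ⊢
    generalize Q j = b at hj ⊢
    revert hj
    fin_cases a <;> fin_cases b <;> simp
  simp_all

/-- The mean square of a random observable after noise with random directions. -/
theorem avg_noise (g : ℝ) (S : Finset (Fin n)) (w y : Vec n) :
    avg (fun s => ∑ Q, w Q * (∑ R, siteK g S s Q R * y R) ^ 2) =
      ∑ R, y R ^ 2 * ∑ Q, w Q * siteK g S 0 Q R ^ 2 := by
  rw [avg_sum]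
  have h : ∀ Q, avg (fun s => w Q * (∑ R, siteK g S s Q R * y R) ^ 2) =
      ∑ R, y R ^ 2 * (w Q * siteK g S 0 Q R ^ 2) := by
    intro Q
    rw [avg_mul_left]
    have e : ∀ s, (∑ R, siteK g S s Q R * y R) ^ 2 =
        ∑ R, ∑ R', (siteK g S s Q R * siteK g S s Q R') * (y R * y R') := by
      intro s
      rw [sq, sum_mul_sum]
      refine sum_congr rfl fun R _ => sum_congr rfl fun R' _ => ?_
      ring
    simp only [e, avg_sum, avg_mul_right, avg_siteK_mul]
    simp only [ite_mul, zero_mul, sum_ite_eq, mem_univ, if_true, mul_sum]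
    exact sum_congr rfl fun R _ => by ring
  simp only [h, mul_sum]
  rw [sum_comm]

/-! ## Propagation of errors through a layer -/

/-- The squared norm of the observable `∑ₚ o(P) h(·, P)`. -/
def qf (h : Ker n) (o : Vec n) : ℝ := ∑ Z, (∑ P, o P * h Z P) ^ 2

theorem qf_nonneg (h : Ker n) (o : Vec n) : 0 ≤ qf h o :=
  sum_nonneg fun _ _ => sq_nonneg _

/-- The functional with value `r R` at the string `Z = R` only. -/
def delta (Z P : Str n) : ℝ := if P = Z then 1 else 0

theorem qf_delta (o : Vec n) : qf delta o = ∑ P, o P ^ 2 := by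
  simp [qf, delta]

theorem qf_layer (K N D : Ker n) (o : Vec n) :
    qf (fun Z P => ∑ R, K R P * ∑ Q, N Q R * D Z Q) o
      = qf D fun Q => ∑ R, N Q R * ∑ P, K R P * o P := by
  unfold qf
  refine sum_congr rfl fun Z _ => ?_
  congr 1
  simp only [mul_sum, sum_mul]
  rw [sum_comm]
  simp only [sum_comm (s := (univ : Finset (Str n))) (f := fun P Q => o P * (_ * (N Q _ * D Z Q)))]
  rw [sum_comm]
  refine sum_congr rfl fun Q _ => sum_congr rfl fun R _ =>
    sum_congr rfl fun P _ => ?_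
  ring

theorem avg_step (g : ℝ) (S : Finset (Fin n)) (i : Fin (d + 1))
    (D : Directions n d → Ker n) (hD : ∀ s c, D (update s i c) = D s)
    (w : Vec n) (hw : ∀ o, avg (fun s => qf (D s) o) ≤ ∑ Q, w Q * o Q ^ 2)
    (K : Ker n) (o : Vec n) :
    avg (fun s => qf (fun Z P => ∑ R, K R P * ∑ Q, siteK g S (s i) Q R * D s Z Q) o)
      ≤ ∑ R, (∑ P, K R P * o P) ^ 2 * ∑ Q, w Q * siteK g S 0 Q R ^ 2 := by
  simp only [qf_layer]
  rw [avg_coord i (fun b s => qf (D s) fun Q => ∑ R, siteK g S b Q R * ∑ P, K R P * o P)]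
  · rw [← avg_noise]
    exact avg_mono fun b => hw _
  simp_all

theorem qf_sum_le {ι : Type*} (I : Finset ι) (l : ι → ℝ) (hl : ∀ i ∈ I, 0 < l i)
    (h : ι → Ker n) (o : Vec n) :
    qf (fun Z P => ∑ i ∈ I, h i Z P) o ≤ (∑ i ∈ I, l i) * ∑ i ∈ I, qf (h i) o / l i := by
  unfold qf
  simp only [sum_div]
  rw [sum_comm, mul_sum]
  refine sum_le_sum fun Z _ => ?_
  have e : ∑ P, o P * ∑ i ∈ I, h i Z P = ∑ i ∈ I, ∑ P, o P * h i Z P := by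
    simp only [mul_sum]
    rw [sum_comm]
  rw [e]
  refine sum_sq_le_sum_mul_sum_of_sq_le_mul I (fun i hi => (hl i hi).le)
    (fun i hi => div_nonneg (sq_nonneg _) (hl i hi).le) (fun i hi => ?_)
  exact (mul_div_cancel₀ _ (hl i hi).ne').ge

theorem avg_qf_add_le {α : Type*} [Fintype α] {u v a b : ℝ} (hu : 0 < u) (hv : 0 < v)
    (h k : α → Ker n) (o : Vec n) (ha : avg (fun s => qf (h s) o) ≤ u * a)
    (hb : avg (fun s => qf (k s) o) ≤ v * b) :
    avg (fun s => qf (fun Z P => h s Z P + k s Z P) o) ≤ (u + v) * (a + b) := by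
  have h1 : ∀ s, qf (fun Z P => h s Z P + k s Z P) o ≤
      (u + v) * (u⁻¹ * qf (h s) o + v⁻¹ * qf (k s) o) := by
    intro s
    have := qf_sum_le (univ : Finset Bool) (fun i => cond i u v)
      (by simp_all) (fun i => cond i (h s) (k s)) o
    simpa [div_eq_inv_mul] using this
  refine (avg_mono h1).trans ?_
  rw [avg_mul_left, avg_add, avg_mul_left, avg_mul_left]
  have h2 : u⁻¹ * avg (fun s => qf (h s) o) ≤ a := by
    rw [inv_mul_le_iff₀ hu]; exact ha
  have h3 : v⁻¹ * avg (fun s => qf (k s) o) ≤ b := by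
    rw [inv_mul_le_iff₀ hv]; exact hb
  exact mul_le_mul_of_nonneg_left (add_le_add h2 h3) (by positivity)

/-! ## Exact and truncated evolution -/

/-- The exact functional after `k` more layers, the next one being layer `t`. -/
def full (gk nk : ℕ → Ker n) (r : Vec n) : ℕ → ℕ → Vec n
  | _, 0, P => r P
  | t, k + 1, P => ∑ R, gk t R P * ∑ Q, nk (t + 1) Q R * full gk nk r (t + 1) k Q

/-- The functional that drops everything but the identity after `c` layers. -/
def capped (gk nk : ℕ → Ker n) (r : Vec n) : ℕ → ℕ → ℕ → Vec n
  | _, 0, _, P => r P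
  | _, _ + 1, 0, P => if P = 0 then r 0 else 0
  | t, k + 1, c + 1, P => ∑ R, gk t R P * ∑ Q, nk (t + 1) Q R * capped gk nk r (t + 1) k c Q

/-- The functional that moreover drops all Pauli paths of total weight at least `b`. -/
def budgeted (gk nk : ℕ → Ker n) (r : Vec n) : ℕ → ℕ → ℕ → ℕ → Vec n
  | _, 0, _, b, P => if b = 0 then 0 else r P
  | _, _ + 1, 0, b, P => if b = 0 then 0 else if P = 0 then r 0 else 0
  | t, k + 1, c + 1, b, P =>
    ∑ R, gk t R P * ∑ Q, nk (t + 1) Q R * budgeted gk nk r (t + 1) k c (b - wt R) Q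

/-- The functional that drops all strings of weight more than `κ` after each layer of gates. -/
def lowWeight (gk nk : ℕ → Ker n) (r : Vec n) (κ : ℕ) : ℕ → ℕ → Vec n
  | _, 0, P => r P
  | t, k + 1, P => ∑ R, gk t R P * (if wt R ≤ κ then
      ∑ Q, nk (t + 1) Q R * lowWeight gk nk r κ (t + 1) k Q else 0)

def dirAt (s : Directions n d) (t : ℕ) : Fin n → Fin 2 := if h : t < d + 1 then s ⟨t, h⟩ else 0

/-- The transition kernel of noise layer `t`. -/
def noiseK (g : ℝ) (S : ℕ → Finset (Fin n)) (s : Directions n d) (t : ℕ)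
    (Q R : Str n) : ℝ := siteK g (S t) (dirAt s t) Q R

/-- The kernels of uniform noise. -/
notation:max "𝒰" g:max s:max => noiseK g (fun _ => univ) s

theorem noiseK_zero_right (g : ℝ) (S : ℕ → Finset (Fin n)) (s : Directions n d) (t : ℕ)
    (Q : Str n) : noiseK g S s t Q 0 = if Q = 0 then 1 else 0 :=
  siteK_of_trivial g _ (fun _ _ => rfl) Q

theorem IsLayer.zero_right {p : Fin n → Fin n} (hK : IsLayer p K)
    (R : Str n) : K R 0 = if R = 0 then 1 else 0 := by
  by_cases h : R = 0
  · subst h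
    rw [hK.trivial_eq 0 0 (fun _ _ => rfl)]
  rw [if_neg h]
  by_contra hc
  exact h ((hK.zero_iff hc).mpr rfl)

theorem noiseK_update (g : ℝ) (S : ℕ → Finset (Fin n)) (s : Directions n d)
    (i : Fin (d + 1)) (c : Fin n → Fin 2) {t : ℕ} (ht : t ≠ i) :
    noiseK g S (update s i c) t = noiseK g S s t := by
  funext Q R
  unfold noiseK dirAt
  split_ifs with h
  · rw [update_of_ne]
    intro h'
    exact ht (by rw [← h'])
  rfl

theorem full_congr (gk : ℕ → Ker n) {nk nk' : ℕ → Ker n}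
    (r : Vec n) (k : ℕ) : ∀ t, (∀ i, t < i → nk i = nk' i) →
      full gk nk r t k = full gk nk' r t k := by
  induction k with
  | zero => intro t _; rfl
  | succ k ih =>
    intro t h
    funext P
    simp only [full]
    rw [ih (t + 1) fun i hi => h i (by omega), h (t + 1) (by omega)]

theorem capped_congr (gk : ℕ → Ker n) {nk nk' : ℕ → Ker n}
    (r : Vec n) (k : ℕ) : ∀ t c, (∀ i, t < i → nk i = nk' i) →
      capped gk nk r t k c = capped gk nk' r t k c := by
  induction k with
  | zero => intro t c _; cases c <;> rfl
  | succ k ih =>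
    intro t c h
    funext P
    rcases c with _ | c
    · rfl
    simp only [capped]
    rw [ih (t + 1) c fun i hi => h i (by omega), h (t + 1) (by omega)]

theorem budgeted_congr (gk : ℕ → Ker n) {nk nk' : ℕ → Ker n}
    (r : Vec n) (k : ℕ) : ∀ t c b, (∀ i, t < i → nk i = nk' i) →
      budgeted gk nk r t k c b = budgeted gk nk' r t k c b := by
  induction k with
  | zero => intro t c b _; cases c <;> rfl
  | succ k ih =>
    intro t c b h
    funext P
    rcases c with _ | c
    · rfl
    simp only [budgeted]
    rw [h (t + 1) (by omega)]
    simp only [ih (t + 1) c _ fun i hi => h i (by omega)]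

theorem lowWeight_congr (gk : ℕ → Ker n) {nk nk' : ℕ → Ker n}
    (r : Vec n) (κ k : ℕ) : ∀ t, (∀ i, t < i → nk i = nk' i) →
      lowWeight gk nk r κ t k = lowWeight gk nk' r κ t k := by
  induction k with
  | zero => intro t _; rfl
  | succ k ih =>
    intro t h
    funext P
    simp only [lowWeight]
    rw [ih (t + 1) fun i hi => h i (by omega), h (t + 1) (by omega)]

theorem sum_layer_zero {p : Fin n → Fin n} {N : Ker n} (hK : IsLayer p K)
    (hN : ∀ Q, N Q 0 = if Q = 0 then 1 else 0) (h : Ker n) :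
    ∑ R, K R 0 * ∑ Q, N Q R * h R Q = h 0 0 := by
  simp [hK.zero_right, hN]

theorem full_zero (hg : Layers p gk) (S : ℕ → Finset (Fin n)) (s : Directions n d)
    (r : Vec n) (k : ℕ) : ∀ t, full gk (noiseK g S s) r t k 0 = r 0 := by
  induction k with
  | zero => intro t; rfl
  | succ k ih =>
    intro t
    simp only [full]
    rw [sum_layer_zero (hg t) (noiseK_zero_right g S s (t + 1)), ih]

theorem capped_zero (hg : Layers p gk) (S : ℕ → Finset (Fin n))
    (s : Directions n d) (r : Vec n) (k : ℕ) : ∀ t c, capped gk (noiseK g S s) r t k c 0 = r 0 := by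
  induction k with
  | zero => intro t c; cases c <;> rfl
  | succ k ih =>
    intro t c
    rcases c with _ | c
    · simp [capped]
    simp only [capped]
    rw [sum_layer_zero (hg t) (noiseK_zero_right g S s (t + 1)), ih]

theorem budgeted_zero (hg : Layers p gk) (S : ℕ → Finset (Fin n))
    (s : Directions n d) (r : Vec n) (k : ℕ) {b : ℕ} (hb : b ≠ 0) :
    ∀ t c, budgeted gk (noiseK g S s) r t k c b 0 = r 0 := by
  induction k with
  | zero => intro t c; cases c <;> simp [budgeted, hb]
  | succ k ih =>
    intro t c
    rcases c with _ | c
    · simp [budgeted, hb]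
    simp only [budgeted]
    rw [sum_layer_zero (hg t) (noiseK_zero_right g S s (t + 1))
      (fun R Q => budgeted gk (noiseK g S s) r (t + 1) k c (b - wt R) Q)]
    have : wt (0 : Str n) = 0 := wt_eq_zero.mpr rfl
    rw [this, Nat.sub_zero, ih]

theorem budgeted_of_budget_zero (gk nk : ℕ → Ker n) (r : Vec n) (k : ℕ) :
    ∀ t c P, budgeted gk nk r t k c 0 P = 0 := by
  induction k with
  | zero => intro t c P; cases c <;> simp [budgeted]
  | succ k ih =>
    intro t c P
    rcases c with _ | c
    · simp [budgeted]
    simp [budgeted, ih]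

/-- A layer preserves the norm. -/
theorem IsLayer.sum_sq (hK : IsLayer q K)
    (o : Vec n) : ∑ R, (∑ P, K R P * o P) ^ 2 = ∑ P, o P ^ 2 := by
  simpa using hK.sum_mul_sq (fun _ => 1) (fun _ _ _ => rfl) o

theorem avg_layer_contract (h0 : 0 < g) (h1 : g ≤ 4 / 7) (S : Finset (Fin n)) (i : Fin (d + 1))
    (D : Directions n d → Ker n) (hD : ∀ s c, D (update s i c) = D s)
    (hw : ∀ o, avg (fun s => qf (D s) o) ≤ ∑ Q, o Q ^ 2) (hK : IsLayer q K) (o : Vec n) :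
    avg (fun s => qf (fun Z P => ∑ R, K R P * ∑ Q, siteK g S (s i) Q R * D s Z Q) o)
      ≤ ∑ P, o P ^ 2 := by
  have h := avg_step g S i D hD (fun _ => 1) (by simpa using hw) K o
  refine h.trans ?_
  rw [← hK.sum_sq o]
  refine sum_le_sum fun R _ => ?_
  refine mul_le_of_le_one_right (sq_nonneg _) ?_
  simp only [one_mul]
  exact (sum_siteK_sq_le h0 h1 S 0 R).trans (pw_le_one (by positivity) (by nlinarith) S R)

theorem noiseK_eq (S : ℕ → Finset (Fin n)) (s : Directions n d) {t : ℕ} (ht : t < d + 1) :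
    noiseK g S s t = siteK g (S t) (s ⟨t, ht⟩) := by
  funext Q R
  simp [noiseK, dirAt, ht]

theorem avg_qf_full_le (h0 : 0 < g) (h1 : g ≤ 4 / 7) (hg : Layers p gk)
    (S : ℕ → Finset (Fin n)) (k : ℕ) : ∀ t, t + k = d → ∀ o : Vec n,
    avg (fun s : Directions n d => qf (fun Z => full gk (noiseK g S s) (delta Z) t k) o)
      ≤ ∑ P, o P ^ 2 := by
  induction k with
  | zero => intro t _ o; simp only [full]; rw [avg_const]; exact (qf_delta o).le
  | succ k ih =>
    intro t ht o
    have hlt : t + 1 < d + 1 := by omega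
    simp only [full, noiseK_eq S _ hlt]
    refine avg_layer_contract h0 h1 (S (t + 1)) ⟨t + 1, hlt⟩
      (fun s Z => full gk (noiseK g S s) (delta Z) (t + 1) k) (fun s c => ?_)
      (ih (t + 1) (by omega)) (hg t) o
    funext Z
    exact full_congr gk _ k (t + 1) fun i hi => noiseK_update g S s _ c (by simp; omega)

theorem avg_qf_capped_le (h0 : 0 < g) (h1 : g ≤ 4 / 7) (hg : Layers p gk)
    (S : ℕ → Finset (Fin n)) (k : ℕ) : ∀ t c, t + k = d → ∀ o : Vec n,
    avg (fun s : Directions n d => qf (fun Z => capped gk (noiseK g S s) (delta Z) t k c) o)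
      ≤ ∑ P, o P ^ 2 := by
  induction k with
  | zero =>
    intro t c _ o
    cases c <;> simp only [capped] <;> rw [avg_const] <;> exact (qf_delta o).le
  | succ k ih =>
    intro t c ht o
    rcases c with _ | c
    · simp only [capped]
      rw [avg_const, qf]
      simp only [mul_ite, mul_zero, sum_ite_eq', mem_univ, if_true]
      simp only [delta, mul_ite, mul_one, mul_zero, ite_pow, ne_eq, OfNat.ofNat_ne_zero,
        not_false_eq_true, zero_pow, sum_ite_eq, mem_univ, if_true]
      exact single_le_sum (f := fun P => o P ^ 2) (fun _ _ => sq_nonneg _) (mem_univ 0)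
    have hlt : t + 1 < d + 1 := by omega
    simp only [capped, noiseK_eq S _ hlt]
    refine avg_layer_contract h0 h1 (S (t + 1)) ⟨t + 1, hlt⟩
      (fun s Z => capped gk (noiseK g S s) (delta Z) (t + 1) k c) (fun s c => ?_)
      (ih (t + 1) c (by omega)) (hg t) o
    funext Z
    exact capped_congr gk _ k (t + 1) _ fun i hi => noiseK_update g S s _ c (by simp; omega)

/-- A layer followed by uniform noise contracts by `q²` on strings other than the identity. -/
theorem avg_layer_nontrivial (h0 : 0 < g) (h1 : g ≤ 4 / 7) (i : Fin (d + 1))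
    (D : Directions n d → Ker n) (hD : ∀ s c, D (update s i c) = D s) {a : ℝ} (ha : 0 ≤ a)
    (hw : ∀ o, avg (fun s => qf (D s) o) ≤ ∑ Q, (if Q = 0 then 0 else a) * o Q ^ 2)
    (hK : IsLayer q K) (o : Vec n) :
    avg (fun s => qf (fun Z P => ∑ R, K R P * ∑ Q, siteK g univ (s i) Q R * D s Z Q) o)
      ≤ ∑ P, (if P = 0 then 0 else (1 - g / 2) ^ 2 * a) * o P ^ 2 := by
  have h := avg_step g univ i D hD _ hw K o
  refine h.trans ?_
  rw [← hK.sum_mul_sq (fun P => if P = 0 then 0 else (1 - g / 2) ^ 2 * a)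
    (fun R P hRP => by simp [hK.zero_iff hRP]) o]
  refine sum_le_sum fun R _ => ?_
  rw [mul_comm]
  refine mul_le_mul_of_nonneg_right ?_ (sq_nonneg _)
  split_ifs with hR
  · subst hR
    simp [siteK_of_trivial g (S := univ) 0 (R := (0 : Str n)) (fun _ _ => rfl)]
  calc ∑ Q, (if Q = 0 then 0 else a) * siteK g univ 0 Q R ^ 2
      ≤ ∑ Q, a * siteK g univ 0 Q R ^ 2 := by
        refine sum_le_sum fun Q _ => mul_le_mul_of_nonneg_right ?_ (sq_nonneg _)
        split_ifs <;> simp [ha]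
    _ ≤ a * (1 - g / 2) ^ 2 := by
        rw [← mul_sum]
        refine mul_le_mul_of_nonneg_left ((sum_siteK_sq_le h0 h1 univ 0 R).trans ?_) ha
        obtain ⟨j, hj⟩ := ne_iff.mp hR
        exact pw_le (by positivity) (by nlinarith) (mem_univ j) hj
    _ = _ := mul_comm _ _

theorem avg_qf_full_sub_capped_le (h0 : 0 < g) (h1 : g ≤ 4 / 7)
    (hg : Layers p gk) (k : ℕ) : ∀ t c, t + k = d → ∀ o : Vec n,
    avg (fun s : Directions n d => qf (fun Z P =>
        full gk (𝒰 g s) (delta Z) t k P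
        - capped gk (𝒰 g s) (delta Z) t k c P) o)
      ≤ ∑ P, (if P = 0 then 0 else ((1 - g / 2) ^ 2) ^ c) * o P ^ 2 := by
  have hnn : ∀ (c : ℕ) (o : Vec n),
      0 ≤ ∑ P, (if P = 0 then 0 else ((1 - g / 2) ^ 2) ^ c) * o P ^ 2 := by
    intro c o
    positivity
  induction k with
  | zero =>
    intro t c _ o
    refine le_trans (le_of_eq ?_) (hnn c o)
    cases c <;> simp only [full, capped, sub_self] <;> simp [qf, avg]
  | succ k ih =>
    intro t c ht o
    rcases c with _ | c
    · have e : ∀ s : Directions n d, qf (fun Z P =>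
          full gk (𝒰 g s) (delta Z) t (k + 1) P
          - capped gk (𝒰 g s) (delta Z) t (k + 1) 0 P) o
          = qf (fun Z => full gk (𝒰 g s) (delta Z) t (k + 1))
            (fun P => if P = 0 then 0 else o P) := by
        intro s
        unfold qf
        refine sum_congr rfl fun Z _ => ?_
        congr 1
        refine sum_congr rfl fun P _ => ?_
        by_cases hP : P = 0
        · subst hP
          simp [capped, full_zero hg]
        simp [capped, hP]
      simp only [e]
      refine (avg_qf_full_le h0 h1 hg _ (k + 1) t ht _).trans (le_of_eq ?_)
      refine sum_congr rfl fun P _ => ?_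
      by_cases hP : P = 0 <;> simp [hP]
    have hlt : t + 1 < d + 1 := by omega
    have e : ∀ s : Directions n d, (fun Z P =>
        full gk (𝒰 g s) (delta Z) t (k + 1) P
        - capped gk (𝒰 g s) (delta Z) t (k + 1) (c + 1) P)
        = fun Z P => ∑ R, gk t R P * ∑ Q, siteK g univ (s ⟨t + 1, hlt⟩) Q R *
          (full gk (𝒰 g s) (delta Z) (t + 1) k Q
        - capped gk (𝒰 g s) (delta Z) (t + 1) k c Q) := by
      intro s
      funext Z P
      simp only [full, capped, noiseK_eq _ _ hlt, mul_sub, sum_sub_distrib]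
    have hpow : ((1 - g / 2) ^ 2) ^ (c + 1) = (1 - g / 2) ^ 2 * ((1 - g / 2) ^ 2) ^ c :=
      pow_succ' _ _
    simp only [e, hpow]
    refine avg_layer_nontrivial h0 h1 ⟨t + 1, hlt⟩ (fun s Z Q =>
          (full gk (𝒰 g s) (delta Z) (t + 1) k Q
        - capped gk (𝒰 g s) (delta Z) (t + 1) k c Q))
        (fun s c' => ?_) (by positivity) (ih (t + 1) c (by omega)) (hg t) o
    have hu : ∀ i, t + 1 < i → 𝒰 g (update s ⟨t + 1, hlt⟩ c') i = 𝒰 g s i :=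
      fun i hi => noiseK_update g _ s _ c' (by simp; omega)
    funext Z P
    rw [full_congr gk _ k (t + 1) hu, capped_congr gk _ k (t + 1) c hu]

theorem avg_layer_budget (h0 : 0 < g) (h1 : g ≤ 4 / 7) (i : Fin (d + 1))
    (D : ℕ → Directions n d → Ker n) (hD : ∀ b s c, D b (update s i c) = D b s)
    (hD0 : ∀ b s Z, b ≠ 0 → D b s Z 0 = 0) {a : ℝ} (ha : 0 ≤ a)
    (hw : ∀ b o, avg (fun s => qf (D b s) o) ≤ a * (1 - g / 2) ^ b * ∑ Q, o Q ^ 2)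
    (hK : IsLayer q K) {b : ℕ} (hb : b ≠ 0)
    (o : Vec n) : avg (fun s => qf (fun Z P => ∑ R, K R P * ∑ Q, siteK g univ (s i) Q R *
        D (b - wt R) s Z Q) o) ≤ 2 / g * a * (1 - g / 2) ^ b * ∑ P, o P ^ 2 := by
  set x := 1 - g / 2 with hx
  have hx0 : 0 < x := by rw [hx]; linarith
  have hx1 : x < 1 := by rw [hx]; linarith
  have e : ∀ s : Directions n d, (fun Z P => ∑ R, K R P * ∑ Q,
      siteK g univ (s i) Q R * D (b - wt R) s Z Q) = fun Z P =>
      ∑ w ∈ Finset.Icc 1 n, ∑ R, (if wt R = w then K R P else 0) * ∑ Q,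
        siteK g univ (s i) Q R * D (b - w) s Z Q := by
    intro s
    funext Z P
    rw [sum_comm]
    refine sum_congr rfl fun R _ => ?_
    by_cases hR : R = 0
    · subst hR
      have hz : wt (0 : Str n) = 0 := wt_eq_zero.mpr rfl
      simp only [siteK_of_trivial g (S := univ) (s i) (R := (0 : Str n)) (fun _ _ => rfl),
        hz, Nat.sub_zero, ite_mul, one_mul, zero_mul, sum_ite_eq', mem_univ,
        if_true, hD0 b s Z hb, mul_zero]
      simp_all
    rw [sum_eq_single (wt R)]
    · simp
    · intro w _ hw
      simp [Ne.symm hw]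
    intro hc
    exact absurd (mem_Icc.mpr ⟨wt_pos hR, wt_le R⟩) hc
  simp only [e]
  refine (avg_mono fun s => qf_sum_le (Finset.Icc 1 n) (fun w => x ^ w)
    (fun w _ => pow_pos hx0 w) (fun w Z P => ∑ R, (if wt R = w then K R P else 0) * ∑ Q,
        siteK g univ (s i) Q R * D (b - w) s Z Q) o).trans ?_
  rw [avg_mul_left, avg_sum]
  have hgeo : ∑ w ∈ Finset.Icc 1 n, x ^ w ≤ 2 / g := by
    have h2 : ∑ w ∈ Finset.Icc 1 n, x ^ w ≤ ∑ w ∈ range (n + 1), x ^ w := by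
      refine sum_le_sum_of_subset_of_nonneg (fun w hw => ?_) (fun w _ _ => by positivity)
      have := mem_Icc.mp hw
      simp; omega
    refine h2.trans ?_
    have h3 := Summable.sum_le_tsum (range (n + 1)) (fun w _ => by positivity)
      (summable_geometric_of_lt_one hx0.le hx1)
    rw [tsum_geometric_of_lt_one hx0.le hx1] at h3
    refine h3.trans (le_of_eq ?_)
    have h4 : 1 - x = g / 2 := by rw [hx]; ring
    rw [h4, inv_div]
  have hterm : ∀ w ∈ Finset.Icc 1 n, avg (fun s => qf (fun Z P =>
      ∑ R, (if wt R = w then K R P else 0) * ∑ Q,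
        siteK g univ (s i) Q R * D (b - w) s Z Q) o / x ^ w) ≤
      a * x ^ b * ∑ R, if wt R = w then (∑ P, K R P * o P) ^ 2 else 0 := by
    intro w _
    have h2 := avg_step g univ i (D (b - w)) (hD (b - w)) (fun _ => a * x ^ (b - w)) (fun o => by
        have := hw (b - w) o
        rwa [mul_sum] at this) (fun R P => if wt R = w then K R P else 0) o
    simp only [div_eq_mul_inv, avg_mul_right]
    rw [← div_eq_mul_inv, div_le_iff₀ (pow_pos hx0 w)]
    refine h2.trans ?_
    rw [mul_sum, sum_mul]
    refine sum_le_sum fun R _ => ?_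
    by_cases hR : wt R = w
    · simp only [hR, if_true]
      rw [← mul_sum]
      have h3 := sum_siteK_sq_le h0 h1 univ 0 R
      rw [pw_univ, hR, ← hx] at h3
      have h4 : x ^ (b - w) * x ^ w ≤ x ^ b := by
        rw [← pow_add]
        exact pow_le_pow_of_le_one hx0.le hx1.le (by omega)
      have h5 : a * x ^ (b - w) * ∑ Q, siteK g univ 0 Q R ^ 2 ≤ a * x ^ b * x ^ w := by
        calc _ ≤ a * x ^ (b - w) * (x ^ 2) ^ w := by gcongr
          _ = a * (x ^ (b - w) * x ^ w) * x ^ w := by ring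
          _ ≤ a * x ^ b * x ^ w := by gcongr
      calc _ ≤ (∑ P, K R P * o P) ^ 2 * (a * x ^ b * x ^ w) := by gcongr
        _ = _ := by ring
    simp [hR]
  have hsum : ∑ w ∈ Finset.Icc 1 n, ∑ R, (if wt R = w then (∑ P, K R P * o P) ^ 2 else 0)
      ≤ ∑ P, o P ^ 2 := by
    rw [← hK.sum_sq o, sum_comm]
    refine sum_le_sum fun R _ => ?_
    rw [sum_ite_eq]
    split_ifs
    · rfl
    positivity
  calc _ ≤ 2 / g * ∑ w ∈ Finset.Icc 1 n,
        (a * x ^ b * ∑ R, if wt R = w then (∑ P, K R P * o P) ^ 2 else 0) := by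
        refine mul_le_mul hgeo (sum_le_sum hterm) (sum_nonneg fun w _ => ?_) (by positivity)
        refine mul_nonneg (by positivity) (sum_nonneg fun s _ =>
          div_nonneg (qf_nonneg _ _) (by positivity))
    _ ≤ 2 / g * (a * x ^ b * ∑ P, o P ^ 2) := by
        rw [← mul_sum]
        gcongr
    _ = _ := by ring

theorem avg_qf_capped_sub_budgeted_le (h0 : 0 < g) (h1 : g ≤ 4 / 7)
    (hg : Layers p gk) (k : ℕ) : ∀ t c b, t + k = d → ∀ o : Vec n,
    avg (fun s : Directions n d => qf (fun Z P =>
        capped gk (𝒰 g s) (delta Z) t k c P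
        - budgeted gk (𝒰 g s) (delta Z) t k c b P) o)
      ≤ (2 / g) ^ c * (1 - g / 2) ^ b * ∑ P, o P ^ 2 := by
  have hx0 : 0 < 1 - g / 2 := by linarith
  have h2g : 1 ≤ 2 / g := by rw [le_div_iff₀ h0]; linarith
  have hb0 : ∀ k t c, t + k = d → ∀ o : Vec n, avg (fun s : Directions n d => qf (fun Z P =>
        capped gk (𝒰 g s) (delta Z) t k c P
        - budgeted gk (𝒰 g s) (delta Z) t k c 0 P) o)
      ≤ (2 / g) ^ c * (1 - g / 2) ^ 0 * ∑ P, o P ^ 2 := by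
    intro k t c ht o
    simp only [budgeted_of_budget_zero, sub_zero]
    refine (avg_qf_capped_le h0 h1 hg _ k t c ht o).trans ?_
    rw [pow_zero, mul_one]
    exact le_mul_of_one_le_left (sum_nonneg fun _ _ => sq_nonneg _) (one_le_pow₀ h2g)
  induction k with
  | zero =>
    intro t c b ht o
    by_cases hb : b = 0
    · simp_all
    refine le_trans (le_of_eq (b := 0) ?_) (mul_nonneg (by positivity)
      (sum_nonneg fun _ _ => sq_nonneg _))
    cases c <;> simp [capped, budgeted, hb, qf, avg]
  | succ k ih =>
    intro t c b ht o
    by_cases hb : b = 0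
    · simp_all
    rcases c with _ | c
    · refine le_trans (le_of_eq (b := 0) ?_) (mul_nonneg (by positivity)
        (sum_nonneg fun _ _ => sq_nonneg _))
      simp [capped, budgeted, hb, qf, avg]
    have hlt : t + 1 < d + 1 := by omega
    have e : ∀ s : Directions n d, (fun Z P =>
        capped gk (𝒰 g s) (delta Z) t (k + 1) (c + 1) P
        - budgeted gk (𝒰 g s) (delta Z) t (k + 1) (c + 1) b P)
        = fun Z P => ∑ R, gk t R P * ∑ Q, siteK g univ (s ⟨t + 1, hlt⟩) Q R *
          (capped gk (𝒰 g s) (delta Z) (t + 1) k c Q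
        - budgeted gk (𝒰 g s) (delta Z) (t + 1) k c (b - wt R) Q)
        := by
      intro s
      funext Z P
      simp only [capped, budgeted, noiseK_eq _ _ hlt, mul_sub, sum_sub_distrib]
    simp only [e]
    rw [pow_succ']
    refine avg_layer_budget h0 h1 ⟨t + 1, hlt⟩ (fun b s Z Q =>
          (capped gk (𝒰 g s) (delta Z) (t + 1) k c Q
        - budgeted gk (𝒰 g s) (delta Z) (t + 1) k c b Q))
        (fun b s c' => ?_) (fun b s Z hb => ?_) (by positivity)
        (fun b o => ih (t + 1) c b (by omega) o) (hg t) hb o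
    · have hu : ∀ i, t + 1 < i → 𝒰 g (update s ⟨t + 1, hlt⟩ c') i = 𝒰 g s i :=
        fun i hi => noiseK_update g _ s _ c' (by simp; omega)
      funext Z P
      rw [capped_congr gk _ k (t + 1) c hu, budgeted_congr gk _ k (t + 1) c b hu]
    rw [capped_zero hg, budgeted_zero hg _ _ _ _ hb, sub_self]

/-! ## Error bounds for uniform noise and arbitrary gates -/

/-- The truncated functional including the read-out noise. -/
def truncTop (gk nk : ℕ → Ker n) (r : Vec n) (d l c b : ℕ) (P : Str n) : ℝ :=
  if wt P ≤ l then ∑ Q, nk 0 Q P * budgeted gk nk r 0 d c (b - wt P) Q else 0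

/-- The exact functional including the read-out noise. -/
def fullTop (gk nk : ℕ → Ker n) (r : Vec n) (d : ℕ) (P : Str n) : ℝ :=
  ∑ Q, nk 0 Q P * full gk nk r 0 d Q

theorem qf_mask (h : Ker n) (c : Str n → Prop) [DecidablePred c] (o : Vec n) :
    qf (fun Z P => if c P then h Z P else 0) o = qf h fun P => if c P then o P else 0 := by
  unfold qf
  simp_all

theorem sum_mask_sq_le (c : Str n → Prop) [DecidablePred c] (o : Vec n) :
    ∑ P, (if c P then o P else 0) ^ 2 ≤ ∑ P, o P ^ 2 := by
  refine sum_le_sum fun P _ => ?_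
  split_ifs
  · rfl
  simp [sq_nonneg]

theorem sum_id_layer (X : Vec n) (P : Str n) :
    ∑ R, (if R = P then 1 else 0) * X R = X P := by simp

/-- Read-out noise suppresses observables of large weight. -/
theorem avg_qf_top_le (h0 : 0 < g) (h1 : g ≤ 4 / 7) (D : Directions n d → Ker n)
    (hD : ∀ s c, D (update s 0 c) = D s)
    (hw : ∀ o, avg (fun s => qf (D s) o) ≤ ∑ Q, o Q ^ 2) (S : ℕ → Finset (Fin n))
    (hS : S 0 = univ) {l : ℕ} (o : Vec n) (ho : ∀ P, wt P < l → o P = 0) :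
    avg (fun s => qf (fun Z P => ∑ Q, noiseK g S s 0 Q P * D s Z Q) o)
      ≤ ((1 - g / 2) ^ 2) ^ l * ∑ P, o P ^ 2 := by
  have h := avg_step g univ 0 D hD (fun _ => 1) (by simpa using hw)
    (fun R P => if R = P then 1 else 0) o
  simp only [sum_id_layer, one_mul] at h
  have e : ∀ s : Directions n d, noiseK g S s 0 = siteK g univ (s 0) := by
    intro s
    rw [noiseK_eq S s (Nat.succ_pos d), hS]
    rfl
  simp only [e]
  refine h.trans ?_
  rw [mul_sum]
  refine sum_le_sum fun R _ => ?_
  have h2 : ∑ P, (if R = P then 1 else 0) * o P = o R := by simp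
  rw [h2, mul_comm]
  by_cases hR : wt R < l
  · simp [ho R hR]
  refine mul_le_mul_of_nonneg_right ((sum_siteK_sq_le h0 h1 _ _ R).trans ?_) (sq_nonneg _)
  rw [pw_univ]
  exact pow_le_pow_of_le_one (by positivity) (by nlinarith) (not_lt.mp hR)

theorem avg_uniform_error_of_budget_one (h0 : 0 < g) (h1 : g ≤ 4 / 7)
    (hg : Layers p gk) (l c : ℕ) (o : Vec n) :
    avg (fun s : Directions n d => qf (fun Z P =>
        fullTop gk (𝒰 g s) (delta Z) d P
        - truncTop gk (𝒰 g s) (delta Z) d l c 1 P) o)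
      ≤ (1 - g / 2) ^ 2 * ∑ P, o P ^ 2 := by
  have e : ∀ s : Directions n d, qf (fun Z P =>
      fullTop gk (𝒰 g s) (delta Z) d P - truncTop gk (𝒰 g s) (delta Z) d l c 1 P) o
      = qf (fun Z P => ∑ Q, 𝒰 g s 0 Q P * full gk (𝒰 g s) (delta Z) 0 d Q)
        (fun P => if 1 ≤ wt P then o P else 0) := by
    intro s
    rw [← qf_mask]
    congr 1
    funext Z P
    by_cases hP : P = 0
    · subst hP
      have hz : wt (0 : Str n) = 0 := wt_eq_zero.mpr rfl
      simp [fullTop, truncTop, hz, noiseK_zero_right, full_zero hg, budgeted_zero hg]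
    have h2 := wt_pos hP
    have h3 : 1 - wt P = 0 := by omega
    simp [fullTop, truncTop, h2, h3, budgeted_of_budget_zero]
  simp only [e]
  refine (avg_qf_top_le (l := 1) h0 h1 (fun s Z => full gk (𝒰 g s)
    (delta Z) 0 d) (fun s c => ?_) (avg_qf_full_le h0 h1 hg _ d 0 (by omega)) _ rfl _ ?_).trans ?_
  · funext Z
    exact full_congr gk _ d 0 fun i hi => noiseK_update g _ s 0 c (by simp; omega)
  · simp_all
  rw [pow_one]
  exact mul_le_mul_of_nonneg_left (sum_mask_sq_le _ o) (by positivity)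

theorem avg_uniform_error (h0 : 0 < g) (h1 : g ≤ 4 / 7) (hg : Layers p gk)
    {l c b : ℕ} (hb : b ≠ 0) {α β γ : ℝ} (hα : 0 < α) (hβ : 0 < β) (hγ : 0 < γ)
    (h2 : (1 - g / 2) ^ (c + 1) ≤ α) (h3 : n ≤ l ∨ (1 - g / 2) ^ (l + 1) ≤ β)
    (h4 : (2 / g) ^ (c + 1) * (1 - g / 2) ^ b ≤ γ ^ 2) (o : Vec n) :
    avg (fun s : Directions n d => qf (fun Z P =>
        fullTop gk (𝒰 g s) (delta Z) d P
        - truncTop gk (𝒰 g s) (delta Z) d l c b P) o)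
      ≤ (α + β + γ) ^ 2 * ∑ P, o P ^ 2 := by
  have hx0 : 0 < 1 - g / 2 := by linarith
  have hnn : 0 ≤ ∑ P, o P ^ 2 := sum_nonneg fun _ _ => sq_nonneg _
  have hupd : ∀ (s : Directions n d) c' i, 0 < i → 𝒰 g (update s 0 c') i = 𝒰 g s i :=
    fun s c' i hi => noiseK_update g _ s 0 c' (by simp; omega)
  have hK : ∀ s : Directions n d, 𝒰 g s 0 =
      siteK g univ (s 0) := fun s => noiseK_eq _ s (Nat.succ_pos d)
  set F : Directions n d → Ker n := fun s Z P =>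
    ∑ Q, 𝒰 g s 0 Q P * full gk (𝒰 g s) (delta Z) 0 d Q with hF
  set C : Directions n d → Ker n := fun s Z P =>
    ∑ Q, 𝒰 g s 0 Q P * capped gk (𝒰 g s) (delta Z) 0 d c Q with hC
  set B : Directions n d → Ker n := fun s Z P =>
    ∑ Q, 𝒰 g s 0 Q P * budgeted gk (𝒰 g s) (delta Z) 0 d c (b - wt P) Q with hB
  have p1 : avg (fun s => qf (fun Z P => F s Z P - C s Z P) o) ≤ α * (α * ∑ P, o P ^ 2) := by
    have e : ∀ s, (fun Z P => F s Z P - C s Z P) = fun Z P => ∑ R, (if R = P then 1 else 0) *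
        ∑ Q, siteK g univ (s 0) Q R * (full gk (𝒰 g s) (delta Z) 0 d Q
          - capped gk (𝒰 g s) (delta Z) 0 d c Q) := by
      intro s
      funext Z P
      rw [sum_id_layer]
      simp only [hF, hC, hK, mul_sub, sum_sub_distrib]
    simp only [e]
    refine (avg_layer_nontrivial h0 h1 0 (fun s Z Q =>
      full gk (𝒰 g s) (delta Z) 0 d Q - capped gk (𝒰 g s) (delta Z) 0 d c Q) (fun s c' => ?_)
      (by positivity) (avg_qf_full_sub_capped_le h0 h1 hg d 0 c (by omega)) one_isLayer o).trans ?_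
    · funext Z Q
      rw [full_congr gk _ d 0 (hupd s c'), capped_congr gk _ d 0 c (hupd s c')]
    rw [← mul_assoc, mul_sum]
    refine sum_le_sum fun P _ => mul_le_mul_of_nonneg_right ?_ (sq_nonneg _)
    split_ifs
    · positivity
    calc (1 - g / 2) ^ 2 * ((1 - g / 2) ^ 2) ^ c = (1 - g / 2) ^ (c + 1) *
        (1 - g / 2) ^ (c + 1) := by
          rw [← pow_succ', ← pow_mul, ← pow_add]
          congr 1
          omega
      _ ≤ α * α := by gcongr
  have p2 : avg (fun s => qf (fun Z P => if l + 1 ≤ wt P then C s Z P else 0) o)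
      ≤ β * (β * ∑ P, o P ^ 2) := by
    rcases h3 with h3 | h3
    · have e : ∀ P : Str n, ¬ l + 1 ≤ wt P := fun P => by
        have := wt_le P
        omega
      simp only [e, if_false]
      refine le_trans (le_of_eq (b := 0) ?_) (by positivity)
      simp [qf, avg]
    simp only [qf_mask]
    refine (avg_qf_top_le (l := l + 1) h0 h1 (fun s Z => capped gk
      (𝒰 g s) (delta Z) 0 d c) (fun s c' => ?_)
      (avg_qf_capped_le h0 h1 hg _ d 0 c (by omega)) _ rfl _ ?_).trans ?_
    · funext Z
      exact capped_congr gk _ d 0 c (hupd s c')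
    · simp_all
    rw [← mul_assoc]
    refine mul_le_mul ?_ (sum_mask_sq_le _ o) (sum_nonneg fun _ _ => sq_nonneg _) (by positivity)
    calc ((1 - g / 2) ^ 2) ^ (l + 1) = (1 - g / 2) ^ (l + 1) * (1 - g / 2) ^ (l + 1) := by
          rw [← pow_mul, ← pow_add]
          congr 1
          omega
      _ ≤ β * β := by gcongr
  have p3 : avg (fun s => qf (fun Z P => if wt P ≤ l then C s Z P - B s Z P else 0) o)
      ≤ γ * (γ * ∑ P, o P ^ 2) := by
    simp only [qf_mask]
    have e : ∀ s, (fun Z P => C s Z P - B s Z P) = fun Z P => ∑ R, (if R = P then 1 else 0) *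
        ∑ Q, siteK g univ (s 0) Q R * (capped gk (𝒰 g s) (delta Z) 0 d c Q
          - budgeted gk (𝒰 g s) (delta Z) 0 d c (b - wt R) Q) := by
      intro s
      funext Z P
      rw [sum_id_layer (fun R => ∑ Q, siteK g univ (s 0) Q R * (capped gk (𝒰 g s) (delta Z) 0 d c Q
          - budgeted gk (𝒰 g s) (delta Z) 0 d c (b - wt R) Q))]
      simp only [hC, hB, hK, mul_sub, sum_sub_distrib]
    simp only [e]
    refine (avg_layer_budget h0 h1 0 (fun b s Z Q =>
      capped gk (𝒰 g s) (delta Z) 0 d c Q - budgeted gk (𝒰 g s) (delta Z) 0 d c b Q)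
      (fun b s c' => ?_) (fun b s Z hb => ?_) (a := (2 / g) ^ c) (by positivity)
      (fun b o => avg_qf_capped_sub_budgeted_le h0 h1 hg d 0 c b (by omega) o)
      one_isLayer hb _).trans ?_
    · funext Z Q
      rw [capped_congr gk _ d 0 c (hupd s c'), budgeted_congr gk _ d 0 c b (hupd s c')]
    · rw [capped_zero hg, budgeted_zero hg _ _ _ _ hb, sub_self]
    rw [← pow_succ', ← mul_assoc, ← sq]
    exact mul_le_mul h4 (sum_mask_sq_le _ o) (sum_nonneg fun _ _ => sq_nonneg _) (by positivity)
  have p4 := avg_qf_add_le hα hβ _ _ o p1 p2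
  rw [← add_mul] at p4
  have p5 := avg_qf_add_le (add_pos hα hβ) hγ _ _ o p4 p3
  have e : ∀ s, (fun Z P => (F s Z P - C s Z P + if l + 1 ≤ wt P then C s Z P else 0)
      + if wt P ≤ l then C s Z P - B s Z P else 0) = fun Z P =>
      fullTop gk (𝒰 g s) (delta Z) d P - truncTop gk (𝒰 g s) (delta Z) d l c b P := by
    intro s
    funext Z P
    by_cases hP : wt P ≤ l
    · have : ¬ l + 1 ≤ wt P := by omega
      simp [fullTop, truncTop, hP, this, hF, hB]
    have : l + 1 ≤ wt P := by omega
    simp [fullTop, truncTop, hP, this, hF]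
  simp only [e] at p5
  linarith

/-! ## Error bounds for gate-based noise -/

def Untouched (p : ℕ → Fin n → Fin n) (t k : ℕ) (P : Str n) : Prop :=
  ∀ i, t ≤ i → i < t + k → GateTrivial (p i) P

theorem untouched_succ {t k : ℕ} :
    Untouched p t (k + 1) P ↔ GateTrivial (p t) P ∧ Untouched p (t + 1) k P := by
  constructor
  · intro h
    exact ⟨h t le_rfl (by omega), fun i hi hi' => h i (by omega) (by omega)⟩
  rintro ⟨h1, h2⟩ i hi hi'
  rcases hi.eq_or_lt with rfl | h
  · exact h1
  exact h2 i h (by omega)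

open Classical in
/-- The factor `x` for strings that meet a gate. -/
def touchWeight (p : ℕ → Fin n → Fin n) (x : ℝ) (t k : ℕ) (P : Str n) : ℝ :=
  if Untouched p t k P then 1 else x

theorem touchWeight_succ_of_trivial {x : ℝ} {t k : ℕ} (h : GateTrivial (p t) P) :
    touchWeight p x t (k + 1) P = touchWeight p x (t + 1) k P := by
  have e : Untouched p t (k + 1) P ↔ Untouched p (t + 1) k P := by
    rw [untouched_succ]
    exact and_iff_right h
  unfold touchWeight
  aesop

theorem touchWeight_succ_of_not_trivial {x : ℝ} {t k : ℕ}
    (h : ¬ GateTrivial (p t) P) : touchWeight p x t (k + 1) P = x :=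
  if_neg fun h2 => h (untouched_succ.mp h2).1

theorem siteK_gateTrivial {S : Finset (Fin n)} (hS : ∀ j ∈ S, q j ≠ j)
    {R : Str n} (hR : GateTrivial q R) (s : Fin n → Fin 2) (Q : Str n) :
    siteK g S s Q R = if Q = R then 1 else 0 := siteK_of_trivial g s (fun j hj => hR j (hS j hj)) Q

theorem exists_of_not_gateTrivial {R : Str n} (h : ¬ GateTrivial q R) : ∃ j, q j ≠ j ∧ R j ≠ 0 := by
  unfold GateTrivial at h
  push Not at h
  exact h

theorem avg_qf_full_touch_le (h0 : 0 < g) (h1 : g ≤ 4 / 7) (hg : Layers p gk)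
    {S : ℕ → Finset (Fin n)} (hS : ∀ t j, t < d → (j ∈ S (t + 1) ↔ p t j ≠ j)) (k : ℕ) :
    ∀ t, t + k = d → ∀ o : Vec n,
    avg (fun s : Directions n d => qf (fun Z => full gk (noiseK g S s) (delta Z) t k) o)
      ≤ ∑ P, touchWeight p ((1 - g / 2) ^ 2) t k P * o P ^ 2 := by
  have hx0 : (0 : ℝ) ≤ (1 - g / 2) ^ 2 := by positivity
  have hx1 : (1 - g / 2) ^ 2 ≤ 1 := by nlinarith
  induction k with
  | zero =>
    intro t _ o
    simp only [full]
    rw [avg_const]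
    refine (qf_delta o).le.trans (le_of_eq (sum_congr rfl fun P _ => ?_))
    have : Untouched p t 0 P := fun i hi hi' => by omega
    simp [touchWeight, this]
  | succ k ih =>
    intro t ht o
    have hlt : t + 1 < d + 1 := by omega
    simp only [full, noiseK_eq S _ hlt]
    refine (avg_step g (S (t + 1)) ⟨t + 1, hlt⟩
      (fun s Z => full gk (noiseK g S s) (delta Z) (t + 1) k) (fun s c => ?_) _
      (ih (t + 1) (by omega)) (gk t) o).trans ?_
    · funext Z
      exact full_congr gk _ k (t + 1) fun i hi => noiseK_update g S s _ c (by simp; omega)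
    rw [← (hg t).sum_mul_sq (touchWeight p ((1 - g / 2) ^ 2) t (k + 1)) (fun R P hRP => ?_) o]
    · refine sum_le_sum fun R _ => ?_
      rw [mul_comm]
      refine mul_le_mul_of_nonneg_right ?_ (sq_nonneg _)
      by_cases hR : GateTrivial (p t) R
      · have e : touchWeight p ((1 - g / 2) ^ 2) t (k + 1) R
            = touchWeight p ((1 - g / 2) ^ 2) (t + 1) k R := touchWeight_succ_of_trivial hR
        rw [e]
        simp only [siteK_gateTrivial (g := g) (fun j hj => (hS t j (by omega)).mp hj) hR]
        simp
      have e : touchWeight p ((1 - g / 2) ^ 2) t (k + 1) R = (1 - g / 2) ^ 2 :=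
        touchWeight_succ_of_not_trivial hR
      rw [e]
      obtain ⟨j, hj, hRj⟩ := exists_of_not_gateTrivial hR
      refine le_trans (sum_le_sum fun Q _ => mul_le_of_le_one_left (sq_nonneg _) ?_)
        ((sum_siteK_sq_le h0 h1 _ _ R).trans (pw_le hx0 hx1 ((hS t j (by omega)).mpr hj) hRj))
      unfold touchWeight
      split_ifs
      · rfl
      exact hx1
    have h2 := (hg t).trivial_iff R P hRP
    by_cases hR : GateTrivial (p t) R
    · have h3 := (hg t).trivial_eq R P hR
      simp_all
    have hP := fun h => hR (h2.mpr h)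
    rw [touchWeight_succ_of_not_trivial hR, touchWeight_succ_of_not_trivial hP]

variable {σ τ : State} {Q : Oracle} {X Y : List ℕ}

/-! ## A program logic for the machine -/

/-- The program halts within `T` steps in a state with the property `Φ`. -/
def Runs (Q : Oracle) (p : Program) (σ : State) (T : ℕ) (Φ : State → Prop) : Prop :=
  ∃ τ k, Exec Q p σ τ k ∧ k ≤ T ∧ Φ τ

def after (Q : Oracle) (σ : State) (l : List Instr) : State :=
  l.foldl (fun σ i => Instr.step Q σ i) σ

attribute [simp] after Instr.step Test.holds

def blk (l : List Instr) : Program := l.foldr (fun i p => .seq (.instr i) p) .skip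

def seqs (l : List Program) : Program := l.foldr .seq .skip

section

variable {Φ Ψ : State → Prop} {T T' : ℕ} {p : Program}

theorem Runs.mono (h : Runs Q p σ T Φ) (hT : T ≤ T') (hΦ : ∀ τ, Φ τ → Ψ τ) : Runs Q p σ T' Ψ := by
  obtain ⟨τ, k, h1, h2, h3⟩ := h
  exact ⟨τ, k, h1, h2.trans hT, hΦ τ h3⟩

theorem Runs.le (h : Runs Q p σ T Φ)
    (hT : T ≤ T' := by first | omega | (simp <;> omega)) : Runs Q p σ T' Φ := h.mono hT fun _ h => h

theorem Runs.skip (h : Φ σ) : Runs Q .skip σ 0 Φ := ⟨σ, 0, .skip σ, le_rfl, h⟩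

theorem Runs.instr {i : Instr} (h : Φ (i.step Q σ)) : Runs Q (.instr i) σ 1 Φ :=
  ⟨_, 1, .instr i σ, le_rfl, h⟩

theorem Runs.seq {p q : Program} (h : Runs Q p σ T Φ) (h' : ∀ τ, Φ τ → Runs Q q τ T' Ψ) :
    Runs Q (.seq p q) σ (T + T') Ψ := by
  obtain ⟨τ, k, h1, h2, h3⟩ := h
  obtain ⟨υ, l, h4, h5, h6⟩ := h' τ h3
  exact ⟨υ, k + l, .seq h1 h4, by omega, h6⟩

theorem Runs.ite {b : Test} {p q : Program} (h1 : b.holds σ → Runs Q p σ T Φ)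
    (h2 : ¬ b.holds σ → Runs Q q σ T Φ) : Runs Q (.ite b p q) σ (T + 1) Φ := by
  by_cases h : b.holds σ
  · obtain ⟨τ, k, h3, h4, h5⟩ := h1 h
    exact ⟨τ, k + 1, .ite_true h h3, by omega, h5⟩
  obtain ⟨τ, k, h3, h4, h5⟩ := h2 h
  exact ⟨τ, k + 1, .ite_false h h3, by omega, h5⟩

theorem Runs.blk (l : List Instr) (h : Φ (after Q σ l)) : Runs Q (blk l) σ l.length Φ := by
  induction l generalizing σ with
  | nil => exact Runs.skip h
  | cons i l ih =>
    have := Runs.seq (p := .instr i) (q := NoisyCircuit.blk l) (T := 1) (T' := l.length)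
      (Φ := fun τ => τ = i.step Q σ) (Runs.instr rfl) (fun τ hτ => ih (by subst hτ; exact h))
    rw [List.length_cons, add_comm]
    exact this

theorem Runs.blk_seq (l : List Instr) {p : Program} (h : Runs Q p (after Q σ l) T Φ) :
    Runs Q (.seq (NoisyCircuit.blk l) p) σ (l.length + T) Φ :=
  Runs.seq (Runs.blk (Φ := fun τ => τ = after Q σ l) l rfl) (fun τ hτ => by subst hτ; exact h)

theorem Runs.while {b : Test} {p : Program} (I : State → ℕ → Prop) {k : ℕ} (hI : I σ k)
    (h : ∀ σ k, I σ k → b.holds σ → ∃ T, Runs Q p σ T fun τ => ∃ k', I τ k' ∧ k' + T + 1 ≤ k)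
    (hk : ∀ σ k, I σ k → 1 ≤ k) : Runs Q (.while b p) σ k fun τ => ¬ b.holds τ ∧ ∃ k', I τ k' := by
  induction k using Nat.strong_induction_on generalizing σ with
  | _ k ih =>
    by_cases hb : b.holds σ
    · obtain ⟨T, τ, l, h1, h2, k', h3, h4⟩ := h σ k hI hb
      obtain ⟨υ, l', h5, h6, h7⟩ := ih k' (by omega) h3
      exact ⟨υ, l + l' + 1, .while_true hb h1 h5, by omega, h7⟩
    exact ⟨σ, 1, .while_false hb, hk σ k hI, hb, k, hI⟩

end

/-! ## Lists and worklists in memory -/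

/-- A Pauli string as the list of its nontrivial letters. -/
abbrev Letters (n : ℕ) := List (Fin n × Fin 4)

/-- A linked list of letters in the cells `lo, …, hi - 1`. -/
def LAt (M : ℕ → ℕ) (lo hi : ℕ) : ℕ → Letters n → Prop
  | x, [] => x = 0
  | x, c :: l => lo ≤ x ∧ x + 3 ≤ hi ∧ M x = c.1 ∧ M (x + 1) = (c.2 : ℕ) ∧ LAt M lo hi (M (x + 2)) l

structure Task (n : ℕ) where
  st : ℕ
  t : ℕ
  b : ℕ
  todo : Letters n
  done : Letters n
  v : ℝ

/-- A linked list of tasks; the coefficients are kept at even addresses of the real memory. -/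
def SAt (M : ℕ → ℕ) (S : ℕ → ℝ) (lo hi : ℕ) : ℕ → List (Task n) → Prop
  | x, [] => x = 0
  | x, r :: W => lo ≤ x ∧ x + 6 ≤ hi ∧ M x = r.st ∧ M (x + 1) = r.t ∧ M (x + 2) = r.b ∧
      LAt M lo hi (M (x + 3)) r.todo ∧ LAt M lo hi (M (x + 4)) r.done ∧
      S (x + x) = r.v ∧ SAt M S lo hi (M (x + 5)) W

theorem LAt.mono {M M' : ℕ → ℕ} {lo hi hi' : ℕ} (hM : ∀ a, lo ≤ a → a < hi → M' a = M a)
    (hh : hi ≤ hi') {l : Letters n} : ∀ {x : ℕ}, LAt M lo hi x l → LAt M' lo hi' x l := by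
  induction l with
  | nil => intro x h; exact h
  | cons c l ih =>
    intro x h
    obtain ⟨h1, h2, h3, h4, h5⟩ := h
    refine ⟨h1, by omega, ?_, ?_, ?_⟩ <;> rw [hM _ (by omega) (by omega)]
    exacts [h3, h4, ih h5]

theorem SAt.mono {M M' : ℕ → ℕ} {S S' : ℕ → ℝ} {lo hi hi' : ℕ}
    (hM : ∀ a, lo ≤ a → a < hi → M' a = M a) (hS : ∀ a, a < hi → S' (a + a) = S (a + a))
    (hh : hi ≤ hi') {W : List (Task n)} : ∀ {x : ℕ}, SAt M S lo hi x W → SAt M' S' lo hi' x W := by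
  induction W with
  | nil => intro x h; exact h
  | cons r W ih =>
    intro x h
    obtain ⟨h1, h2, h3, h4, h5, h6, h7, h8, h9⟩ := h
    refine ⟨h1, by omega, ?_, ?_, ?_, ?_, ?_, ?_, ?_⟩ <;>
      first | rw [hM _ (by omega) (by omega)] | rw [hS _ (by omega)]
    exacts [h3, h4, h5, h6.mono hM hh, h7.mono hM hh, h8, ih h9]

theorem LAt.eq_zero_iff {M : ℕ → ℕ} {lo hi x : ℕ} (hlo : 0 < lo) {l : Letters n}
    (h : LAt M lo hi x l) : x = 0 ↔ l = [] := by
  cases l <;> simp_all [LAt]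
  omega

theorem SAt.eq_zero_iff {M : ℕ → ℕ} {S : ℕ → ℝ} {lo hi x : ℕ} (hlo : 0 < lo)
    {W : List (Task n)} (h : SAt M S lo hi x W) : x = 0 ↔ W = [] := by
  cases W <;> simp_all [SAt]
  omega

/-- The constants that stay in their registers, and the zeroed buffer for Pauli strings; the cells
`n, …, n + 7` are scratch space, `N[3]` is the first free cell above. -/
structure Static (n d m : ℕ) (g : ℝ) (σ : State) : Prop where
  n_eq : σ.N 0 = n
  d_eq : σ.N 1 = d
  m_eq : σ.N 2 = m
  zero : σ.N 7 = 0
  one : σ.N 8 = 1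
  two : σ.N 9 = 2
  three : σ.N 10 = 3
  g_eq : σ.R 1 = g
  buf : ∀ i < n, σ.M i = 0
  hp : n + 8 ≤ σ.N 3

/-- `τ` arises from `σ` by changing only natural registers in `X`, real registers in `Y` or from
`100` on, scratch space and free memory. -/
structure Keep (n : ℕ) (X Y : List ℕ) (σ τ : State) : Prop where
  N : ∀ x, x ∉ X → x ≠ 3 → τ.N x = σ.N x
  R : ∀ y, y ∉ Y → y < 100 → τ.R y = σ.R y
  M : ∀ a, a < n ∨ n + 8 ≤ a → a < σ.N 3 → τ.M a = σ.M a
  hp : σ.N 3 ≤ τ.N 3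
  even : ∀ a, a < σ.N 3 → τ.S (a + a) = σ.S (a + a)
  odd : ∀ a, τ.S (a + a + 1) = σ.S (a + a + 1)

theorem Keep.eN (h : Keep n X Y σ τ) (x : ℕ) (hx : x ∉ X := by first | decide | simp)
    (hx' : x ≠ 3 := by simp) : τ.N x = σ.N x := h.N x hx hx'

theorem Keep.eR (h : Keep n X Y σ τ) (y : ℕ) (hy : y ∉ Y := by first | decide | simp)
    (hy' : y < 100 := by simp) : τ.R y = σ.R y := h.R y hy hy'

theorem Keep.refl (σ : State) : Keep n X Y σ σ :=
  ⟨fun _ _ _ => rfl, fun _ _ _ => rfl, fun _ _ _ => rfl, le_rfl, fun _ _ => rfl, fun _ => rfl⟩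

theorem Keep.mono {X' Y' : List ℕ} (h : Keep n X Y σ τ)
    (hX : X ⊆ X' := by first | (simp; done) | decide)
    (hY : Y ⊆ Y' := by first | (simp; done) | decide) : Keep n X' Y' σ τ :=
  ⟨fun x hx => h.N x fun h' => hx (hX h'), fun y hy => h.R y fun h' => hy (hY h'), h.M, h.hp,
    h.even, h.odd⟩

theorem Keep.trans {X' Y' X'' Y'' : List ℕ} {υ : State} (h : Keep n X Y σ τ)
    (h' : Keep n X' Y' τ υ) (hX : X ⊆ X'' := by first | (simp; done) | decide)
    (hY : Y ⊆ Y'' := by first | (simp; done) | decide)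
    (hX' : X' ⊆ X'' := by first | (simp; done) | decide)
    (hY' : Y' ⊆ Y'' := by first | (simp; done) | decide) : Keep n X'' Y'' σ υ := by
  have h1 := h.mono hX hY
  have h2 := h'.mono hX' hY'
  exact ⟨fun x hx hx' => (h2.N x hx hx').trans (h1.N x hx hx'),
    fun y hy hy' => (h2.R y hy hy').trans (h1.R y hy hy'),
    fun a ha ha' => (h2.M a ha (ha'.trans_le h1.hp)).trans (h1.M a ha ha'),
    h1.hp.trans h2.hp, fun a ha => (h2.even a (ha.trans_le h1.hp)).trans (h1.even a ha),
    fun a => (h2.odd a).trans (h1.odd a)⟩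

theorem Static.keep {m : ℕ} (h : Static n d m g σ)
    (hk : Keep n X Y σ τ) (hX : ∀ x ∈ [0, 1, 2, 7, 8, 9, 10], x ∉ X := by decide)
    (hY : 1 ∉ Y := by decide) : Static n d m g τ := by
  have e : ∀ x ∈ [0, 1, 2, 7, 8, 9, 10], τ.N x = σ.N x := fun x hx =>
    hk.N x (hX x hx) (by rintro rfl; simp at hx)
  have eM := fun i hi => hk.M i (.inl hi)
  have eR := hk.R 1 hY
  obtain ⟨_, _, _, _, _, _, _, _, _, hp⟩ := h
  refine ⟨?_, ?_, ?_, ?_, ?_, ?_, ?_, ?_, fun i hi => ?_, hp.trans hk.hp⟩ <;> simp_all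
  rw [eM i hi (by omega)]

theorem Keep.lat (h : Keep n X Y σ τ) {x : ℕ}
    {l : Letters n} (hl : LAt σ.M (n + 8) (σ.N 3) x l) : LAt τ.M (n + 8) (τ.N 3) x l :=
  hl.mono (fun a ha ha' => h.M a (Or.inr ha) ha') h.hp

theorem Keep.sat (h : Keep n X Y σ τ) {x : ℕ}
    {W : List (Task n)} (hW : SAt σ.M σ.S (n + 8) (σ.N 3) x W) : SAt τ.M τ.S (n + 8) (τ.N 3) x W :=
  hW.mono (fun a ha ha' => h.M a (Or.inr ha) ha') h.even h.hp

def LReg (σ : State) (x : ℕ) (l : Letters n) : Prop := LAt σ.M (n + 8) (σ.N 3) (σ.N x) l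

/-- `N[4]` points to the worklist `W`. -/
def Work (σ : State) (W : List (Task n)) : Prop := SAt σ.M σ.S (n + 8) (σ.N 3) (σ.N 4) W

theorem LReg.keep {x : ℕ} {l : Letters n} (hl : LReg σ x l)
    (h : Keep n X Y σ τ) (hx : x ∉ X := by decide) (hx' : x ≠ 3 := by decide) : LReg τ x l := by
  unfold LReg
  rw [h.N x hx hx']
  exact h.lat hl

theorem LReg.after {x y : ℕ} {l : Letters n} (h : LReg σ x l) (L : List Instr)
    (hx : (after Q σ L).N y = σ.N x) (h3 : (after Q σ L).N 3 = σ.N 3 := by simp)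
    (hM : (after Q σ L).M = σ.M := by simp) : LReg (after Q σ L) y l := by
  unfold LReg
  rw [hx, h3, hM]
  exact h

theorem Work.keep {W : List (Task n)} (hW : Work σ W)
    (h : Keep n X Y σ τ) (hx : 4 ∉ X := by decide) : Work τ W := by
  unfold Work
  rw [h.N 4 hx (by decide)]
  exact h.sat hW

/-- The instruction only changes registers, natural ones in `X` and real ones in `Y`. -/
def Instr.OnlyRegs (X Y : List ℕ) : Instr → Bool
  | .constN x _ | .addN x _ _ | .subN x _ _ | .loadN x _ | .queryN x _ _ => x ∈ X
  | .castR y _ | .addR y _ _ | .subR y _ _ | .mulR y _ _ | .divR y _ _ | .loadR y _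
  | .queryR y _ _ => y ∈ Y
  | .storeN _ _ | .storeR _ _ => false

theorem keep_after {l : List Instr} (hX : 3 ∉ X := by decide)
    (h : ∀ i ∈ l, i.OnlyRegs X Y = true := by decide) : Keep n X Y σ (after Q σ l) := by
  induction l generalizing σ with
  | nil => exact Keep.refl σ
  | cons i l ih =>
    have h1 := ih (σ := i.step Q σ) fun j hj => h j (List.mem_cons_of_mem _ hj)
    have h2 := h i List.mem_cons_self
    refine Keep.trans (X := X) (Y := Y) ?_ h1 (by simp) (by simp) (by simp) (by simp)
    have e : ∀ x y : ℕ, x ∈ X → y ∉ X → y ≠ x := fun x y hx hy h => hy (h ▸ hx)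
    have e' : ∀ x y : ℕ, x ∈ Y → y ∉ Y → y ≠ x := fun x y hx hy h => hy (h ▸ hx)
    cases i <;> simp only [Instr.OnlyRegs, decide_eq_true_eq, Bool.false_eq_true] at h2 <;>
      refine ⟨fun y hy _ => ?_, fun y hy _ => ?_, fun _ _ _ => rfl, ?_, fun _ _ => rfl,
        fun _ => rfl⟩ <;> simp only [Instr.step, update_apply] <;> first
        | rfl
        | exact if_neg (e _ _ h2 hy)
        | exact if_neg (e' _ _ h2 hy)
        | exact (if_neg fun hc => hX (by rw [hc]; exact h2)).ge

/-! ## Basic routines -/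

/-- Allocates the list cell `(N[j], N[a])` followed by the list `N[tl]`, and points `N[x]` to it. -/
def consP (x j a tl : ℕ) : Program := blk [
  .addN 52 3 7, .storeN 52 j, .addN 52 52 8, .storeN 52 a, .addN 52 52 8, .storeN 52 tl,
  .addN x 3 7, .addN 3 52 8]

structure InRegs (σ : State) (r : Task n) : Prop where
  st : σ.N 15 = r.st
  t : σ.N 11 = r.t
  b : σ.N 12 = r.b
  todo : LReg σ 13 r.todo
  done : LReg σ 14 r.done
  v : σ.R 3 = r.v

def pushP : Program := blk [
  .addN 50 3 7, .storeN 50 15, .addN 50 50 8, .storeN 50 11, .addN 50 50 8, .storeN 50 12,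
  .addN 50 50 8, .storeN 50 13, .addN 50 50 8, .storeN 50 14, .addN 50 50 8, .storeN 50 4,
  .addN 51 3 3, .storeR 51 3, .addN 4 3 7, .addN 3 50 8]

def popP : Program := blk [
  .loadN 15 4, .addN 50 4 8, .loadN 11 50, .addN 50 50 8, .loadN 12 50, .addN 50 50 8,
  .loadN 13 50, .addN 50 50 8, .loadN 14 50, .addN 50 50 8, .addN 51 4 4, .loadR 3 51, .loadN 4 50]

section

variable {m : ℕ} {W : List (Task n)} {r : Task n}

attribute [local simp] update_apply add_assoc List.foldl

theorem consP_runs (hs : Static n d m g σ) {x j a tl : ℕ} {c : Fin n × Fin 4} {l : Letters n}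
    (hc1 : σ.N j = c.1) (hc2 : σ.N a = (c.2 : ℕ)) (hl : LReg σ tl l) (hx : x ≠ 3 := by simp)
    (hx' : x ≠ 52 := by simp) (hj : j ≠ 3 ∧ j ≠ 52 := by simp) (ha : a ≠ 3 ∧ a ≠ 52 := by simp)
    (ht : tl ≠ 3 ∧ tl ≠ 52 := by simp) (hx7 : x ≠ 7 ∧ x ≠ 8 := by simp) :
    Runs Q (consP x j a tl) σ 8 fun τ => Keep n [52, x] [] σ τ ∧ LReg τ x (c :: l) := by
  have hz := hs.zero
  have ho := hs.one
  have hp := hs.hp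
  have h72 := hx7.2.symm
  have hk : Keep n [52, x] [] σ (after Q σ [
      .addN 52 3 7, .storeN 52 j, .addN 52 52 8, .storeN 52 a, .addN 52 52 8, .storeN 52 tl,
      .addN x 3 7, .addN 3 52 8]) := by
    refine ⟨fun y => ?_, fun _ _ _ => rfl, fun b _ hb => ?_, ?_, fun _ _ => rfl, fun _ => rfl⟩
    · simp_all
    · simp [hz, ho, hx'.symm]
      grind
    simp [hz, ho, hx'.symm, h72]
  refine Runs.blk _ ⟨hk, ?_⟩
  have hl' : LAt _ (n + 8) _ (σ.N tl) l := hk.lat hl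
  refine ⟨?_, ?_, ?_, ?_, ?_⟩ <;> simp_all [hx'.symm]

theorem pushP_runs (hs : Static n d m g σ) (hr : InRegs σ r) (hW : Work σ W) :
    Runs Q pushP σ 16 fun τ => Keep n [4, 50, 51] [] σ τ ∧ Work τ (r :: W) := by
  have hz := hs.zero
  have ho := hs.one
  have hp := hs.hp
  obtain ⟨h1, h2, h3, h4, h5, h6⟩ := hr
  have hk : Keep n [4, 50, 51] [] σ (after Q σ [
      .addN 50 3 7, .storeN 50 15, .addN 50 50 8, .storeN 50 11, .addN 50 50 8, .storeN 50 12,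
      .addN 50 50 8, .storeN 50 13, .addN 50 50 8, .storeN 50 14, .addN 50 50 8, .storeN 50 4,
      .addN 51 3 3, .storeR 51 3, .addN 4 3 7, .addN 3 50 8]) := by
    refine ⟨fun y _ _ => ?_, fun _ _ _ => rfl, fun b _ hb => ?_, ?_, fun b hb => ?_, fun b => ?_⟩
    · simp_all
    · simp [hz, ho]
      grind
    · simp [hz, ho]
    · simp [show b + b ≠ σ.N 3 + σ.N 3 by omega]
    simp [show b + (b + 1) ≠ σ.N 3 + σ.N 3 by omega]
  have k1 := hk.lat h4
  have k2 := hk.lat h5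
  have k3 := hk.sat hW
  refine Runs.blk _ ⟨hk, ?_⟩
  refine ⟨?_, ?_, ?_, ?_, ?_, ?_, ?_, ?_, ?_⟩ <;> simp_all

theorem popP_runs (hs : Static n d m g σ) (hW : Work σ (r :: W)) :
    Runs Q popP σ 13 fun τ => Keep n [4, 11, 12, 13, 14, 15, 50, 51] [3] σ τ ∧ Work τ W ∧
      InRegs τ r := by
  have ho := hs.one
  obtain ⟨h1, h2, h3, h4, h5, h6, h7, h8, h9⟩ := hW
  exact Runs.blk _ ⟨keep_after, by simpa [Work, ho], by simpa [ho], by simpa [ho], by simpa [ho],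
    by simpa [LReg, ho], by simpa [LReg, ho], by simpa [ho]⟩

end

variable {W : List (Task n)} {r : Task n} {l l' done : Letters n} {m : ℕ}

/-! ## Real arithmetic in gate entries -/

/-- Arithmetic expressions in the real and imaginary parts of the entries of a gate. -/
inductive RExpr
  | entry (k : Fin 2) (x y : Fin 2 × Fin 2)
  | zero
  | one
  | op (o : Fin 4) (a b : RExpr)

def opFun : Fin 4 → ℝ → ℝ → ℝ := ![(· + ·), (· - ·), (· * ·), (· / ·)]

def opInstr : Fin 4 → ℕ → ℕ → ℕ → Instr := ![.addR, .subR, .mulR, .divR]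

/-- The real part (`k = 0`) or imaginary part (otherwise) of an entry. -/
def entryVal (W : TwoQubitGate) (k : Fin 2) (x y : Fin 2 × Fin 2) : ℝ := if k = 0 then (W.1 x y).re
  else (W.1 x y).im

def RExpr.eval (W : TwoQubitGate) : RExpr → ℝ
  | .entry k x y => entryVal W k x y
  | .zero => 0
  | .one => 1
  | .op o a b => opFun o (a.eval W) (b.eval W)

/-- Evaluates an expression into `R[r]`, for the gate whose layer and first qubit are written in
the scratch cells `n` and `n + 1`. -/
def RExpr.code : RExpr → ℕ → List Instr
  | .entry k x y, r => [.addN 54 0 9, .storeN 54 (7 + x.1), .addN 54 54 8, .storeN 54 (7 + x.2),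
      .addN 54 54 8, .storeN 54 (7 + y.1), .addN 54 54 8, .storeN 54 (7 + y.2), .queryR r k 0]
  | .zero, r => [.subR r r r]
  | .one, r => [.castR r 8]
  | .op o a b, r => a.code r ++ b.code (r + 1) ++ [opInstr o r r (r + 1)]

theorem after_append (Q : Oracle) (σ : State) (l l' : List Instr) :
    after Q σ (l ++ l') = after Q (after Q σ l) l' := List.foldl_append

structure EvalFrame (n r : ℕ) (σ τ : State) : Prop where
  N : ∀ x, x ≠ 54 → τ.N x = σ.N x
  R : ∀ y, y < r → τ.R y = σ.R y
  M : ∀ a, a < n + 2 ∨ n + 8 ≤ a → τ.M a = σ.M a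
  S : τ.S = σ.S

theorem EvalFrame.trans {r r' : ℕ} {υ : State} (h : EvalFrame n r σ τ)
    (h' : EvalFrame n r' τ υ) (hr : r ≤ r') : EvalFrame n r σ υ :=
  ⟨fun x hx => (h'.N x hx).trans (h.N x hx), fun y hy => (h'.R y (hy.trans_le hr)).trans (h.R y hy),
    fun a ha => (h'.M a ha).trans (h.M a ha), h'.S.trans h.S⟩

theorem EvalFrame.keep (h : EvalFrame n 100 σ τ) : Keep n [54] [] σ τ :=
  ⟨fun x hx _ => h.N x (by simpa using hx), fun y _ hy => h.R y hy,
    fun a ha _ => h.M a (by omega), (h.N 3 (by simp)).ge, fun a _ => by rw [h.S],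
    fun a => by rw [h.S]⟩

theorem EvalFrame.static {r : ℕ} (h : EvalFrame n r σ τ) (hr : 1 < r)
    (hs : Static n d m g σ) : Static n d m g τ := by
  obtain ⟨hN, hR, hM, hS⟩ := h
  have h1 := hR 1 hr
  obtain ⟨⟩ := hs
  constructor <;> simp_all
  exact fun i hi => by rw [hM i (by omega)]; simp_all

def ReadsGates (Q : Oracle) (n d : ℕ) (U : ℕ → Fin n → TwoQubitGate) : Prop :=
  ∀ t < d, ∀ (j : Fin n) (k : Fin 2) (x y : Fin 2 × Fin 2) (a : ℕ → ℕ), a 0 = t → a 1 = j →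
    a 2 = x.1 → a 3 = x.2 → a 4 = y.1 → a 5 = y.2 → Q.real k a = entryVal (U t j) k x y

theorem RExpr.code_after {U : ℕ → Fin n → TwoQubitGate}
    (hQ : ReadsGates Q n d U) {t : ℕ} (ht : t < d) (j : Fin n) (e : RExpr) :
    ∀ (r : ℕ) (σ : State), 1 < r → Static n d m g σ → σ.M n = t → σ.M (n + 1) = j →
      EvalFrame n r σ (after Q σ (e.code r)) ∧ (after Q σ (e.code r)).R r = e.eval (U t j) := by
  induction e with
  | entry k x y =>
    intro r σ hr hs h0 h1
    have hn := hs.n_eq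
    have hz := hs.zero
    have ho := hs.one
    have h2 := hs.two
    have hbit : ∀ b : Fin 2, σ.N (7 + b) = b := by
      intro b
      fin_cases b
      · exact hz
      exact ho
    have hne : ∀ b : Fin 2, 7 + (b : ℕ) ≠ 54 := fun b => by omega
    simp only [RExpr.code, after, List.foldl, Instr.step]
    refine ⟨⟨fun z hz => ?_, fun z hz => ?_, fun a ha => ?_, rfl⟩, ?_⟩
    · simp [hz]
    · simp [update_apply, hz.ne]
    · have e2 : a ≠ n + 2 := by omega
      have e3 : a ≠ n + 3 := by omega
      have e4 : a ≠ n + 4 := by omega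
      have e5 : a ≠ n + 5 := by omega
      simp [update_apply, add_assoc, hn, ho, h2, e2, e3, e4, e5]
    simp only [update_self]
    apply hQ t ht j k x y <;> simp [add_assoc, hn, ho, h2, hne, hbit, h0, h1]
  | zero =>
    intro r σ hr hs h0 h1
    refine ⟨⟨fun _ _ => rfl, fun y hy => update_of_ne hy.ne _ _, fun _ _ => rfl, rfl⟩, ?_⟩
    simp [RExpr.code, RExpr.eval]
  | one =>
    intro r σ hr hs h0 h1
    refine ⟨⟨fun _ _ => rfl, fun y hy => update_of_ne hy.ne _ _, fun _ _ => rfl, rfl⟩, ?_⟩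
    simp [RExpr.code, RExpr.eval, hs.one]
  | op o a b ha hb =>
    intro r σ hr hs h0 h1
    obtain ⟨fa, va⟩ := ha r σ hr hs h0 h1
    obtain ⟨fb, vb⟩ := hb (r + 1) _ (by omega) (fa.static hr hs) (by rw [fa.M n (by omega), h0])
      (by rw [fa.M (n + 1) (by omega), h1])
    have e (τ) : after Q τ [opInstr o r r (r + 1)] =
        { τ with R := update τ.R r (opFun o (τ.R r) (τ.R (r + 1))) } := by fin_cases o <;> rfl
    rw [RExpr.code, after_append, after_append, e]
    refine ⟨(fa.trans fb (by omega)).trans (r' := r) ⟨fun _ _ => rfl, fun y hy =>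
      update_of_ne hy.ne _ _, fun _ _ => rfl, rfl⟩ le_rfl, ?_⟩
    simp only [update_self, RExpr.eval]
    rw [vb, fb.R r (by omega), va]

/-- The function of a gate is given by an arithmetic expression. -/
def Expressible (f : TwoQubitGate → ℝ) : Prop := ∃ e : RExpr, ∀ W, e.eval W = f W

theorem Expressible.op {f h : TwoQubitGate → ℝ} (hf : Expressible f) (hh : Expressible h)
    (o : Fin 4) : Expressible fun W => opFun o (f W) (h W) := by
  obtain ⟨a, ha⟩ := hf
  obtain ⟨b, hb⟩ := hh
  exact ⟨.op o a b, fun W => by simp [RExpr.eval, ha, hb]⟩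

theorem Expressible.add {f h : TwoQubitGate → ℝ} (hf : Expressible f) (hh : Expressible h) :
    Expressible fun W => f W + h W := hf.op hh 0

theorem Expressible.sub {f h : TwoQubitGate → ℝ} (hf : Expressible f) (hh : Expressible h) :
    Expressible fun W => f W - h W := hf.op hh 1

theorem Expressible.mul {f h : TwoQubitGate → ℝ} (hf : Expressible f) (hh : Expressible h) :
    Expressible fun W => f W * h W := hf.op hh 2

theorem Expressible.zero : Expressible fun _ => 0 := ⟨.zero, fun _ => rfl⟩

theorem Expressible.one : Expressible fun _ => 1 := ⟨.one, fun _ => rfl⟩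

theorem Expressible.neg_one : Expressible fun _ => -1 :=
  ⟨.op 1 .zero .one, fun _ => by simp [RExpr.eval, opFun]⟩

/-- Real and imaginary part are given by arithmetic expressions. -/
def CExpressible (f : TwoQubitGate → ℂ) : Prop :=
  Expressible (fun W => (f W).re) ∧ Expressible fun W => (f W).im

theorem CExpressible.mul {f h : TwoQubitGate → ℂ} (hf : CExpressible f) (hh : CExpressible h) :
    CExpressible fun W => f W * h W := by
  simp only [CExpressible, Complex.mul_re, Complex.mul_im]
  exact ⟨(hf.1.mul hh.1).sub (hf.2.mul hh.2), (hf.1.mul hh.2).add (hf.2.mul hh.1)⟩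

theorem CExpressible.star {f : TwoQubitGate → ℂ} (hf : CExpressible f) :
    CExpressible fun W => star (f W) := by
  refine ⟨by simpa using hf.1, ?_⟩
  have := Expressible.zero.sub hf.2
  simpa using this

theorem CExpressible.sum {ι : Type*} (s : Finset ι) (f : ι → TwoQubitGate → ℂ)
    (hf : ∀ i, CExpressible (f i)) : CExpressible fun W => ∑ i ∈ s, f i W := by
  classical
  induction s using Finset.induction_on with
  | empty => simpa [CExpressible] using Expressible.zero
  | insert i s hi ih =>
    simp only [sum_insert hi, CExpressible, Complex.add_re, Complex.add_im]
    exact ⟨(hf i).1.add ih.1, (hf i).2.add ih.2⟩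

theorem cexpressible_entry (x y : Fin 2 × Fin 2) : CExpressible fun W => W.1 x y :=
  ⟨⟨.entry 0 x y, fun _ => by simp [RExpr.eval, entryVal]⟩,
    ⟨.entry 1 x y, fun _ => by simp [RExpr.eval, entryVal]⟩⟩

theorem cexpressible_sigma (a : Fin 4) (x y : Fin 2) : CExpressible fun _ => sigma a x y := by
  fin_cases a <;> fin_cases x <;> fin_cases y <;>
    simp [CExpressible, sigma, Expressible.zero, Expressible.one, Expressible.neg_one]

theorem ptm_expressible (b a : Fin 4 × Fin 4) : Expressible fun W => ptm W b a := by
  have h4 : Expressible fun _ => (4 : ℝ) := by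
    have := (Expressible.one.add Expressible.one).add (Expressible.one.add Expressible.one)
    norm_num at this
    exact this
  refine Expressible.op (CExpressible.sum _ (fun i W => _) fun i => ?_).1 h4 3
  simp only [Matrix.diag, mul_apply, conjTranspose_apply, kroneckerMap_apply]
  refine CExpressible.sum _ _ fun k => CExpressible.mul (CExpressible.sum _ _ fun l =>
    CExpressible.mul (CExpressible.sum _ _ fun x => CExpressible.mul
      (CExpressible.star (cexpressible_entry _ _)) ?_) (cexpressible_entry _ _)) ?_
  · exact (cexpressible_sigma _ _ _).mul (cexpressible_sigma _ _ _)
  exact (cexpressible_sigma _ _ _).mul (cexpressible_sigma _ _ _)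

/-- An expression for the transition coefficients of a gate. -/
def ptmExpr (b a : Fin 4 × Fin 4) : RExpr := (ptm_expressible b a).choose

theorem ptmExpr_eval (b a : Fin 4 × Fin 4) (W : TwoQubitGate) :
    (ptmExpr b a).eval W = ptm W b a := (ptm_expressible b a).choose_spec W

/-! ## Lists of letters -/

/-- The Pauli string with the given letters. -/
def str : Letters n → Str n
  | [] => 0
  | c :: l => update (str l) c.1 c.2

/-- The qubits occurring in a list of letters. -/
abbrev sites (l : Letters n) : List (Fin n) := l.map Prod.fst

/-- Each qubit occurs at most once, with a nontrivial letter. -/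
def Proper (l : Letters n) : Prop := (sites l).Nodup ∧ ∀ c ∈ l, c.2 ≠ 0

section

theorem str_of_notMem (h : j ∉ sites l) : str l j = 0 := by
  induction l with
  | nil => rfl
  | cons c l ih =>
    simp only [sites, List.map_cons, List.mem_cons, not_or] at h
    rw [str, update_of_ne h.1, ih h.2]

theorem str_of_mem (hl : (sites l).Nodup) {c : Fin n × Fin 4} (h : c ∈ l) : str l c.1 = c.2 := by
  induction l with
  | nil => cases h
  | cons c' l ih =>
    simp only [sites, List.map_cons, List.nodup_cons] at hl
    rcases List.mem_cons.mp h with rfl | h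
    · rw [str, update_self]
    have : c.1 ≠ c'.1 := fun e => hl.1 (e ▸ List.mem_map_of_mem h)
    rw [str, update_of_ne this, ih hl.2 h]

theorem str_perm (h : l.Perm l') (hl : (sites l).Nodup) : str l = str l' := by
  funext j
  by_cases hj : j ∈ sites l
  · obtain ⟨c, hc, rfl⟩ := List.mem_map.mp hj
    rw [str_of_mem hl hc, str_of_mem ((h.map Prod.fst).nodup_iff.mp hl) (h.mem_iff.mp hc)]
  rw [str_of_notMem hj, str_of_notMem fun h' => hj ((h.map Prod.fst).mem_iff.mpr h')]

theorem Proper.perm (h : l.Perm l') (hl : Proper l) : Proper l' :=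
  ⟨(h.map Prod.fst).nodup_iff.mp hl.1, fun c hc => hl.2 c (h.mem_iff.mpr hc)⟩

theorem Proper.nil : Proper ([] : Letters n) := ⟨List.nodup_nil, fun _ h => by cases h⟩

theorem Proper.sublist (h : l'.Sublist l) (hl : Proper l) : Proper l' :=
  ⟨hl.1.sublist (h.map Prod.fst), fun c hc => hl.2 c (h.subset hc)⟩

theorem wt_str (hl : Proper l) : wt (str l) = l.length := by
  have e : (univ.filter fun j => str l j ≠ 0) = (sites l).toFinset := by
    ext j
    simp only [mem_filter, mem_univ, true_and, List.mem_toFinset]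
    constructor
    · intro h
      by_contra hc
      exact h (str_of_notMem hc)
    intro h
    obtain ⟨c, hc, rfl⟩ := List.mem_map.mp h
    rw [str_of_mem hl.1 hc]
    exact hl.2 c hc
  rw [wt, e, List.toFinset_card_of_nodup hl.1, List.length_map]

end

/-! ## Reading Pauli coefficients -/

/-- Writes the letters of the list `N[14]` (or zeros) into the buffer. -/
def fillP (w : ℕ) : Program := .seq (blk [.addN 30 14 7]) (.while (.ltN 7 30) (blk [
  .loadN 31 30, .addN 33 30 8, .loadN 32 33, .addN 33 33 8, .storeN 31 w, .loadN 30 33]))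

/-- Reads the entry of the `k`-th real table at the Pauli string `N[14]`. -/
def coefP (k x : ℕ) : Program := .seq (fillP 32) (.seq (.instr (.queryR x k 7)) (fillP 7))

structure FillFrame (n : ℕ) (σ τ : State) : Prop where
  N : ∀ x, x ∉ [30, 31, 32, 33] → τ.N x = σ.N x
  R : τ.R = σ.R
  M : ∀ a, n ≤ a → τ.M a = σ.M a
  S : τ.S = σ.S

theorem FillFrame.trans {υ : State} (h : FillFrame n σ τ) (h' : FillFrame n τ υ) :
    FillFrame n σ υ := ⟨fun x hx => (h'.N x hx).trans (h.N x hx), h'.R.trans h.R,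
    fun a ha => (h'.M a ha).trans (h.M a ha), h'.S.trans h.S⟩

section

theorem fillP_runs (hz : σ.N 7 = 0) (ho : σ.N 8 = 1) {w : ℕ} (c : Bool)
    (hw : w = bif c then 7 else 32) (hp : Proper l) (hl : LReg σ 14 l)
    (hb : ∀ i : Fin n, σ.M i = bif c then (str l i : ℕ) else 0) :
    Runs Q (fillP w) σ (7 * l.length + 2) fun τ => FillFrame n σ τ ∧
      ∀ i : Fin n, τ.M i = bif c then 0 else (str l i : ℕ) := by
  let I : State → ℕ → Prop := fun τ k => FillFrame n σ τ ∧ ∃ l' : Letters n,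
    l'.Sublist l ∧ LReg τ 30 l' ∧ k = 7 * l'.length + 1 ∧
    ∀ i : Fin n, τ.M i = if i ∈ sites l' then (bif c then (str l i : ℕ) else 0)
      else bif c then 0 else (str l i : ℕ)
  have hstart : I ((Instr.addN 30 14 7).step Q σ) (7 * l.length + 1) := by
    refine ⟨⟨fun x hx => ?_, rfl, fun _ _ => rfl, rfl⟩, l, List.Sublist.refl l, ?_, rfl, ?_⟩
    · simp at hx
      simp [Instr.step, hx]
    · simpa [LReg, Instr.step, hz] using hl
    intro i
    refine (hb i).trans ?_
    split_ifs with h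
    · rfl
    rw [str_of_notMem h]
    cases c <;> rfl
  have h1 := Runs.while (Q := Q) (b := .ltN 7 30) (p := blk [
    .loadN 31 30, .addN 33 30 8, .loadN 32 33, .addN 33 33 8, .storeN 31 w, .loadN 30 33])
    I hstart (fun τ k ⟨hf, l', hs, hl', hk, hM⟩ hb => ?_) (fun τ k ⟨_, l', _, _, hk, _⟩ => by omega)
  · have h2 := Runs.seq (Runs.blk (Q := Q) (σ := σ) (Φ := fun τ => τ = (Instr.addN 30 14 7).step Q σ)
      [.addN 30 14 7] rfl) (fun τ hτ => by rw [hτ]; exact h1)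
    refine h2.mono (by simp; omega) ?_
    rintro τ ⟨hb, k, hf, l', hs, hl', hk, hM⟩
    refine ⟨hf, fun i => ?_⟩
    have hz' : τ.N 7 = 0 := by rw [hf.N 7 (by decide), hz]
    have : l' = [] := by
      refine (LAt.eq_zero_iff (by omega) hl').mp ?_
      simp only [Test.holds, hz', not_lt, nonpos_iff_eq_zero] at hb
      exact hb
    simp_all
  have hz' : τ.N 7 = 0 := by rw [hf.N 7 (by decide), hz]
  have ho' : τ.N 8 = 1 := by rw [hf.N 8 (by decide), ho]
  have hne : l' ≠ [] := by
    intro h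
    have := (LAt.eq_zero_iff (by omega) hl').mpr h
    simp only [Test.holds, hz', this] at hb
    omega
  obtain ⟨a, l'', rfl⟩ := List.exists_cons_of_ne_nil hne
  obtain ⟨g1, g2, g3, g4, g5⟩ := hl'
  refine ⟨6, Runs.blk _ ⟨7 * l''.length + 1, ⟨hf.trans ⟨fun x hx => ?_, rfl, fun b hb' => ?_, rfl⟩,
    l'', (List.sublist_cons_self a l'').trans hs, ?_, rfl, ?_⟩, ?_⟩⟩
  · simp at hx
    simp [hx]
  · have : b ≠ a.1 := by omega
    simp [update_apply, g3, this]
  · simp [LReg, update_apply, g3, ho', add_assoc, show τ.N 30 + 2 ≠ a.1 by omega]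
    exact LAt.mono (fun b hb _ => update_of_ne (by omega) _ _) le_rfl g5
  · have ha : str l a.1 = a.2 := str_of_mem hp.1 (hs.subset List.mem_cons_self)
    have hnd := hp.1.sublist (hs.map Prod.fst)
    simp only [List.map_cons, List.nodup_cons] at hnd
    intro i
    by_cases hi : i = a.1
    · subst hi
      rw [if_neg hnd.1, ha]
      subst hw
      cases c <;> simp [g3, ho', g4, hz']
    have hi' : (i : ℕ) ≠ a.1 := fun h => hi (Fin.ext h)
    have h2 := hM i
    simp only [sites, List.map_cons, List.mem_cons, hi, false_or] at h2
    simpa [update_apply, g3, hi'] using h2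
  simp only [List.length_cons] at hk ⊢
  simp
  omega

/-- The table `k` holds the values of a function of Pauli strings. -/
def ReadsCoef (Q : Oracle) (n k : ℕ) (f : Vec n) : Prop := ∀ a, Q.real k a = f (readString n a)

theorem coefP_runs (hs : Static n d m g σ) {k x : ℕ} {f : Vec n} (hQ : ReadsCoef Q n k f)
    (hp : Proper l) (hl : LReg σ 14 l) :
    Runs Q (coefP k x) σ (14 * l.length + 5) fun τ =>
      Keep n [30, 31, 32, 33] [x] σ τ ∧ τ.R x = f (str l) := by
  have h1 := fillP_runs (Q := Q) hs.zero hs.one (w := 32) false rfl hp hl (fun i => hs.buf i i.2)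
  refine (Runs.seq h1 (fun τ hτ => Runs.seq (T := 1) (T' := 7 * l.length + 2)
    (Ψ := fun υ => Keep n [30, 31, 32, 33] [x] σ υ ∧ υ.R x = f (str l))
    (Φ := fun υ => υ = (Instr.queryR x k 7).step Q τ) (Runs.instr rfl) ?_)).le
  rintro υ rfl
  obtain ⟨hf, hM⟩ := hτ
  have hl' : LReg ((Instr.queryR x k 7).step Q τ) 14 l := by
    have : LAt τ.M (n + 8) (τ.N 3) (τ.N 14) l := by
      rw [hf.N 3 (by decide), hf.N 14 (by decide)]
      exact LAt.mono (fun a ha _ => hf.M a (by omega)) le_rfl hl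
    exact this
  refine (fillP_runs (c := true) (σ := (Instr.queryR x k 7).step Q τ)
    ((hf.N 7 (by decide)).trans hs.zero) ((hf.N 8 (by decide)).trans hs.one) rfl hp hl'
    hM).mono le_rfl ?_
  rintro υ ⟨hf', hM'⟩
  refine ⟨⟨fun y hy _ => ?_, fun y hy _ => ?_, fun a ha _ => ?_, ?_, fun a _ => ?_, fun a => ?_⟩,
    ?_⟩
  · rw [hf'.N y hy]
    exact hf.N y hy
  · rw [hf'.R]
    simp at hy
    simp [Instr.step, hy, hf.R]
  · by_cases han : a < n
    · rw [hs.buf a han]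
      exact hM' ⟨a, han⟩
    rw [hf'.M a (by omega)]
    exact hf.M a (by omega)
  · rw [hf'.N 3 (by decide)]
    exact (hf.N 3 (by decide)).ge
  · rw [hf'.S]
    exact congrFun hf.S _
  · rw [hf'.S]
    exact congrFun hf.S _
  rw [hf'.R]
  simp only [Instr.step, update_self]
  rw [hQ]
  congr 1
  funext j
  have hz : τ.N 7 = 0 := by rw [hf.N 7 (by decide), hs.zero]
  have e : τ.M j = (str l j : ℕ) := hM j
  simp only [readString, hz, zero_add, e]
  simp_all

end

/-! ## Processing noise and gates letter by letter -/

section Values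

theorem siteK_congr_of_zero (g : ℝ) {S S' : Finset (Fin n)} (s : Fin n → Fin 2) {R : Str n}
    (h : ∀ j, R j ≠ 0 → (j ∈ S ↔ j ∈ S')) (Q : Str n) : siteK g S s Q R = siteK g S' s Q R := by
  unfold siteK
  refine prod_congr rfl fun j _ => ?_
  by_cases hR : R j = 0
  · aesop
  simp_all

/-- The transition kernel of the gates on the qubits of `T`. -/
def layerK (q : Fin n → Fin n) (W : Fin n → TwoQubitGate) (T : Finset (Fin n)) (R P : Str n) : ℝ :=
  ∏ j, if j ∈ T then if j < q j then ptm (W j) (R j, R (q j)) (P j, P (q j))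
      else if q j = j then (if R j = P j then 1 else 0) else 1 else if R j = P j then 1 else 0

theorem layerK_congr_of_fixed (W : Fin n → TwoQubitGate)
    {T T' : Finset (Fin n)} (h : ∀ j, q j ≠ j → (j ∈ T ↔ j ∈ T')) (R P : Str n) :
    layerK q W T R P = layerK q W T' R P := by
  unfold layerK
  refine prod_congr rfl fun j _ => ?_
  by_cases hq : q j = j
  · simp_all
  simp_all

theorem layerK_univ (hq : Involutive q) (W : Fin n → TwoQubitGate)
    {T : Finset (Fin n)} (hT : ∀ j, q j ∈ T → j ∈ T) (hP : ∀ j ∉ T, P j = 0)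
    (R : Str n) : layerK q W univ R P = layerK q W T R P := by
  have hT' : ∀ j, j ∉ T → q j ∉ T := fun j hj h => hj (hT j h)
  by_cases hR : ∀ j ∉ T, R j = 0
  · unfold layerK
    refine prod_congr rfl fun j _ => ?_
    by_cases hj : j ∈ T
    · simp [hj]
    have h1 := hT' j hj
    simp only [mem_univ, if_true, hj, if_false, hR j hj, hR _ h1, hP j hj, hP _ h1]
    have h2 : ptm (W j) (0, 0) (0, 0) = 1 := by
      have := ptm_zero_right (W j) (0, 0)
      simp_all
    simp [h2]
  push Not at hR
  obtain ⟨j, hj, hRj⟩ := hR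
  have e1 : layerK q W T R P = 0 := by
    refine prod_eq_zero (mem_univ j) ?_
    simp_all
  rw [e1]
  have hz : ∀ b : Fin 4 × Fin 4, b ≠ (0, 0) → ∀ W, ptm W b (0, 0) = 0 := by
    intro b hb W
    have := ptm_zero_right W b
    simp_all
  rcases lt_trichotomy j (q j) with h | h | h
  · refine prod_eq_zero (mem_univ j) ?_
    simp_all
  · refine prod_eq_zero (mem_univ j) ?_
    simp [← h, hP j hj, hRj]
  refine prod_eq_zero (mem_univ (q j)) ?_
  rw [hq j]
  simp_all

theorem sum_layerK_pair {E : Type*} [AddCommGroup E] [Module ℝ E]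
    (hq : Involutive q) (W : Fin n → TwoQubitGate) {T T' : Finset (Fin n)}
    (hT : ∀ j, q j ∈ T ↔ j ∈ T) {i : Fin n} (hi : i < q i) (hiT : i ∉ T)
    (hT' : ∀ j, j ∈ T' ↔ j = i ∨ j = q i ∨ j ∈ T) (P : Str n) (h : Str n → E) :
    ∑ R, layerK q W T' R P • h R = ∑ b : Fin 4 × Fin 4, ptm (W i) b (P i, P (q i)) •
      ∑ R, layerK q W T R (update (update P i b.1) (q i) b.2) • h R := by
  simp only [smul_sum]
  rw [sum_comm]
  refine sum_congr rfl fun R _ => ?_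
  simp only [smul_smul, ← sum_smul]
  congr 1
  have hqi : q i ∉ T := fun hc => hiT ((hT i).mp hc)
  set rest : ℝ := ∏ j ∈ (univ.erase i).erase (q i), if j ∈ T then
      if j < q j then ptm (W j) (R j, R (q j)) (P j, P (q j))
      else if q j = j then (if R j = P j then 1 else 0) else 1
    else if R j = P j then 1 else 0 with hrest
  have hmem : q i ∈ (univ : Finset (Fin n)).erase i := by simp [hi.ne']
  have e1 : layerK q W T' R P = ptm (W i) (R i, R (q i)) (P i, P (q i)) * rest := by
    unfold layerK
    rw [← mul_prod_erase _ _ (mem_univ i), ← mul_prod_erase _ _ hmem]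
    have h1 : i ∈ T' := (hT' i).mpr (Or.inl rfl)
    have h2 : q i ∈ T' := (hT' _).mpr (Or.inr (Or.inl rfl))
    simp only [h1, h2, if_true, hi, hq i, not_lt.mpr hi.le, if_false, hi.ne, one_mul]
    refine congrArg (fun z => ptm (W i) (R i, R (q i)) (P i, P (q i)) * z) ?_
    rw [hrest]
    refine prod_congr rfl fun j hj => ?_
    simp_all
  have e2 : ∀ b : Fin 4 × Fin 4, layerK q W T R (update (update P i b.1) (q i) b.2) =
      (if R i = b.1 then 1 else 0) * ((if R (q i) = b.2 then 1 else 0) * rest) := by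
    intro b
    unfold layerK
    rw [← mul_prod_erase _ _ (mem_univ i), ← mul_prod_erase _ _ hmem]
    simp only [hiT, hqi, if_false, update_self, update_of_ne hi.ne]
    refine congrArg (fun z => (if R i = b.1 then (1 : ℝ) else 0) *
      ((if R (q i) = b.2 then 1 else 0) * z)) ?_
    rw [hrest]
    refine prod_congr rfl fun j hj => ?_
    simp only [mem_erase, mem_univ, and_true] at hj
    have k1 : q j ≠ q i := fun hc => hj.2 (hq.injective hc)
    have k2 : q j ≠ i := fun hc => hj.1 (by rw [← hc, hq j])
    simp_all
  rw [e1]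
  simp only [e2]
  rw [Fintype.sum_prod_type]
  simp

theorem sum_siteK_insert_smul {E : Type*} [AddCommGroup E] [Module ℝ E] (g : ℝ)
    {S : Finset (Fin n)} (s : Fin n → Fin 2) (hj : j ∉ S) (R : Str n) (h : Str n → E) :
    ∑ Q, siteK g (insert j S) s Q R • h Q =
      ∑ b, nu g (s j) b (R j) • ∑ Q, siteK g S s Q (update R j b) • h Q := by
  have e : ∀ Q, siteK g (insert j S) s Q R =
      ∑ b, nu g (s j) b (R j) * siteK g S s Q (update R j b) := by
    intro Q
    have := sum_siteK_insert g s hj R (fun Q' => if Q' = Q then 1 else 0)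
    simp_all
  simp only [e, sum_smul, smul_sum, smul_smul]
  exact sum_comm

end Values

section

theorem str_append (l m : Letters n) (k : Fin n) :
    str (l ++ m) k = if k ∈ sites l then str l k else str m k := by
  induction l with
  | nil => simp
  | cons c l ih =>
    rw [List.cons_append]
    simp only [str, sites, List.map_cons, List.mem_cons]
    by_cases h : k = c.1
    · subst h; simp
    simp_all

theorem str_filter (l : Letters n) (hl : (sites l).Nodup) (p k : Fin n) :
    str (l.filter fun c => c.1 ≠ p) k = if k = p then 0 else str l k := by
  split_ifs with h
  · refine str_of_notMem fun hk => ?_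
    simp_all
  by_cases hk : k ∈ sites l
  · obtain ⟨c, hc, rfl⟩ := List.mem_map.mp hk
    rw [str_of_mem hl hc, str_of_mem (hl.sublist ((List.filter_sublist).map _))]
    simp_all
  rw [str_of_notMem hk, str_of_notMem fun h' => hk ?_]
  simp_all

/-- Adds a letter unless it is trivial. -/
def addLetter (j : Fin n) (a : Fin 4) (l : Letters n) : Letters n := if a = 0 then l else (j, a) :: l

theorem str_addLetter {a : Fin 4} (h : j ∉ sites l) :
    str (addLetter j a l) = update (str l) j a := by
  unfold addLetter
  split_ifs with ha
  · subst ha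
    rw [← str_of_notMem h, update_eq_self]
  rfl

theorem sites_addLetter {k : Fin n} {a : Fin 4} (h : k ∈ sites (addLetter j a l)) :
    k = j ∨ k ∈ sites l := by
  unfold addLetter at h
  aesop

theorem Proper.addLetter (hl : Proper l) (a : Fin 4)
    (hj : j ∉ sites l) : Proper (addLetter j a l) := by
  unfold NoisyCircuit.addLetter
  split_ifs with h
  · exact hl
  exact ⟨List.nodup_cons.mpr ⟨hj, hl.1⟩, fun c hc => by
    rcases List.mem_cons.mp hc with rfl | hc
    · exact h
    exact hl.2 c hc⟩

theorem proper_append {m : Letters n} : Proper (l ++ m) ↔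
    Proper l ∧ Proper m ∧ ∀ k ∈ sites l, k ∉ sites m := by
  unfold Proper sites
  rw [List.map_append, List.nodup_append']
  simp only [List.mem_append, List.Disjoint]
  constructor
  · rintro ⟨⟨h1, h2, h3⟩, h4⟩
    exact ⟨⟨h1, fun c hc => h4 c (Or.inl hc)⟩, ⟨h2, fun c hc => h4 c (Or.inr hc)⟩,
      fun k hk hk' => h3 hk hk'⟩
  rintro ⟨⟨h1, h4⟩, ⟨h2, h5⟩, h3⟩
  exact ⟨⟨h1, h2, fun k hk hk' => h3 k hk hk'⟩, fun c hc => hc.elim (h4 c) (h5 c)⟩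

end

structure Inst (n : ℕ) where
  d : ℕ
  g : ℝ
  part : ℕ → Fin n → Fin n
  involutive : ∀ t, Involutive (part t)
  dir : ℕ → Fin n → Fin 2
  gate : ℕ → Fin n → TwoQubitGate
  /-- whether the noise is gate-based -/
  gb : Bool

namespace Inst

variable (I : Inst n)

/-- The qubits with noise at noise layer `t`. -/
def noisy : ℕ → Finset (Fin n)
  | 0 => univ
  | t + 1 => bif I.gb then univ.filter fun j => I.part t j ≠ j else univ

/-- The qubits of the gates, in layer `t`, that meet the list. -/
def closure (t : ℕ) (l : Letters n) : Finset (Fin n) :=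
  univ.filter fun j => j ∈ sites l ∨ I.part t j ∈ sites l

variable {E : Type*} [AddCommGroup E] [Module ℝ E] (F : ℕ → ℕ → Str n → E)

/-- The value of a string whose letters `todo` still have to pass noise layer `t`. -/
def valN (t b : ℕ) (todo done : Letters n) (v : ℝ) : E :=
  if todo.length ≤ b then v • ∑ Q, siteK I.g (I.noisy t ∩ (sites todo).toFinset) (I.dir t) Q
    (str (todo ++ done)) • F t (b - todo.length) Q else 0

/-- The value of a string after the gates of layer `t`. -/
def valH (t b : ℕ) (R : Str n) : E :=
  if wt R ≤ b then ∑ Q, siteK I.g (I.noisy (t + 1)) (I.dir (t + 1)) Q R • F (t + 1) (b - wt R) Q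
  else 0

/-- The value of a string whose letters `todo` still have to pass gate layer `t`. -/
def valG (t b : ℕ) (todo done : Letters n) (v : ℝ) : E :=
  v • ∑ R, layerK (I.part t) (I.gate t) (I.closure t todo) R (str (todo ++ done)) • I.valH F t b R

theorem valN_nil (t b : ℕ) (done : Letters n) (v : ℝ) :
    I.valN F t b [] done v = v • F t b (str done) := by
  simp [valN, siteK_empty]

theorem valN_exhausted (t : ℕ) {todo : Letters n} (h : todo ≠ []) (done : Letters n) (v : ℝ) :
    I.valN F t 0 todo done v = 0 := by
  have : ¬ todo.length ≤ 0 := by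
    simpa using h
  simp [valN, this]

section

variable {F} {t b : ℕ} {a : Fin 4}

theorem str_cons_append (h : Proper ((j, a) :: l ++ done)) :
    str ((j, a) :: l ++ done) = str (l ++ (j, a) :: done) :=
  str_perm (by simpa using (List.perm_middle (l₁ := l) (a := (j, a)) (l₂ := done)).symm) h.1

theorem proper_cons_append (h : Proper ((j, a) :: l ++ done)) : Proper (l ++ (j, a) :: done) :=
  h.perm (by simpa using (List.perm_middle (l₁ := l) (a := (j, a)) (l₂ := done)).symm)

theorem valN_quiet (h : Proper ((j, a) :: l ++ done)) (hj : j ∉ I.noisy t) (v : ℝ) :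
    I.valN F t (b + 1) ((j, a) :: l) done v = I.valN F t b l ((j, a) :: done) v := by
  have e : I.noisy t ∩ (sites ((j, a) :: l)).toFinset = I.noisy t ∩ (sites l).toFinset := by
    simp_all
  unfold valN
  rw [e, str_cons_append h]
  simp

theorem valN_step (h : Proper ((j, a) :: l ++ done)) (hj : j ∈ I.noisy t) (v : ℝ) :
    I.valN F t (b + 1) ((j, a) :: l) done v =
      ∑ c, I.valN F t b l (addLetter j c done) (v * nu I.g (I.dir t j) c a) := by
  have h2 := (List.nodup_cons.mp (by simpa [sites] using h.1) :
    j ∉ List.map Prod.fst (l ++ done) ∧ (List.map Prod.fst (l ++ done)).Nodup)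
  have hjl : j ∉ sites l := fun hc => h2.1 (by simp_all)
  have hjd : j ∉ sites done := fun hc => h2.1 (by simp_all)
  have e : I.noisy t ∩ (sites ((j, a) :: l)).toFinset =
      insert j (I.noisy t ∩ (sites l).toFinset) := by
    simp_all
  have hs : ∀ c, update (str ((j, a) :: l ++ done)) j c = str (l ++ addLetter j c done) := by
    intro c
    funext k
    rw [str_append, str_addLetter hjd]
    by_cases hk : k = j
    · simp_all
    rw [update_of_ne hk, update_of_ne hk, str_append]
    simp [str, hk]
  have hnot : j ∉ I.noisy t ∩ (sites l).toFinset := by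
    simp_all
  unfold valN
  rw [e, sum_siteK_insert_smul _ _ hnot]
  simp only [List.length_cons, Nat.add_le_add_iff_right, Nat.add_sub_add_right, hs]
  have ha : str ((j, a) :: l ++ done) j = a := by
    rw [List.cons_append, str, update_self]
  rw [ha]
  split_ifs
  · simp only [smul_sum, smul_smul, mul_assoc]
  simp

theorem valN_xy (h : Proper ((j, a) :: l ++ done)) (hj : j ∈ I.noisy t) (ha : a ≠ 3) (v : ℝ) :
    I.valN F t (b + 1) ((j, a) :: l) done v =
      I.valN F t b l ((j, a) :: done) (v * (1 - I.g / 2)) := by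
  have ha0 : a ≠ 0 := h.2 (j, a) (by simp)
  have hz : ∀ l' done', I.valN F t b l' done' 0 = 0 := by
    intro l' done'
    simp [valN]
  rw [I.valN_step h hj, sum_eq_single a]
  · have : nu I.g (I.dir t j) a a = 1 - I.g / 2 := by
      revert ha ha0
      fin_cases a <;> simp [nu]
    rw [this, addLetter, if_neg ha0]
  · intro c _ hc
    have : nu I.g (I.dir t j) c a = 0 := by
      revert ha ha0 hc
      fin_cases a <;> fin_cases c <;> simp [nu]
    rw [this, mul_zero, hz]
  simp_all

theorem valN_z (h : Proper ((j, 3) :: l ++ done)) (hj : j ∈ I.noisy t) (v : ℝ) :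
    I.valN F t (b + 1) ((j, 3) :: l) done v =
      I.valN F t b l done (v * (if I.dir t j = 0 then I.g else -I.g)) +
      I.valN F t b l ((j, 3) :: done) (v * (1 - I.g)) := by
  have hz : ∀ l' done', I.valN F t b l' done' 0 = 0 := by
    intro l' done'
    simp [valN]
  rw [I.valN_step h hj, Fin.sum_univ_four]
  simp [nu, addLetter, hz]

theorem siteK_noisy_inter (t' : ℕ) (l : Letters n) (Q : Str n) :
    siteK I.g (I.noisy t' ∩ (sites l).toFinset) (I.dir t') Q (str l) =
      siteK I.g (I.noisy t') (I.dir t') Q (str l) := by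
  refine siteK_congr_of_zero _ _ (fun k hk => ?_) Q
  simp only [mem_inter, List.mem_toFinset]
  have : k ∈ sites l := by
    by_contra hc
    exact hk (str_of_notMem hc)
  simp [this]

theorem valG_nil (h : Proper done) (v : ℝ) :
    I.valG F t b [] done v = I.valN F (t + 1) b done [] v := by
  have e : ∀ R, layerK (I.part t) (I.gate t) (I.closure t []) R (str ([] ++ done)) =
      if R = str done then 1 else 0 := by
    intro R
    have : I.closure t [] = ∅ := by simp [closure]
    rw [this]
    simp [layerK, prod_ite_zero, funext_iff]
  unfold valG valN
  simp only [e, List.append_nil, I.siteK_noisy_inter]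
  simp only [ite_smul, one_smul, zero_smul, sum_ite_eq', mem_univ, if_true, valH, wt_str h]
  split_ifs <;> simp

theorem valG_fixed (h : Proper ((j, a) :: l ++ done)) (hj : I.part t j = j) (v : ℝ) :
    I.valG F t b ((j, a) :: l) done v = I.valG F t b l ((j, a) :: done) v := by
  unfold valG
  rw [str_cons_append h]
  congr 1
  refine sum_congr rfl fun R _ => ?_
  congr 1
  refine layerK_congr_of_fixed _ (fun k hk => ?_) _ _
  simp only [closure, mem_filter, mem_univ, true_and, sites, List.map_cons, List.mem_cons]
  have h1 : k ≠ j := fun hc => hk (by rw [hc, hj])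
  have h2 : I.part t k ≠ j := fun hc => h1 (by rw [← I.involutive t k, hc, hj])
  simp [h1, h2]

theorem valG_pair (h : Proper ((j, a) :: l ++ done))
    (hd : ∀ k ∈ sites done, I.part t k ∉ sites ((j, a) :: l)) {i : Fin n} (hi : i < I.part t i)
    (hij : j = i ∨ j = I.part t i) (hl' : l'.Perm (l.filter fun c => c.1 ≠ I.part t j)) (v : ℝ) :
    I.valG F t b ((j, a) :: l) done v = ∑ c : Fin 4 × Fin 4,
      I.valG F t b l' (addLetter i c.1 (addLetter (I.part t i) c.2 done))
        (v * ptm (I.gate t i) c (str ((j, a) :: l) i, str ((j, a) :: l) (I.part t i))) := by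
  have hinv := I.involutive t
  set q := I.part t with hq
  obtain ⟨hp1, hp2, hp3⟩ := proper_append.mp h
  have hjd : j ∉ sites done := hp3 j (by simp)
  have hqjd : q j ∉ sites done := fun hc => hd _ hc (by rw [hinv]; simp)
  have hjl : j ∉ sites l := (List.nodup_cons.mp hp1.1).1
  have hnl : (sites l).Nodup := (List.nodup_cons.mp hp1.1).2
  have hpair : ∀ k, (k = j ∨ k = q j) ↔ (k = i ∨ k = q i) := by
    intro k
    rcases hij with rfl | rfl
    · rfl
    rw [hinv]
    exact or_comm
  have hid : i ∉ sites done := by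
    rcases (hpair i).mpr (Or.inl rfl) with h1 | h1 <;> rw [h1] <;> assumption
  have hqid : q i ∉ sites done := by
    rcases (hpair (q i)).mpr (Or.inr rfl) with h1 | h1 <;> rw [h1] <;> assumption
  have hml' : ∀ k, k ∈ sites l' ↔ k ∈ sites l ∧ k ≠ q j := by
    intro k
    rw [(hl'.map Prod.fst).mem_iff]
    simp
  have hil' : ∀ k, (k = i ∨ k = q i) → k ∉ sites l' := by
    intro k hk hc
    rcases (hpair k).mpr hk with rfl | rfl
    · simp_all
    exact ((hml' _).mp hc).2 rfl
  have hcl : ∀ k, q k ∈ I.closure t l' ↔ k ∈ I.closure t l' := by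
    intro k
    simp only [closure, mem_filter, mem_univ, true_and, ← hq]
    rw [hinv k]
    exact or_comm
  have hicl : i ∉ I.closure t l' := by
    simp only [closure, mem_filter, mem_univ, true_and, not_or, ← hq]
    exact ⟨hil' i (Or.inl rfl), hil' _ (Or.inr rfl)⟩
  have hT' : ∀ k, k ∈ I.closure t ((j, a) :: l) ↔ k = i ∨ k = q i ∨ k ∈ I.closure t l' := by
    intro k
    rw [← or_assoc, ← hpair]
    simp only [closure, mem_filter, mem_univ, true_and, ← hq, hml', sites,
      List.map_cons, List.mem_cons]
    have h1 : q k = j ↔ k = q j := ⟨fun h => by rw [← h, hinv], fun h => by rw [h, hinv]⟩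
    have h2 : q k = q j ↔ k = j := hinv.injective.eq_iff
    simp only [h1, ne_eq, h2]
    tauto
  unfold valG
  rw [sum_layerK_pair hinv _ hcl hi hicl hT']
  simp only [smul_sum, smul_smul]
  refine sum_congr rfl fun c _ => sum_congr rfl fun R _ => ?_
  have es : update (update (str ((j, a) :: l ++ done)) i c.1) (q i) c.2 =
      str (l' ++ addLetter i c.1 (addLetter (q i) c.2 done)) := by
    have hi2 : i ∉ sites (addLetter (q i) c.2 done) := fun hc => by
      rcases sites_addLetter hc with h1 | h1
      · exact hi.ne h1
      exact hid h1
    funext k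
    rw [str_append, str_addLetter hi2, str_addLetter hqid]
    by_cases h1 : k = q i
    · subst h1
      rw [if_neg (hil' _ (Or.inr rfl)), update_self, update_of_ne hi.ne', update_self]
    by_cases h2 : k = i
    · subst h2
      rw [if_neg (hil' _ (Or.inl rfl)), update_of_ne h1, update_self, update_self]
    rw [update_of_ne h1, update_of_ne h2, update_of_ne h2, update_of_ne h1]
    have h3 : ¬ (k = j ∨ k = q j) := fun hc => ((hpair k).mp hc).elim h2 h1
    push Not at h3
    rw [str_append]
    have e1 : k ∈ sites ((j, a) :: l) ↔ k ∈ sites l' := by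
      rw [hml']
      simp [h3.1, h3.2]
    simp only [e1]
    split_ifs with hk
    · rw [str, update_of_ne h3.1, str_perm hl' ((hl'.map Prod.fst).nodup_iff.mpr
          (hnl.sublist (List.filter_sublist.map _))), str_filter l hnl, if_neg h3.2]
    rfl
  have e1 : str ((j, a) :: l ++ done) i = str ((j, a) :: l) i := by
    rw [str_append]
    split_ifs with hk
    · rfl
    rw [str_of_notMem hk, str_of_notMem hid]
  have e2 : str ((j, a) :: l ++ done) (q i) = str ((j, a) :: l) (q i) := by
    rw [str_append]
    split_ifs with hk
    · rfl
    rw [str_of_notMem hk, str_of_notMem hqid]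
  rw [es, e1, e2, mul_assoc]

end

theorem valG_start {P : Letters n} (v : ℝ) (t b : ℕ) :
    I.valG F t b P [] v = v • ∑ R, layerK (I.part t) (I.gate t) univ R (str P) •
      I.valH F t b R := by
  unfold valG
  rw [List.append_nil]
  congr 1
  refine sum_congr rfl fun R _ => ?_
  rw [layerK_univ (I.involutive t) _ (T := I.closure t P)]
  · intro j
    simp only [closure, mem_filter, mem_univ, true_and]
    rw [I.involutive t j]
    exact fun h => h.symm
  intro j hj
  simp only [closure, mem_filter, mem_univ, true_and, not_or] at hj
  exact str_of_notMem hj.1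

theorem valN_start {P : Letters n} (v : ℝ) (t b : ℕ) (h : Proper P) :
    I.valN F t b P [] v = v • if wt (str P) ≤ b then
      ∑ Q, siteK I.g (I.noisy t) (I.dir t) Q (str P) • F t (b - wt (str P)) Q else 0 := by
  unfold valN
  rw [List.append_nil, wt_str h]
  simp only [I.siteK_noisy_inter]
  split_ifs <;> simp

end Inst

/-! ## The worklist engine -/

structure Reads (Q : Oracle) (I : Inst n) : Prop where
  part : ∀ t < I.d, ∀ (j : Fin n) (a : ℕ → ℕ), a 0 = t → a 1 = j → Q.nat 0 a = I.part t j
  dir : ∀ t < I.d + 1, ∀ (j : Fin n) (a : ℕ → ℕ), a 0 = t → a 1 = j → Q.nat 1 a = (I.dir t j : ℕ)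
  gates : ReadsGates Q n I.d I.gate

/-- The total value over all extensions of a list of letters by at most `b` letters on the qubits
from `t` on, of which there are `r`. -/
def enumV {E : Type*} [Add E] (fin : Letters n → E) : ℕ → ℕ → ℕ → Letters n → E
  | 0, _, _, l => fin l
  | _ + 1, _, 0, l => fin l
  | r + 1, t, b + 1, l => if h : t < n then
      enumV fin r (t + 1) (b + 1) l + (enumV fin r (t + 1) b ((⟨t, h⟩, 1) :: l) +
        (enumV fin r (t + 1) b ((⟨t, h⟩, 2) :: l) + enumV fin r (t + 1) b ((⟨t, h⟩, 3) :: l)))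
    else fin l

def engX : List ℕ := 4 :: List.range' 11 49

def engY : List ℕ := List.range' 3 47

/-- A use of the worklist engine. The value `F` of strings that passed noise layer `t`, and the value
`fin` of enumerated strings, are accumulated. -/
structure Eng (n : ℕ) (E : Type*) where
  Q : Oracle
  I : Inst n
  m : ℕ
  F : ℕ → ℕ → Str n → E
  fin : Letters n → E
  Acc : State → E → Prop
  pN : ℕ → ℕ → ℕ → ℕ
  pG : ℕ → ℕ → ℕ → ℕ
  pE : ℕ → ℕ → ℕ → ℕ

/-- A bound for the number of steps needed for one branch of a gate. -/
def branchCost : ℕ :=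
  (∑ b : Fin 4 × Fin 4, ∑ a : Fin 4 × Fin 4, ((ptmExpr b a).code 100).length) + 40

/-- A bound for the number of steps needed for one letter. -/
def stepCost : ℕ := 16 * branchCost + 200

namespace Eng

variable {E : Type*} [AddCommGroup E] [Module ℝ E] (e : Eng n E)

def val (r : Task n) : E := if r.st = 0 then e.I.valN e.F r.t r.b r.todo r.done r.v
  else if r.st = 1 then e.I.valG e.F r.t r.b r.todo r.done r.v
  else enumV e.fin (n - r.t) r.t r.b r.done

def pot (r : Task n) : ℕ := if r.st = 0 then e.pN r.b r.todo.length r.done.length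
  else if r.st = 1 then e.pG r.b r.todo.length r.done.length else e.pE (n - r.t) r.b r.done.length

def Valid (r : Task n) : Prop := (r.st = 0 ∧ r.t ≤ e.I.d ∧ Proper (r.todo ++ r.done)) ∨
  (r.st = 1 ∧ r.t < e.I.d ∧ Proper (r.todo ++ r.done) ∧
    ∀ k ∈ sites r.done, e.I.part r.t k ∉ sites r.todo) ∨
  (r.st = 2 ∧ r.t ≤ n ∧ Proper r.done ∧ ∀ k ∈ sites r.done, (k : ℕ) < r.t)

/-- The effect of processing the task `r` within `T` steps, with `s` steps to spare. -/
def Step (s T : ℕ) (r : Task n) (W : List (Task n)) (z : E) (τ : State) : Prop :=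
  Static n e.I.d e.m e.I.g τ ∧ ∃ W' z', Work τ (W' ++ W) ∧ e.Acc τ z' ∧ (∀ r' ∈ W', e.Valid r') ∧
    z' + (W'.map e.val).sum = z + e.val r ∧ T + s + (W'.map e.pot).sum ≤ e.pot r

def Does (s : ℕ) (p : Program) (r : Task n) : Prop :=
  ∀ σ W z, Static n e.I.d e.m e.I.g σ → Work σ W → InRegs σ r → e.Acc σ z →
    ∃ T, Runs e.Q p σ T (e.Step s T r W z)

structure Ok : Prop where
  reads : Reads e.Q e.I
  stable : ∀ σ τ z, Keep n engX engY σ τ → e.Acc σ z → e.Acc τ z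
  pN_zero : ∀ u v, stepCost ≤ e.pN 0 (u + 1) v
  pN_succ : ∀ b u v, stepCost + e.pN b u (v + 1) + e.pN b u v ≤ e.pN (b + 1) (u + 1) v
  pG_zero : ∀ b v, stepCost + e.pN b v 0 ≤ e.pG b 0 v
  pG_succ : ∀ b u v, stepCost * (u + 1) + 16 * e.pG b u (v + 2) ≤ e.pG b (u + 1) v
  pG_mono : ∀ b u u' v v', u ≤ u' → v ≤ v' → e.pG b u v ≤ e.pG b u' v'
  pE_succ : ∀ r b w, stepCost + e.pE r (b + 1) w + 3 * e.pE r b (w + 1) ≤ e.pE (r + 1) (b + 1) w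

variable {e} {z : E}

theorem Step.of_keep (ho : e.Ok) (hs : Static n e.I.d e.m e.I.g σ) (hk : Keep n engX engY σ τ)
    (hz : e.Acc σ z) {W' : List (Task n)} (hW : Work τ (W' ++ W)) (hv : ∀ r' ∈ W', e.Valid r')
    (hval : (W'.map e.val).sum = e.val r) {s T : ℕ} (hT : T + s + (W'.map e.pot).sum ≤ e.pot r) :
    e.Step s T r W z τ := ⟨hs.keep hk, W', z, hW, ho.stable σ τ z hk hz, hv, by rw [hval], hT⟩

theorem Step.push (ho : e.Ok) (hs : Static n e.I.d e.m e.I.g σ) (hk : Keep n engX engY σ τ)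
    (hz : e.Acc σ z) {r' : Task n} (hW : Work τ (r' :: W)) (hv : e.Valid r')
    (hval : e.val r' = e.val r) {s T : ℕ} (hT : T + s + e.pot r' ≤ e.pot r) : e.Step s T r W z τ :=
  Step.of_keep ho hs hk hz (W' := [r']) hW (by simpa) (by simpa) (by simpa)

end Eng

theorem InRegs.keep_v {v : ℝ} (hr : InRegs σ r) (hk : Keep n X Y σ τ) (hv : τ.R 3 = v)
    (hX : ∀ x ∈ [11, 12, 13, 14, 15], x ∉ X := by decide) : InRegs τ { r with v := v } where
  st := (hk.N 15 (hX _ (by simp)) (by simp)).trans hr.st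
  t := (hk.N 11 (hX _ (by simp)) (by simp)).trans hr.t
  b := (hk.N 12 (hX _ (by simp)) (by simp)).trans hr.b
  todo := hr.todo.keep hk (hX _ (by simp))
  done := hr.done.keep hk (hX _ (by simp))
  v := hv

theorem InRegs.keep (hr : InRegs σ r)
    (hk : Keep n X Y σ τ) (hX : ∀ x ∈ [11, 12, 13, 14, 15], x ∉ X := by decide)
    (hY : 3 ∉ Y := by decide) : InRegs τ r := hr.keep_v hk ((hk.R 3 hY (by simp)).trans hr.v) hX

/-- Marks the letter `(N[20], N[21])` as done and pushes the task. -/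
def keepP : Program := .seq (consP 14 20 21 14) pushP

/-- Reads the `k`-th natural table at `(N[y], N[20])` into `N[x]`. -/
def askP (k y x : ℕ) : Program := blk [.storeN 0 y, .addN 53 0 8, .storeN 53 20, .queryN x k 0]

def switchP (x : ℕ) (f : Fin 4 → Program) : Program :=
  .ite (.ltN x 8) (f 0) (.ite (.ltN x 9) (f 1) (.ite (.ltN x 10) (f 2) (f 3)))

section

theorem keepP_runs (hs : Static n d m g σ) (hr : InRegs σ r)
    (hW : Work σ W) {c : Fin n × Fin 4} (hj : σ.N 20 = c.1) (ha : σ.N 21 = (c.2 : ℕ)) :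
    Runs Q keepP σ 24 fun τ => Keep n [4, 14, 50, 51, 52] [] σ τ ∧
      Work τ ({ r with done := c :: r.done } :: W) ∧ InRegs τ { r with done := c :: r.done } := by
  refine Runs.seq (T := 8) (T' := 16) (consP_runs hs hj ha hr.done) ?_
  rintro τ ⟨hk, hl⟩
  have hr' : InRegs τ { r with done := c :: r.done } :=
    ⟨(hk.eN 15).trans hr.st, (hk.eN 11).trans hr.t, (hk.eN 12).trans hr.b, hr.todo.keep hk, hl,
      (hk.eR 3).trans hr.v⟩
  refine (pushP_runs (hs.keep hk) hr' (hW.keep hk)).mono le_rfl ?_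
  rintro υ ⟨hk', hW'⟩
  exact ⟨hk.trans hk', hW', hr'.keep hk'⟩

theorem askP_runs (hs : Static n d m g σ) {k y x t j v : ℕ} (hy : σ.N y = t) (hj : σ.N 20 = j)
    (hx : x ≠ 3) (hQ : ∀ a : ℕ → ℕ, a 0 = t → a 1 = j → Q.nat k a = v) :
    Runs Q (askP k y x) σ 4 fun τ => Keep n [53, x] [] σ τ ∧ τ.N x = v ∧ τ.M n = t ∧
      τ.M (n + 1) = j := by
  have hn := hs.n_eq
  have ho := hs.one
  have hp := hs.hp
  refine Runs.blk _ ?_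
  simp only [after, List.foldl, Instr.step]
  refine ⟨⟨fun w hw _ => ?_, fun _ _ _ => rfl, fun b hb _ => ?_, ?_, fun _ _ => rfl, fun _ => rfl⟩,
    ?_, ?_, ?_⟩
  · simp_all
  · have h1 : b ≠ n := by omega
    have h2 : b ≠ n + 1 := by omega
    simp_all
  · simp [update_apply, hx.symm]
  · simp_all
  · simp [hn, ho, hy]
  simp [hn, ho, hj]

theorem switchP_runs (hs : Static n d m g σ) {x : ℕ} {a : Fin 4} (hx : σ.N x = (a : ℕ))
    {f : Fin 4 → Program} {T : ℕ} {Φ : State → Prop} (h : Runs Q (f a) σ T Φ) :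
    Runs Q (switchP x f) σ (T + 3) Φ := by
  have h1 := hs.one
  have h2 := hs.two
  have h3 := hs.three
  unfold switchP
  refine Runs.ite (T := T + 2) (fun hb => ?_) (fun hb => ?_)
  · simp only [Test.holds, hx, h1] at hb
    have : a = 0 := by omega
    subst this
    exact h.le
  refine Runs.ite (T := T + 1) (fun hb' => ?_) (fun hb' => ?_)
  · simp only [Test.holds, hx, h1, h2] at hb hb'
    have : a = 1 := by omega
    subst this
    exact h.le
  refine Runs.ite (T := T) (fun hb'' => ?_) (fun hb'' => ?_)
  · simp only [Test.holds, hx, h1, h2, h3] at hb hb' hb''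
    have : a = 2 := by omega
    simp_all
  simp only [Test.holds, hx, h1, h2, h3] at hb hb' hb''
  have : a = 3 := by omega
  simp_all

end

variable {E : Type*} [AddCommGroup E] [Module ℝ E] {e : Eng n E} {z : E} {t b : ℕ} {v : ℝ}

/-! ### Noise -/

def popLetterP : Program :=
  blk [.loadN 20 13, .addN 50 13 8, .loadN 21 50, .addN 50 50 8, .loadN 13 50]

/-- Applies noise to the letter `(N[20], N[21])`. -/
def noiseP : Program := .ite (.ltN 21 10)
  (.seq (blk [.castR 5 8, .castR 6 9, .divR 6 1 6, .subR 6 5 6, .mulR 3 3 6]) keepP)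
  (.seq (askP 1 11 25)
    (.seq (blk [.castR 5 8, .subR 6 5 1, .mulR 7 3 1, .mulR 3 3 6, .addN 24 14 7])
      (.seq keepP (.seq (.ite (.ltN 7 25) (blk [.subR 8 8 8, .subR 7 8 7]) (blk []))
        (.seq (blk [.subR 8 8 8, .addR 3 7 8, .addN 14 24 7]) pushP)))))

/-- Processes the letter `(N[20], N[21])` at noise that may be gate-based. -/
def siteP (gb : Bool) : Program := bif gb then
    .ite (.ltN 7 11) (.seq (blk [.subN 26 11 8]) (.seq (askP 0 26 22)
      (.ite (.ltN 20 22) noiseP (.ite (.ltN 22 20) noiseP keepP)))) noiseP else noiseP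

def bodyN (gb : Bool) (sink : Program) : Program :=
  .ite (.ltN 7 13) (.ite (.ltN 7 12) (.seq popLetterP (.seq (blk [.subN 12 12 8]) (siteP gb)))
    .skip) sink

theorem popLetterP_runs (hs : Static n d m g σ) {c : Fin n × Fin 4} (hl : LReg σ 13 (c :: l)) :
    Runs Q popLetterP σ 5 fun τ => Keep n [13, 20, 21, 50] [] σ τ ∧ LReg τ 13 l ∧
      τ.N 20 = c.1 ∧ τ.N 21 = (c.2 : ℕ) := by
  refine Runs.blk _ ?_
  obtain ⟨h1, h2, h3, h4, h5⟩ := hl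
  have ho := hs.one
  exact ⟨keep_after, by simpa [LReg, ho, add_assoc] using h5, by simpa [ho] using h3,
    by simpa [ho] using h4⟩

namespace Eng

variable {a : Fin 4}

def SitePost (e : Eng n E) (t b : ℕ) (c : Fin n × Fin 4) (l done : Letters n) (v : ℝ)
    (W : List (Task n)) (σ τ : State) : Prop :=
  Keep n engX engY σ τ ∧ ∃ W', Work τ (W' ++ W) ∧ (∀ r' ∈ W', e.Valid r') ∧
    (W'.map e.val).sum = e.I.valN e.F t (b + 1) (c :: l) done v ∧
    (W'.map e.pot).sum ≤ e.pN b l.length (done.length + 1) + e.pN b l.length done.length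

theorem keepP_site (hs : Static n e.I.d e.m e.I.g σ) (hr : InRegs σ ⟨0, t, b, l, done, v⟩)
    (hW : Work σ W) (hj : σ.N 20 = j) (ha : σ.N 21 = (a : ℕ)) (ht : t ≤ e.I.d)
    (hp : Proper ((j, a) :: l ++ done)) (hn : j ∉ e.I.noisy t) :
    Runs e.Q keepP σ 24 (e.SitePost t b (j, a) l done v W σ) := by
  refine (keepP_runs (c := (j, a)) hs hr hW hj ha).mono le_rfl ?_
  rintro τ ⟨hk, hW', -⟩
  refine ⟨hk.mono, [⟨0, t, b, l, (j, a) :: done, v⟩], hW', ?_, ?_, ?_⟩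
  · simp [Valid, ht, Inst.proper_cons_append hp]
  · simp [val, e.I.valN_quiet hp hn]
  simp [pot]

theorem noiseP_site (ho : e.Ok) (hs : Static n e.I.d e.m e.I.g σ)
    (hr : InRegs σ ⟨0, t, b, l, done, v⟩)
    (hW : Work σ W) (hj : σ.N 20 = j) (ha : σ.N 21 = (a : ℕ)) (ht : t ≤ e.I.d)
    (hp : Proper ((j, a) :: l ++ done)) (hn : j ∈ e.I.noisy t) :
    Runs e.Q noiseP σ 100 (e.SitePost t b (j, a) l done v W σ) := by
  refine (Runs.ite (T := 80) (fun hb => ?_) fun hb => ?_).le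
  · have ha3 : a ≠ 3 := by
      rintro rfl
      simp [ha, hs.three] at hb
    refine (Runs.blk_seq (T := 24) _ ?_).le
    set τ := after e.Q σ [.castR 5 8, .castR 6 9, .divR 6 1 6, .subR 6 5 6, .mulR 3 3 6] with hτ
    have hk : Keep n [] [3, 5, 6] σ τ := keep_after
    have hr' := hr.keep_v hk (v := v * (1 - e.I.g / 2))
      (by simp [hτ, hr.v, hs.one, hs.two, hs.g_eq])
    refine (keepP_runs (c := (j, a)) (hs.keep hk) hr' (hW.keep hk)
      ((hk.eN _).trans hj) ((hk.eN _).trans ha)).mono le_rfl ?_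
    rintro υ ⟨hk', hW', -⟩
    refine ⟨hk.trans hk' (by decide) (by decide) (by decide) (by decide),
      [⟨0, t, b, l, (j, a) :: done, v * (1 - e.I.g / 2)⟩], hW', ?_, ?_, ?_⟩
    · simp [Valid, ht, Inst.proper_cons_append hp]
    · simp [val, e.I.valN_xy hp hn ha3]
    simp [pot]
  have ha3 : a = 3 := by
    simp only [Test.holds, ha, hs.three] at hb
    omega
  subst ha3
  refine (Runs.seq (T := 4) (T' := 76) (askP_runs hs (v := (e.I.dir t j : ℕ)) hr.t hj
    (by simp) fun a h0 h1 => ho.reads.dir t (by omega) j a h0 h1) ?_)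
  rintro σ1 ⟨k1, hdir, -, -⟩
  have s1 := hs.keep k1
  have r1 := hr.keep k1
  refine (Runs.blk_seq (T := 71) _ ?_).le
  set σ2 := after e.Q σ1 [.castR 5 8, .subR 6 5 1, .mulR 7 3 1, .mulR 3 3 6, .addN 24 14 7] with hσ2
  have k2 : Keep n [24] [3, 5, 6, 7] σ1 σ2 := keep_after
  have s2 := s1.keep k2
  have hv7 : σ2.R 7 = v * e.I.g := by simp [hσ2, r1.v, s1.g_eq]
  have h24 : LReg σ2 24 done := r1.done.after _ (by simp [s1.zero])
  have r2 := r1.keep_v k2 (v := v * (1 - e.I.g)) (by simp [hσ2, r1.v, s1.one, s1.g_eq])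
  have k12 : Keep n [24, 25, 53] [3, 5, 6, 7] σ σ2 := k1.trans k2
  refine (Runs.seq (T := 24) (T' := 47) (keepP_runs (c := (j, 3)) s2 r2 (hW.keep k12)
    ((k12.eN _).trans hj) ((k12.eN _).trans ha)) ?_)
  rintro σ3 ⟨k3, hW3, r3⟩
  have s3 := s2.keep k3
  have hd3 : σ3.N 25 = (e.I.dir t j : ℕ) := by rw [k3.eN _, k2.eN _, hdir]
  have hv3 : σ3.R 7 = v * e.I.g := by rw [k3.eR _, hv7]
  refine Runs.seq (T := 3) (T' := 44) (Φ := fun σ4 => Keep n [] [7, 8] σ3 σ4 ∧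
    σ4.R 7 = v * if e.I.dir t j = 0 then e.I.g else -e.I.g) ?_ ?_
  · refine Runs.ite (T := 2) (fun hb => ?_) (fun hb => ?_)
    · refine Runs.blk _ ⟨keep_after, ?_⟩
      have : e.I.dir t j ≠ 0 := fun h => by simp [hd3, h, s3.zero] at hb
      simp [hv3, this]
    refine (Runs.blk (Q := e.Q) [] ⟨Keep.refl _, ?_⟩).le
    have : e.I.dir t j = 0 := by
      simp only [Test.holds, hd3, s3.zero] at hb
      omega
    simp [after, hv3, this]
  rintro σ4 ⟨k4, hv4⟩
  refine (Runs.blk_seq (T := 16) _ ?_).le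
  set σ5 := after e.Q σ4 [.subR 8 8 8, .addR 3 7 8, .addN 14 24 7] with hσ5
  have k5 : Keep n [14] [3, 8] σ4 σ5 := keep_after
  have k45 : Keep n [14] [3, 7, 8] σ3 σ5 := k4.trans k5
  have k35 : Keep n [4, 14, 50, 51, 52] [3, 7, 8] σ2 σ5 := k3.trans k45
  have r5 : InRegs σ5 ⟨0, t, b, l, done, v * if e.I.dir t j = 0 then e.I.g else -e.I.g⟩ :=
    ⟨(k35.eN _).trans r2.st, (k35.eN _).trans r2.t, (k35.eN _).trans r2.b, r2.todo.keep k35,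
      ((h24.keep k3).keep k4).after _ (by simp [(s3.keep k4).zero]), by simp [hσ5, hv4]⟩
  refine (pushP_runs (s2.keep k35) r5 (hW3.keep k45)).mono le_rfl ?_
  rintro σ6 ⟨k6, hW6⟩
  refine ⟨(k12.trans (X'' := engX) (Y'' := engY) k35).trans k6,
    [⟨0, t, b, l, done, v * if e.I.dir t j = 0 then e.I.g else -e.I.g⟩,
    ⟨0, t, b, l, (j, 3) :: done, v * (1 - e.I.g)⟩], hW6, ?_, ?_, ?_⟩
  · have hp' : Proper (l ++ done) := hp.sublist (List.sublist_cons_self _ _)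
    simp [Valid, ht, Inst.proper_cons_append hp, hp']
  · simp [val, e.I.valN_z hp hn]
  simp [pot, add_comm]

theorem siteP_site (ho : e.Ok) (hs : Static n e.I.d e.m e.I.g σ)
    (hr : InRegs σ ⟨0, t, b, l, done, v⟩)
    (hW : Work σ W) (hj : σ.N 20 = j) (ha : σ.N 21 = (a : ℕ)) (ht : t ≤ e.I.d)
    (hp : Proper ((j, a) :: l ++ done)) :
    Runs e.Q (siteP e.I.gb) σ 110 (e.SitePost t b (j, a) l done v W σ) := by
  unfold siteP
  rcases hgb : e.I.gb with _ | _
  · have hn : j ∈ e.I.noisy t := by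
      cases t <;> simp [Inst.noisy, hgb]
    exact (noiseP_site ho hs hr hW hj ha ht hp hn).le
  refine (Runs.ite (T := 109) (fun hb => ?_) (fun hb => ?_)).le
  · obtain ⟨t, rfl⟩ : ∃ t', t = t' + 1 := by
      refine ⟨t - 1, ?_⟩
      simp only [Test.holds, hs.zero, hr.t] at hb
      omega
    refine (Runs.blk_seq (T := 106) _ ?_).le
    set σ1 := after e.Q σ [.subN 26 11 8] with hσ1
    have k1 : Keep n [26] [] σ σ1 := keep_after
    have s1 := hs.keep k1
    have h26 : σ1.N 26 = t := by simp [hσ1, hr.t, hs.one]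
    refine Runs.seq (T := 4) (T' := 102) (askP_runs s1 (v := (e.I.part t j : ℕ)) h26
      ((k1.eN _).trans hj) (by simp) fun a h0 h1 => ho.reads.part t (by omega) j a h0 h1) ?_
    rintro σ2 ⟨k2, h22, -, -⟩
    have k12 : Keep n [22, 26, 53] [] σ σ2 := k1.trans k2
    have s2 := hs.keep k12
    have r2 := hr.keep k12
    have hj2 := (k12.eN 20).trans hj
    have ha2 := (k12.eN 21).trans ha
    have lift : ∀ τ, e.SitePost (t + 1) b (j, a) l done v W σ2 τ →
        e.SitePost (t + 1) b (j, a) l done v W σ τ := fun τ h =>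
      ⟨(k12.trans h.1 (by decide) (by decide) (by simp) (by simp)), h.2⟩
    have hmem : j ∈ e.I.noisy (t + 1) ↔ e.I.part t j ≠ j := by simp [Inst.noisy, hgb]
    refine (Runs.ite (T := 101) (fun hb => ?_) (fun hb => ?_))
    · refine (noiseP_site ho s2 r2 (hW.keep k12) hj2 ha2 ht hp (hmem.mpr ?_)).mono (by omega) lift
      intro hc
      simp [hj2, h22, hc] at hb
    refine (Runs.ite (T := 100) (fun hb' => ?_) (fun hb' => ?_))
    · refine (noiseP_site ho s2 r2 (hW.keep k12) hj2 ha2 ht hp (hmem.mpr ?_)).mono le_rfl lift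
      intro hc
      simp [hj2, h22, hc] at hb'
    refine (keepP_site s2 r2 (hW.keep k12) hj2 ha2 ht hp (fun h => hmem.mp h ?_)).mono
      (by omega) lift
    simp only [Test.holds, hj2, h22] at hb hb'
    exact Fin.ext (by omega)
  have : t = 0 := by
    simp only [Test.holds, hs.zero, hr.t] at hb
    omega
  subst this
  exact (noiseP_site ho hs hr hW hj ha ht hp (by simp [Inst.noisy])).le

theorem bodyN_does (ho : e.Ok) {sink : Program}
    (hsink : ∀ r, e.Valid r → r.st = 0 → r.todo = [] → e.Does 30 sink r) (hv : e.Valid r)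
    (h0 : r.st = 0) : e.Does 25 (bodyN e.I.gb sink) r := by
  intro σ W z hs hW hr hz
  have hc : 200 ≤ stepCost := by unfold stepCost; omega
  obtain ⟨-, ht, hp⟩ : r.st = 0 ∧ r.t ≤ e.I.d ∧ Proper (r.todo ++ r.done) := by
    rcases hv with h | h | h <;> first | exact h | omega
  have htodo := LAt.eq_zero_iff (by omega) hr.todo
  by_cases hnil : r.todo = []
  · obtain ⟨T, h⟩ := hsink r hv h0 hnil σ W z hs hW hr hz
    refine ⟨T + 1, Runs.ite (fun hb => ?_) fun hb => h.mono le_rfl ?_⟩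
    · simp [hs.zero, htodo.mpr hnil] at hb
    rintro τ ⟨h3, W', z', h4, h5, h6, h7, h8⟩
    exact ⟨h3, W', z', h4, h5, h6, h7, by omega⟩
  have hb1 : (Test.ltN 7 13).holds σ := by
    simpa [hs.zero, Nat.pos_iff_ne_zero, htodo] using hnil
  obtain ⟨c, l, hl⟩ := List.exists_cons_of_ne_nil hnil
  obtain ⟨st, t, b, todo, done, v⟩ := r
  simp only at h0 hl ht hp
  subst h0 hl
  rcases b with _ | b
  · refine ⟨2, Runs.ite (T := 1) (fun _ => Runs.ite (T := 0) (fun hb => ?_) fun _ => Runs.skip ?_)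
      fun h => absurd hb1 h⟩
    · simp [hs.zero, hr.b] at hb
    refine Step.of_keep ho hs (Keep.refl σ) hz (W' := []) hW (by simp) ?_ ?_
    · simp [val, e.I.valN_exhausted]
    have := ho.pN_zero l.length done.length
    simp [pot]
    omega
  refine ⟨120, Runs.ite (T := 119) (fun _ => Runs.ite (T := 118) (fun _ => ?_) fun hb => ?_)
    fun h => absurd hb1 h⟩
  · refine (Runs.seq (T := 5) (T' := 111) (popLetterP_runs hs hr.todo) ?_).le
    rintro σ1 ⟨k1, hl1, hj1, ha1⟩
    refine (Runs.blk_seq (T := 110) _ ?_)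
    set σ2 := after e.Q σ1 [.subN 12 12 8] with hσ2
    have k2 : Keep n [12] [] σ1 σ2 := keep_after
    have k12 : Keep n [12, 13, 20, 21, 50] [] σ σ2 := k1.trans k2
    have r2 : InRegs σ2 ⟨0, t, b, l, done, v⟩ :=
      ⟨(k12.eN _).trans hr.st, (k12.eN _).trans hr.t, by simp [hσ2, k1.eN 12, hr.b,
        (hs.keep k1).one], hl1.keep k2, hr.done.keep k12, (k12.eR _).trans hr.v⟩
    refine (siteP_site (j := c.1) (a := c.2) ho (hs.keep k12) r2 (hW.keep k12)
      ((k2.eN _).trans hj1) ((k2.eN _).trans ha1) ht hp).mono le_rfl ?_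
    rintro τ ⟨k3, W', hW', hval', hsum, hpot⟩
    refine Step.of_keep ho hs (k12.trans k3) hz hW' hval' ?_ ?_
    · simp [hsum, val]
    have := ho.pN_succ b l.length done.length
    change _ ≤ e.pN (b + 1) (l.length + 1) done.length
    omega
  simp [hs.zero, hr.b] at hb

end Eng

/-! ### Gates -/

/-- Looks up the letter of qubit `N[22]` in the list `N[13]`, and removes it. -/
def scanP : Program := .seq (blk [.addN 30 13 7, .constN 13 0, .constN 23 0])
  (.while (.ltN 7 30) (.seq (blk [.loadN 31 30, .addN 33 30 8, .loadN 32 33, .addN 33 33 8,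
    .loadN 30 33]) (.ite (.ltN 31 22) (consP 13 31 32 13)
      (.ite (.ltN 22 31) (consP 13 31 32 13) (blk [.addN 23 32 7])))))

def addLetterP (x : ℕ) (c : Fin 4) : Program := if c = 0 then blk [] else consP 14 x (7 + c) 14

def branchP (a b : Fin 4 × Fin 4) : Program :=
  .seq (askP 0 11 25) (.seq (blk ((ptmExpr b a).code 100 ++ [.mulR 3 7 100, .addN 14 24 7]))
    (.seq (addLetterP 22 b.2) (.seq (addLetterP 20 b.1) pushP)))

def branchesP (a : Fin 4 × Fin 4) : Program :=
  seqs ((univ : Finset (Fin 4 × Fin 4)).toList.map (branchP a))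

/-- Processes the letter `(N[20], N[21])`, whose qubit is in a gate with qubit `N[22]`. -/
def pairP : Program :=
  .seq scanP (.seq (.ite (.ltN 22 20) (blk [.addN 26 20 7, .addN 20 22 7, .addN 22 26 7,
    .addN 26 21 7, .addN 21 23 7, .addN 23 26 7]) (blk []))
  (.seq (blk [.addN 24 14 7, .subR 8 8 8, .addR 7 3 8])
    (switchP 21 fun a1 => switchP 23 fun a2 => branchesP (a1, a2))))

def bodyG : Program := .ite (.ltN 7 13) (.seq popLetterP (.seq (askP 0 11 22)
    (.ite (.ltN 20 22) pairP (.ite (.ltN 22 20) pairP keepP))))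
  (.seq (blk [.constN 15 0, .addN 11 11 8, .addN 13 14 7, .constN 14 0]) pushP)

theorem str_concat (m : Letters n) (c : Fin n × Fin 4) (h : (sites (m ++ [c])).Nodup)
    (p : Fin n) : str (m ++ [c]) p = if c.1 = p then c.2 else str m p := by
  rw [str_append]
  have h2 : c.1 ∉ sites m := by
    rw [sites, List.map_append, List.nodup_append'] at h
    simp_all
  by_cases hp : c.1 = p
  · subst hp
    simp [h2, str]
  rw [if_neg hp]
  split_ifs with hm
  · rfl
  rw [str_of_notMem hm, str, update_of_ne (Ne.symm hp)]
  rfl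

theorem scanP_runs (hs : Static n d m g σ) (hl : LReg σ 13 l) (hnd : (sites l).Nodup) {p : Fin n}
    (hp : σ.N 22 = p) :
    Runs Q scanP σ (20 * l.length + 4) fun τ => Keep n [13, 23, 30, 31, 32, 33, 52] [] σ τ ∧
      (∃ l' : Letters n, l'.Perm (l.filter fun c => c.1 ≠ p) ∧ LReg τ 13 l') ∧
      τ.N 23 = (str l p : ℕ) := by
  let I : State → ℕ → Prop := fun τ k => Keep n [13, 23, 30, 31, 32, 33, 52] [] σ τ ∧
    ∃ m r l' : Letters n, m ++ r = l ∧ LReg τ 30 r ∧ LReg τ 13 l' ∧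
    l'.Perm (m.filter fun c => c.1 ≠ p) ∧ τ.N 23 = (str m p : ℕ) ∧ k = 20 * r.length + 1
  refine (Runs.blk_seq (T := 20 * l.length + 1) _ ?_).le
  have k0 : Keep n [13, 23, 30] [] σ (after Q σ [.addN 30 13 7, .constN 13 0, .constN 23 0]) :=
    keep_after
  have h1 := Runs.while (Q := Q) (σ := after Q σ [.addN 30 13 7, .constN 13 0, .constN 23 0])
    (b := .ltN 7 30) (p := .seq (blk [.loadN 31 30, .addN 33 30 8, .loadN 32 33, .addN 33 33 8,
    .loadN 30 33]) (.ite (.ltN 31 22) (consP 13 31 32 13)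
      (.ite (.ltN 22 31) (consP 13 31 32 13) (blk [.addN 23 32 7]))))
    I (k := 20 * l.length + 1) ?_ ?_ (fun τ k ⟨_, m, r, l', _, _, _, _, _, hk⟩ => by omega)
  · refine h1.mono le_rfl ?_
    rintro τ ⟨hb, k, hk, m, r, l', hmr, hr, hl', hperm, h23, -⟩
    have s1 := hs.keep hk
    have : r = [] := by
      exact (LAt.eq_zero_iff (by omega) hr).mp (by simpa [s1.zero] using hb)
    subst this
    rw [List.append_nil] at hmr
    subst hmr
    exact ⟨hk, ⟨l', hperm, hl'⟩, h23⟩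
  · refine ⟨k0.mono, [], l, [], rfl, ?_, ?_, by simp, ?_, rfl⟩
    · have : LReg σ 13 l := hl
      simpa [LReg, hs.zero] using this
    · simp [LReg, LAt]
    simp [str]
  rintro τ k ⟨hk, m, r, l', hmr, hr, hl', hperm, h23, rfl⟩ hb
  have s1 := hs.keep hk
  have hne : r ≠ [] := by
    intro h
    have := (LAt.eq_zero_iff (by omega) hr).mpr h
    simp [s1.zero, this] at hb
  obtain ⟨c, r, rfl⟩ := List.exists_cons_of_ne_nil hne
  refine ⟨15, (Runs.blk_seq (T := 10) _ ?_)⟩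
  set τ1 := after Q τ [.loadN 31 30, .addN 33 30 8, .loadN 32 33, .addN 33 33 8, .loadN 30 33]
    with hτ1
  have k1 : Keep n [30, 31, 32, 33] [] τ τ1 := keep_after
  have kk : Keep n [13, 23, 30, 31, 32, 33, 52] [] σ τ1 := hk.trans k1
  have s2 := hs.keep kk
  obtain ⟨g1, g2, g3, g4, g5⟩ := hr
  have e31 : τ1.N 31 = c.1 := by aesop
  have e32 : τ1.N 32 = (c.2 : ℕ) := by simpa [hτ1, s1.one] using g4
  have e30 : LReg τ1 30 r := by
    simpa [LReg, hτ1, s1.one, add_assoc] using g5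
  have e22 : τ1.N 22 = p := (kk.eN 22).trans hp
  have hmc : (m ++ [c]) ++ r = l := by rw [← hmr]; simp
  have hnd' : (sites (m ++ [c])).Nodup := by
    rw [← hmc] at hnd
    exact hnd.sublist ((List.sublist_append_left _ _).map _)
  have hcons : c.1 ≠ p → Runs Q (consP 13 31 32 13) τ1 8 fun υ =>
      ∃ k', I υ k' ∧ k' + 15 + 1 ≤ 20 * (c :: r).length + 1 := by
    intro hcp
    refine (consP_runs s2 e31 e32 (hl'.keep k1)).mono le_rfl ?_
    rintro υ ⟨k2, hl2⟩
    refine ⟨20 * r.length + 1, ⟨kk.trans k2, m ++ [c], r, c :: l', hmc, e30.keep k2, hl2, ?_, ?_,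
      rfl⟩, ?_⟩
    · rw [List.filter_append]
      simp only [List.filter_cons, List.filter_nil, ne_eq, hcp, not_false_eq_true, decide_true,
        if_true]
      exact (List.Perm.cons c hperm).trans (List.perm_append_singleton _ _).symm
    · rw [k2.eN 23, k1.eN 23, h23, str_concat m c hnd', if_neg hcp]
    simp only [List.length_cons]
    omega
  refine Runs.ite (T := 9) (fun hb => ?_) (fun hb => ?_)
  · refine (hcons ?_).le
    intro h
    simp [e31, e22, h] at hb
  refine Runs.ite (T := 8) (fun hb' => ?_) (fun hb' => ?_)
  · refine (hcons ?_).le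
    intro h
    simp [e31, e22, h] at hb'
  have hcp : c.1 = p := by
    simp only [Test.holds, e31, e22] at hb hb'
    exact Fin.ext (by omega)
  refine (Runs.blk (Q := Q) [.addN 23 32 7] ?_).le
  have k2 : Keep n [23] [] τ1 (after Q τ1 [.addN 23 32 7]) := keep_after
  refine ⟨20 * r.length + 1, ⟨kk.trans k2, m ++ [c], r, l', hmc, e30.keep k2,
    (hl'.keep k1).keep k2, ?_, ?_, rfl⟩, ?_⟩
  · simp_all
  · rw [str_concat m c hnd', if_pos hcp]
    simp [e32, s2.zero]
  simp only [List.length_cons]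
  omega

theorem addLetterP_runs (hs : Static n d m g σ)
    {x : ℕ} (hx : x ≠ 3 ∧ x ≠ 52) (hj : σ.N x = j) (c : Fin 4)
    (hl : LReg σ 14 l) : Runs Q (addLetterP x c) σ 8 fun τ => Keep n [14, 52] [] σ τ ∧
      LReg τ 14 (addLetter j c l) := by
  unfold addLetterP addLetter
  split_ifs with hc
  · exact (Runs.blk (Q := Q) [] ⟨Keep.refl _, hl⟩).le
  have h7 : σ.N (7 + c) = (c : ℕ) := by
    fin_cases c <;> [exact hs.zero; exact hs.one; exact hs.two; exact hs.three]
  refine (consP_runs hs (c := (j, c)) hj h7 hl (hj := hx) (ha := ⟨by omega, by omega⟩)).mono le_rfl ?_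
  rintro τ ⟨hk, hl'⟩
  exact ⟨hk.mono, hl'⟩

namespace Eng

variable {i k : Fin n}

structure GateRegs (e : Eng n E) (t b : ℕ) (i k : Fin n) (l done : Letters n) (v : ℝ) (σ : State) :
    Prop where
  static : Static n e.I.d e.m e.I.g σ
  st : σ.N 15 = 1
  t : σ.N 11 = t
  b : σ.N 12 = b
  todo : LReg σ 13 l
  done : LReg σ 24 done
  v : σ.R 7 = v
  i : σ.N 20 = i
  k : σ.N 22 = k

theorem GateRegs.keep (h : e.GateRegs t b i k l done v σ) (hk : Keep n X Y σ τ)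
    (hX : ∀ x ∈ [0, 1, 2, 7, 8, 9, 10, 11, 12, 13, 15, 20, 22, 24], x ∉ X := by decide)
    (hY : ∀ y ∈ [1, 7], y ∉ Y := by decide) : e.GateRegs t b i k l done v τ where
  static := h.static.keep hk (fun x hx => hX x (by
    simp only [List.mem_cons] at hx ⊢; tauto)) (hY 1 (by simp))
  st := (hk.N _ (hX _ (by simp)) (by simp)).trans h.st
  t := (hk.N _ (hX _ (by simp)) (by simp)).trans h.t
  b := (hk.N _ (hX _ (by simp)) (by simp)).trans h.b
  todo := h.todo.keep hk (hX _ (by simp))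
  done := h.done.keep hk (hX _ (by simp))
  v := (hk.R _ (hY _ (by simp)) (by simp)).trans h.v
  i := (hk.N _ (hX _ (by simp)) (by simp)).trans h.i
  k := (hk.N _ (hX _ (by simp)) (by simp)).trans h.k

def branchTask (e : Eng n E) (t b : ℕ) (i k : Fin n) (l done : Letters n) (v : ℝ)
    (a c : Fin 4 × Fin 4) : Task n :=
  ⟨1, t, b, l, addLetter i c.1 (addLetter k c.2 done), v * ptm (e.I.gate t i) c a⟩

theorem branchP_runs (ho : e.Ok) (ht : t < e.I.d) (h : e.GateRegs t b i k l done v σ)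
    (hW : Work σ W) (a c : Fin 4 × Fin 4) :
    Runs e.Q (branchP a c) σ branchCost fun τ => Keep n [4, 14, 25, 50, 51, 52, 53, 54] [3] σ τ ∧
      Work τ (e.branchTask t b i k l done v a c :: W) := by
  have hc : ((ptmExpr c a).code 100).length + 40 ≤ branchCost := by
    unfold branchCost
    refine Nat.add_le_add_right ?_ _
    refine le_trans ?_ (single_le_sum (f := fun c => ∑ a : Fin 4 × Fin 4,
      ((ptmExpr c a).code 100).length) (fun _ _ => Nat.zero_le _) (mem_univ c))
    exact single_le_sum (f := fun a => ((ptmExpr c a).code 100).length)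
      (fun _ _ => Nat.zero_le _) (mem_univ a)
  refine (Runs.seq (T := 4) (T' := ((ptmExpr c a).code 100).length + 2 + 32)
    (askP_runs h.static (v := (e.I.part t i : ℕ)) h.t h.i (by simp)
      fun a h0 h1 => ho.reads.part t ht i a h0 h1) ?_).le
  rintro σ1 ⟨k1, -, hM0, hM1⟩
  have h1 := h.keep k1
  refine (Runs.blk_seq (T := 32) _ ?_).le
  rw [after_append]
  obtain ⟨hf, hv⟩ := RExpr.code_after ho.reads.gates ht i (ptmExpr c a) 100 σ1 (by simp) h1.static
    hM0 hM1
  set σ2 := after e.Q σ1 ((ptmExpr c a).code 100) with hσ2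
  have k2 := hf.keep
  have h2 := h1.keep k2
  set σ3 := after e.Q σ2 [.mulR 3 7 100, .addN 14 24 7] with hσ3
  have k3 : Keep n [14] [3] σ2 σ3 := keep_after
  have h3 := h2.keep k3
  have h14 : LReg σ3 14 done := h2.done.after _ (by simp [h2.static.zero])
  have hv3 : σ3.R 3 = v * ptm (e.I.gate t i) c a := by
    simp [hσ3, h2.v, hv, ptmExpr_eval]
  refine Runs.seq (T := 8) (T' := 24) (addLetterP_runs h3.static (by simp) h3.k c.2 h14) ?_
  rintro σ4 ⟨k4, h14'⟩
  have h4 := h3.keep k4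
  refine Runs.seq (T := 8) (T' := 16) (addLetterP_runs h4.static (by simp) h4.i c.1 h14') ?_
  rintro σ5 ⟨k5, h14''⟩
  have h5 := h4.keep k5
  have k12 : Keep n [25, 53, 54] [] σ σ2 := k1.trans k2
  have k13 : Keep n [14, 25, 53, 54] [3] σ σ3 := k12.trans k3
  have k45 : Keep n [14, 52] [] σ3 σ5 := k4.trans k5
  have k15 : Keep n [14, 25, 52, 53, 54] [3] σ σ5 := k13.trans k45
  refine (pushP_runs (r := e.branchTask t b i k l done v a c) h5.static
    ⟨h5.st, h5.t, h5.b, h5.todo, h14'', ?_⟩ (hW.keep k15)).mono le_rfl ?_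
  · rw [k45.eR _, hv3]
    rfl
  rintro σ6 ⟨k6, hW6⟩
  exact ⟨k15.trans k6, hW6⟩

theorem branches_runs (ho : e.Ok) (ht : t < e.I.d) (a : Fin 4 × Fin 4)
    (L : List (Fin 4 × Fin 4)) : ∀ {σ : State}
    {W : List (Task n)}, e.GateRegs t b i k l done v σ → Work σ W →
    Runs e.Q (seqs (L.map (branchP a))) σ (branchCost * L.length) fun τ =>
      Keep n [4, 14, 25, 50, 51, 52, 53, 54] [3] σ τ ∧
      Work τ ((L.map (e.branchTask t b i k l done v a)).reverse ++ W) := by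
  induction L with
  | nil =>
    intro σ W h hW
    exact Runs.skip ⟨Keep.refl _, hW⟩
  | cons c L ih =>
    intro σ W h hW
    refine (Runs.seq (branchP_runs ho ht h hW a c) ?_).mono (T := branchCost + branchCost * L.length)
      (by simp; ring_nf; omega) (fun _ h => h)
    rintro σ1 ⟨k1, hW1⟩
    refine (ih (h.keep k1) hW1).mono le_rfl ?_
    rintro σ2 ⟨k2, hW2⟩
    refine ⟨k1.trans k2, ?_⟩
    simpa using hW2

end Eng

namespace Eng
variable {a : Fin 4}

theorem length_addLetter_le (j : Fin n) (a : Fin 4) (l : Letters n) :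
    (addLetter j a l).length ≤ l.length + 1 := by
  unfold addLetter
  split_ifs <;> simp

theorem pairP_runs (ho : e.Ok) (hs : Static n e.I.d e.m e.I.g σ)
    (hr : InRegs σ ⟨1, t, b, l, done, v⟩) (hW : Work σ W) (hj : σ.N 20 = j) (ha : σ.N 21 = (a : ℕ))
    (hk : σ.N 22 = e.I.part t j) (hne : e.I.part t j ≠ j) (ht : t < e.I.d)
    (hp : Proper ((j, a) :: l ++ done))
    (hd : ∀ k ∈ sites done, e.I.part t k ∉ sites ((j, a) :: l)) :
    Runs e.Q pairP σ (20 * l.length + 16 * branchCost + 40) fun τ => Keep n engX engY σ τ ∧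
      ∃ W', Work τ (W' ++ W) ∧ (∀ r' ∈ W', e.Valid r') ∧
      (W'.map e.val).sum = e.I.valG e.F t b ((j, a) :: l) done v ∧
      (W'.map e.pot).sum ≤ 16 * e.pG b l.length (done.length + 2) := by
  have hinv := e.I.involutive t
  obtain ⟨hp1, hp2, hp3⟩ := proper_append.mp hp
  have hnd : (sites l).Nodup := (List.nodup_cons.mp hp1.1).2
  have hjl : j ∉ sites l := (List.nodup_cons.mp hp1.1).1
  refine (Runs.seq (T := 20 * l.length + 4) (T' := 16 * branchCost + 36)
    (scanP_runs hs hr.todo hnd hk) ?_).le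
  rintro σ1 ⟨k1, ⟨l', hperm, hl'⟩, h23⟩
  have s1 := hs.keep k1
  -- after sorting the two qubits
  obtain ⟨i, hi, hij⟩ : ∃ i, i < e.I.part t i ∧ (j = i ∨ j = e.I.part t i) := by
    rcases lt_or_gt_of_ne hne with h | h
    · exact ⟨e.I.part t j, by rwa [hinv], Or.inr (hinv j).symm⟩
    exact ⟨j, h, Or.inl rfl⟩
  set a1 := str ((j, a) :: l) i with ha1
  set a2 := str ((j, a) :: l) (e.I.part t i) with ha2
  have hsj : str ((j, a) :: l) j = a := by rw [str, update_self]
  have hsk : str ((j, a) :: l) (e.I.part t j) = str l (e.I.part t j) := by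
    rw [str, update_of_ne hne]
  refine Runs.mono (T := 7 + (16 * branchCost + 29)) (Runs.seq (Φ := fun σ2 =>
    Keep n [20, 21, 22, 23, 26] [] σ1 σ2 ∧ σ2.N 20 = i ∧ σ2.N 22 = e.I.part t i ∧
    σ2.N 21 = (a1 : ℕ) ∧ σ2.N 23 = (a2 : ℕ)) ?_ ?_) (by omega) (fun _ h => h)
  · have h20 : σ1.N 20 = j := (k1.eN _).trans hj
    have h21 : σ1.N 21 = (a : ℕ) := (k1.eN _).trans ha
    have h22 : σ1.N 22 = e.I.part t j := (k1.eN _).trans hk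
    refine Runs.ite (T := 6) (fun hb => ?_) (fun hb => ?_)
    · refine Runs.blk _ ⟨keep_after, ?_⟩
      have : j = e.I.part t i := by
        rcases hij with rfl | h
        · exact absurd hi (not_lt.mpr (le_of_lt (by simpa [h20, h22] using hb)))
        exact h
      have hqi : e.I.part t j = i := by rw [this, hinv]
      rw [ha1, ha2, ← this, hsj, ← hqi, hsk]
      simp [h20, h21, h22, h23, s1.zero]
    refine (Runs.blk (Q := e.Q) [] ⟨Keep.refl _, ?_⟩).le
    have : j = i := by
      refine hij.resolve_right fun h => hb ?_
      simpa [h20, h22, h, hinv i] using hi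
    subst this
    rw [ha1, ha2, hsj, hsk]
    exact ⟨h20, h22, h21, h23⟩
  rintro σ2 ⟨k2, h20, h22, h21, h23'⟩
  refine (Runs.blk_seq (T := 16 * branchCost + 26) _ ?_).le
  set σ3 := after e.Q σ2 [.addN 24 14 7, .subR 8 8 8, .addR 7 3 8] with hσ3
  have k3 : Keep n [24] [7, 8] σ2 σ3 := keep_after
  have k12 : Keep n [13, 20, 21, 22, 23, 26, 30, 31, 32, 33, 52] [] σ σ2 := k1.trans k2
  have k13 : Keep n [13, 20, 21, 22, 23, 24, 26, 30, 31, 32, 33, 52] [7, 8] σ σ3 := k12.trans k3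
  have s3 := hs.keep k13
  have hreg : e.GateRegs t b i (e.I.part t i) l' done v σ3 := by
    refine ⟨s3, (k13.eN _).trans hr.st, (k13.eN _).trans hr.t, (k13.eN _).trans hr.b,
      (hl'.keep k2).keep k3, (hr.done.keep k12).after _ (by simp [(hs.keep k12).zero]),
      by simp [hσ3, k12.eR 3, hr.v], (k3.eN _).trans h20, (k3.eN _).trans h22⟩
  have hlen : (univ : Finset (Fin 4 × Fin 4)).toList.length = 16 := by simp
  have hrun := branches_runs ho ht (a1, a2) (univ : Finset (Fin 4 × Fin 4)).toList hreg
    (hW.keep k13)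
  rw [hlen, mul_comm branchCost] at hrun
  refine (switchP_runs (T := 16 * branchCost + 3) s3 ((k3.eN _).trans h21)
    (switchP_runs (f := fun a2 => branchesP (a1, a2)) s3 ((k3.eN _).trans h23')
      hrun)).mono (by omega) ?_
  rintro τ ⟨k4, hW4⟩
  refine ⟨k13.trans k4, _, hW4, ?_, ?_, ?_⟩
  · intro r' hr'
    obtain ⟨c, -, rfl⟩ := List.mem_map.mp (List.mem_reverse.mp hr')
    have hml' : ∀ k, k ∈ sites l' ↔ k ∈ sites l ∧ k ≠ e.I.part t j := by
      intro k
      rw [(hperm.map Prod.fst).mem_iff]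
      simp only [sites, List.mem_map, List.mem_filter, decide_eq_true_eq]
      aesop
    have hpl' : Proper l' := by
      refine Proper.perm hperm.symm ?_
      exact Proper.sublist (List.filter_sublist.trans (List.sublist_cons_self (j, a) l)) hp1
    have hpair : ∀ k, (k = i ∨ k = e.I.part t i) ↔ (k = j ∨ k = e.I.part t j) := by
      intro k
      rcases hij with rfl | rfl
      · rfl
      rw [hinv]
      exact or_comm
    have hnl' : ∀ k, (k = i ∨ k = e.I.part t i) → k ∉ sites l' := by
      intro k hk hc
      rcases (hpair k).mp hk with rfl | rfl
      · exact hjl ((hml' _).mp hc).1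
      exact ((hml' _).mp hc).2 rfl
    have hjd : j ∉ sites done := hp3 j (by simp)
    have hqjd : e.I.part t j ∉ sites done := fun hc => hd _ hc (by rw [hinv]; simp)
    have hnd' : ∀ k, (k = i ∨ k = e.I.part t i) → k ∉ sites done := by
      intro k hk
      rcases (hpair k).mp hk with rfl | rfl <;> assumption
    refine Or.inr (Or.inl ⟨rfl, ht, ?_, ?_⟩)
    · refine proper_append.mpr ⟨hpl', ?_, ?_⟩
      · refine Proper.addLetter (Proper.addLetter hp2 _ (hnd' _ (Or.inr rfl))) _ fun hc => ?_
        rcases sites_addLetter hc with h | h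
        · exact hi.ne h
        exact hnd' _ (Or.inl rfl) h
      intro k hk hc
      rcases sites_addLetter hc with h | h
      · exact hnl' _ (Or.inl h) hk
      rcases sites_addLetter h with h | h
      · exact hnl' _ (Or.inr h) hk
      exact hp3 k (List.mem_cons_of_mem _ ((hml' k).mp hk).1) h
    intro k hk
    change e.I.part t k ∉ sites l'
    rcases sites_addLetter hk with rfl | h
    · exact hnl' _ (Or.inr rfl)
    rcases sites_addLetter h with rfl | h
    · rw [hinv]
      exact hnl' _ (Or.inl rfl)
    intro hc
    exact hd k h (List.mem_cons_of_mem _ ((hml' _).mp hc).1)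
  · rw [e.I.valG_pair hp hd hi hij hperm]
    rw [List.map_reverse, List.sum_reverse, List.map_map, sum_map_toList]
    rfl
  rw [List.map_reverse, List.sum_reverse, List.map_map]
  refine (List.sum_le_card_nsmul _ (e.pG b l.length (done.length + 2)) ?_).trans ?_
  · intro x hx
    obtain ⟨c, -, rfl⟩ := List.mem_map.mp hx
    have h1 := length_addLetter_le i c.1 (addLetter (e.I.part t i) c.2 done)
    have h2 := length_addLetter_le (e.I.part t i) c.2 done
    refine ho.pG_mono b _ _ _ _ ?_ (by simp only [branchTask]; omega)
    exact (hperm.length_eq).trans_le (List.length_filter_le _ _)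
  simp

theorem bodyG_does (ho : e.Ok) (hv : e.Valid r) (h1 : r.st = 1) : e.Does 25 bodyG r := by
  intro σ W z hs hW hr hz
  have hc : 200 + 16 * branchCost = stepCost := by unfold stepCost; omega
  obtain ⟨-, ht, hp, hd⟩ : r.st = 1 ∧ r.t < e.I.d ∧ Proper (r.todo ++ r.done) ∧
      ∀ k ∈ sites r.done, e.I.part r.t k ∉ sites r.todo := by
    rcases hv with h | h | h <;> first | exact h | omega
  have htodo := LAt.eq_zero_iff (by omega) hr.todo
  obtain ⟨st, t, b, todo, done, v⟩ := r
  simp only at h1 ht hp hd htodo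
  subst h1
  rcases todo with _ | ⟨⟨j, a⟩, l⟩
  · refine ⟨21, Runs.ite (T := 20) (fun hb => ?_) fun _ => ?_⟩
    · simp [hs.zero, htodo.mpr rfl] at hb
    refine Runs.blk_seq (T := 16) _ ?_
    set σ1 := after e.Q σ [.constN 15 0, .addN 11 11 8, .addN 13 14 7, .constN 14 0] with hσ1
    have k1 : Keep n [11, 13, 14, 15] [] σ σ1 := keep_after
    have r1 : InRegs σ1 ⟨0, t + 1, b, done, [], v⟩ := ⟨by simp [hσ1], by simp [hσ1, hr.t, hs.one],
      (k1.eN _).trans hr.b, hr.done.after _ (by simp [hs.zero]), by simp [hσ1, LReg, LAt],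
      (k1.eR _).trans hr.v⟩
    refine (pushP_runs (hs.keep k1) r1 (hW.keep k1)).mono le_rfl ?_
    rintro τ ⟨k2, hW2⟩
    have hpd : Proper done := by simpa using hp
    refine Step.push ho hs (k1.trans k2) hz hW2 ?_ ?_ ?_
    · simp [Valid, hpd]
      omega
    · simp [val, e.I.valG_nil hpd]
    have := ho.pG_zero b done.length
    simp [pot]
    omega
  have hpot : e.pot ⟨1, t, b, (j, a) :: l, done, v⟩ = e.pG b (l.length + 1) done.length := rfl
  have hpG := ho.pG_succ b l.length done.length
  have hmul : stepCost * (l.length + 1) = stepCost * l.length + stepCost := by ring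
  have hmul2 : 200 * l.length ≤ stepCost * l.length := Nat.mul_le_mul_right _ (by omega)
  refine ⟨20 * l.length + 16 * branchCost + 60,
    Runs.ite (T := 20 * l.length + 16 * branchCost + 59) (fun _ => ?_) fun hb => ?_⟩
  · refine (Runs.seq (T := 5) (T' := 20 * l.length + 16 * branchCost + 54)
      (popLetterP_runs hs hr.todo) ?_).le
    rintro σ1 ⟨k1, hl1, hj1, ha1⟩
    refine (Runs.seq (T := 4) (T' := 20 * l.length + 16 * branchCost + 50)
      (askP_runs (hs.keep k1) (v := (e.I.part t j : ℕ)) ((k1.eN _).trans hr.t) hj1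
      (by simp) fun a h0 h1 => ho.reads.part t ht j a h0 h1) ?_).le
    rintro σ2 ⟨k2, h22, -, -⟩
    have k12 : Keep n [13, 20, 21, 22, 50, 53] [] σ σ2 := k1.trans k2
    have r2 : InRegs σ2 ⟨1, t, b, l, done, v⟩ := ⟨(k12.eN _).trans hr.st, (k12.eN _).trans hr.t,
        (k12.eN _).trans hr.b, hl1.keep k2, hr.done.keep k12, (k12.eR _).trans hr.v⟩
    have hj2 := (k2.eN 20).trans hj1
    have ha2 := (k2.eN 21).trans ha1
    have hpair : e.I.part t j ≠ j → Runs e.Q pairP σ2 (20 * l.length + 16 * branchCost + 40)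
        (e.Step 25 (20 * l.length + 16 * branchCost + 60) ⟨1, t, b, (j, a) :: l, done, v⟩ W z) := by
      intro hne
      refine (pairP_runs ho (hs.keep k12) r2 (hW.keep k12) hj2 ha2 h22 hne ht hp hd).mono le_rfl ?_
      rintro τ ⟨k3, W', hW', hv', hsum, hpot'⟩
      refine Step.of_keep ho hs (k12.trans k3) hz hW' hv' ?_ ?_
      · simp [hsum, val]
      omega
    refine (Runs.ite (T := 20 * l.length + 16 * branchCost + 41) (fun hb => ?_) fun hb => ?_).le
    · refine (hpair fun h => ?_).le
      simp [hj2, h22, h] at hb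
    refine Runs.ite (T := 20 * l.length + 16 * branchCost + 40) (fun hb' => ?_) fun hb' => ?_
    · refine (hpair fun h => ?_).le
      simp [hj2, h22, h] at hb'
    have hfix : e.I.part t j = j := by
      simp only [Test.holds, hj2, h22] at hb hb'
      exact Fin.ext (by omega)
    refine (keepP_runs (c := (j, a)) (hs.keep k12) r2 (hW.keep k12) hj2 ha2).mono (by omega) ?_
    rintro τ ⟨k3, hW3, -⟩
    refine Step.push ho hs (k12.trans k3) hz hW3 ?_ ?_ ?_
    · refine Or.inr (Or.inl ⟨rfl, ht, Inst.proper_cons_append hp, fun k hk => ?_⟩)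
      rcases List.mem_cons.mp hk with rfl | hk
      · simpa [hfix] using (List.nodup_cons.mp (proper_append.mp hp).1.1).1
      exact fun hc => hd k hk (List.mem_cons_of_mem _ hc)
    · simp [val, e.I.valG_fixed hp hfix]
    have h3 := ho.pG_mono b l.length l.length (done.length + 1) (done.length + 2) le_rfl (by omega)
    simp [pot]
    omega
  have := hr.todo.1
  simp only [Test.holds, hs.zero] at hb
  omega

end Eng

/-! ### Enumeration, and the main loop -/

def bodyE (fin : Program) : Program := .ite (.ltN 11 0) (.ite (.ltN 7 12)
  (.seq (blk [.addN 20 11 7, .addN 24 14 7, .addN 11 11 8]) (.seq pushP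
  (.seq (blk [.subN 12 12 8]) (.seq (.seq (consP 14 20 10 24) pushP)
    (.seq (.seq (consP 14 20 9 24) pushP) (.seq (consP 14 20 8 24) pushP)))))) fin) fin

def engineP (gb : Bool) (sink fin : Program) : Program :=
  .while (.ltN 7 4) (.seq popP (.ite (.ltN 15 8) (bodyN gb sink)
    (.ite (.ltN 15 9) bodyG (bodyE fin))))

namespace Eng

theorem extendP_runs (hs : Static n d m g σ)
    {todo done' : Letters n} (hr : InRegs σ ⟨2, t, b, todo, done', v⟩)
    (h24 : LReg σ 24 done) (hW : Work σ W) (hj : σ.N 20 = j) (a : Fin 4) :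
    Runs Q (.seq (consP 14 20 (7 + a) 24) pushP) σ 24 fun τ => Keep n [4, 14, 50, 51, 52] [] σ τ ∧
      Work τ (⟨2, t, b, todo, (j, a) :: done, v⟩ :: W) ∧
      InRegs τ ⟨2, t, b, todo, (j, a) :: done, v⟩ := by
  have h7 : σ.N (7 + a) = (a : ℕ) := by
    fin_cases a <;> [exact hs.zero; exact hs.one; exact hs.two; exact hs.three]
  refine Runs.seq (T := 8) (T' := 16) (consP_runs hs (c := (j, a)) hj h7 h24
    (ha := ⟨by omega, by omega⟩)) ?_
  rintro τ ⟨hk, hl⟩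
  have hr' : InRegs τ ⟨2, t, b, todo, (j, a) :: done, v⟩ :=
    ⟨(hk.eN 15).trans hr.st, (hk.eN 11).trans hr.t, (hk.eN 12).trans hr.b, hr.todo.keep hk, hl,
      (hk.eR 3).trans hr.v⟩
  refine (pushP_runs (hs.keep hk) hr' (hW.keep hk)).mono le_rfl ?_
  rintro υ ⟨hk', hW'⟩
  exact ⟨hk.trans hk', hW', hr'.keep hk'⟩

theorem bodyE_does (ho : e.Ok) {fin : Program}
    (hfin : ∀ r, e.Valid r → r.st = 2 → r.b = 0 ∨ r.t = n → e.Does 30 fin r) (hv : e.Valid r)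
    (h2 : r.st = 2) : e.Does 25 (bodyE fin) r := by
  intro σ W z hs hW hr hz
  have hc : 200 ≤ stepCost := by unfold stepCost; omega
  obtain ⟨-, ht, hp, hd⟩ : r.st = 2 ∧ r.t ≤ n ∧ Proper r.done ∧ ∀ k ∈ sites r.done, (k : ℕ) < r.t := by
    rcases hv with h | h | h <;> first | exact h | omega
  by_cases hlast : r.b = 0 ∨ r.t = n
  · obtain ⟨T, h⟩ := hfin r hv h2 hlast σ W z hs hW hr hz
    have h' : Runs e.Q fin σ T (e.Step 25 (T + 2) r W z) := by
      refine h.mono le_rfl fun τ ⟨h3, W', z', h4, h5, h6, h7, h8⟩ => ?_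
      exact ⟨h3, W', z', h4, h5, h6, h7, by omega⟩
    refine ⟨T + 2, Runs.ite (T := T + 1) (fun hb => Runs.ite (fun hb' => ?_) fun _ => h') fun _ =>
      h'.le⟩
    exfalso
    simp only [Test.holds, hs.zero, hs.n_eq, hr.t, hr.b] at hb hb'
    omega
  push Not at hlast
  obtain ⟨st, t, b, todo, done, v⟩ := r
  simp only at h2 ht hp hd hlast
  subst h2
  obtain ⟨b, rfl⟩ : ∃ b', b = b' + 1 := ⟨b - 1, by omega⟩
  have htn : t < n := by omega
  have hb1 : (Test.ltN 11 0).holds σ := by simpa [hs.n_eq, hr.t]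
  have hb2 : (Test.ltN 7 12).holds σ := by simp [hs.zero, hr.b]
  refine ⟨94, Runs.ite (T := 93) (fun _ => Runs.ite (T := 92) (fun _ => ?_) fun h =>
    absurd hb2 h) fun h => absurd hb1 h⟩
  refine Runs.blk_seq (T := 89) _ ?_
  set σ1 := after e.Q σ [.addN 20 11 7, .addN 24 14 7, .addN 11 11 8] with hσ1
  have k1 : Keep n [11, 20, 24] [] σ σ1 := keep_after
  have r1 : InRegs σ1 ⟨2, t + 1, b + 1, todo, done, v⟩ := ⟨(k1.eN _).trans hr.st,
    by simp [hσ1, hr.t, hs.one], (k1.eN _).trans hr.b, hr.todo.keep k1, hr.done.keep k1,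
    (k1.eR _).trans hr.v⟩
  have h20 : σ1.N 20 = t := by simp [hσ1, hr.t, hs.zero]
  have h24 : LReg σ1 24 done := hr.done.after _ (by simp [hs.zero])
  have s1 := hs.keep k1
  refine Runs.seq (T := 16) (T' := 73) (pushP_runs s1 r1 (hW.keep k1)) ?_
  rintro σ2 ⟨k2, hW2⟩
  have s2 := s1.keep k2
  have r2 := r1.keep k2
  refine Runs.blk_seq (T := 72) _ ?_
  set σ3 := after e.Q σ2 [.subN 12 12 8] with hσ3
  have k3 : Keep n [12] [] σ2 σ3 := keep_after
  have r3 : InRegs σ3 ⟨2, t + 1, b, todo, done, v⟩ := ⟨(k3.eN _).trans r2.st,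
    (k3.eN _).trans r2.t, by simp [hσ3, r2.b, s2.one], r2.todo.keep k3, r2.done.keep k3,
    (k3.eR _).trans r2.v⟩
  have k23 : Keep n [4, 12, 50, 51] [] σ1 σ3 := k2.trans k3
  have s3 := s1.keep k23
  have j3 : σ3.N 20 = (⟨t, htn⟩ : Fin n) := (k23.eN _).trans h20
  refine Runs.seq (T := 24) (T' := 48) (extendP_runs s3 r3 (h24.keep k23) (hW2.keep k3) j3 3) ?_
  rintro σ4 ⟨k4, hW4, r4⟩
  have s4 := s3.keep k4
  have k24 : Keep n [4, 12, 14, 50, 51, 52] [] σ1 σ4 := k23.trans k4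
  refine Runs.seq (T := 24) (T' := 24) (extendP_runs s4 r4 (h24.keep k24) hW4
    ((k4.eN _).trans j3) 2) ?_
  rintro σ5 ⟨k5, hW5, r5⟩
  have s5 := s4.keep k5
  have k25 : Keep n [4, 12, 14, 50, 51, 52] [] σ1 σ5 := k24.trans k5
  refine (extendP_runs s5 r5 (h24.keep k25) hW5 ((k5.eN _).trans
    ((k4.eN _).trans j3)) 1).mono le_rfl ?_
  rintro σ6 ⟨k6, hW6, -⟩
  have k26 : Keep n [4, 12, 14, 50, 51, 52] [] σ1 σ6 := k25.trans k6
  have hnew : ∀ a : Fin 4, a ≠ 0 → e.Valid ⟨2, t + 1, b, todo, (⟨t, htn⟩, a) :: done, v⟩ := by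
    intro a ha
    refine Or.inr (Or.inr ⟨rfl, htn, ?_, ?_⟩)
    · exact ⟨List.nodup_cons.mpr ⟨fun hc => absurd (hd _ hc) (lt_irrefl t), hp.1⟩,
        List.forall_mem_cons.mpr ⟨ha, hp.2⟩⟩
    exact List.forall_mem_cons.mpr ⟨Nat.lt_succ_self t, fun k hk => Nat.lt_succ_of_lt (hd k hk)⟩
  obtain ⟨m, hm⟩ : ∃ m, n - t = m + 1 := ⟨n - t - 1, by omega⟩
  have hm' : n - (t + 1) = m := by omega
  refine Step.of_keep ho hs (k1.trans k26) hz (W' := [⟨2, t + 1, b, todo, (⟨t, htn⟩, 1) :: done, v⟩,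
      ⟨2, t + 1, b, todo, (⟨t, htn⟩, 2) :: done, v⟩, ⟨2, t + 1, b, todo, (⟨t, htn⟩, 3) :: done, v⟩,
      ⟨2, t + 1, b + 1, todo, done, v⟩]) hW6 ?_ ?_ ?_
  · simp [hnew]
    exact Or.inr (Or.inr ⟨rfl, htn, hp, fun k hk => Nat.lt_succ_of_lt (hd k hk)⟩)
  · simp only [List.map_cons, List.map_nil, List.sum_cons, List.sum_nil, add_zero, val]
    simp only [OfNat.ofNat_ne_zero, OfNat.ofNat_ne_one, if_false, hm, hm', enumV, htn, dif_pos]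
    abel
  have := ho.pE_succ m b done.length
  simp [pot, hm, hm']
  omega

/-- The engine accumulates the values of all tasks. -/
theorem engine_runs (ho : e.Ok) {sink fin : Program}
    (hsink : ∀ r, e.Valid r → r.st = 0 → r.todo = [] → e.Does 30 sink r)
    (hfin : ∀ r, e.Valid r → r.st = 2 → r.b = 0 ∨ r.t = n → e.Does 30 fin r)
    (hs : Static n e.I.d e.m e.I.g σ) (hW : Work σ W) (hz : e.Acc σ z) (hv : ∀ r ∈ W, e.Valid r) :
    Runs e.Q (engineP e.I.gb sink fin) σ ((W.map e.pot).sum + 1) fun τ =>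
      Static n e.I.d e.m e.I.g τ ∧ Work τ ([] : List (Task n)) ∧
        e.Acc τ (z + (W.map e.val).sum) := by
  let J : State → ℕ → Prop := fun τ k => Static n e.I.d e.m e.I.g τ ∧ ∃ W' z', Work τ W' ∧
    e.Acc τ z' ∧ (∀ r ∈ W', e.Valid r) ∧ z' + (W'.map e.val).sum = z + (W.map e.val).sum ∧
    k = (W'.map e.pot).sum + 1
  refine (Runs.while J (σ := σ) (k := (W.map e.pot).sum + 1) ⟨hs, W, z, hW, hz, hv, rfl, rfl⟩ ?_
    (fun τ k ⟨_, _, _, _, _, _, _, hk⟩ => by omega)).mono le_rfl ?_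
  · rintro τ k ⟨s1, W', z', hW', hz', hv', hsum, rfl⟩ hb
    have hne : W' ≠ [] := by
      intro h
      simp [s1.zero, (SAt.eq_zero_iff (by omega) hW').mpr h] at hb
    obtain ⟨r, W'', rfl⟩ := List.exists_cons_of_ne_nil hne
    obtain ⟨τ1, k1, h1, h2, hk1, hW1, r1⟩ := popP_runs (Q := e.Q) s1 hW'
    have s2 := s1.keep hk1
    have hz1 := ho.stable τ τ1 z' (hk1.mono) hz'
    have hvr := hv' r List.mem_cons_self
    have conv : ∀ {p : Program}, e.Does 25 p r → ∃ T, Runs e.Q p τ1 T (e.Step 25 T r W'' z') :=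
      fun h => h τ1 W'' z' s2 hW1 r1 hz1
    have main : ∃ T, Runs e.Q (.ite (.ltN 15 8) (bodyN e.I.gb sink)
        (.ite (.ltN 15 9) bodyG (bodyE fin))) τ1 (T + 2) (e.Step 25 T r W'' z') := by
      have h15 := r1.st
      rcases id hvr with h | h | h
      · obtain ⟨T, hT⟩ := conv (bodyN_does ho hsink hvr h.1)
        refine ⟨T, (Runs.ite (fun _ => hT) fun hb => ?_).le⟩
        simp [h15, h.1, s2.one] at hb
      · obtain ⟨T, hT⟩ := conv (bodyG_does ho hvr h.1)
        refine ⟨T, Runs.ite (T := T + 1) (fun hb => ?_) fun _ => Runs.ite (fun _ => hT) fun hb => ?_⟩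
        · simp [h15, h.1, s2.one] at hb
        simp [h15, h.1, s2.two] at hb
      obtain ⟨T, hT⟩ := conv (bodyE_does ho hfin hvr h.1)
      refine ⟨T, Runs.ite (T := T + 1) (fun hb => ?_) fun _ => Runs.ite (fun hb => ?_) fun _ => hT⟩
      · simp [h15, h.1, s2.one] at hb
      simp [h15, h.1, s2.two] at hb
    obtain ⟨T, hT⟩ := main
    refine ⟨13 + (T + 2), Runs.seq (Φ := fun υ => υ = τ1) ⟨τ1, k1, h1, h2, rfl⟩ ?_⟩
    rintro υ rfl
    refine hT.mono le_rfl fun ω ⟨s3, V, z'', hV, hzV, hvV, hsV, hpV⟩ => ?_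
    refine ⟨_, ⟨s3, V ++ W'', z'', hV, hzV,
      List.forall_mem_append.mpr ⟨hvV, (List.forall_mem_cons.mp hv').2⟩, ?_, rfl⟩, ?_⟩
    · rw [List.map_append, List.sum_append, ← add_assoc, hsV, ← hsum, List.map_cons, List.sum_cons,
        add_assoc]
    rw [List.map_append, List.sum_append, List.map_cons, List.sum_cons]
    omega
  rintro τ ⟨hb, k, s1, W', z', hW', hz', -, hsum, -⟩
  have : W' = [] := by
    exact (SAt.eq_zero_iff (by omega) hW').mp (by simpa [s1.zero] using hb)
  simp_all

end Eng

/-! ## Enumeration of strings -/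

section Enum

/-- A bound for the number of enumerated strings, weighted by `B` for each letter. -/
def tail (B : ℕ) : ℕ → ℕ → ℕ
  | 0, _ => 1
  | _ + 1, 0 => 1
  | r + 1, b + 1 => tail B r (b + 1) + B * tail B r b

theorem one_le_tail (B : ℕ) : ∀ r b, 1 ≤ tail B r b
  | 0, _ => le_rfl
  | _ + 1, 0 => le_rfl
  | r + 1, b + 1 => (one_le_tail B r (b + 1)).trans (Nat.le_add_right _ _)

theorem tail_le_aux (B : ℕ) (hn : 1 ≤ n) : ∀ r b, (tail B r b : ℝ) ≤ n ^ b * (1 + B / n) ^ r := by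
  have h1 : (1 : ℝ) ≤ n := by exact_mod_cast hn
  have h2 : (1 : ℝ) ≤ 1 + B / n := le_add_of_nonneg_right (by positivity)
  have base : ∀ r b : ℕ, (1 : ℝ) ≤ n ^ b * (1 + B / n) ^ r := fun r b =>
    one_le_mul_of_one_le_of_one_le (one_le_pow₀ h1) (one_le_pow₀ h2)
  intro r
  induction r with
  | zero => intro b; simpa [tail] using base 0 b
  | succ r ih =>
    intro b
    rcases b with _ | b
    · simpa [tail] using base (r + 1) 0
    have e : (n : ℝ) ^ (b + 1) * (1 + B / n) ^ (r + 1) =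
        n ^ (b + 1) * (1 + B / n) ^ r + B * (n ^ b * (1 + B / n) ^ r) := by
      have h3 : (n : ℝ) * (1 + B / n) = n + B := by field_simp
      linear_combination (n : ℝ) ^ b * (1 + B / n) ^ r * h3
    rw [e]
    push_cast [tail]
    have h := mul_le_mul_of_nonneg_left (ih b) (Nat.cast_nonneg (α := ℝ) B)
    linarith [ih (b + 1)]

theorem tail_le (B : ℕ) (hn : 1 ≤ n) (b : ℕ) : (tail B n b : ℝ) ≤ exp B * n ^ b := by
  have h1 : (0 : ℝ) < n := by exact_mod_cast hn
  refine (tail_le_aux B hn n b).trans ?_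
  rw [mul_comm]
  refine mul_le_mul_of_nonneg_right ?_ (by positivity)
  calc (1 + (B : ℝ) / n) ^ n ≤ exp (B / n) ^ n :=
        pow_le_pow_left₀ (by positivity) (by linarith [add_one_le_exp ((B : ℝ) / n)]) _
    _ = exp B := by
        rw [← exp_nat_mul]
        congr 1
        field_simp

theorem enumV_eq {E : Type*} [AddCommGroup E] {fin : Letters n → E} {f : Str n → E}
    (hf : ∀ l, Proper l → fin l = f (str l)) : ∀ (r t b : ℕ) (l : Letters n), t + r = n →
      Proper l → (∀ k ∈ sites l, (k : ℕ) < t) →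
      enumV fin r t b l = ∑ P : Str n, if (∀ k : Fin n, (k : ℕ) < t → P k = str l k) ∧
        (univ.filter fun k : Fin n => t ≤ k ∧ P k ≠ 0).card ≤ b then f P else 0 := by
  have last : ∀ (t b : ℕ) (l : Letters n), Proper l → (∀ k ∈ sites l, (k : ℕ) < t) → b = 0 ∨ n ≤ t →
      fin l = ∑ P : Str n, if (∀ k : Fin n, (k : ℕ) < t → P k = str l k) ∧
        (univ.filter fun k : Fin n => t ≤ k ∧ P k ≠ 0).card ≤ b then f P else 0 := by
    intro t b l hp hl hb
    rw [sum_eq_single (str l), if_pos, hf l hp]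
    · refine ⟨fun _ _ => rfl, ?_⟩
      rw [card_eq_zero.mpr, Nat.le_iff_lt_or_eq]
      · omega
      refine filter_eq_empty_iff.mpr fun k _ h => h.2 (str_of_notMem fun hk => ?_)
      have := hl k hk
      omega
    · intro P _ hP
      rw [if_neg]
      rintro ⟨h1, h2⟩
      refine hP (funext fun k => ?_)
      by_cases hk : (k : ℕ) < t
      · exact h1 k hk
      rcases hb with rfl | hb
      · rw [str_of_notMem fun h => hk (hl k h)]
        by_contra hne
        have := filter_eq_empty_iff.mp (card_eq_zero.mp (Nat.le_zero.mp h2)) (mem_univ k)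
        exact this ⟨by omega, hne⟩
      omega
    simp_all
  intro r
  induction r with
  | zero =>
    intro t b l htr hp hl
    exact last t b l hp hl (Or.inr (by omega))
  | succ r ih =>
    intro t b l htr hp hl
    rcases b with _ | b
    · exact last t 0 l hp hl (Or.inl rfl)
    have ht : t < n := by omega
    have hj : (⟨t, ht⟩ : Fin n) ∉ sites l := fun h => lt_irrefl t (hl _ h)
    have hnew : ∀ a : Fin 4, a ≠ 0 → Proper ((⟨t, ht⟩, a) :: l) ∧
        ∀ k ∈ sites ((⟨t, ht⟩, a) :: l), (k : ℕ) < t + 1 := by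
      intro a ha
      have := hp.addLetter a hj
      rw [addLetter, if_neg ha] at this
      refine ⟨this, fun k hk => ?_⟩
      simp only [sites, List.map_cons, List.mem_cons] at hk
      rcases hk with rfl | hk
      · simp
      exact (hl k hk).trans (Nat.lt_succ_self t)
    have hl' : ∀ k ∈ sites l, (k : ℕ) < t + 1 := fun k hk => (hl k hk).trans (Nat.lt_succ_self t)
    rw [enumV, dif_pos ht, ih _ _ _ (by omega) hp hl',
      ih _ _ _ (by omega) (hnew 1 (by decide)).1 (hnew 1 (by decide)).2,
      ih _ _ _ (by omega) (hnew 2 (by decide)).1 (hnew 2 (by decide)).2,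
      ih _ _ _ (by omega) (hnew 3 (by decide)).1 (hnew 3 (by decide)).2,
      ← sum_add_distrib, ← sum_add_distrib, ← sum_add_distrib]
    refine sum_congr rfl fun P _ => ?_
    have hpre : ∀ (l' : Letters n) (a : Fin 4), str l' = update (str l) ⟨t, ht⟩ a →
        ((∀ k : Fin n, (k : ℕ) < t + 1 → P k = str l' k) ↔
          (∀ k : Fin n, (k : ℕ) < t → P k = str l k) ∧ P ⟨t, ht⟩ = a) := by
      intro l' a h'
      rw [h']
      constructor
      · intro h
        refine ⟨fun k hk => ?_, ?_⟩
        · have := h k (by omega)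
          rwa [update_of_ne (fun hc => by rw [hc] at hk; simp at hk)] at this
        have := h ⟨t, ht⟩ (Nat.lt_succ_self t)
        rwa [update_self] at this
      rintro ⟨h1, h2⟩ k hk
      by_cases hkt : k = ⟨t, ht⟩
      · rw [hkt, update_self, h2]
      rw [update_of_ne hkt]
      refine h1 k ?_
      have : (k : ℕ) ≠ t := fun h => hkt (Fin.ext h)
      omega
    have h0 : str l = update (str l) ⟨t, ht⟩ 0 := by
      conv_rhs => rw [← str_of_notMem hj]
      simp
    have hcard : (univ.filter fun k : Fin n => t ≤ k ∧ P k ≠ 0).card =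
        (univ.filter fun k : Fin n => t + 1 ≤ k ∧ P k ≠ 0).card +
          if P ⟨t, ht⟩ = 0 then 0 else 1 := by
      by_cases hP : P ⟨t, ht⟩ = 0
      · rw [if_pos hP, add_zero]
        congr 1
        refine filter_congr fun k _ => ⟨fun h => ⟨?_, h.2⟩, fun h => ⟨by omega, h.2⟩⟩
        have : (k : ℕ) ≠ t := fun hk => h.2 (by rw [← hP]; congr 1; exact Fin.ext hk)
        omega
      rw [if_neg hP, ← card_insert_of_notMem (a := (⟨t, ht⟩ : Fin n)) (by simp)]
      congr 1
      ext k
      simp only [mem_filter, mem_univ, true_and, mem_insert]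
      constructor
      · rintro ⟨h1, h2⟩
        by_cases hk : k = ⟨t, ht⟩
        · exact Or.inl hk
        have : (k : ℕ) ≠ t := fun h => hk (Fin.ext h)
        exact Or.inr ⟨by omega, h2⟩
      rintro (rfl | ⟨h1, h2⟩)
      · exact ⟨le_rfl, hP⟩
      exact ⟨by omega, h2⟩
    rw [hcard]
    simp only [hpre l 0 h0, hpre _ _ (rfl : str ((⟨t, ht⟩, (1 : Fin 4)) :: l) = _),
      hpre _ _ (rfl : str ((⟨t, ht⟩, (2 : Fin 4)) :: l) = _),
      hpre _ _ (rfl : str ((⟨t, ht⟩, (3 : Fin 4)) :: l) = _)]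
    generalize P ⟨t, ht⟩ = a
    fin_cases a <;> simp

theorem enumV_start {E : Type*} [AddCommGroup E] {fin : Letters n → E} {f : Str n → E}
    (hf : ∀ l, Proper l → fin l = f (str l)) (b : ℕ) :
    enumV fin n 0 b [] = ∑ P : Str n, if wt P ≤ b then f P else 0 := by
  rw [enumV_eq hf n 0 b [] (zero_add n) Proper.nil (fun k hk => by cases hk)]
  simp [wt]

end Enum

/-! ## Depth-first evaluation -/

namespace Inst

variable (I : Inst n)

/-- The transition kernel of gate layer `t`. -/
def kg (t : ℕ) (R P : Str n) : ℝ := layerK (I.part t) (I.gate t) univ R P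

/-- The transition kernel of noise layer `t`. -/
def nk (t : ℕ) (Q R : Str n) : ℝ := siteK I.g (I.noisy t) (I.dir t) Q R

end Inst

def collectP : Program := .seq (coefP 3 4) (blk [.mulR 4 4 3, .addR 2 2 4])

/-- Continues with the next layer of gates, for at most `N[6]` layers. -/
def dfsSink : Program := .ite (.ltN 7 14) (.ite (.ltN 11 1) (.ite (.ltN 11 6)
  (.seq (blk [.addN 13 14 7, .addN 14 7 7, .addN 15 8 7]) pushP) .skip) collectP) collectP

def dfsFin : Program := .seq (coefP 2 3)
  (.seq (blk [.addN 13 14 7, .addN 14 7 7, .addN 15 7 7, .addN 11 7 7, .addN 12 5 7]) pushP)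

/-- The engine for the functionals `budgeted`. -/
def dfs (Q : Oracle) (I : Inst n) (m K L : ℕ) (o r : Vec n) : Eng n ℝ where
  Q := Q
  I := I
  m := m
  F t b P := budgeted I.kg I.nk r t (I.d - t) (K - t) (b + 1) P
  fin l := I.valN (fun t b P => budgeted I.kg I.nk r t (I.d - t) (K - t) (b + 1) P) 0 L l []
    (o (str l))
  Acc σ z := σ.R 2 = z ∧ σ.N 5 = L ∧ σ.N 6 = K
  pN b _ v := stepCost * (60 ^ v * 62 ^ b)
  pG b w _ := stepCost * (2 * 62 ^ b * 17 ^ w)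
  pE r b w := stepCost * (2 * 62 ^ L * 2 ^ w * tail 7 r b)

section Dfs

variable {K L : ℕ} {I : Inst n} {o r : Vec n}

theorem stepCost_ge : 200 ≤ stepCost := by unfold stepCost; omega

theorem dfs_ok (hQ : Reads Q I) : (dfs Q I m K L o r).Ok where
  reads := hQ
  stable := by
    rintro σ τ z hk ⟨h1, h2, h3⟩
    exact ⟨(hk.eR 2).trans h1, (hk.eN 5).trans h2, (hk.eN 6).trans h3⟩
  pN_zero u v := Nat.le_mul_of_pos_right _ (by positivity)
  pN_succ b u v := by
    change stepCost + stepCost * _ + stepCost * _ ≤ stepCost * _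
    have h : 1 ≤ 60 ^ v * 62 ^ b := Nat.one_le_iff_ne_zero.mpr (by positivity)
    calc _ = stepCost * (1 + 61 * (60 ^ v * 62 ^ b)) := by ring
      _ ≤ stepCost * (62 * (60 ^ v * 62 ^ b)) := Nat.mul_le_mul_left _ (by omega)
      _ = _ := by ring
  pG_zero b v := by
    change stepCost + stepCost * _ ≤ stepCost * _
    have h : 1 ≤ 62 ^ b := Nat.one_le_iff_ne_zero.mpr (by positivity)
    calc _ = stepCost * (1 + 62 ^ b) := by ring
      _ ≤ stepCost * (2 * 62 ^ b * 17 ^ 0) := Nat.mul_le_mul_left _ (by omega)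
  pG_succ b u v := by
    change stepCost * _ + 16 * (stepCost * _) ≤ stepCost * _
    have h : 1 ≤ 62 ^ b := Nat.one_le_iff_ne_zero.mpr (by positivity)
    have h' : u + 1 ≤ 17 ^ u := Nat.lt_pow_self (by norm_num)
    calc _ = stepCost * ((u + 1) * 1 + 32 * 62 ^ b * 17 ^ u) := by ring
      _ ≤ stepCost * (17 ^ u * 62 ^ b + 32 * 62 ^ b * 17 ^ u) :=
        Nat.mul_le_mul_left _ (Nat.add_le_add_right (Nat.mul_le_mul h' h) _)
      _ ≤ stepCost * (17 ^ u * 62 ^ b + 33 * 62 ^ b * 17 ^ u) := by gcongr; norm_num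
      _ = _ := by ring
  pG_mono b u u' v v' hu _ := Nat.mul_le_mul_left _ (Nat.mul_le_mul_left _
    (Nat.pow_le_pow_right (by norm_num) hu))
  pE_succ r b w := by
    change stepCost + stepCost * _ + 3 * (stepCost * _) ≤ stepCost * _
    have h : 1 ≤ 62 ^ L * 2 ^ w * tail 7 r b :=
      Nat.one_le_iff_ne_zero.mpr (by have := one_le_tail 7 r b; positivity)
    calc _ = stepCost * (1 + 2 * 62 ^ L * 2 ^ w * tail 7 r (b + 1) +
          12 * (62 ^ L * 2 ^ w * tail 7 r b)) := by ring
      _ ≤ stepCost * (2 * 62 ^ L * 2 ^ w * tail 7 r (b + 1) +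
          14 * (62 ^ L * 2 ^ w * tail 7 r b)) := Nat.mul_le_mul_left _ (by omega)
      _ = _ := by rw [tail]; ring

theorem collectP_runs (hQ : ReadsCoef Q n 3 r)
    (hs : Static n d m g σ) (hp : Proper l) (hl : LReg σ 14 l) :
    Runs Q collectP σ (14 * l.length + 7) fun τ => Keep n [30, 31, 32, 33] [2, 4] σ τ ∧
      τ.R 2 = σ.R 2 + σ.R 3 * r (str l) := by
  refine (Runs.seq (coefP_runs hs (x := 4) hQ hp hl) (T' := 2) ?_).le
  rintro τ ⟨k1, h1⟩
  refine Runs.blk _ ?_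
  set σ1 := after Q τ [.mulR 4 4 3, .addR 2 2 4] with hσ1
  have k2 : Keep n [] [2, 4] τ σ1 := keep_after
  refine ⟨k1.trans k2, ?_⟩
  have e2 := k1.eR 2
  have e3 := k1.eR 3
  simp [hσ1, h1, e2, e3]
  ring

theorem dfs_sink (hQ : ReadsCoef Q n 3 r) (hr : Reads Q I)
    (hb : ∀ t k c b, b ≠ 0 → budgeted I.kg I.nk r t k c b 0 = r 0) (x : Task n)
    (hv : (dfs Q I m K L o r).Valid x) (h0 : x.st = 0) (hx : x.todo = []) :
    (dfs Q I m K L o r).Does 30 dfsSink x := by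
  intro σ W z hs hW hx' hz
  obtain ⟨st, t, b, todo, done, v⟩ := x
  simp only at h0 hx
  subst h0 hx
  obtain ⟨ht, hp⟩ : t ≤ I.d ∧ Proper done := by
    rcases hv with h | h | h <;> simp at h
    exact h
  set e := dfs Q I m K L o r with he
  have hpot : e.pot ⟨0, t, b, [], done, v⟩ = stepCost * (60 ^ done.length * 62 ^ b) := rfl
  have hval : e.val ⟨0, t, b, [], done, v⟩ =
      v • budgeted I.kg I.nk r t (I.d - t) (K - t) (b + 1) (str done) := by
    simp only [Eng.val, if_true]
    exact I.valN_nil _ _ _ _ _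
  have hpos : 1 ≤ 62 ^ b := Nat.one_le_iff_ne_zero.mpr (by positivity)
  have h50 : done.length + 1 ≤ 60 ^ done.length := Nat.lt_pow_self (by norm_num)
  have hbig : 200 * (done.length + 1) ≤ stepCost * (60 ^ done.length * 62 ^ b) :=
    Nat.mul_le_mul stepCost_ge (h50.trans (Nat.le_mul_of_pos_right _ hpos))
  have h14 : (0 < σ.N 14) ↔ done ≠ [] := by
    rw [Nat.pos_iff_ne_zero]
    exact not_congr (LAt.eq_zero_iff (by omega) hx'.done)
  have hF : budgeted I.kg I.nk r t (I.d - t) (K - t) (b + 1) (str done) = r (str done) →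
      Runs Q collectP σ (14 * done.length + 7)
        (e.Step 30 (14 * done.length + 10) ⟨0, t, b, [], done, v⟩ W z) := by
    intro hb'
    refine (collectP_runs hQ hs hp hx'.done).mono le_rfl ?_
    rintro τ ⟨k1, h2⟩
    refine ⟨hs.keep k1, [], z + v * r (str done), hW.keep k1, ⟨?_, ?_, ?_⟩, by simp, ?_, ?_⟩
    · rw [h2, hz.1, hx'.v]
    · exact (k1.eN 5).trans hz.2.1
    · exact (k1.eN 6).trans hz.2.2
    · simp_all
    rw [hpot]
    simp
    omega
  by_cases hd : done = []
  · refine ⟨_, Runs.ite (fun h => absurd hd (h14.mp ?_)) fun _ => (hF ?_).le (T' := 14 * done.length + 9)⟩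
    · simpa only [Test.holds, hs.zero] using h
    subst hd
    exact hb _ _ _ _ (Nat.succ_ne_zero b)
  have hne : str done ≠ 0 := by
    intro h
    have h1 := wt_str hp
    rw [h] at h1
    have : done.length ≠ 0 := fun h => hd (List.length_eq_zero_iff.mp h)
    simp [wt] at h1
    omega
  have hl0 : 1 ≤ done.length := List.length_pos_iff.mpr hd
  by_cases htd : t = I.d
  · refine ⟨_, Runs.ite (fun _ => Runs.ite (fun h => ?_) fun _ => (hF ?_).le (T' := 14 * done.length + 8)) fun h => ?_⟩
    · simp only [Test.holds, hs.d_eq, hx'.t] at h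
      exact absurd h (by simp [he, dfs, htd])
    · rw [htd, Nat.sub_self]
      simp [budgeted]
    exact absurd (h14.mpr hd) (by simpa only [Test.holds, hs.zero] using h)
  have hlt : t < I.d := lt_of_le_of_ne ht htd
  obtain ⟨k, hk⟩ : ∃ k, I.d - t = k + 1 := ⟨I.d - t - 1, by omega⟩
  by_cases htK : t < K
  · obtain ⟨c, hc⟩ : ∃ c, K - t = c + 1 := ⟨K - t - 1, by omega⟩
    refine ⟨22, Runs.ite (T := 21) (fun _ => Runs.ite (T := 20) (fun _ => Runs.ite (T := 19)
      (fun _ => ?_) fun h => ?_) fun h => ?_) fun h => ?_⟩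
    · refine Runs.blk_seq (T := 16) _ ?_
      set σ1 := after e.Q σ [.addN 13 14 7, .addN 14 7 7, .addN 15 8 7] with hσ1
      have k1 : Keep n [13, 14, 15] [] σ σ1 := keep_after
      have r1 : InRegs σ1 ⟨1, t, b, done, [], v⟩ := ⟨by simp [hσ1, hs.one, hs.zero],
        (k1.eN _).trans hx'.t, (k1.eN _).trans hx'.b, hx'.done.after _ (by simp [hs.zero]),
        by simp [LReg, LAt, hσ1, hs.zero], (k1.eR _).trans hx'.v⟩
      refine (pushP_runs (hs.keep k1) r1 (hW.keep k1)).mono le_rfl ?_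
      rintro τ ⟨k2, hW2⟩
      refine Eng.Step.push (dfs_ok hr) hs (k1.trans k2) hz hW2
        (.inr (.inl ⟨rfl, hlt, by simpa using hp, by simp [sites]⟩)) ?_ ?_
      · rw [← he, hval, hk, hc]
        simp only [Eng.val, one_ne_zero, if_false, if_true, Inst.valG_start, smul_eq_mul, budgeted]
        congr 1
        refine sum_congr rfl fun R _ => ?_
        change _ * I.valH e.F t b R = _
        congr 1
        unfold Inst.valH
        have e1 : I.d - (t + 1) = k := by omega
        have e2 : K - (t + 1) = c := by omega
        split_ifs with hw
        · refine sum_congr rfl fun P _ => ?_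
          simp only [he, dfs, smul_eq_mul, e1, e2, Inst.nk]
          rw [show b - wt R + 1 = b + 1 - wt R by omega]
        symm
        refine sum_eq_zero fun P _ => ?_
        rw [show b + 1 - wt R = 0 by omega, budgeted_of_budget_zero, mul_zero]
      rw [← he, hpot]
      change 22 + 30 + stepCost * (2 * 62 ^ b * 17 ^ done.length) ≤ _
      have h17 : 1 ≤ 62 ^ b * 17 ^ done.length := Nat.one_le_iff_ne_zero.mpr (by positivity)
      have h3 : 3 * 17 ^ done.length ≤ 60 ^ done.length := by
        refine le_trans ?_ (Nat.pow_le_pow_left (show 3 * 17 ≤ 60 by norm_num) _)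
        rw [Nat.mul_pow]
        exact Nat.mul_le_mul_right _ (Nat.le_self_pow (by omega) 3)
      have hsc := stepCost_ge
      generalize stepCost = c at hsc ⊢
      calc _ ≤ c * (62 ^ b * 17 ^ done.length) + c * (2 * 62 ^ b * 17 ^ done.length) :=
            Nat.add_le_add_right (by nlinarith) _
        _ = c * (3 * 17 ^ done.length * 62 ^ b) := by ring
        _ ≤ _ := Nat.mul_le_mul_left _ (Nat.mul_le_mul_right _ h3)
    · exact absurd htK (by simpa [hx'.t, hz.2.2] using h)
    · exact absurd hlt (by simpa [hx'.t, hs.d_eq, he, dfs] using h)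
    exact absurd (h14.mpr hd) (by simpa only [Test.holds, hs.zero] using h)
  refine ⟨4, Runs.ite (T := 3) (fun _ => Runs.ite (T := 2) (fun _ => Runs.ite (T := 1)
    (fun h => ?_) fun _ => ?_) fun h => ?_) fun h => ?_⟩
  · exact absurd (by simpa [hx'.t, hz.2.2] using h) htK
  · refine (Runs.skip ?_).le
    refine ⟨hs, [], z, hW, hz, by simp, ?_, ?_⟩
    · rw [hval, hk, show K - t = 0 by omega]
      simp [budgeted, hne]
    rw [hpot]
    simp
    omega
  · exact absurd hlt (by simpa [hx'.t, hs.d_eq, he, dfs] using h)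
  exact absurd (h14.mpr hd) (by simpa only [Test.holds, hs.zero] using h)

theorem dfsFin_runs (hQ : ReadsCoef Q n 2 o) (hs : Static n d m g σ) (hW : Work σ W)
    (hp : Proper done)
    (hl : LReg σ 14 done) (h5 : σ.N 5 = L) :
    Runs Q dfsFin σ (14 * done.length + 26) fun τ => Keep n engX engY σ τ ∧
      Work τ (⟨0, 0, L, done, [], o (str done)⟩ :: W) := by
  refine (Runs.seq (coefP_runs hs (x := 3) hQ hp hl) (T' := 21) ?_).le
  rintro σ1 ⟨k1, hR⟩
  refine Runs.blk_seq (T := 16) _ ?_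
  set σ2 := after Q σ1 [.addN 13 14 7, .addN 14 7 7, .addN 15 7 7, .addN 11 7 7, .addN 12 5 7]
    with hσ2
  have s1 := hs.keep k1
  have hd := hl.keep k1
  have k2 : Keep n [11, 12, 13, 14, 15] [] σ1 σ2 := keep_after
  have h5 : σ1.N 5 = L := (k1.eN 5).trans h5
  have r1 : InRegs σ2 ⟨0, 0, L, done, [], o (str done)⟩ := ⟨by simp [hσ2, s1.zero],
    by simp [hσ2, s1.zero], by simp [hσ2, s1.zero, h5], hd.after _ (by simp [s1.zero]),
    by simp [LReg, LAt, hσ2, s1.zero], (k2.eR _).trans hR⟩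
  refine (pushP_runs (s1.keep k2) r1 ((hW.keep k1).keep k2)).mono le_rfl ?_
  rintro τ ⟨k3, hW3⟩
  exact ⟨(k1.trans (X'' := engX) (Y'' := engY) k2).trans k3, hW3⟩

theorem dfs_fin (hQ : ReadsCoef Q n 2 o) (hr : Reads Q I) (x : Task n)
    (hv : (dfs Q I m K L o r).Valid x) (h2 : x.st = 2) (hx : x.b = 0 ∨ x.t = n) :
    (dfs Q I m K L o r).Does 30 dfsFin x := by
  intro σ W z hs hW hx' hz
  obtain ⟨st, t, b, todo, done, v⟩ := x
  simp only at h2 hx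
  subst h2
  have hp : Proper done := by
    rcases hv with h | h | h <;> simp at h
    exact h.2.1
  set e := dfs Q I m K L o r with he
  refine ⟨14 * done.length + 26, (dfsFin_runs hQ hs hW hp hx'.done hz.2.1).mono le_rfl ?_⟩
  rintro τ ⟨k, hW3⟩
  refine Eng.Step.push (dfs_ok hr) hs k hz hW3 (.inl ⟨rfl, Nat.zero_le _, by simpa using hp⟩) ?_ ?_
  · rw [← he]
    simp only [Eng.val, if_true, OfNat.ofNat_ne_zero, OfNat.ofNat_ne_one, if_false]
    have : enumV e.fin (n - t) t b done = e.fin done := by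
      rcases hx with rfl | rfl
      · cases n - t <;> rfl
      rw [Nat.sub_self]; rfl
    rw [this]
    rfl
  change _ + 30 + stepCost * (60 ^ 0 * 62 ^ L) ≤
    stepCost * (2 * 62 ^ L * 2 ^ done.length * tail 7 (n - t) b)
  have h2 : done.length + 1 ≤ 2 ^ done.length := Nat.lt_pow_self (by norm_num)
  have h52 : 1 ≤ 62 ^ L := Nat.one_le_iff_ne_zero.mpr (by positivity)
  have hsc := stepCost_ge
  generalize stepCost = c at hsc ⊢
  calc _ ≤ c * (done.length + 1) + c * 62 ^ L := by nlinarith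
    _ ≤ c * (62 ^ L * 2 ^ done.length) + c * (62 ^ L * 2 ^ done.length) := by
      refine Nat.add_le_add (Nat.mul_le_mul_left _ ?_) (Nat.mul_le_mul_left _ ?_)
      · exact h2.trans (Nat.le_mul_of_pos_left _ h52)
      exact Nat.le_mul_of_pos_right _ (by omega)
    _ = c * (2 * 62 ^ L * 2 ^ done.length * 1) := by ring
    _ ≤ _ := Nat.mul_le_mul_left _ (Nat.mul_le_mul_left _ (one_le_tail 7 (n - t) b))

end Dfs

/-! ## Layerwise evaluation by tables -/

/-- The number of a Pauli string. -/
def code (P : Str n) : ℕ := finFunctionFinEquiv P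

theorem code_lt (P : Str n) : code P < 4 ^ n := (finFunctionFinEquiv P).isLt

theorem code_injective : Injective (code (n := n)) :=
  fun _ _ h => finFunctionFinEquiv.injective (Fin.ext h)

theorem code_cons {c : Fin n × Fin 4} (h : c.1 ∉ sites l) :
    code (str (c :: l)) = code (str l) + c.2 * 4 ^ (c.1 : ℕ) := by
  simp only [code, finFunctionFinEquiv_apply]
  rw [← add_sum_erase _ _ (mem_univ c.1),
    ← add_sum_erase (a := c.1) _ (fun k => (str l k : ℕ) * 4 ^ (k : ℕ)) (mem_univ _)]
  rw [str_of_notMem h, str, update_self, sum_congr rfl fun k hk => by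
    aesop]
  simp
  ring

theorem code_zero : code (0 : Str n) = 0 := by
  simp [code]

/-- The tables in memory before pass `i`. The source is `f`, the destination `z`. -/
structure Tab (n κ d i : ℕ) (f : Vec n) (σ : State) (z : Vec n) : Prop where
  cap : σ.N 5 = κ
  dst_base : σ.N 60 = 2 * (4 ^ n * (i + 1)) + 1
  src_base : σ.N 62 = 2 * (4 ^ n * i) + 1
  pass : σ.N 63 = i
  last : σ.N 64 = d + 1
  size : σ.N 65 = 2 * 4 ^ n
  lo : n + 8 ≤ σ.N 61
  hi : σ.N 61 + 4 * n ≤ σ.N 3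
  pow : ∀ (j : Fin n) (a : Fin 4), σ.M (σ.N 61 + 4 * j + a) = 2 * (a * 4 ^ (j : ℕ))
  src : ∀ P, σ.S (2 * (4 ^ n * i + code P) + 1) = f P
  dst : ∀ P, σ.S (2 * (4 ^ n * (i + 1) + code P) + 1) = z P
  free : ∀ a, 4 ^ n * (i + 2) ≤ a → σ.S (2 * a + 1) = 0

theorem Tab.keep {κ i : ℕ} {f z : Vec n} (h : Tab n κ d i f σ z) (hk : Keep n X Y σ τ)
    (hX : ∀ x ∈ [5, 60, 61, 62, 63, 64, 65], x ∉ X := by decide) : Tab n κ d i f τ z := by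
  have hN : ∀ x ∈ [5, 60, 61, 62, 63, 64, 65], τ.N x = σ.N x := fun x hx =>
    hk.N x (hX x hx) (by rintro rfl; simp at hx)
  have hS : ∀ a, τ.S (2 * a + 1) = σ.S (2 * a + 1) := fun a => by rw [two_mul]; exact hk.odd a
  have h61 := hN 61 (by simp)
  have h1 := h.lo
  have h2 := h.hi
  exact ⟨(hN 5 (by simp)).trans h.cap, (hN 60 (by simp)).trans h.dst_base,
    (hN 62 (by simp)).trans h.src_base, (hN 63 (by simp)).trans h.pass,
    (hN 64 (by simp)).trans h.last, (hN 65 (by simp)).trans h.size, h1.trans h61.ge,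
    by rw [h61]; exact h2.trans hk.hp,
    fun j a => by rw [h61, hk.M _ (Or.inr (by omega)) (by omega), h.pow],
    fun P => (hS _).trans (h.src P), fun P => (hS _).trans (h.dst P),
    fun a ha => (hS _).trans (h.free a ha)⟩

/-- Computes into `N[40]` the address of the string `N[14]` in the table with base `N[y]`. -/
def addrP (y : ℕ) : Program := .seq (blk [.addN 40 y 7, .addN 41 14 7]) (.while (.ltN 7 41) (blk [
  .loadN 42 41, .addN 42 42 42, .addN 42 42 42, .addN 43 41 8, .loadN 44 43, .addN 42 42 44,
  .addN 42 42 61, .loadN 42 42, .addN 40 40 42, .addN 43 43 8, .loadN 41 43]))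

/-- Adds the contribution of the string `N[14]` to the table of the present pass; in the last pass
all contributions go to the entry of the identity. -/
def tabSink : Program := .ite (.ltN 11 1)
  (.seq (addrP 60) (blk [.loadR 5 40, .addR 5 5 3, .storeR 40 5]))
  (.seq (coefP 3 4) (blk [.mulR 4 4 3, .loadR 5 60, .addR 5 5 4, .storeR 60 5]))

def tabFin : Program := .ite (.ltN 7 63) (.seq (addrP 62) (.seq (blk [.loadR 3 40, .addN 13 14 7,
  .addN 14 7 7, .addN 15 8 7, .subN 11 63 8, .addN 12 5 7]) pushP)) dfsFin

def tabF (d : ℕ) (r : Vec n) (t _b : ℕ) (P : Str n) : Vec n :=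
  if t < d then Pi.single P 1 else Pi.single 0 (r P)

def tabEng (Q : Oracle) (I : Inst n) (m κ i : ℕ) (o r f : Vec n) : Eng n (Vec n) where
  Q := Q
  I := I
  m := m
  F := tabF I.d r
  fin l := if i = 0 then I.valN (tabF I.d r) 0 κ l [] (o (str l))
    else I.valG (tabF I.d r) (i - 1) κ l [] (f (str l))
  Acc := Tab n κ I.d i f
  pN b u v := stepCost * (50 ^ v * 52 ^ min u b)
  pG _ w v := stepCost * (2 * 52 ^ v * 43265 ^ w)
  pE r b w := stepCost * (4 * 43265 ^ w * tail 129796 r b)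

section Tables

variable {κ i : ℕ} {I : Inst n} {o r f : Vec n}

theorem tabEng_ok (hQ : Reads Q I) : (tabEng Q I m κ i o r f).Ok where
  reads := hQ
  stable := fun σ τ z hk h => h.keep hk
  pN_zero u v := Nat.le_mul_of_pos_right _ (by positivity)
  pN_succ b u v := by
    change stepCost + stepCost * _ + stepCost * _ ≤ stepCost * _
    have h : 1 ≤ 50 ^ v * 52 ^ min u b := Nat.one_le_iff_ne_zero.mpr (by positivity)
    rw [Nat.succ_min_succ]
    calc _ = stepCost * (1 + 51 * (50 ^ v * 52 ^ min u b)) := by ring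
      _ ≤ stepCost * (52 * (50 ^ v * 52 ^ min u b)) := Nat.mul_le_mul_left _ (by omega)
      _ = _ := by rw [pow_succ]; ring
  pG_zero b v := by
    change stepCost + stepCost * _ ≤ stepCost * _
    have h : 1 ≤ 52 ^ v := Nat.one_le_iff_ne_zero.mpr (by positivity)
    have h' : 52 ^ min v b ≤ 52 ^ v := Nat.pow_le_pow_right (by norm_num) (min_le_left _ _)
    calc _ = stepCost * (1 + 52 ^ min v b) := by ring
      _ ≤ stepCost * (2 * 52 ^ v * 43265 ^ 0) := Nat.mul_le_mul_left _ (by omega)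
  pG_succ b u v := by
    change stepCost * _ + 16 * (stepCost * _) ≤ stepCost * _
    have h : 1 ≤ 52 ^ v := Nat.one_le_iff_ne_zero.mpr (by positivity)
    have h' : u + 1 ≤ 43265 ^ u := Nat.lt_pow_self (by norm_num)
    have e : 52 ^ (v + 2) = 2704 * 52 ^ v := by rw [pow_add]; norm_num [mul_comm]
    rw [e]
    calc _ = stepCost * ((u + 1) * 1 + 86528 * 52 ^ v * 43265 ^ u) := by ring
      _ ≤ stepCost * (43265 ^ u * 52 ^ v + 86528 * 52 ^ v * 43265 ^ u) :=
        Nat.mul_le_mul_left _ (Nat.add_le_add_right (Nat.mul_le_mul h' h) _)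
      _ ≤ stepCost * (43265 ^ u * 52 ^ v + 86529 * 52 ^ v * 43265 ^ u) := by gcongr; norm_num
      _ = _ := by ring
  pG_mono b u u' v v' hu hv := Nat.mul_le_mul_left _ (Nat.mul_le_mul (Nat.mul_le_mul_left _
    (Nat.pow_le_pow_right (by norm_num) hv)) (Nat.pow_le_pow_right (by norm_num) hu))
  pE_succ r b w := by
    change stepCost + stepCost * _ + 3 * (stepCost * _) ≤ stepCost * _
    have h : 1 ≤ 43265 ^ w * tail 129796 r b :=
      Nat.one_le_iff_ne_zero.mpr (by have := one_le_tail 129796 r b; positivity)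
    calc _ = stepCost * (1 + 4 * 43265 ^ w * tail 129796 r (b + 1) +
          519180 * (43265 ^ w * tail 129796 r b)) := by ring
      _ ≤ stepCost * (4 * 43265 ^ w * tail 129796 r (b + 1) +
          519184 * (43265 ^ w * tail 129796 r b)) := Nat.mul_le_mul_left _ (by omega)
      _ = _ := by rw [tail]; ring

theorem addrP_runs (hs : Static n d m g σ) {z : Vec n}
    (hz : Tab n κ d i f σ z) (hp : Proper l) (hl : LReg σ 14 l) {y : ℕ} (hy : y = 60 ∨ y = 62) :
    Runs Q (addrP y) σ (12 * l.length + 3) fun τ => Keep n [40, 41, 42, 43, 44] [] σ τ ∧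
      τ.N 40 = σ.N y + 2 * code (str l) := by
  refine (Runs.blk_seq (T := 12 * l.length + 1) _ ?_).le
  set σ1 := after Q σ [.addN 40 y 7, .addN 41 14 7] with hσ1
  have k1 : Keep n [40, 41, 42, 43, 44] [] σ σ1 := keep_after (h := by simp [Instr.OnlyRegs])
  let J : State → ℕ → Prop := fun τ k => Keep n [40, 41, 42, 43, 44] [] σ τ ∧ ∃ l' : Letters n,
    LReg τ 41 l' ∧ Proper l' ∧ τ.N 40 + 2 * code (str l') = σ.N y + 2 * code (str l) ∧
    k = 12 * l'.length + 1
  refine (Runs.while J (k := 12 * l.length + 1) ⟨k1, l, ?_, hp, ?_, rfl⟩ ?_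
    (fun τ k ⟨_, _, _, _, _, h⟩ => by omega)).mono le_rfl ?_
  · exact hl.after _ (by rcases hy with rfl | rfl <;> simp [hs.zero])
  · rcases hy with rfl | rfl <;> simp [hσ1, hs.zero]
  · rintro τ k ⟨k2, l', hl', hp', hc, rfl⟩ hb
    have s2 := hs.keep k2
    have z2 := hz.keep k2
    cases l' with
    | nil =>
      have : τ.N 41 = 0 := hl'
      simp [s2.zero, this] at hb
    | cons c l' =>
      obtain ⟨-, -, hc1, hc2, hl''⟩ := hl'
      refine ⟨11, Runs.blk _ ?_⟩
      set τ1 := after Q τ [.loadN 42 41, .addN 42 42 42, .addN 42 42 42, .addN 43 41 8,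
        .loadN 44 43, .addN 42 42 44, .addN 42 42 61, .loadN 42 42, .addN 40 40 42, .addN 43 43 8,
        .loadN 41 43] with hτ1
      have k3 : Keep n [40, 41, 42, 43, 44] [] τ τ1 := keep_after
      have h3 : τ1.N 3 = τ.N 3 := by simp [hτ1]
      have hM : τ1.M = τ.M := by simp [hτ1]
      have h41 : τ1.N 41 = τ.M (τ.N 41 + 2) := by
        simp [hτ1, s2.one, add_assoc]
      have hpow := z2.pow c.1 c.2
      have h40 : τ1.N 40 = τ.N 40 + 2 * (c.2 * 4 ^ (c.1 : ℕ)) := by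
        rw [← hpow]
        have e : τ.N 61 + 4 * c.1 + c.2 = c.1 + c.1 + (c.1 + c.1) + c.2 + τ.N 61 := by omega
        simp [hτ1, s2.one, hc1, hc2, e]
      refine ⟨_, ⟨k2.trans k3, l', ?_, hp'.sublist (List.sublist_cons_self _ _), ?_, rfl⟩, ?_⟩
      · unfold LReg
        simp_all
      · have := code_cons (c := c) (l := l') (List.nodup_cons.mp hp'.1).1
        linarith
      aesop
  rintro τ ⟨hb, k, k2, l', hl', -, hc, -⟩
  have : l' = [] := by
    refine (LAt.eq_zero_iff (by omega) hl').mp ?_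
    simpa [(hs.keep k2).zero] using hb
  subst this
  refine ⟨k2, ?_⟩
  have h0 : code (str ([] : Letters n)) = 0 := code_zero
  omega

theorem Tab.store {z : Vec n} (hz : Tab n κ d i f σ z) (P : Str n)
    {x y : ℕ} (hx : σ.N x = σ.N 60 + 2 * code P) (hy : σ.R y = z P + v) :
    Tab n κ d i f (Instr.step Q σ (.storeR x y)) (z + Pi.single P v) := by
  have ha : σ.N x = 2 * (4 ^ n * (i + 1) + code P) + 1 := by rw [hx, hz.dst_base]; ring
  have hlt := code_lt (n := n)
  refine ⟨hz.cap, hz.dst_base, hz.src_base, hz.pass, hz.last, hz.size, hz.lo, hz.hi, hz.pow,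
    fun P' => ?_, fun P' => ?_, fun a h => ?_⟩
  · have h := hlt P'
    have : 2 * (4 ^ n * i + code P') + 1 ≠ σ.N x := by
      linarith
    simp only [Instr.step, update_of_ne this]
    exact hz.src P'
  · simp only [Instr.step]
    by_cases hP : P' = P
    · simp_all
    have : 2 * (4 ^ n * (i + 1) + code P') + 1 ≠ σ.N x := by
      rw [ha]
      have : code P' ≠ code P := fun h => hP (code_injective h)
      omega
    rw [update_of_ne this, hz.dst P']
    simp [hP]
  have h' := hlt P
  have : 2 * a + 1 ≠ σ.N x := by
    linarith
  simp only [Instr.step, update_of_ne this]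
  exact hz.free a h

theorem Static.storeR {x y : ℕ} (hs : Static n d m g σ) :
    Static n d m g (Instr.step Q σ (.storeR x y)) := by
  obtain ⟨⟩ := hs
  constructor <;> assumption

theorem Work.storeR (hW : Work σ W) {x y a : ℕ}
    (hx : σ.N x = 2 * a + 1) : Work (Instr.step Q σ (.storeR x y)) W := by
  refine SAt.mono (fun _ _ _ => rfl) (fun c _ => ?_) le_rfl hW
  exact update_of_ne (by omega) _ _

theorem tab_sink (hQ : ReadsCoef Q n 3 r) (x : Task n)
    (hv : (tabEng Q I m κ i o r f).Valid x) (h0 : x.st = 0) (hx : x.todo = []) :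
    (tabEng Q I m κ i o r f).Does 30 tabSink x := by
  intro σ W z hs hW hx' hz
  obtain ⟨st, t, b, todo, done, v⟩ := x
  simp only at h0 hx
  subst h0 hx
  have hp : Proper done := by
    rcases hv with h | h | h <;> simp at h
    exact h.2
  have hz : Tab n κ I.d i f σ z := hz
  have hval : (tabEng Q I m κ i o r f).val ⟨0, t, b, [], done, v⟩ =
      v • tabF I.d r t b (str done) := by
    simp only [Eng.val, if_true]
    exact I.valN_nil _ _ _ _ _
  have hpot : 14 * done.length + 10 + 30 ≤ (tabEng Q I m κ i o r f).pot ⟨0, t, b, [], done, v⟩ := by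
    change _ ≤ stepCost * (50 ^ done.length * 52 ^ min 0 b)
    have h50 : done.length + 1 ≤ 50 ^ done.length := Nat.lt_pow_self (by norm_num)
    rw [Nat.zero_min, pow_zero, mul_one]
    refine le_trans ?_ (Nat.mul_le_mul stepCost_ge h50)
    omega
  refine ⟨14 * done.length + 10, Runs.ite (T := 14 * done.length + 9) (fun ht => ?_) fun ht => ?_⟩
  · have ht : t < I.d := by simpa [hs.d_eq, hx'.t, tabEng] using ht
    refine (Runs.seq (addrP_runs hs hz hp hx'.done (Or.inl rfl)) (T' := 3) ?_).le
    rintro σ1 ⟨k1, h40⟩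
    refine Runs.blk _ ?_
    set σ2 := after Q σ1 [.loadR 5 40, .addR 5 5 3] with hσ2
    have k2 : Keep n [] [5] σ1 σ2 := keep_after
    have k := k1.trans k2 (X'' := [40, 41, 42, 43, 44]) (Y'' := [5])
    have z1 := hz.keep k1
    have z2 := hz.keep k
    have e60 : σ1.N 60 = σ.N 60 := k1.eN 60
    have e60' : σ2.N 60 = σ.N 60 := k.eN 60
    have e40 : σ2.N 40 = σ.N 60 + 2 * code (str done) := (k2.eN 40).trans h40
    have e3 : σ1.R 3 = v := (k1.eR 3).trans hx'.v
    have hR : σ2.R 5 = z (str done) + v := by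
      have := z1.dst (str done)
      rw [show 2 * (4 ^ n * (i + 1) + code (str done)) + 1 = σ1.N 40 by
        rw [h40, hz.dst_base]; ring] at this
      simp [hσ2, this, e3]
    change (tabEng Q I m κ i o r f).Step _ _ _ _ _ (Instr.step Q σ2 (.storeR 40 5))
    refine ⟨(hs.keep k).storeR, [], z + Pi.single (str done) v, (hW.keep k).storeR
      (a := 4 ^ n * (i + 1) + code (str done)) (by rw [e40, hz.dst_base]; ring),
      z2.store (str done) (by rw [e40, e60']) hR, by simp, ?_, by simpa using hpot⟩
    rw [hval, tabF, if_pos ht, ← Pi.single_smul]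
    simp
  have ht : ¬ t < I.d := by simpa [hs.d_eq, hx'.t, tabEng] using ht
  refine (Runs.seq (coefP_runs hs (x := 4) hQ hp hx'.done) (T' := 4) ?_).le
  rintro σ1 ⟨k1, h4⟩
  refine Runs.blk _ ?_
  set σ2 := after Q σ1 [.mulR 4 4 3, .loadR 5 60, .addR 5 5 4] with hσ2
  have k2 : Keep n [] [4, 5] σ1 σ2 := keep_after
  have k := k1.trans k2 (X'' := [30, 31, 32, 33]) (Y'' := [4, 5])
  have z1 := hz.keep k1
  have z2 := hz.keep k
  have e3 : σ1.R 3 = v := (k1.eR 3).trans hx'.v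
  have hR : σ2.R 5 = z 0 + v * r (str done) := by
    have := z1.dst 0
    rw [code_zero, add_zero, ← z1.dst_base] at this
    simp [hσ2, this, e3, h4]
    ring
  change (tabEng Q I m κ i o r f).Step _ _ _ _ _ (Instr.step Q σ2 (.storeR 60 5))
  refine ⟨(hs.keep k).storeR, [], z + Pi.single 0 (v * r (str done)), (hW.keep k).storeR
    (a := 4 ^ n * (i + 1)) z2.dst_base,
    z2.store 0 (by rw [code_zero, mul_zero, add_zero]) hR, by simp, ?_, by simpa using hpot⟩
  rw [hval, tabF, if_neg ht, ← Pi.single_smul]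
  simp

theorem tab_fin (hQ : ReadsCoef Q n 2 o) (hr : Reads Q I) (hi : i ≤ I.d) (x : Task n)
    (hv : (tabEng Q I m κ i o r f).Valid x) (h2 : x.st = 2) (hx : x.b = 0 ∨ x.t = n) :
    (tabEng Q I m κ i o r f).Does 30 tabFin x := by
  intro σ W z hs hW hx' hz
  obtain ⟨st, t, b, todo, done, v⟩ := x
  simp only at h2 hx
  subst h2
  have hp : Proper done := by
    rcases hv with h | h | h <;> simp at h
    exact h.2.1
  have hz' : Tab n κ I.d i f σ z := hz
  set e := tabEng Q I m κ i o r f with he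
  have hval : e.val ⟨2, t, b, todo, done, v⟩ = e.fin done := by
    simp only [Eng.val, OfNat.ofNat_ne_zero, OfNat.ofNat_ne_one, if_false]
    rcases hx with rfl | rfl
    · cases n - t <;> rfl
    rw [Nat.sub_self]; rfl
  have hpot : 14 * done.length + 27 + 30 + stepCost * (2 * 43265 ^ done.length) ≤
      e.pot ⟨2, t, b, todo, done, v⟩ := by
    change _ ≤ stepCost * (4 * 43265 ^ done.length * tail 129796 (n - t) b)
    have h2 : done.length + 1 ≤ 43265 ^ done.length := Nat.lt_pow_self (by norm_num)
    have hsc := stepCost_ge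
    have h3 := one_le_tail 129796 (n - t) b
    generalize stepCost = c at hsc ⊢
    calc _ ≤ c * (done.length + 1) + c * (2 * 43265 ^ done.length) :=
          Nat.add_le_add_right (by nlinarith) _
      _ ≤ c * (2 * 43265 ^ done.length) + c * (2 * 43265 ^ done.length) :=
        Nat.add_le_add_right (Nat.mul_le_mul_left _ (by omega)) _
      _ = c * (4 * 43265 ^ done.length * 1) := by ring
      _ ≤ _ := Nat.mul_le_mul_left _ (Nat.mul_le_mul_left _ h3)
  refine ⟨14 * done.length + 27, Runs.ite (T := 14 * done.length + 26) (fun h0 => ?_) fun h0 => ?_⟩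
  · have h0 : i ≠ 0 := by
      simp only [Test.holds, hs.zero, hz'.pass] at h0
      omega
    refine (Runs.seq (addrP_runs hs hz' hp hx'.done (Or.inr rfl)) (T' := 22) ?_).le
    rintro σ1 ⟨k1, h40⟩
    refine Runs.blk_seq (T := 16) _ ?_
    set σ2 := after e.Q σ1 [.loadR 3 40, .addN 13 14 7, .addN 14 7 7, .addN 15 8 7, .subN 11 63 8,
      .addN 12 5 7] with hσ2
    have s1 := hs.keep k1
    have z1 := hz'.keep k1
    have hd := hx'.done.keep k1
    have k2 : Keep n [11, 12, 13, 14, 15] [3] σ1 σ2 := keep_after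
    have r1 : InRegs σ2 ⟨1, i - 1, κ, done, [], f (str done)⟩ := by
      have hS := z1.src (str done)
      rw [show 2 * (4 ^ n * i + code (str done)) + 1 = σ1.N 40 by
        rw [h40, hz'.src_base]; ring] at hS
      exact ⟨by simp [hσ2, s1.zero, s1.one], by simp [hσ2, s1.one, z1.pass],
        by simp [hσ2, s1.zero, z1.cap], hd.after _ (by simp [s1.zero]),
        by simp [LReg, LAt, hσ2, s1.zero], by simp [hσ2, hS]⟩
    refine (pushP_runs (s1.keep k2) r1 ((hW.keep k1).keep k2)).mono le_rfl ?_
    rintro τ ⟨k3, hW3⟩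
    refine Eng.Step.push (tabEng_ok hr) hs ((k1.trans (X'' := engX) (Y'' := engY) k2).trans k3) hz
      hW3 (.inr (.inl ⟨rfl, show i - 1 < I.d by omega, by simpa using hp, by simp [sites]⟩)) ?_ ?_
    · rw [← he, hval]
      simp [Eng.val, he, tabEng, h0]
    aesop
  have h0 : i = 0 := by
    simp only [Test.holds, hs.zero, hz'.pass] at h0
    omega
  refine (dfsFin_runs hQ hs hW hp hx'.done hz'.cap).mono le_rfl ?_
  rintro τ ⟨k, hW3⟩
  refine Eng.Step.push (tabEng_ok hr) hs k hz hW3 (.inl ⟨rfl, Nat.zero_le _, by simpa using hp⟩)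
    ?_ ?_
  · aesop
  refine le_trans ?_ hpot
  have h1 : 52 ^ min done.length κ ≤ 2 * 43265 ^ done.length :=
    (Nat.pow_le_pow_right (by norm_num) (min_le_left _ _)).trans
      ((Nat.pow_le_pow_left (show 52 ≤ 43265 by norm_num) _).trans
        (Nat.le_mul_of_pos_left _ two_pos))
  have h3 := Nat.mul_le_mul_left stepCost h1
  change _ + 30 + stepCost * (50 ^ 0 * 52 ^ min done.length κ) ≤ _
  simp_all

end Tables

/-! ## The programs for uniform noise -/

/-- Multiplies `R[a]` by `R[p]`, and `R[a']` by `R[p']`, until `R[a] ≤ R[thr]`, and counts in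
`N[x]`. -/
def powLoop (thr a p a' p' x : ℕ) : Program :=
  .while (.ltR thr a) (blk [.mulR a a p, .mulR a' a' p', .addN x x 8])

theorem powLoop_runs {thr a p a' p' x : ℕ} (hx : x ≠ 8)
    (hne : a ≠ a' ∧ thr ≠ a ∧ thr ≠ a' ∧ p ≠ a ∧ p ≠ a' ∧ p' ≠ a ∧ p' ≠ a') :
    ∀ (k : ℕ) (σ : State), σ.N 8 = 1 → (∀ j < k, σ.R thr < σ.R a * σ.R p ^ j) →
      σ.R a * σ.R p ^ k ≤ σ.R thr → Runs Q (powLoop thr a p a' p' x) σ (4 * k + 1) fun τ =>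
        τ = ⟨update σ.N x (σ.N x + k), σ.M,
          update (update σ.R a (σ.R a * σ.R p ^ k)) a' (σ.R a' * σ.R p' ^ k), σ.S⟩ := by
  obtain ⟨h1, h2, h3, h4, h5, h6, h7⟩ := hne
  intro k
  induction k with
  | zero =>
    intro σ _ _ hk
    refine ⟨σ, 1, .while_false ?_, by omega, ?_⟩
    · simpa using hk
    simp
  | succ k ih =>
    intro σ h8 hj hk
    have e : ∀ j, σ.R a * σ.R p ^ (j + 1) = σ.R a * σ.R p * σ.R p ^ j := fun j => by ring
    set σ1 := after Q σ [.mulR a a p, .mulR a' a' p', .addN x x 8] with hσ1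
    have ea : σ1.R a = σ.R a * σ.R p := by simp [hσ1, h1]
    have ea' : σ1.R a' = σ.R a' * σ.R p' := by simp [hσ1, h6, h1.symm]
    have et : σ1.R thr = σ.R thr := by simp [hσ1, h2, h3]
    have ep : σ1.R p = σ.R p := by simp [hσ1, h4, h5]
    have ep' : σ1.R p' = σ.R p' := by simp [hσ1, h6, h7]
    obtain ⟨τ, c, hτ, hc, h⟩ := ih σ1 (by simp [hσ1, hx.symm, h8])
      (fun j hj' => by rw [et, ea, ep, ← e]; exact hj _ (by omega)) (by
        simp_all)
    obtain ⟨τ', c', hτ', hc', h'⟩ := Runs.blk (Q := Q) (σ := σ) (Φ := fun υ => υ = σ1)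
      [.mulR a a p, .mulR a' a' p', .addN x x 8] rfl
    subst h'
    refine ⟨τ, c' + c + 1, .while_true ?_ hτ' hτ, ?_, ?_⟩
    · simpa using hj 0 (by omega)
    · simp at hc'
      omega
    rw [h, ea, ea', ep, ep', e k, pow_succ (σ.R p') k]
    congr 1
    · ext y
      by_cases hy : y = x
      · subst hy
        simp [hσ1, h8]
        ring
      simp [hσ1, hy]
    ext y
    by_cases hy : y = a'
    · subst hy
      simp
      ring
    by_cases hy' : y = a
    · simp_all
    simp [hσ1, hy, hy']

def setupP : List Instr := [.constN 8 1, .constN 9 2, .constN 10 3, .constN 16 8, .addN 3 0 16,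
  .castR 50 8, .castR 51 9, .divR 52 1 51, .subR 52 50 52]

def paramsAll : Program := .ite (.ltR 0 52)
  (.seq (blk [.mulR 54 0 0, .addR 55 52 60, .divR 56 51 1, .divR 57 51 1])
  (.seq (powLoop 54 55 52 57 56 6)
  (.seq (blk [.subR 58 50 0, .mulR 58 0 58, .divR 58 58 51, .mulR 59 58 58, .mulR 57 57 52])
  (.seq (powLoop 59 57 52 62 60 5)
  (.seq (blk [.addR 61 52 60]) (powLoop 58 61 52 62 60 12)))))) .skip

def paramsRandom : Program := .seq (blk [.addR 61 52 60]) (.seq (powLoop 0 61 52 62 60 5)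
  (blk [.addN 6 5 7, .addN 12 5 7]))

attribute [local simp] after setupP start

structure Ready (n d m K L l : ℕ) (g : ℝ) (σ : State) : Prop where
  static : Static n d m g σ
  N5 : σ.N 5 = L
  N6 : σ.N 6 = K
  N12 : σ.N 12 = l
  zero : ∀ x ∈ [4, 11, 13, 14, 15, 70], σ.N x = 0
  R2 : σ.R 2 = 0
  R3 : σ.R 3 = 0

theorem Ready.work {K L l : ℕ} (h : Ready n d m K L l g σ) :
    Work σ ([] : List (Task n)) := h.zero 4 (by simp)

/-- Reads the letters of the term `N[70]`. -/
def readTermP : Program := .while (.ltN 20 0) (.seq (askP 2 70 21)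
  (.seq (.ite (.ltN 7 21) (consP 13 20 21 13) .skip) (blk [.addN 20 20 8])))

def pushTermsP : Program := .while (.ltN 70 2) (.seq (blk [.constN 20 0, .constN 13 0])
  (.seq readTermP (.seq (blk [.storeN 0 70, .queryR 3 4 0, .addN 12 5 7])
  (.seq pushP (blk [.addN 70 70 8])))))

def pushEnumP : Program := .seq (blk [.constN 15 2]) pushP

def uniformP (params push : Program) : Program :=
  .seq (.seq (blk setupP) params) (.seq push (.seq (engineP false dfsSink dfsFin)
    (blk [.subR 0 2 2, .addR 0 2 0])))

section

variable {K L l : ℕ} {ε : ℝ}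

theorem paramsAll_runs_of_le (h : 1 - g / 2 ≤ ε) :
    Runs Q (.seq (blk setupP) paramsAll) (start n d m ε g) 10 (Ready n d m 0 0 0 g) := by
  refine Runs.blk_seq (T := 1) _ (Runs.ite (T := 0) (fun hb => ?_) fun _ => Runs.skip ?_)
  · exfalso
    simp at hb
    linarith
  constructor
  · constructor <;> simp
  all_goals simp

theorem paramsAll_runs (h : ε < 1 - g / 2) (hK : ∀ j < K, ε ^ 2 < (1 - g / 2) ^ (j + 1))
    (hK' : (1 - g / 2) ^ (K + 1) ≤ ε ^ 2)
    (hL : ∀ j < L, (ε * (1 - ε) / 2) ^ 2 < (2 / g) ^ (K + 1) * (1 - g / 2) ^ (j + 1))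
    (hL' : (2 / g) ^ (K + 1) * (1 - g / 2) ^ (L + 1) ≤ (ε * (1 - ε) / 2) ^ 2)
    (hl : ∀ j < l, ε * (1 - ε) / 2 < (1 - g / 2) ^ (j + 1))
    (hl' : (1 - g / 2) ^ (l + 1) ≤ ε * (1 - ε) / 2) :
    Runs Q (.seq (blk setupP) paramsAll) (start n d m ε g) (4 * (K + L + l) + 23)
      (Ready n d m K L l g) := by
  refine (Runs.blk_seq (T := 4 * (K + L + l) + 14) _ (Runs.ite (T := 4 * (K + L + l) + 13)
    (fun _ => ?_) fun hb => ?_)).mono (by simp [setupP]; omega) fun _ h => h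
  · refine (Runs.blk_seq (T := 4 * (K + L + l) + 9) _ ?_).le
    refine (Runs.seq (powLoop_runs (by decide) (by decide) K _ ?_ ?_ ?_)
      (T' := 4 * (L + l) + 8) ?_).le
    · simp
    · intro j hj
      have := hK j hj
      rw [sq, pow_succ'] at this
      simpa using this
    · simpa [← pow_succ', ← sq] using hK'
    rintro _ rfl
    refine (Runs.blk_seq (T := 4 * (L + l) + 3) _ ?_).le
    refine (Runs.seq (powLoop_runs (by decide) (by decide) L _ ?_ ?_ ?_) (T' := 4 * l + 2) ?_).le
    · simp
    · intro j hj
      have := hL j hj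
      rw [sq, pow_succ' _ K, pow_succ' _ j] at this
      simpa [mul_assoc] using this
    · have := hL'
      rw [sq, pow_succ' _ K, pow_succ' _ L] at this
      simpa [mul_assoc] using this
    rintro _ rfl
    refine (Runs.blk_seq (T := 4 * l + 1) _ ?_).le
    refine (powLoop_runs (by decide) (by decide) l _ ?_ ?_ ?_).mono le_rfl ?_
    · simp
    · intro j hj
      have := hl j hj
      rw [pow_succ'] at this
      simpa using this
    · have := hl'
      rw [pow_succ'] at this
      simpa using this
    rintro _ rfl
    constructor
    · constructor <;> simp
    all_goals simp
  exfalso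
  simp at hb
  linarith

theorem paramsRandom_runs (hL : ∀ j < L, ε < (1 - g / 2) ^ (j + 1))
    (hL' : (1 - g / 2) ^ (L + 1) ≤ ε) :
    Runs Q (.seq (blk setupP) paramsRandom) (start n d m ε g) (4 * L + 13)
      (Ready n d m L L L g) := by
  refine (Runs.blk_seq (T := 4 * L + 4) _ ?_).mono (by simp [setupP]; omega) fun _ h => h
  refine (Runs.blk_seq (T := 4 * L + 3) _ ?_).le
  refine (Runs.seq (powLoop_runs (by decide) (by decide) L _ ?_ ?_ ?_) (T' := 2) ?_).le
  · simp
  · intro j hj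
    have := hL j hj
    rw [pow_succ'] at this
    simpa using this
  · have := hL'
    rw [pow_succ'] at this
    simpa using this
  rintro _ rfl
  refine Runs.blk _ ?_
  constructor
  · constructor <;> simp
  all_goals simp

end

section

variable {K L l : ℕ} {I : Inst n} {o r : Vec n}

theorem dfs_start {P : Letters n} (h : Proper P) (v : ℝ) (hl : wt (str P) ≤ l) :
    I.valN (dfs Q I m K L o r).F 0 L P [] v = v * truncTop I.kg I.nk r I.d l K (L + 1) (str P) := by
  rw [I.valN_start _ v 0 L h, smul_eq_mul, truncTop, if_pos hl]
  congr 1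
  split_ifs with hw
  · refine sum_congr rfl fun R _ => ?_
    change _ * budgeted _ _ _ _ _ _ _ _ = _
    rw [show L - wt (str P) + 1 = L + 1 - wt (str P) by omega, Nat.sub_zero, Nat.sub_zero]
    rfl
  rw [show L + 1 - wt (str P) = 0 by omega]
  simp [budgeted_of_budget_zero]

/-- The input contains the list of terms `(w i, P i)`. -/
structure ReadsTerms (Q : Oracle) (n m : ℕ) (w : ℕ → ℝ) (P : ℕ → Str n) : Prop where
  letter : ∀ i < m, ∀ (j : Fin n) (a : ℕ → ℕ), a 0 = i → a 1 = j → Q.nat 2 a = (P i j : ℕ)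
  weight : ∀ i < m, ∀ a : ℕ → ℕ, a 0 = i → Q.real 4 a = w i

theorem readTermP_runs {i : ℕ} (hs : Static n d m g σ) (h70 : σ.N 70 = i)
    (hQ : ∀ (j : Fin n) (a : ℕ → ℕ), a 0 = i → a 1 = j → Q.nat 2 a = (P j : ℕ))
    (h20 : σ.N 20 = 0) (h13 : σ.N 13 = 0) :
    Runs Q readTermP σ (15 * n + 1) fun τ => Keep n [13, 20, 21, 52, 53] [] σ τ ∧
      ∃ l : Letters n, LReg τ 13 l ∧ Proper l ∧ str l = P := by
  let J : State → ℕ → Prop := fun τ k => Keep n [13, 20, 21, 52, 53] [] σ τ ∧ ∃ j, τ.N 20 = j ∧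
    j ≤ n ∧ (∃ l : Letters n, LReg τ 13 l ∧ Proper l ∧ (∀ x ∈ sites l, (x : ℕ) < j) ∧
      ∀ x : Fin n, (x : ℕ) < j → str l x = P x) ∧ k = 15 * (n - j) + 1
  refine (Runs.while J (k := 15 * n + 1) ⟨Keep.refl σ, 0, h20, Nat.zero_le n,
    ⟨[], h13, Proper.nil, by simp [sites], fun x hx => by omega⟩, rfl⟩ ?_
    (fun τ k ⟨_, _, _, _, _, h⟩ => by omega)).mono le_rfl ?_
  · rintro τ k ⟨k1, j, hj, hjn, ⟨l, hl, hp, hlt, hP⟩, rfl⟩ hb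
    have s1 := hs.keep k1
    have hj' : j < n := by simpa [hj, s1.n_eq] using hb
    refine ⟨14, (Runs.seq (askP_runs s1 (t := i) (j := j) (v := P ⟨j, hj'⟩)
      ((k1.eN 70).trans h70) hj (by simp) (hQ ⟨j, hj'⟩)) (T' := 10) ?_).le⟩
    rintro τ1 ⟨k2, h21, -, -⟩
    have s2 := s1.keep k2
    have hl1 := hl.keep k2
    have h20' : τ1.N 20 = (⟨j, hj'⟩ : Fin n) := (k2.eN 20).trans hj
    have hjl : (⟨j, hj'⟩ : Fin n) ∉ sites l := fun h => lt_irrefl j (hlt _ h)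
    have key : Runs Q (.ite (.ltN 7 21) (consP 13 20 21 13) .skip) τ1 9 fun τ' =>
        Keep n [13, 52] [] τ1 τ' ∧ LReg τ' 13 (addLetter ⟨j, hj'⟩ (P ⟨j, hj'⟩) l) := by
      refine Runs.ite (T := 8) (fun h => ?_) fun h => ?_
      · have hne : P ⟨j, hj'⟩ ≠ 0 := fun h' => by simp [s2.zero, h21, h'] at h
        refine (consP_runs s2 (c := (⟨j, hj'⟩, P ⟨j, hj'⟩)) h20' h21 hl1).mono le_rfl ?_
        rintro τ' ⟨k3, h3⟩
        rw [addLetter, if_neg hne]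
        exact ⟨k3.mono, h3⟩
      have hne : P ⟨j, hj'⟩ = 0 := Fin.ext (by simpa [s2.zero, h21] using h)
      rw [addLetter, if_pos hne]
      exact (Runs.skip ⟨Keep.refl _, hl1⟩).le
    refine Runs.seq (T := 9) (T' := 1) key ?_
    rintro τ2 ⟨k3, hl2⟩
    refine Runs.blk _ ?_
    set τ3 := after Q τ2 [.addN 20 20 8] with hτ3
    have k4 : Keep n [20] [] τ2 τ3 := keep_after
    have k24 : Keep n [13, 20, 21, 52, 53] [] τ τ3 := (k2.trans k3 (X'' := [13, 21, 52, 53])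
      (Y'' := [])).trans k4
    have h20'' : τ3.N 20 = j + 1 := by simp [hτ3, k3.eN 20, h20', (s2.keep k3).one]
    refine ⟨_, ⟨k1.trans k24, j + 1, h20'', hj', ⟨_, hl2.keep k4, hp.addLetter _ hjl, ?_, ?_⟩,
      rfl⟩, by omega⟩
    · intro x hx
      rcases sites_addLetter hx with rfl | hx
      · simp_all
      exact (hlt x hx).trans (Nat.lt_succ_self j)
    intro x hx
    rw [str_addLetter hjl]
    by_cases hxj : x = ⟨j, hj'⟩
    · simp_all
    rw [update_of_ne hxj]
    have : (x : ℕ) ≠ j := fun h => hxj (Fin.ext h)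
    exact hP x (by omega)
  rintro τ ⟨hb, k, k1, j, hj, hjn, ⟨l, hl, hp, -, hP⟩, -⟩
  have : j = n := by
    have : ¬ j < n := by simpa [hj, (hs.keep k1).n_eq] using hb
    omega
  subst this
  exact ⟨k1, l, hl, hp, funext fun x => hP x x.2⟩

theorem pushTermsP_runs {w : ℕ → ℝ} {P : ℕ → Str n} (hQ : ReadsTerms Q n m w P)
    (hn : 1 ≤ n) (hσ : Ready n I.d m K L l I.g σ) :
    Runs Q pushTermsP σ (40 * n * m + 1) fun τ => Static n I.d m I.g τ ∧
      (dfs Q I m K L o r).Acc τ 0 ∧ ∃ W : List (Task n), Work τ W ∧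
      (∀ x ∈ W, (dfs Q I m K L o r).Valid x) ∧
      (W.map (dfs Q I m K L o r).pot).sum = m * (stepCost * 62 ^ L) ∧
      (W.map (dfs Q I m K L o r).val).sum =
        ∑ i ∈ range m, w i * truncTop I.kg I.nk r I.d n K (L + 1) (P i) := by
  set e := dfs Q I m K L o r with he
  let J : State → ℕ → Prop := fun τ k => Static n I.d m I.g τ ∧ e.Acc τ 0 ∧ τ.N 14 = 0 ∧
    τ.N 11 = 0 ∧ τ.N 15 = 0 ∧ ∃ i, τ.N 70 = i ∧ i ≤ m ∧ (∃ W : List (Task n), Work τ W ∧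
      (∀ x ∈ W, e.Valid x) ∧ (W.map e.pot).sum = i * (stepCost * 62 ^ L) ∧ (W.map e.val).sum =
        ∑ i ∈ range i, w i * truncTop I.kg I.nk r I.d n K (L + 1) (P i)) ∧
    k = 40 * n * (m - i) + 1
  refine (Runs.while J (k := 40 * n * m + 1) ⟨hσ.static, ⟨hσ.R2, hσ.N5, hσ.N6⟩,
    hσ.zero 14 (by simp), hσ.zero 11 (by simp), hσ.zero 15 (by simp), 0, hσ.zero 70 (by simp),
    Nat.zero_le m, ⟨[], hσ.work, by simp, by simp, by simp⟩, rfl⟩ ?_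
    (fun τ k ⟨_, _, _, _, _, _, _, _, _, h⟩ => by omega)).mono le_rfl ?_
  · rintro τ k ⟨s1, hz, h14, h11, h15, i, h70, him, ⟨W, hW, hv, hpot, hval⟩, rfl⟩ hb
    have him' : i < m := by simpa [h70, s1.m_eq] using hb
    refine ⟨15 * n + 23, (Runs.blk_seq (T := 15 * n + 21) _ ?_).le⟩
    set τ1 := after Q τ [.constN 20 0, .constN 13 0] with hτ1
    have k1 : Keep n [13, 20] [] τ τ1 := keep_after
    have s2 := s1.keep k1
    refine (Runs.seq (readTermP_runs s2 ((k1.eN 70).trans h70)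
      (hQ.letter i him') (by simp [hτ1]) (by simp [hτ1])) (T' := 20) ?_).le
    rintro τ2 ⟨k2, lt, hl2, hp, hstr⟩
    have s3 := s2.keep k2
    have k02 : Keep n [13, 20, 21, 52, 53] [] τ τ2 := k1.trans k2
    have h70' : τ2.N 70 = i := (k02.eN 70).trans h70
    have h5' : τ2.N 5 = L := (k02.eN 5).trans hz.2.1
    refine Runs.blk_seq (T := 17) _ ?_
    set τ3 := after Q τ2 [.storeN 0 70, .queryR 3 4 0, .addN 12 5 7] with hτ3
    have k3 : Keep n [12] [3] τ2 τ3 := by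
      refine ⟨fun x hx _ => ?_, fun y hy _ => ?_, fun a ha _ => ?_, ?_, fun _ _ => rfl,
        fun _ => rfl⟩
      · simp at hx
        simp [hτ3, hx]
      · simp at hy
        simp [hτ3, hy]
      · have : a ≠ n := by omega
        simp [hτ3, s3.n_eq, this]
      simp [hτ3]
    have s4 := s3.keep k3
    have r4 : InRegs τ3 ⟨0, 0, L, lt, [], w i⟩ := by
      have k03 := k02.trans k3 (X'' := [12, 13, 20, 21, 52, 53]) (Y'' := [3])
      refine ⟨(k03.eN 15).trans h15, (k03.eN 11).trans h11,
        ?_, hl2.keep k3, (k03.eN 14).trans h14, ?_⟩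
      · simp [hτ3, s3.zero, h5']
      simpa [hτ3, s3.n_eq, h70'] using hQ.weight i him' _ (by simp)
    refine Runs.seq (T := 16) (T' := 1) (pushP_runs s4 r4 ((hW.keep k02).keep k3)) ?_
    rintro τ4 ⟨k4, hW4⟩
    refine Runs.blk _ ?_
    set τ5 := after Q τ4 [.addN 70 70 8] with hτ5
    have k5 : Keep n [70] [] τ4 τ5 := keep_after
    have k05 : Keep n [4, 12, 13, 20, 21, 50, 51, 52, 53, 70] [3] τ τ5 :=
      ((k02.trans k3 (X'' := [12, 13, 20, 21, 52, 53]) (Y'' := [3])).trans k4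
        (X'' := [4, 12, 13, 20, 21, 50, 51, 52, 53]) (Y'' := [3])).trans k5
    refine ⟨_, ⟨s1.keep k05, ⟨(k05.eR 2).trans hz.1,
      (k05.eN 5).trans hz.2.1, (k05.eN 6).trans hz.2.2⟩,
      (k05.eN 14).trans h14, (k05.eN 11).trans h11, (k05.eN 15).trans h15, i + 1, ?_, him',
      ⟨⟨0, 0, L, lt, [], w i⟩ :: W, hW4.keep k5, ?_, ?_, ?_⟩, rfl⟩, ?_⟩
    · simp [hτ5, (s4.keep k4).one, k4.eN 70, k3.eN 70, h70']
    · exact List.forall_mem_cons.mpr ⟨Or.inl ⟨rfl, Nat.zero_le _, by simpa using hp⟩, hv⟩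
    · rw [List.map_cons, List.sum_cons, hpot]
      change stepCost * (60 ^ 0 * 62 ^ L) + _ = _
      ring
    · rw [List.map_cons, List.sum_cons, hval, sum_range_succ, add_comm]
      congr 1
      exact hstr ▸ dfs_start hp (w i) (l := n) (by rw [wt]; exact (card_le_univ _).trans (by simp))
    obtain ⟨q, hq⟩ : ∃ q, m - i = q + 1 := ⟨m - i - 1, by omega⟩
    rw [hq, show m - (i + 1) = q by omega, mul_add]
    omega
  rintro τ ⟨hb, k, s1, hz, -, -, -, i, h70, him, ⟨W, hW, hv, hpot, hval⟩, -⟩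
  have : i = m := by
    have : ¬ i < m := by simpa [h70, s1.m_eq] using hb
    omega
  subst this
  exact ⟨s1, hz, W, hW, hv, hpot, hval⟩

theorem pushEnumP_runs (hσ : Ready n I.d m K L l I.g σ) :
    Runs Q pushEnumP σ 17 fun τ => Static n I.d m I.g τ ∧
      (dfs Q I m K L o r).Acc τ 0 ∧ ∃ W : List (Task n), Work τ W ∧
      (∀ x ∈ W, (dfs Q I m K L o r).Valid x) ∧
      (W.map (dfs Q I m K L o r).pot).sum = stepCost * (2 * 62 ^ L * tail 7 n l) ∧
      (W.map (dfs Q I m K L o r).val).sum = ∑ P, o P * truncTop I.kg I.nk r I.d l K (L + 1) P := by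
  refine Runs.blk_seq (T := 16) _ ?_
  set σ1 := after Q σ [.constN 15 2] with hσ1
  have k1 : Keep n [15] [] σ σ1 := keep_after
  have hs := hσ.static.keep k1
  have r1 : InRegs σ1 ⟨2, 0, l, ([] : Letters n), [], 0⟩ :=
    ⟨by simp [hσ1], (k1.eN 11).trans (hσ.zero 11 (by simp)), (k1.eN 12).trans hσ.N12,
      (k1.eN 13).trans (hσ.zero 13 (by simp)), (k1.eN 14).trans (hσ.zero 14 (by simp)),
      (k1.eR 3).trans hσ.R3⟩
  refine (pushP_runs hs r1 (hσ.work.keep k1)).mono le_rfl ?_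
  rintro τ ⟨k2, hW⟩
  have k := k1.trans k2 (X'' := [4, 15, 50, 51]) (Y'' := [])
  refine ⟨hs.keep k2, ⟨(k.eR 2).trans hσ.R2, (k.eN 5).trans hσ.N5, (k.eN 6).trans hσ.N6⟩, _, hW,
    ?_, ?_, ?_⟩
  · intro x hx
    rw [List.mem_singleton.mp hx]
    exact Or.inr (Or.inr ⟨rfl, Nat.zero_le _, Proper.nil, by simp [sites]⟩)
  · simp [Eng.pot, dfs]
  simp only [List.map_cons, List.map_nil, List.sum_cons, List.sum_nil, add_zero, Eng.val,
    OfNat.ofNat_ne_zero, OfNat.ofNat_ne_one, if_false, Nat.sub_zero]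
  rw [enumV_start (f := fun P => o P * ∑ R, I.nk 0 R P *
    budgeted I.kg I.nk r 0 I.d K (L + 1 - wt P) R)]
  · refine sum_congr rfl fun P _ => ?_
    simp only [truncTop, mul_ite, mul_zero]
  intro l' hp
  have := dfs_start (Q := Q) (I := I) (m := m) (K := K) (L := L) (o := o) (r := r) hp (o (str l'))
    (l := wt (str l')) le_rfl
  rwa [truncTop, if_pos le_rfl] at this

theorem uniformP_runs {params push : Program} {T₁ T₂ T₃ : ℕ} (hQ : Reads Q I)
    (hgb : I.gb = false) (ho : ReadsCoef Q n 2 o) (hr : ReadsCoef Q n 3 r)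
    (hb : ∀ t k c b, b ≠ 0 → budgeted I.kg I.nk r t k c b 0 = r 0)
    (h1 : Runs Q (.seq (blk setupP) params) σ T₁ (Ready n I.d m K L l I.g))
    (h2 : ∀ τ, Ready n I.d m K L l I.g τ → Runs Q push τ T₂ fun τ => Static n I.d m I.g τ ∧
      (dfs Q I m K L o r).Acc τ 0 ∧ ∃ W : List (Task n), Work τ W ∧
      (∀ x ∈ W, (dfs Q I m K L o r).Valid x) ∧
      (W.map (dfs Q I m K L o r).pot).sum = T₃ ∧ (W.map (dfs Q I m K L o r).val).sum = v) :
    Runs Q (uniformP params push) σ (T₁ + (T₂ + (T₃ + 3))) fun τ => τ.R 0 = v := by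
  refine Runs.seq h1 fun τ hτ => Runs.seq (h2 τ hτ) ?_
  rintro τ1 ⟨s1, hz, W, hW, hv, rfl, rfl⟩
  have h3 := Eng.engine_runs (dfs_ok hQ) (dfs_sink hr hQ hb) (dfs_fin ho hQ) s1 hW hz hv
  have hgb' : (dfs Q I m K L o r).I.gb = false := hgb
  rw [hgb'] at h3
  refine (Runs.seq h3 (T' := 2) ?_).mono le_rfl fun _ h => h
  rintro τ2 ⟨-, -, hz', -⟩
  refine Runs.blk _ ?_
  rw [zero_add] at hz'
  simp [hz']

end

/-! ## The program for gate-based noise -/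

/-- Computes in `N[5]` the largest weight of the strings that are kept. -/
def capLoop : Program := .while (.ltR 54 55) (.seq (blk [.mulR 55 55 53, .addN 5 5 8])
  (.ite (.ltN 5 0) .skip (blk [.subR 55 55 55])))

def tabSetup : List Instr := setupP ++ [.mulR 53 52 52, .mulR 54 0 0, .addN 17 1 8, .castR 55 17,
  .mulR 55 55 53, .mulR 55 55 53]

def powersP : Program := .while (.ltN 66 0) (blk [.addN 67 67 8, .storeN 67 68, .addN 67 67 8,
  .addN 69 68 68, .storeN 67 69, .addN 67 67 8, .addN 69 69 68, .storeN 67 69, .addN 67 67 8,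
  .addN 68 69 68, .addN 66 66 8])

def passesP : Program := .while (.ltN 63 64) (.seq (blk [.constN 15 2, .constN 11 0,
  .addN 12 5 7, .constN 13 0, .constN 14 0]) (.seq pushP (.seq (engineP true tabSink tabFin)
    (blk [.addN 62 60 7, .addN 60 60 65, .addN 63 63 8]))))

def tableP : Program := .seq (.seq (blk tabSetup) capLoop) (.ite (.ltN 7 5)
  (.seq (blk [.addN 61 3 7, .addN 67 3 7, .addN 68 9 7]) (.seq powersP
    (.seq (blk [.addN 3 67 7, .addN 65 68 7, .addN 60 65 8, .addN 62 8 7, .addN 64 1 8])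
      (.seq passesP (blk [.loadR 0 62]))))) (blk [.queryR 0 2 7]))

def passV (I : Inst n) (κ : ℕ) (o r : Vec n) (i : ℕ) (f : Vec n) : Vec n :=
  ∑ P, if wt P ≤ κ then match i with
    | 0 => o P • ∑ R, I.nk 0 R P • tabF I.d r 0 0 R
    | i + 1 => f P • ∑ R, I.kg i R P • if wt R ≤ κ then
        ∑ R', I.nk (i + 1) R' R • tabF I.d r (i + 1) 0 R' else 0
  else 0

def tabs (I : Inst n) (κ : ℕ) (o r : Vec n) : ℕ → Vec n
  | 0 => 0
  | i + 1 => passV I κ o r i (tabs I κ o r i)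

/-- A bound for the number of steps of one pass. -/
def passCost (n κ : ℕ) : ℕ := stepCost * (4 * tail 129796 n κ) + 26

theorem siteK_of_wt_lt (g : ℝ) (S : Finset (Fin n)) (s : Fin n → Fin 2) {Q R : Str n}
    (h : wt R < wt Q) : siteK g S s Q R = 0 := by
  obtain ⟨j, hQ, hR⟩ : ∃ j, Q j ≠ 0 ∧ R j = 0 := by
    by_contra! hc
    exact absurd h (not_lt.mpr (card_le_card fun j hj => by
      simp_all))
  refine prod_eq_zero (mem_univ j) ?_
  rw [hR]
  split_ifs
  · simp [nu, hQ]
  rfl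

section

variable {κ : ℕ} {I : Inst n} {o r f : Vec n}

theorem passV_apply {i : ℕ} (hi : i < I.d) (Q : Str n) : passV I κ o r i f Q = ∑ P, if wt P ≤ κ then
      match i with
      | 0 => o P * I.nk 0 Q P
      | i + 1 => f P * ∑ R, I.kg i R P * if wt R ≤ κ then I.nk (i + 1) Q R else 0
    else 0 := by
  have key (X : Vec n) : (∑ R, X R • (Pi.single R 1 : Vec n)) Q = X Q := by simp [Finset.sum_apply, Pi.single_apply]
  simp only [passV, Finset.sum_apply]
  refine sum_congr rfl fun P _ => ?_
  split_ifs with hP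
  · rcases i with _ | i
    · simp only [tabF, hi, if_true, Pi.smul_apply, smul_eq_mul]
      rw [key]
    simp only [tabF, hi, if_true, Pi.smul_apply, smul_eq_mul, Finset.sum_apply]
    congr 1
    refine sum_congr rfl fun R _ => ?_
    congr 1
    split_ifs
    · rw [key]
    rfl
  rfl

theorem tabs_of_wt_lt {i : ℕ} (hi : i < I.d) (h : κ < wt P) : tabs I κ o r (i + 1) P = 0 := by
  have h0 : ∀ t (R : Str n), wt R ≤ κ → I.nk t P R = 0 := fun t R hR =>
    siteK_of_wt_lt _ _ _ (by omega)
  rw [tabs, passV_apply hi]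
  aesop

theorem sum_passV_mul {i : ℕ} (hi : i < I.d) (Y : Vec n) : ∑ Q, passV I κ o r i f Q * Y Q =
    ∑ P, if wt P ≤ κ then match i with
      | 0 => o P * ∑ Q, I.nk 0 Q P * Y Q
      | i + 1 => f P * ∑ R, I.kg i R P * if wt R ≤ κ then ∑ Q, I.nk (i + 1) Q R * Y Q else 0
    else 0 := by
  simp only [passV_apply hi, sum_mul]
  rw [sum_comm]
  refine sum_congr rfl fun P _ => ?_
  split_ifs with hP
  · rcases i with _ | i
    · simp only [mul_sum, mul_assoc]
    simp only [mul_sum, sum_mul]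
    rw [sum_comm]
    refine sum_congr rfl fun R _ => ?_
    split_ifs
    · simp only [mul_sum, mul_assoc]
    simp
  simp

theorem sum_tabs_mul (k : ℕ) : ∀ i, i + k + 1 = I.d →
    ∑ P, tabs I κ o r (i + 1) P * lowWeight I.kg I.nk r κ i (k + 1) P =
      tabs I κ o r (I.d + 1) 0 := by
  have hmask : ∀ i, i < I.d → ∀ Y : Vec n, (∑ P, tabs I κ o r (i + 1) P * Y P) =
      ∑ P, if wt P ≤ κ then tabs I κ o r (i + 1) P * Y P else 0 := by
    intro i hi Y
    refine sum_congr rfl fun P _ => ?_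
    split_ifs with h
    · rfl
    rw [tabs_of_wt_lt hi (by omega), zero_mul]
  induction k with
  | zero =>
    intro i hi
    have e : tabs I κ o r (I.d + 1) = passV I κ o r (i + 1) (tabs I κ o r (i + 1)) := by
      rw [← hi]
      rfl
    rw [hmask i (by omega), e, passV, Finset.sum_apply]
    refine sum_congr rfl fun P _ => ?_
    split_ifs with hP
    · simp only [Pi.smul_apply, Finset.sum_apply, smul_eq_mul, lowWeight]
      congr 1
      refine sum_congr rfl fun R _ => ?_
      congr 1
      split_ifs
      · simp only [Finset.sum_apply, Pi.smul_apply, smul_eq_mul]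
        refine sum_congr rfl fun R' _ => ?_
        rw [tabF, if_neg (by omega), Pi.single_eq_same]
      rfl
    rfl
  | succ k ih =>
    intro i hi
    rw [← ih (i + 1) (by omega), hmask i (by omega)]
    exact (sum_passV_mul (i := i + 1) (by omega) _).symm

/-- The last table contains the functional `lowWeight`. -/
theorem tabs_last (hd : 1 ≤ I.d) : tabs I κ o r (I.d + 1) 0 = ∑ P, if wt P ≤ κ then
      o P * ∑ Q, I.nk 0 Q P * lowWeight I.kg I.nk r κ 0 I.d Q else 0 := by
  obtain ⟨k, hk⟩ : ∃ k, I.d = k + 1 := ⟨I.d - 1, by omega⟩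
  rw [← sum_tabs_mul k 0 (by omega), hk]
  exact sum_passV_mul (i := 0) (by omega) _

theorem tab_value (i : ℕ) : enumV (tabEng Q I m κ i o r f).fin n 0 κ [] = passV I κ o r i f := by
  rcases i with _ | i
  · rw [enumV_start (f := fun P => o P • if wt P ≤ κ then
      ∑ R, I.nk 0 R P • tabF I.d r 0 0 R else 0) fun l hp => I.valN_start _ _ 0 κ hp]
    refine sum_congr rfl fun P _ => ?_
    split_ifs <;> rfl
  have e : (tabEng Q I m κ (i + 1) o r f).fin =
      fun l => I.valG (tabF I.d r) i κ l [] (f (str l)) := by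
    funext l
    simp [tabEng]
  rw [e, enumV_start (f := fun P => f P • ∑ R, I.kg i R P • I.valH (tabF I.d r) i κ R)
    fun l _ => I.valG_start _ _ i κ]
  rfl

theorem pass_runs (hQ : Reads Q I) (hgb : I.gb = true) (ho : ReadsCoef Q n 2 o)
    (hr : ReadsCoef Q n 3 r) {i : ℕ} (hi : i ≤ I.d) (hs : Static n I.d m I.g σ)
    (hW : Work σ ([] : List (Task n))) (hz : Tab n κ I.d i f σ 0) :
    Runs Q (.seq (blk [.constN 15 2, .constN 11 0, .addN 12 5 7, .constN 13 0, .constN 14 0])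
      (.seq pushP (.seq (engineP true tabSink tabFin)
      (blk [.addN 62 60 7, .addN 60 60 65, .addN 63 63 8])))) σ
      (passCost n κ - 1) fun τ => Static n I.d m I.g τ ∧
        Work τ ([] : List (Task n)) ∧ Tab n κ I.d (i + 1) (passV I κ o r i f) τ 0 := by
  have hc : passCost n κ = stepCost * (4 * tail 129796 n κ) + 26 := rfl
  refine (Runs.blk_seq (T := passCost n κ - 6) _ ?_).le
  set σ1 := after Q σ [.constN 15 2, .constN 11 0, .addN 12 5 7, .constN 13 0, .constN 14 0]
    with hσ1
  have k1 : Keep n [11, 12, 13, 14, 15] [] σ σ1 := keep_after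
  have s1 := hs.keep k1
  have r1 : InRegs σ1 ⟨2, 0, κ, ([] : Letters n), [], σ1.R 3⟩ := by
    refine ⟨by simp [hσ1], by simp [hσ1], by simp [hσ1, hs.zero, hz.cap], ?_, ?_, rfl⟩ <;> aesop
  refine (Runs.seq (pushP_runs s1 r1 (hW.keep k1)) (T' := passCost n κ - 22) ?_).le
  rintro σ2 ⟨k2, hW2⟩
  have h3 := Eng.engine_runs (tabEng_ok (m := m) (κ := κ) (i := i) (o := o) (r := r) (f := f) hQ)
    (tab_sink hr) (tab_fin ho hQ hi) (s1.keep k2) hW2 ((hz.keep k1).keep k2) (by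
      intro x hx
      rw [List.mem_singleton.mp hx]
      exact Or.inr (Or.inr ⟨rfl, Nat.zero_le _, Proper.nil, by simp [sites]⟩))
  have hgb' : (tabEng Q I m κ i o r f).I.gb = true := hgb
  rw [hgb'] at h3
  change Runs Q _ _ _ _ at h3
  refine (Runs.seq h3 (T' := 3) ?_).mono ?_ fun _ h => h
  · rintro σ3 ⟨s3, hW3, hz3⟩
    refine Runs.blk _ ?_
    have hz3 : Tab n κ I.d i f σ3 (passV I κ o r i f) := by
      have : (0 : Vec n) + (List.map (tabEng Q I m κ i o r f).val
          [⟨2, 0, κ, ([] : Letters n), [], σ1.R 3⟩]).sum = passV I κ o r i f := by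
        rw [zero_add, ← tab_value (Q := Q) (m := m) i]
        simp [Eng.val]
      rw [← this]
      exact hz3
    set σ4 := after Q σ3 [.addN 62 60 7, .addN 60 60 65, .addN 63 63 8] with hσ4
    have k4 : Keep n [60, 62, 63] [] σ3 σ4 := keep_after
    have hS : σ4.S = σ3.S := by simp [hσ4]
    have e61 := k4.eN 61
    have hp := code_lt (n := n)
    have h1 := hz3.lo
    have h2 := hz3.hi
    have ho := s3.one
    have hp := hz3.pass
    refine ⟨s3.keep k4, hW3.keep k4, ⟨(k4.eN 5).trans hz3.cap,
      by simp [hσ4, hz3.dst_base, hz3.size]; ring, by simp [hσ4, hz3.dst_base, s3.zero],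
      by simp_all [after, Instr.step], (k4.eN 64).trans hz3.last, (k4.eN 65).trans hz3.size,
      h1.trans e61.ge, by rw [e61]; exact h2.trans k4.hp,
      fun j a => by rw [e61, k4.M _ (Or.inr (by omega)) (by omega), hz3.pow],
      fun P => by rw [hS]; exact hz3.dst P,
      fun P => by rw [hS]; exact hz3.free _ (Nat.le_add_right _ _), fun a ha => ?_⟩⟩
    rw [hS]
    refine hz3.free a (le_trans ?_ ha)
    simp_all
  simp [Eng.pot, tabEng]
  omega

theorem passes_runs (hQ : Reads Q I) (hgb : I.gb = true) (ho : ReadsCoef Q n 2 o)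
    (hr : ReadsCoef Q n 3 r) (hs : Static n I.d m I.g σ)
    (hW : Work σ ([] : List (Task n))) (hz : Tab n κ I.d 0 0 σ 0) :
    Runs Q passesP σ (passCost n κ * (I.d + 1) + 1)
      fun τ => Tab n κ I.d (I.d + 1) (tabs I κ o r (I.d + 1)) τ 0 := by
  set c := passCost n κ with hc
  have : 26 ≤ c := Nat.le_add_left _ _
  let J : State → ℕ → Prop := fun τ k => Static n I.d m I.g τ ∧ Work τ ([] : List (Task n)) ∧
    ∃ i, i ≤ I.d + 1 ∧ Tab n κ I.d i (tabs I κ o r i) τ 0 ∧ k = c * (I.d + 1 - i) + 1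
  refine (Runs.while J (k := c * (I.d + 1) + 1) ⟨hs, hW, 0, Nat.zero_le _, hz, rfl⟩ ?_
    (fun τ k ⟨_, _, _, _, _, h⟩ => by omega)).mono le_rfl ?_
  · rintro τ k ⟨s1, hW1, i, hi, hz1, rfl⟩ hb
    have hi' : i < I.d + 1 := by simpa [hz1.pass, hz1.last] using hb
    refine ⟨c - 1, (pass_runs hQ hgb ho hr (by omega) s1 hW1 hz1).mono (by omega) ?_⟩
    rintro υ ⟨s2, hW2, hz2⟩
    refine ⟨_, ⟨s2, hW2, i + 1, hi', hz2, rfl⟩, ?_⟩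
    obtain ⟨q, hq⟩ : ∃ q, I.d + 1 - i = q + 1 := ⟨I.d - i, by omega⟩
    rw [hq, show I.d + 1 - (i + 1) = q by omega, mul_add]
    omega
  rintro τ ⟨hb, k, -, -, i, hi, hz1, -⟩
  have : i = I.d + 1 := by
    have : ¬ i < I.d + 1 := by simpa [hz1.pass, hz1.last] using hb
    omega
  rwa [this] at hz1

theorem capLoop_runs (h8 : σ.N 8 = 1) (h0 : σ.N 0 = n) (h5 : σ.N 5 = 0) (hn : 1 ≤ n) (hκ : κ ≤ n)
    (h54 : 0 ≤ σ.R 54) (h1 : ∀ j < κ, σ.R 54 < σ.R 55 * σ.R 53 ^ j)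
    (h2 : κ = n ∨ σ.R 55 * σ.R 53 ^ κ ≤ σ.R 54) :
    Runs Q capLoop σ (5 * κ + 1) fun τ => ∃ y, τ = ⟨update σ.N 5 κ, σ.M, update σ.R 55 y, σ.S⟩ := by
  let J : State → ℕ → Prop := fun τ k => ∃ c ≤ κ, τ = ⟨update σ.N 5 c, σ.M,
      update σ.R 55 (if c < n then σ.R 55 * σ.R 53 ^ c else 0), σ.S⟩ ∧ k = 5 * (κ - c) + 1
  refine (Runs.while J (k := 5 * κ + 1) ⟨0, Nat.zero_le _, ?_, rfl⟩ ?_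
    (fun τ k ⟨_, _, _, h⟩ => by omega)).mono le_rfl ?_
  · rw [if_pos (by omega), pow_zero, mul_one, ← h5]
    simp
  · rintro _ k ⟨c, hc, rfl, rfl⟩ hb
    have hcn : c < n := by
      by_contra h
      simp [h] at hb
      linarith
    have hcκ : c < κ := by
      rcases hc.lt_or_eq with h | rfl
      · exact h
      rcases h2 with h | h
      · omega
      simp [hcn] at hb
      linarith
    refine ⟨4, Runs.blk_seq (T := 2) _ (Runs.ite (T := 1) (fun h => ?_) fun h => ?_)⟩
    · have h' : c + 1 < n := by simpa [h8, h0] using h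
      refine (Runs.skip ?_).le
      refine ⟨_, ⟨c + 1, hcκ, ?_, rfl⟩, by omega⟩
      simp [h8, hcn, h', pow_succ, mul_assoc]
    have h' : ¬ c + 1 < n := by simpa [h8, h0] using h
    refine Runs.blk _ ?_
    refine ⟨_, ⟨c + 1, hcκ, ?_, rfl⟩, by omega⟩
    simp [h8, hcn, h']
  rintro _ ⟨hb, k, c, hc, rfl, rfl⟩
  have : c = κ := by
    by_contra h
    have hlt : c < κ := lt_of_le_of_ne hc h
    refine hb ?_
    simpa [show c < n by omega] using h1 c hlt
  simp_all

theorem powersP_runs (h8 : σ.N 8 = 1) (h0 : σ.N 0 = n) (h66 : σ.N 66 = 0) (h68 : σ.N 68 = 2)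
    (hM : ∀ y, σ.M y = 0) :
    Runs Q powersP σ (12 * n + 1) fun τ => (∀ x ∉ [66, 67, 68, 69], τ.N x = σ.N x) ∧
      τ.N 67 = σ.N 67 + 4 * n ∧ τ.N 68 = 2 * 4 ^ n ∧ τ.R = σ.R ∧ τ.S = σ.S ∧
      (∀ y < σ.N 67, τ.M y = 0) ∧
      ∀ (j : Fin n) (a : Fin 4), τ.M (σ.N 67 + 4 * j + a) = 2 * (a * 4 ^ (j : ℕ)) := by
  let J : State → ℕ → Prop := fun τ k => ∃ c ≤ n, (∀ x ∉ [66, 67, 68, 69], τ.N x = σ.N x) ∧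
      τ.N 66 = c ∧ τ.N 67 = σ.N 67 + 4 * c ∧ τ.N 68 = 2 * 4 ^ c ∧ τ.R = σ.R ∧ τ.S = σ.S ∧
      (∀ y, y < σ.N 67 ∨ σ.N 67 + 4 * c ≤ y → τ.M y = 0) ∧
      (∀ j < c, ∀ a : Fin 4, τ.M (σ.N 67 + 4 * j + a) = 2 * (a * 4 ^ j)) ∧
      k = 12 * (n - c) + 1
  refine (Runs.while J (k := 12 * n + 1) ⟨0, Nat.zero_le _, fun _ _ => rfl, h66, rfl, h68, rfl, rfl,
    fun y _ => hM y, fun j hj => by omega, rfl⟩ ?_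
    (fun τ k ⟨_, _, _, _, _, _, _, _, _, _, h⟩ => by omega)).mono le_rfl ?_
  · rintro τ k ⟨c, hc, hN, e66, e67, e68, hR, hS, hM0, hM1, rfl⟩ hb
    have e0 : τ.N 0 = n := (hN 0 (by simp)).trans h0
    have e8 : τ.N 8 = 1 := (hN 8 (by simp)).trans h8
    have hcn : c < n := by simpa [e66, e0] using hb
    refine ⟨11, Runs.blk _ ⟨_, ⟨c + 1, hcn, fun x hx => ?_, ?_, ?_, ?_, ?_, ?_, ?_, ?_, rfl⟩,
      by omega⟩⟩
    · simp only [List.mem_cons, List.not_mem_nil, or_false, not_or] at hx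
      obtain ⟨x1, x2, x3, x4⟩ := hx
      simp [x1, x2, x3, x4]
      simp_all
    · simp [e66, e8]
    · simp [e67, e8]
      ring
    · simp [e68]
      ring
    · simp [hR]
    · simp [hS]
    · intro y hy
      have y1 : y ≠ σ.N 67 + 4 * c + 1 := by omega
      have y2 : y ≠ σ.N 67 + 4 * c + 1 + 1 := by omega
      have y3 : y ≠ σ.N 67 + 4 * c + 1 + 1 + 1 := by omega
      simp [e67, e8, y1, y2, y3]
      exact hM0 y (by omega)
    intro j hj a
    rcases Nat.lt_succ_iff_lt_or_eq.mp hj with hj | rfl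
    · have y1 : σ.N 67 + 4 * j + a ≠ σ.N 67 + 4 * c + 1 := by omega
      have y2 : σ.N 67 + 4 * j + a ≠ σ.N 67 + 4 * c + 1 + 1 := by omega
      have y3 : σ.N 67 + 4 * j + a ≠ σ.N 67 + 4 * c + 1 + 1 + 1 := by omega
      simp [e67, e8, y1, y2, y3]
      exact hM1 j hj a
    fin_cases a
    · simp [e67, e8]
      rw [update_of_ne (by omega), update_of_ne (by omega), update_of_ne (by omega)]
      simp_all
    · simp [e67, e8, e68]
    · simp [e67, e8, e68]
      ring
    simp [e67, e8, e68]
    ring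
  rintro τ ⟨hb, k, c, hc, hN, e66, e67, e68, hR, hS, hM0, hM1, -⟩
  have e0 : τ.N 0 = n := (hN 0 (by simp)).trans h0
  have : c = n := by
    have : ¬ c < n := by simpa [e66, e0] using hb
    omega
  simp_all

theorem tableMain_runs (hQ : Reads Q I) (hgb : I.gb = true) (ho : ReadsCoef Q n 2 o)
    (hr : ReadsCoef Q n 3 r) (hz : ∀ x ∈ [4, 7, 63, 66], σ.N x = 0) (h5 : σ.N 5 = κ)
    (hs : Static n I.d m I.g σ) (h3 : σ.N 3 = n + 8) (hM : ∀ x, σ.M x = 0) (hS : ∀ x, σ.S x = 0) :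
    Runs Q (.seq (blk [.addN 61 3 7, .addN 67 3 7, .addN 68 9 7]) (.seq powersP
      (.seq (blk [.addN 3 67 7, .addN 65 68 7, .addN 60 65 8, .addN 62 8 7, .addN 64 1 8])
      (.seq passesP (blk [.loadR 0 62]))))) σ (12 * n + 11 + passCost n κ * (I.d + 1))
      fun τ => τ.R 0 = tabs I κ o r (I.d + 1) 0 := by
  refine (Runs.blk_seq (T := 12 * n + 8 + passCost n κ * (I.d + 1))
    _ ?_).le
  set σ1 := after Q σ [.addN 61 3 7, .addN 67 3 7, .addN 68 9 7] with hσ1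
  have k1 : Keep n [61, 67, 68] [] σ σ1 := keep_after
  have s1 := hs.keep k1
  have h7 := hs.zero
  have h9 := hs.two
  have z1 : ∀ x ∈ [4, 7, 63, 66], σ1.N x = 0 := fun x hx =>
    (k1.N x (fun h => by simp at hx h; omega) (by rintro rfl; simp at hx)).trans (hz x hx)
  have hM : ∀ x, σ1.M x = 0 := by aesop
  have hS : ∀ x, σ1.S x = 0 := by aesop
  have h61 : σ1.N 61 = n + 8 := by simp [hσ1, h3, h7]
  have h67 : σ1.N 67 = n + 8 := by simp [hσ1, h3, h7]
  have h68 : σ1.N 68 = 2 := by simp [hσ1, h9, h7]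
  refine (Runs.seq (powersP_runs (n := n) s1.one s1.n_eq (z1 66 (by simp)) h68 hM) (T' := 7 +
    passCost n κ * (I.d + 1)) ?_).le
  rintro σ2 ⟨hN2, e67, e68, hR2, hS2, hM2, hpow⟩
  rw [h67] at e67 hM2 hpow
  refine (Runs.blk_seq (T := 2 + passCost n κ * (I.d + 1))
    _ ?_).le
  set σ3 := after Q σ2 [.addN 3 67 7, .addN 65 68 7, .addN 60 65 8, .addN 62 8 7, .addN 64 1 8]
    with hσ3
  have hN3 : ∀ x ∉ [3, 65, 60, 62, 64, 66, 67, 68, 69], σ3.N x = σ1.N x := fun x hx =>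
    (show σ3.N x = σ2.N x by
      simp only [List.mem_cons, List.not_mem_nil, or_false, not_or] at hx
      obtain ⟨x1, x2, x3, x4, x5, -⟩ := hx
      simp [hσ3, x1, x2, x3, x4, x5]).trans (hN2 x (by
        simp_all))
  have hM3 : σ3.M = σ2.M := by simp [hσ3]
  have hS3 : σ3.S = fun _ => 0 := by
    simp [hσ3, hS2]
    exact funext hS
  have e7 : σ2.N 7 = 0 := by rw [hN2 7 (by simp)]; exact s1.zero
  have e8 : σ2.N 8 = 1 := by rw [hN2 8 (by simp)]; exact s1.one
  have e1 : σ2.N 1 = I.d := by rw [hN2 1 (by simp)]; exact s1.d_eq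
  have e3' : σ3.N 3 = n + 8 + 4 * n := by simp [hσ3, e67, e7]
  have e61 : σ3.N 61 = n + 8 := by rw [hN3 61 (by simp)]; exact h61
  have hs : Static n I.d m I.g σ3 := by
    have : σ3.R = σ2.R := by simp [hσ3]
    exact ⟨(hN3 0 (by simp)).trans s1.n_eq, (hN3 1 (by simp)).trans s1.d_eq,
      (hN3 2 (by simp)).trans s1.m_eq, (hN3 7 (by simp)).trans s1.zero,
      (hN3 8 (by simp)).trans s1.one, (hN3 9 (by simp)).trans s1.two,
      (hN3 10 (by simp)).trans s1.three, by rw [this, hR2]; exact s1.g_eq,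
      fun i hi => by rw [hM3]; exact hM2 i (by omega), by omega⟩
  have hz : Tab n κ I.d 0 0 σ3 0 := by
    refine ⟨(hN3 5 (by simp)).trans ((k1.eN 5).trans h5), by simp [hσ3, e68, e7, e8],
      by simp [hσ3, e7, e8], (hN3 63 (by simp)).trans (z1 63 (by simp)), by simp [hσ3, e1, e8],
      by simp [hσ3, e68, e7], by omega, by omega, by rw [e61, hM3]; exact hpow, ?_, ?_, ?_⟩
    all_goals simp [hS3]
  have hW : Work σ3 ([] : List (Task n)) := by
    change σ3.N 4 = 0
    rw [hN3 4 (by simp)]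
    exact z1 4 (by simp)
  refine (Runs.seq (passes_runs hQ hgb ho hr hs hW hz) (T' := 1) ?_).le
  intro τ hτ
  refine Runs.blk _ ?_
  have h4 := hτ.src 0
  rw [code_zero, add_zero, ← hτ.src_base] at h4
  simpa using h4

theorem tableP_runs {ε : ℝ} (hQ : Reads Q I) (hgb : I.gb = true) (ho : ReadsCoef Q n 2 o)
    (hr : ReadsCoef Q n 3 r) (hn : 1 ≤ n) (hκ : κ ≤ n)
    (h1 : ∀ j < κ, ε ^ 2 < (I.d + 1) * ((1 - I.g / 2) ^ 2) ^ (j + 2))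
    (h2 : κ = n ∨ (I.d + 1) * ((1 - I.g / 2) ^ 2) ^ (κ + 2) ≤ ε ^ 2) :
    Runs Q tableP (start n I.d m ε I.g) (if κ = 0 then 18 else
      17 * n + 32 + passCost n κ * (I.d + 1)) fun τ =>
        τ.R 0 = if κ = 0 then o 0 else tabs I κ o r (I.d + 1) 0 := by
  set σ0 := after Q (start n I.d m ε I.g) tabSetup with hσ0
  have e53 : σ0.R 53 = (1 - I.g / 2) ^ 2 := by
    simp [hσ0, tabSetup, setupP, start, sq]
  have e54 : σ0.R 54 = ε ^ 2 := by
    simp [hσ0, tabSetup, setupP, start, sq]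
  have e55 : ∀ j, σ0.R 55 * σ0.R 53 ^ j = (I.d + 1) * ((1 - I.g / 2) ^ 2) ^ (j + 2) := by
    intro j
    rw [e53, pow_add _ j 2]
    simp [hσ0, tabSetup, setupP, start]
    ring
  have hcap : Runs Q (.seq (blk tabSetup) capLoop) (start n I.d m ε I.g) (5 * κ + 16) fun τ =>
      ∃ y, τ = ⟨update σ0.N 5 κ, σ0.M, update σ0.R 55 y, σ0.S⟩ := by
    refine (Runs.blk_seq (T := 5 * κ + 1) _ (capLoop_runs (n := n) (by aesop) (by aesop) (by aesop) hn hκ ?_ ?_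
      ?_)).mono (by simp [tabSetup, setupP]; omega) fun _ h => h
    · rw [← hσ0, e54]; positivity
    · simp_all
    simp_all
  by_cases hκ0 : κ = 0
  · rw [if_pos hκ0, if_pos hκ0]
    refine (Runs.seq hcap (T' := 2) ?_).le
    rintro _ ⟨y, rfl⟩
    refine Runs.ite (T := 1) (fun h => ?_) fun _ => Runs.blk _ ?_
    · simp [hκ0] at h
    have hM : σ0.M = fun _ => 0 := by aesop
    simp only [after, List.foldl, Instr.step, update_self, hM]
    exact ho fun _ => 0
  rw [if_neg hκ0, if_neg hκ0]
  refine (Runs.seq hcap (T' := 12 * n + 12 + passCost n κ * (I.d + 1)) ?_).le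
  rintro _ ⟨y, rfl⟩
  refine (Runs.ite (T := 12 * n + 11 + passCost n κ * (I.d + 1)) (fun _ => ?_) fun h => ?_).le
  swap
  · refine absurd ?_ h
    have : σ0.N 7 = 0 := by aesop
    simpa [this] using Nat.pos_of_ne_zero hκ0
  have hs : Static n I.d m I.g ⟨update σ0.N 5 κ, σ0.M, update σ0.R 55 y, σ0.S⟩ := by
    constructor <;> simp [hσ0, tabSetup, setupP, start]
  refine tableMain_runs hQ hgb ho hr ?_ (by simp) hs ?_ ?_ ?_
  · intro x hx
    simp only [List.mem_cons, List.not_mem_nil, or_false] at hx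
    rcases hx with rfl | rfl | rfl | rfl <;> simp [hσ0, tabSetup, setupP, start]
  all_goals simp [hσ0, tabSetup, setupP, start]

end

/-! ## Truncation of the weight with gate-based noise -/

section GateBased

variable {κ : ℕ}
  {S : ℕ → Finset (Fin n)}

theorem pw_mul_compl {y : ℝ} (T : Finset (Fin n)) (P : Str n) :
    pw y T P * pw y Tᶜ P = y ^ wt P := by
  rw [← pw_univ, pw, pw, pw, ← prod_mul_distrib]
  refine prod_congr rfl fun j _ => ?_
  aesop

theorem pw_inv {y : ℝ} (T : Finset (Fin n)) (P : Str n) : pw y⁻¹ T P = (pw y T P)⁻¹ := by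
  rw [pw, pw, ← prod_inv_distrib]
  refine prod_congr rfl fun j _ => ?_
  split_ifs <;> simp

open Classical in
/-- The weight of strings after the gates, before the noise. -/
def starWeight (q : Fin n → Fin n) (x : ℝ) (P : Str n) : ℝ := if GateTrivial q P then x⁻¹ ^ wt P
  else x⁻¹ * pw x⁻¹ (univ.filter fun j => q j ≠ j)ᶜ P

theorem IsLayer.sum_starWeight (hK : IsLayer q K)
    (x : ℝ) (o : Vec n) : ∑ R, starWeight q x R * (∑ P, K R P * o P) ^ 2 =
      ∑ P, starWeight q x P * o P ^ 2 := by
  refine hK.sum_mul_sq _ (fun R P hRP => ?_) o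
  have h2 := hK.trivial_iff R P hRP
  by_cases hR : GateTrivial q R
  · have h3 := hK.trivial_eq R P hR
    simp_all
  rw [starWeight, starWeight, if_neg hR, if_neg fun h => hR (h2.mpr h)]
  congr 1
  refine prod_congr rfl fun j _ => ?_
  by_cases hj : q j = j
  · rw [hK.idle R P hRP j hj]
  simp [hj]

theorem le_starWeight {x : ℝ} (hx : 0 < x) (hx1 : x ≤ 1) (P : Str n) :
    pw x⁻¹ (univ.filter fun j => q j ≠ j)ᶜ P ≤ starWeight q x P := by
  have h1 : 1 ≤ x⁻¹ := (one_le_inv₀ hx).mpr hx1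
  unfold starWeight
  split_ifs with h
  · rw [← pw_univ]
    refine (prod_congr rfl fun j _ => ?_).le
    by_cases hj : q j = j
    · simp [hj]
    simp [h j hj]
  exact le_mul_of_one_le_left (pw_nonneg (by positivity) _ _) h1

theorem starWeight_le {x : ℝ} (hx : 0 < x) (hx1 : x ≤ 1) (P : Str n) :
    starWeight q x P ≤ x⁻¹ ^ wt P := by
  unfold starWeight
  split_ifs with h
  · rfl
  obtain ⟨j, hj, hP⟩ := exists_of_not_gateTrivial h
  rw [← pw_mul_compl (univ.filter fun j => q j ≠ j)]
  refine mul_le_mul_of_nonneg_right ?_ (pw_nonneg (by positivity) _ _)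
  rw [pw_inv]
  refine inv_anti₀ ?_ (pw_le hx.le hx1 (by simpa using hj) hP)
  exact prod_pos fun j _ => by split_ifs <;> simp [hx]

theorem pw_le_starWeight {x : ℝ} (hx : 0 < x) (hx1 : x ≤ 1)
    (hP : ¬ GateTrivial q P) (hκ : κ < wt P) :
    pw x (univ.filter fun j => q j ≠ j) P ≤ x ^ (κ + 2) * starWeight q x P := by
  have h0 : 0 ≤ pw x⁻¹ (univ.filter fun j => q j ≠ j)ᶜ P := pw_nonneg (by positivity) _ _
  have e : pw x (univ.filter fun j => q j ≠ j) P =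
      x ^ wt P * pw x⁻¹ (univ.filter fun j => q j ≠ j)ᶜ P := by
    rw [← pw_mul_compl (univ.filter fun j => q j ≠ j), pw_inv, mul_assoc, mul_inv_cancel₀, mul_one]
    exact (prod_pos fun j _ => by split_ifs <;> simp [hx]).ne'
  rw [e, starWeight, if_neg hP]
  calc _ ≤ x ^ (κ + 1) * pw x⁻¹ (univ.filter fun j => q j ≠ j)ᶜ P :=
        mul_le_mul_of_nonneg_right (pow_le_pow_of_le_one hx.le hx1 hκ) h0
    _ = _ := by rw [pow_succ x (κ + 1)]; field_simp

/-- The error of the truncation for strings of low weight. -/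
def lowError (gk nk : ℕ → Ker n) (κ t k : ℕ) (Z P : Str n) : ℝ :=
  if wt P ≤ κ then full gk nk (delta Z) t k P - lowWeight gk nk (delta Z) κ t k P else 0

theorem lowError_succ (T : Finset (Fin n)) (b : Fin n → Fin 2) {nk : ℕ → Ker n}
    (hnk : nk (t + 1) = siteK g T b) (k : ℕ) (Z P : Str n) : lowError gk nk κ t (k + 1) Z P =
      (∑ R, (if wt P ≤ κ then if wt R ≤ κ then gk t R P else 0 else 0) *
        ∑ Q, siteK g T b Q R * lowError gk nk κ (t + 1) k Z Q) +
      ∑ R, (if wt P ≤ κ then if wt R ≤ κ then 0 else gk t R P else 0) *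
        ∑ Q, siteK g T b Q R * full gk nk (delta Z) (t + 1) k Q := by
  rw [lowError]
  split_ifs with hP
  · simp only [full, lowWeight, hnk]
    rw [← sum_sub_distrib, ← sum_add_distrib]
    refine sum_congr rfl fun R _ => ?_
    split_ifs with hR
    · rw [zero_mul, add_zero, ← mul_sub, ← sum_sub_distrib]
      congr 1
      refine sum_congr rfl fun Q _ => ?_
      by_cases hQ : wt Q ≤ κ
      · rw [lowError, if_pos hQ, mul_sub]
      rw [siteK_of_wt_lt g T b (by omega)]
      ring
    ring
  simp

theorem avg_qf_lowError_le (h0 : 0 < g) (h1 : g ≤ 4 / 7) (hg : Layers p gk)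
    (hS : ∀ t j, t < d → (j ∈ S (t + 1) ↔ p t j ≠ j)) {η : ℝ} (hη : 0 < η) (k : ℕ) :
    ∀ t, t + k = d → ∀ o : Vec n,
    avg (fun s : Directions n d => qf (lowError gk (noiseK g S s) κ t k) o)
      ≤ (k + η) * ((1 - g / 2) ^ 2) ^ (κ + 2) * ∑ P, ((1 - g / 2) ^ 2)⁻¹ ^ wt P * o P ^ 2 := by
  have hx0 : (0 : ℝ) < (1 - g / 2) ^ 2 := pow_pos (by linarith) 2
  have hx1 : (1 - g / 2) ^ 2 ≤ 1 := by nlinarith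
  set x := (1 - g / 2) ^ 2 with hx
  have hsn : ∀ (m : Vec n), 0 ≤ ∑ P, x⁻¹ ^ wt P * m P ^ 2 := fun m =>
    sum_nonneg fun P _ => by positivity
  induction k with
  | zero =>
    intro t _ o
    have e : ∀ s : Directions n d, qf (lowError gk (noiseK g S s) κ t 0) o = 0 := by
      intro s
      simp [qf, lowError, full, lowWeight]
    simp only [e, avg_const]
    exact mul_nonneg (by positivity) (hsn o)
  | succ k ih =>
    intro t ht o
    have hlt : t + 1 < d + 1 := by omega
    have hT : S (t + 1) = univ.filter fun j => p t j ≠ j := by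
      ext j
      simp [hS t j (by omega)]
    set q := p t with hq
    set Y : Vec n := fun R => ∑ P, gk t R P * (if wt P ≤ κ then o P else 0) with hY
    have hYR : ∀ R, κ < wt R → GateTrivial q R → Y R = 0 := by
      intro R hR hRt
      refine sum_eq_zero fun P _ => ?_
      rw [(hg t).trivial_eq R P hRt]
      by_cases h : R = P
      · rw [← h, if_neg (not_le.mpr hR), mul_zero]
      rw [if_neg h, zero_mul]
    have hupd : ∀ (s : Directions n d) c, ∀ i, t + 1 < i →
        noiseK g S (update s ⟨t + 1, hlt⟩ c) i = noiseK g S s i :=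
      fun s c i hi => noiseK_update g S s _ c (by simp; omega)
    have h2 := avg_step g (S (t + 1)) ⟨t + 1, hlt⟩
      (fun s => lowError gk (noiseK g S s) κ (t + 1) k) (fun s c => by
        funext Z P
        unfold lowError
        rw [full_congr gk _ k (t + 1) (hupd s c), lowWeight_congr gk _ κ k (t + 1) (hupd s c)])
      (fun Q => (k + η) * x ^ (κ + 2) * x⁻¹ ^ wt Q) (fun o => by
        refine (ih (t + 1) (by omega) o).trans (le_of_eq ?_)
        rw [mul_sum]
        exact sum_congr rfl fun _ _ => by ring)
      (fun R P => if wt P ≤ κ then if wt R ≤ κ then gk t R P else 0 else 0) o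
    have h3 := avg_step g (S (t + 1)) ⟨t + 1, hlt⟩
      (fun s Z => full gk (noiseK g S s) (delta Z) (t + 1) k) (fun s c => by
        funext Z
        exact full_congr gk _ k (t + 1) (hupd s c)) (fun _ => 1) (fun o => by
        simpa using avg_qf_full_le h0 h1 hg S k (t + 1) (by omega) o)
      (fun R P => if wt P ≤ κ then if wt R ≤ κ then 0 else gk t R P else 0) o
    have e2 : ∀ R, (∑ P, (if wt P ≤ κ then if wt R ≤ κ then gk t R P else 0 else 0) * o P) =
        if wt R ≤ κ then Y R else 0 := by
      intro R
      split_ifs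
      · exact sum_congr rfl fun P _ => by split_ifs <;> simp
      simp
    have e3 : ∀ R, (∑ P, (if wt P ≤ κ then if wt R ≤ κ then 0 else gk t R P else 0) * o P) =
        if wt R ≤ κ then 0 else Y R := by
      intro R
      split_ifs
      · simp
      exact sum_congr rfl fun P _ => by split_ifs <;> simp
    simp only [e2] at h2
    simp only [e3] at h3
    have b2 := h2.trans (c := (k + η) * x ^ (κ + 2) *
        ∑ R, if wt R ≤ κ then starWeight q x R * Y R ^ 2 else 0) (by
      rw [mul_sum]
      refine sum_le_sum fun R _ => ?_
      by_cases hR : wt R ≤ κ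
      · have h4 := (sum_siteK_sq_star_le h0 h1 (S (t + 1)) 0 R).trans
          ((le_of_eq (by rw [hT])).trans (le_starWeight (q := q) hx0 hx1 R))
        simp only [pw_univ] at h4
        have h5 := mul_le_mul_of_nonneg_left h4 (show 0 ≤ (k + η) * x ^ (κ + 2) * Y R ^ 2 by
          positivity)
        rw [if_pos hR, if_pos hR]
        refine le_trans (le_of_eq ?_) (h5.trans (le_of_eq (by ring)))
        rw [mul_sum, mul_sum]
        exact sum_congr rfl fun _ _ => by ring
      simp [hR])
    have b3 := h3.trans (c := x ^ (κ + 2) *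
        ∑ R, if wt R ≤ κ then 0 else starWeight q x R * Y R ^ 2) (by
      rw [mul_sum]
      refine sum_le_sum fun R _ => ?_
      split_ifs with hR
      · simp
      simp only [one_mul]
      by_cases hRt : GateTrivial q R
      · rw [hYR R (by omega) hRt]
        simp
      have h4 := (sum_siteK_sq_le h0 h1 (S (t + 1)) 0 R).trans
        ((le_of_eq (by rw [hT])).trans (pw_le_starWeight hx0 hx1 hRt (by omega : κ < wt R)))
      have h5 := mul_le_mul_of_nonneg_left h4 (sq_nonneg (Y R))
      linarith)
    have h4 := avg_qf_add_le (by positivity) (by positivity) _ _ o b2 b3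
    refine le_trans (le_of_eq ?_) (h4.trans ?_)
    · congr 1
      funext s
      congr 1
      funext Z P
      exact lowError_succ (S (t + 1)) _ (noiseK_eq S s hlt) k Z P
    have e5 : (∑ R, if wt R ≤ κ then starWeight q x R * Y R ^ 2 else 0) +
        (∑ R, if wt R ≤ κ then 0 else starWeight q x R * Y R ^ 2) =
        ∑ P, starWeight q x P * (if wt P ≤ κ then o P else 0) ^ 2 := by
      rw [← (hg t).sum_starWeight, ← sum_add_distrib]
      exact sum_congr rfl fun R _ => by split_ifs <;> simp [hY, ← hq]
    rw [e5]
    have e6 : ∑ P, starWeight q x P * (if wt P ≤ κ then o P else 0) ^ 2 ≤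
        ∑ P, x⁻¹ ^ wt P * o P ^ 2 := by
      refine sum_le_sum fun P _ => ?_
      split_ifs
      · exact mul_le_mul_of_nonneg_right (starWeight_le hx0 hx1 P) (sq_nonneg _)
      have : 0 ≤ x⁻¹ ^ wt P * o P ^ 2 := by positivity
      simpa using this
    refine (mul_le_mul_of_nonneg_left e6 (by positivity)).trans (le_of_eq ?_)
    push_cast
    ring

theorem full_of_untouched (hg : Layers p gk)
    (hS : ∀ t j, t < d → (j ∈ S (t + 1) ↔ p t j ≠ j)) (s : Directions n d) (r : Vec n) (k : ℕ) :
    ∀ t, t + k = d → Untouched p t k P →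
      full gk (noiseK g S s) r t k P = r P := by
  induction k with
  | zero => intro t _ _; rfl
  | succ k ih =>
    intro t ht hP
    obtain ⟨h1, h2⟩ := untouched_succ.mp hP
    have hR : ∀ R, gk t R P = if R = P then 1 else 0 := by
      intro R
      by_cases h : gk t R P = 0
      · rw [h, if_neg]
        rintro rfl
        rw [(hg t).trivial_eq R R h1] at h
        simp at h
      exact (hg t).trivial_eq R P (((hg t).trivial_iff R P h).mpr h1)
    rw [full, noiseK_eq S s (by omega)]
    simp only [hR, siteK_gateTrivial (g := g) (fun j hj => (hS t j (by omega)).mp hj) h1,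
      ite_mul, one_mul, zero_mul, sum_ite_eq', mem_univ, if_true]
    exact ih (t + 1) (by omega) h2

theorem avg_lowWeight_untouched (hg : Layers p gk)
    (hS : ∀ t j, t < d → (j ∈ S (t + 1) ↔ p t j ≠ j)) {Z : Str n} (k : ℕ) :
    ∀ t, t + k = d → Untouched p t k Z → ∀ P, wt P ≤ κ →
      avg (fun s : Directions n d => lowWeight gk (noiseK g S s) (delta Z) κ t k P) = delta Z P := by
  induction k with
  | zero => intro t _ _ P _; simp only [lowWeight, avg_const]
  | succ k ih =>
    intro t ht hZ P hP
    obtain ⟨h1, h2⟩ := untouched_succ.mp hZ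
    have hlt : t + 1 < d + 1 := by omega
    have hfac : ∀ R Q, wt R ≤ κ → avg (fun s : Directions n d =>
        siteK g (S (t + 1)) (s ⟨t + 1, hlt⟩) Q R *
          lowWeight gk (noiseK g S s) (delta Z) κ (t + 1) k Q) =
        if R = Z ∧ Q = Z then 1 else 0 := by
      intro R Q hR
      by_cases hQ : wt Q ≤ κ
      · rw [avg_coord ⟨t + 1, hlt⟩ (fun b s => siteK g (S (t + 1)) b Q R *
          lowWeight gk (noiseK g S s) (delta Z) κ (t + 1) k Q) (fun b s c => by
            rw [lowWeight_congr gk _ κ k (t + 1) fun i hi =>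
              noiseK_update g S s _ c (by simp; omega)])]
        simp only [avg_mul_left, ih (t + 1) (by omega) h2 Q hQ, avg_mul_right, delta]
        by_cases hQZ : Q = Z
        · subst hQZ
          by_cases hRQ : R = Q
          · subst hRQ
            simp only [siteK_gateTrivial (g := g) (fun j hj => (hS t j (by omega)).mp hj) h1]
            simp [avg_const]
          rw [avg_siteK_of_ne g _ (Ne.symm hRQ)]
          simp [hRQ]
        simp [hQZ]
      simp only [siteK_of_wt_lt g (S (t + 1)) _ (show wt R < wt Q by omega), zero_mul, avg_const]
      rw [if_neg]
      rintro ⟨rfl, rfl⟩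
      exact hQ hR
    simp only [lowWeight, noiseK_eq S _ hlt]
    rw [avg_sum]
    simp only [avg_mul_left]
    have e : ∀ R, avg (fun s : Directions n d => if wt R ≤ κ then
        ∑ Q, siteK g (S (t + 1)) (s ⟨t + 1, hlt⟩) Q R *
          lowWeight gk (noiseK g S s) (delta Z) κ (t + 1) k Q else 0) =
        if wt R ≤ κ then if R = Z then 1 else 0 else 0 := by
      intro R
      split_ifs with hR hRZ
      · rw [avg_sum]
        simp_all
      · rw [avg_sum]
        simp_all
      rw [avg_const]
    simp only [e]
    rw [sum_eq_single Z (fun R _ hR => by simp [hR]) (fun h => absurd (mem_univ _) h),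
      (hg t).trivial_eq Z P h1, delta]
    by_cases hZP : Z = P
    · simp_all
    simp [hZP, Ne.symm hZP]

theorem lowWeight_of_le (nk : ℕ → Ker n) (r : Vec n) (k : ℕ) : ∀ t,
    lowWeight gk nk r n t k = full gk nk r t k := by
  induction k with
  | zero => intro t; rfl
  | succ k ih =>
    intro t
    funext P
    simp only [lowWeight, full, ih, wt_le, if_true]

end GateBased

section GateBased

variable {κ : ℕ}
  {S : ℕ → Finset (Fin n)}

theorem avg_full_untouched (hg : Layers p gk)
    (hS : ∀ t j, t < d → (j ∈ S (t + 1) ↔ p t j ≠ j)) {Z : Str n} (hZ : Untouched p 0 d Z)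
    (P : Str n) : avg (fun s : Directions n d => full gk (noiseK g S s) (delta Z) 0 d P) =
      delta Z P := by
  have h := avg_lowWeight_untouched (κ := n) (g := g) hg hS d 0 (zero_add d) hZ P (wt_le P)
  simpa only [lowWeight_of_le] using h

theorem avg_lowError_untouched (hg : Layers p gk)
    (hS : ∀ t j, t < d → (j ∈ S (t + 1) ↔ p t j ≠ j)) {Z : Str n} (hZ : Untouched p 0 d Z)
    (P : Str n) : avg (fun s : Directions n d => lowError gk (noiseK g S s) κ 0 d Z P) = 0 := by
  simp only [lowError]
  split_ifs with hP
  · have h1 := avg_full_untouched (g := g) hg hS hZ P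
    have h2 := avg_lowWeight_untouched (g := g) hg hS d 0 (zero_add d) hZ P hP
    have h3 := avg_add (fun s : Directions n d => full gk (noiseK g S s) (delta Z) 0 d P -
      lowWeight gk (noiseK g S s) (delta Z) κ 0 d P)
      fun s => lowWeight gk (noiseK g S s) (delta Z) κ 0 d P
    simp only [sub_add_cancel] at h3
    linarith
  exact avg_const 0

theorem avg_sum_sq_add {α β : Type*} [Fintype α] [Nonempty α] [Fintype β] (y : β → ℝ)
    (f : α → β → ℝ) (h : ∀ z, y z ≠ 0 → avg (fun s => f s z) = 0) :
    avg (fun s => ∑ z, (y z + f s z) ^ 2) = ∑ z, y z ^ 2 + avg fun s => ∑ z, f s z ^ 2 := by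
  have e : ∀ s, ∑ z, (y z + f s z) ^ 2 =
      ∑ z, y z ^ 2 + (∑ z, (2 * y z) * f s z + ∑ z, f s z ^ 2) := by
    intro s
    rw [← sum_add_distrib, ← sum_add_distrib]
    exact sum_congr rfl fun z _ => by ring
  simp only [e]
  rw [avg_add, avg_add, avg_const, avg_sum]
  simp only [avg_mul_left]
  rw [sum_eq_zero (f := fun z => 2 * y z * avg fun s => f s z), zero_add]
  intro z _
  by_cases hz : y z = 0
  · simp [hz]
  rw [h z hz, mul_zero]

theorem avg_gateBased_layers_le (h0 : 0 < g) (h1 : g ≤ 4 / 7) (hg : Layers p gk)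
    (hd : 1 ≤ d) (hS : ∀ t j, t < d → (j ∈ S (t + 1) ↔ p t j ≠ j)) {η : ℝ} (hη : 0 < η)
    (y v : Vec n) :
    avg (fun s : Directions n d => ∑ Z, (∑ Q, (y Q * full gk (noiseK g S s) (delta Z) 0 d Q +
      v Q * lowError gk (noiseK g S s) κ 0 d Z Q)) ^ 2) ≤
    (1 + (d + η)) * ((1 - g / 2) ^ 2 * ∑ Q, y Q ^ 2 +
      ((1 - g / 2) ^ 2) ^ (κ + 2) * ∑ Q, ((1 - g / 2) ^ 2)⁻¹ ^ wt Q * v Q ^ 2) := by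
  classical
  have hx : 1 / 2 ≤ (1 - g / 2) ^ 2 := by nlinarith
  set yD : Vec n := fun Q => if Untouched p 0 d Q then y Q else 0 with hyD
  set yA : Vec n := fun Q => if Untouched p 0 d Q then 0 else y Q with hyA
  have e1 : ∀ (s : Directions n d) Z, ∑ Q, (y Q * full gk (noiseK g S s) (delta Z) 0 d Q +
      v Q * lowError gk (noiseK g S s) κ 0 d Z Q) = yD Z +
      ∑ Q, 1 * (yA Q * full gk (noiseK g S s) (delta Z) 0 d Q +
        v Q * lowError gk (noiseK g S s) κ 0 d Z Q) := by
    intro s Z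
    have e2 : yD Z = ∑ Q, yD Q * full gk (noiseK g S s) (delta Z) 0 d Q := by
      have : ∀ Q, yD Q * full gk (noiseK g S s) (delta Z) 0 d Q = if Q = Z then yD Q else 0 := by
        intro Q
        by_cases hQ : Untouched p 0 d Q
        · rw [full_of_untouched hg hS s _ d 0 (zero_add d) hQ, delta]
          simp
        simp [hyD, hQ]
      simp [this]
    rw [e2, ← sum_add_distrib]
    refine sum_congr rfl fun Q _ => ?_
    have : y Q = yD Q + yA Q := by
      simp only [hyD, hyA]
      split_ifs <;> simp
    rw [this]
    ring
  simp only [e1]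
  rw [avg_sum_sq_add]
  · have h2 := avg_qf_add_le (u := 1) (v := d + η) (a := (1 - g / 2) ^ 2 * ∑ Q, yA Q ^ 2)
      (b := ((1 - g / 2) ^ 2) ^ (κ + 2) * ∑ Q, ((1 - g / 2) ^ 2)⁻¹ ^ wt Q * v Q ^ 2)
      one_pos (by positivity)
      (fun s : Directions n d => fun Z Q => yA Q * full gk (noiseK g S s) (delta Z) 0 d Q)
      (fun s Z Q => v Q * lowError gk (noiseK g S s) κ 0 d Z Q) (fun _ => 1) (by
        have := avg_qf_full_touch_le h0 h1 hg hS d 0 (zero_add d) yA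
        simp only [qf, one_mul] at this ⊢
        refine this.trans (le_of_eq ?_)
        rw [mul_sum]
        refine sum_congr rfl fun Q _ => ?_
        by_cases hQ : Untouched p 0 d Q <;> simp [hyA, touchWeight, hQ])
      (by
        have := avg_qf_lowError_le (κ := κ) h0 h1 hg hS hη d 0 (zero_add d) v
        simp only [qf, one_mul] at this ⊢
        exact this.trans (le_of_eq (by ring)))
    have e3 : ∑ Q, y Q ^ 2 = ∑ Q, yD Q ^ 2 + ∑ Q, yA Q ^ 2 := by
      rw [← sum_add_distrib]
      refine sum_congr rfl fun Q _ => ?_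
      by_cases hQ : Untouched p 0 d Q <;> simp [hyD, hyA, hQ]
    have h3 : 0 ≤ ∑ Q, yD Q ^ 2 := sum_nonneg fun Q _ => sq_nonneg _
    have h4 : (1 : ℝ) ≤ (1 + (d + η)) * (1 - g / 2) ^ 2 := by
      have : (1 : ℝ) ≤ d := by exact_mod_cast hd
      nlinarith
    have h5 := mul_le_mul_of_nonneg_right h4 h3
    simp only [qf] at h2
    rw [e3]
    linarith
  intro Z hZ
  have hU : Untouched p 0 d Z := by
    by_contra hU
    exact hZ (if_neg hU)
  rw [avg_sum]
  refine sum_eq_zero fun Q _ => ?_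
  rw [avg_mul_left, avg_add, avg_mul_left, avg_mul_left, avg_full_untouched hg hS hU,
    avg_lowError_untouched hg hS hU]
  by_cases hQ : Q = Z
  · subst hQ
    simp [hyA, hU]
  simp [delta, hQ]

/-- The output for gate-based noise: all strings of weight more than `κ` are dropped. -/
def lowTop (gk nk : ℕ → Ker n) (r : Vec n) (d κ : ℕ) (P : Str n) : ℝ :=
  if wt P ≤ κ then ∑ Q, nk 0 Q P * lowWeight gk nk r κ 0 d Q else 0

theorem avg_gateBased_error (h0 : 0 < g) (h1 : g ≤ 4 / 7) (hg : Layers p gk)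
    (hd : 1 ≤ d) (hS : ∀ t j, t < d → (j ∈ S (t + 1) ↔ p t j ≠ j)) (hS0 : S 0 = univ)
    (κ : ℕ) (o : Vec n) :
    avg (fun s : Directions n d => qf (fun Z P => fullTop gk (noiseK g S s) (delta Z) d P -
      lowTop gk (noiseK g S s) (delta Z) d κ P) o) ≤
    (d + 1) * ((1 - g / 2) ^ 2) ^ (κ + 2) * ∑ P, o P ^ 2 := by
  have hx0 : (0 : ℝ) < (1 - g / 2) ^ 2 := pow_pos (by linarith) 2
  have hx1 : (1 - g / 2) ^ 2 ≤ 1 := by nlinarith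
  set x := (1 - g / 2) ^ 2 with hx
  set Y : (Fin n → Fin 2) → Vec n := fun b Q =>
    ∑ P, siteK g univ b Q P * (if wt P ≤ κ then 0 else o P) with hY
  set V : (Fin n → Fin 2) → Vec n := fun b Q =>
    ∑ P, siteK g univ b Q P * (if wt P ≤ κ then o P else 0) with hV
  have key : ∀ η : ℝ, 0 < η → avg (fun s : Directions n d =>
      qf (fun Z P => fullTop gk (noiseK g S s) (delta Z) d P -
        lowTop gk (noiseK g S s) (delta Z) d κ P) o) ≤
      (1 + (d + η)) * (x ^ (κ + 2) * ∑ P, o P ^ 2) := by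
    intro η hη
    have e1 : ∀ s : Directions n d, qf (fun Z P => fullTop gk (noiseK g S s) (delta Z) d P -
        lowTop gk (noiseK g S s) (delta Z) d κ P) o =
        ∑ Z, (∑ Q, (Y (s 0) Q * full gk (noiseK g S s) (delta Z) 0 d Q +
          V (s 0) Q * lowError gk (noiseK g S s) κ 0 d Z Q)) ^ 2 := by
      intro s
      refine sum_congr rfl fun Z _ => ?_
      congr 1
      simp only [hY, hV, sum_mul]
      simp only [← sum_add_distrib]
      rw [sum_comm]
      refine sum_congr rfl fun P _ => ?_
      have e2 : noiseK g S s 0 = siteK g univ (s 0) := by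
        rw [noiseK_eq S s (Nat.succ_pos d), hS0]
        rfl
      rw [fullTop, lowTop, e2]
      split_ifs with hP
      · rw [← sum_sub_distrib, mul_sum]
        refine sum_congr rfl fun Q _ => ?_
        by_cases hQ : wt Q ≤ κ
        · rw [lowError, if_pos hQ]
          ring
        rw [siteK_of_wt_lt g _ _ (by omega)]
        ring
      rw [sub_zero, mul_sum]
      exact sum_congr rfl fun Q _ => by ring
    simp only [e1]
    rw [avg_coord 0 (fun b (s : Directions n d) =>
      ∑ Z, (∑ Q, (Y b Q * full gk (noiseK g S s) (delta Z) 0 d Q +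
        V b Q * lowError gk (noiseK g S s) κ 0 d Z Q)) ^ 2) (fun b s c => by
      have h : ∀ i, 0 < i → noiseK g S (update s 0 c) i = noiseK g S s i :=
        fun i hi => noiseK_update g S s _ c (by simpa using hi.ne')
      simp only [lowError]
      simp only [fun Z => full_congr gk (delta Z) d 0 h, fun Z => lowWeight_congr gk (delta Z) κ d 0 h])]
    refine (avg_mono fun b => avg_gateBased_layers_le h0 h1 hg hd hS hη (Y b) (V b)).trans ?_
    rw [avg_mul_left, avg_add, avg_mul_left, avg_mul_left]
    refine mul_le_mul_of_nonneg_left ?_ (by positivity)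
    have a1 := avg_noise g univ (fun _ => 1) fun P => if wt P ≤ κ then 0 else o P
    have a2 := avg_noise g univ (fun Q => x⁻¹ ^ wt Q) fun P => if wt P ≤ κ then o P else 0
    simp only [one_mul] at a1
    rw [a1, a2]
    rw [mul_sum, mul_sum, mul_sum, ← sum_add_distrib]
    refine sum_le_sum fun P _ => ?_
    have b1 := sum_siteK_sq_le h0 h1 univ 0 P
    have b2 := sum_siteK_sq_star_le h0 h1 univ 0 P
    simp only [pw_univ, compl_univ] at b1 b2
    rw [show pw ((1 - g / 2) ^ 2)⁻¹ ∅ P = 1 by simp [pw]] at b2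
    split_ifs with hP
    · have := mul_le_mul_of_nonneg_left b2 (show 0 ≤ x ^ (κ + 2) * o P ^ 2 by positivity)
      nlinarith
    have b3 := b1.trans (pow_le_pow_of_le_one hx0.le hx1 (show κ + 1 ≤ wt P by omega))
    have := mul_le_mul_of_nonneg_left b3 (show 0 ≤ x * o P ^ 2 by positivity)
    refine le_trans (le_of_eq (by ring)) (this.trans (le_of_eq (by ring)))
  have hn : 0 ≤ x ^ (κ + 2) * ∑ P, o P ^ 2 :=
    mul_nonneg (by positivity) (sum_nonneg fun _ _ => sq_nonneg _)
  refine le_of_forall_pos_le_add fun δ hδ => ?_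
  refine (key (δ / (x ^ (κ + 2) * ∑ P, o P ^ 2 + 1)) (by positivity)).trans ?_
  have : δ / (x ^ (κ + 2) * ∑ P, o P ^ 2 + 1) * (x ^ (κ + 2) * ∑ P, o P ^ 2) ≤ δ := by
    rw [div_mul_eq_mul_div, div_le_iff₀ (by positivity)]
    nlinarith
  linarith

theorem lowTop_of_le (nk : ℕ → Ker n) (r : Vec n) (P : Str n) :
    lowTop gk nk r d n P = fullTop gk nk r d P := by
  rw [lowTop, if_pos (wt_le P), fullTop, lowWeight_of_le]

end GateBased

/-! ## Error bounds for random gates -/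

/-- The sign in `σ_a σ_b σ_a = ± σ_b`. -/
def sg (a b : Fin 4) : ℝ := if a = 0 ∨ b = 0 ∨ a = b then 1 else -1

theorem sg_mul_self (a b : Fin 4) : sg a b * sg a b = 1 := by
  unfold sg
  split_ifs <;> norm_num

theorem avg_sg_mul {b b' : Fin 4} (h : b ≠ b') : avg (fun a => sg a b * sg a b') = 0 := by
  revert h
  fin_cases b <;> fin_cases b' <;> simp [avg, Fin.sum_univ_four, sg]

theorem avg_mul_prod {α β : Type*} [Fintype α] [Fintype β] (f : α → ℝ) (h : β → ℝ) :
    avg (fun u : α × β => f u.1 * h u.2) = avg f * avg h := by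
  simp only [avg, Fintype.sum_prod_type, Fintype.card_prod, ← mul_sum, ← sum_mul]
  push_cast
  ring

/-- A noise direction, and the Pauli matrices multiplied to a gate from the right and from the
left, for each qubit. -/
abbrev Label (n : ℕ) := Fin n → Fin 2 × Fin 4 × Fin 4

/-- The kernel of a layer whose gates are multiplied by Pauli matrices. -/
def twistK (p : Fin n → Fin n) (K : Ker n) (v : Label n) (R P : Str n) : ℝ :=
  K R P * ∏ j, if p j = j then 1 else sg (v j).2.1 (R j) * sg (v j).2.2 (P j)

/-- The kernel of uniform noise with directions `s₀` on the qubits that belong to gates. -/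
def mixK (g : ℝ) (p : Fin n → Fin n) (s₀ : Fin n → Fin 2) (v : Label n) (Q R : Str n) : ℝ :=
  siteK g univ (fun j => if p j ≠ j then s₀ j else (v j).1) Q R

section

variable {p : Fin n → Fin n}

theorem avg_nu_mul {a a' : Fin 4} (h : a ≠ a') (b : Fin 4) :
    avg (fun s => nu g s b a * nu g s b a') = 0 := by
  rw [avg_fin_two]
  revert h
  fin_cases a <;> fin_cases a' <;> fin_cases b <;> simp [nu]

theorem avg_twist (hK : IsLayer p K) (s₀ : Fin n → Fin 2) (Q R R' P P' : Str n) :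
    avg (fun v : Label n => twistK p K v R P * mixK g p s₀ v Q R *
      (twistK p K v R' P' * mixK g p s₀ v Q R')) =
      if R = R' ∧ P = P' then K R P ^ 2 * siteK g univ 0 Q R ^ 2 else 0 := by
  split_ifs with h
  · obtain ⟨rfl, rfl⟩ := h
    have e : ∀ v : Label n, twistK p K v R P * mixK g p s₀ v Q R *
        (twistK p K v R P * mixK g p s₀ v Q R) = K R P ^ 2 * siteK g univ 0 Q R ^ 2 := by
      intro v
      have e1 : mixK g p s₀ v Q R ^ 2 = siteK g univ 0 Q R ^ 2 := by
        rw [mixK, siteK_sq, siteK_sq]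
      have e2 : (∏ j, if p j = j then 1 else sg (v j).2.1 (R j) * sg (v j).2.2 (P j)) ^ 2 = 1 := by
        rw [← prod_pow]
        refine prod_eq_one fun j _ => ?_
        split_ifs
        · simp
        rw [sq, mul_mul_mul_comm, sg_mul_self, sg_mul_self, one_mul]
      rw [← e1, twistK]
      linear_combination (K R P ^ 2 * mixK g p s₀ v Q R ^ 2) * e2
    simp only [e, avg_const]
  by_cases h1 : K R P = 0
  · simp [twistK, h1, avg_const]
  by_cases h2 : K R' P' = 0
  · simp [twistK, h2, avg_const]
  set f : Fin n → Fin 2 × Fin 4 × Fin 4 → ℝ := fun j u =>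
    (if p j = j then nu g u.1 (Q j) (R j) * nu g u.1 (Q j) (R' j)
      else nu g (s₀ j) (Q j) (R j) * nu g (s₀ j) (Q j) (R' j)) *
    ((if p j = j then 1 else sg u.2.1 (R j) * sg u.2.1 (R' j)) *
      if p j = j then 1 else sg u.2.2 (P j) * sg u.2.2 (P' j)) with hf
  have e : ∀ v : Label n, twistK p K v R P * mixK g p s₀ v Q R *
      (twistK p K v R' P' * mixK g p s₀ v Q R') = K R P * K R' P' * ∏ j, f j (v j) := by
    intro v
    have e1 : ∏ j, f j (v j) =
        (∏ j, if p j = j then 1 else sg (v j).2.1 (R j) * sg (v j).2.2 (P j)) * mixK g p s₀ v Q R *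
        ((∏ j, if p j = j then 1 else sg (v j).2.1 (R' j) * sg (v j).2.2 (P' j)) *
          mixK g p s₀ v Q R') := by
      simp only [mixK, siteK, ← prod_mul_distrib]
      refine prod_congr rfl fun j _ => ?_
      by_cases hj : p j = j <;> simp [hf, hj]
      ring
    rw [e1, twistK, twistK]
    ring
  simp only [e]
  rw [avg_mul_left, avg_prod]
  have e2 : ∀ j, avg (f j) = avg (fun s => if p j = j then nu g s (Q j) (R j) *
        nu g s (Q j) (R' j) else nu g (s₀ j) (Q j) (R j) * nu g (s₀ j) (Q j) (R' j)) *
      (avg (fun a => if p j = j then 1 else sg a (R j) * sg a (R' j)) *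
        avg (fun a => if p j = j then 1 else sg a (P j) * sg a (P' j))) := by
    intro j
    rw [← avg_mul_prod, ← avg_mul_prod]
  suffices h3 : ∃ j, avg (f j) = 0 by
    obtain ⟨j, hj⟩ := h3
    rw [prod_eq_zero (mem_univ j) hj, mul_zero]
  by_contra hc
  push Not at hc
  have hR : R = R' := by
    funext j
    by_contra hj
    refine hc j ?_
    rw [e2]
    by_cases hp : p j = j
    · simp only [hp, if_true, avg_nu_mul hj, zero_mul]
    simp only [hp, if_false, avg_sg_mul hj, zero_mul, mul_zero]
  refine h ⟨hR, ?_⟩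
  funext j
  by_contra hj
  by_cases hp : p j = j
  · exact hj ((hK.idle R P h1 j hp).symm.trans ((congrFun hR j).trans (hK.idle R' P' h2 j hp)))
  refine hc j ?_
  rw [e2]
  simp only [hp, if_false, avg_sg_mul hj, mul_zero]

theorem avg_twisted_step (hK : IsLayer p K) (s₀ : Fin n → Fin 2) (i : Fin (d + 1))
    (E E' : (Fin (d + 1) → Label n) → Str n → Ker n)
    (hE : ∀ ω v, E (update ω i v) = E ω) (hE' : ∀ ω v, E' (update ω i v) = E' ω)
    (h : ∀ R R' Q Q', Q ≠ Q' → avg (fun ω => ∑ Z, E ω Z R Q * E' ω Z R' Q') = 0) (P P' : Str n) :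
    avg (fun ω => ∑ Z, (∑ R, twistK p K (ω i) R P * ∑ Q, mixK g p s₀ (ω i) Q R * E ω Z R Q) *
      (∑ R, twistK p K (ω i) R P' * ∑ Q, mixK g p s₀ (ω i) Q R * E' ω Z R Q)) =
    if P = P' then ∑ R, K R P ^ 2 * ∑ Q, siteK g univ 0 Q R ^ 2 *
      avg (fun ω => ∑ Z, E ω Z R Q * E' ω Z R Q) else 0 := by
  set c : Str n → Label n → Str n × Str n → ℝ := fun P v x =>
    twistK p K v x.1 P * mixK g p s₀ v x.2 x.1 with hc
  have e1 : ∀ ω, ∑ Z, (∑ R, twistK p K (ω i) R P * ∑ Q, mixK g p s₀ (ω i) Q R * E ω Z R Q) *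
      (∑ R, twistK p K (ω i) R P' * ∑ Q, mixK g p s₀ (ω i) Q R * E' ω Z R Q) =
      ∑ x : Str n × Str n, ∑ y : Str n × Str n, (c P (ω i) x * c P' (ω i) y) * ∑ Z, E ω Z x.1 x.2 * E' ω Z y.1 y.2 := by
    intro ω
    have e2 : ∀ (P : Str n) (F : Ker n),
        ∑ R, twistK p K (ω i) R P * ∑ Q, mixK g p s₀ (ω i) Q R * F R Q =
        ∑ x : Str n × Str n, c P (ω i) x * F x.1 x.2 := by
      intro P F
      rw [Fintype.sum_prod_type]
      simp only [hc, mul_sum, mul_assoc]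
    simp only [fun Z P => e2 P (E ω Z), fun Z P => e2 P (E' ω Z)]
    simp only [sum_mul_sum]
    simp only [mul_sum]
    rw [sum_comm]
    refine sum_congr rfl fun x _ => ?_
    rw [sum_comm]
    exact sum_congr rfl fun y _ => sum_congr rfl fun Z _ => by ring
  simp only [e1]
  rw [avg_coord i (fun v ω => ∑ x : Str n × Str n, ∑ y : Str n × Str n, (c P v x * c P' v y) *
    ∑ Z, E ω Z x.1 x.2 * E' ω Z y.1 y.2) (fun v ω u => by rw [hE, hE'])]
  simp only [avg_sum, avg_mul_left, avg_mul_right]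
  have e3 : ∀ x y : Str n × Str n, (avg fun v => c P v x * c P' v y) *
      (∑ Z, avg fun ω => E ω Z x.1 x.2 * E' ω Z y.1 y.2) = if y = x then
        if P = P' then K x.1 P ^ 2 * (siteK g univ 0 x.2 x.1 ^ 2 *
          ∑ Z, avg (fun ω => E ω Z x.1 x.2 * E' ω Z x.1 x.2)) else 0 else 0 := by
    rintro ⟨R, Q⟩ ⟨R', Q'⟩
    by_cases hQ : Q = Q'
    · subst hQ
      simp only [hc]
      rw [avg_twist hK]
      by_cases hR : R = R'
      · subst hR
        by_cases hP : P = P' <;> simp [hP, mul_assoc]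
      simp [hR, Ne.symm hR]
    have h0 := h R R' Q Q' hQ
    rw [avg_sum] at h0
    rw [h0, mul_zero, if_neg]
    rintro h1
    exact hQ (Prod.mk.inj h1).2.symm
  simp only [e3, sum_ite_eq', mem_univ, if_true]
  split_ifs
  · rw [Fintype.sum_prod_type]
    simp only [mul_sum]
  simp

end

section

variable {nk : ℕ → Ker n}

/-- The contribution of the Pauli paths of total weight at least `b`. -/
def excess (gk nk : ℕ → Ker n) (r : Vec n) : ℕ → ℕ → ℕ → Vec n
  | _, 0, b, P => if b = 0 then r P else 0
  | t, k + 1, b, P =>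
    ∑ R, gk t R P * ∑ Q, nk (t + 1) Q R * excess gk nk r (t + 1) k (b - wt R) Q

theorem excess_zero_right (hg : Layers p gk)
    (hn : ∀ t Q, nk t Q 0 = if Q = 0 then 1 else 0) (r : Vec n) (k : ℕ)
    (hb : b ≠ 0) : ∀ t, excess gk nk r t k b 0 = 0 := by
  induction k with
  | zero => intro t; simp [excess, hb]
  | succ k ih =>
    intro t
    simp only [excess]
    rw [sum_layer_zero (hg t) (hn (t + 1)) (fun R Q => excess gk nk r (t + 1) k (b - wt R) Q)]
    rw [wt_eq_zero.mpr rfl, Nat.sub_zero, ih]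

theorem full_sub_budgeted (hg : Layers p gk)
    (hn : ∀ t Q, nk t Q 0 = if Q = 0 then 1 else 0) (r : Vec n)
    (hf : ∀ t k, full gk nk r t k 0 = r 0)
    (hb : ∀ t k c b, b ≠ 0 → budgeted gk nk r t k c b 0 = r 0) (k : ℕ) :
    ∀ t c b P, b ≤ c → full gk nk r t k P - budgeted gk nk r t k c b P =
      excess gk nk r t k b P := by
  induction k with
  | zero =>
    intro t c b P _
    by_cases h : b = 0 <;> cases c <;> simp [full, budgeted, excess, h]
  | succ k ih =>
    intro t c b P hbc
    by_cases h : P = 0 ∧ b ≠ 0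
    · rw [h.1, hf, hb _ _ _ _ h.2, sub_self, excess_zero_right hg hn r _ h.2]
    obtain ⟨c', e, hc'⟩ : ∃ c', budgeted gk nk r t (k + 1) c b P =
        budgeted gk nk r t (k + 1) (c' + 1) b P ∧ b ≤ c' + 1 := by
      rcases Nat.eq_zero_or_pos b with rfl | hb0
      · exact ⟨c, by rw [budgeted_of_budget_zero, budgeted_of_budget_zero], by omega⟩
      exact ⟨c - 1, by rw [Nat.sub_add_cancel (by omega)], by omega⟩
    rw [e]
    simp only [full, budgeted, excess]
    rw [← sum_sub_distrib]
    refine sum_congr rfl fun R _ => ?_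
    by_cases hR : gk t R P = 0
    · simp [hR]
    rw [← mul_sub, ← sum_sub_distrib]
    congr 1
    refine sum_congr rfl fun Q _ => ?_
    have hle : b - wt R ≤ c' := by
      rcases Nat.eq_zero_or_pos b with rfl | hb0
      · omega
      have := wt_pos fun h1 : R = 0 => h ⟨((hg t).zero_iff hR).mp h1, by omega⟩
      omega
    rw [← mul_sub, ih _ _ _ _ hle]

/-- The error of the truncation when both depth and total weight are limited to `L`. -/
theorem fullTop_sub_truncTop (hg : Layers p gk)
    (hn : ∀ t Q, nk t Q 0 = if Q = 0 then 1 else 0) (r : Vec n)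
    (hf : ∀ t k, full gk nk r t k 0 = r 0)
    (hb : ∀ t k c b, b ≠ 0 → budgeted gk nk r t k c b 0 = r 0) {l L : ℕ}
    (hl : ∀ P : Str n, wt P ≤ L → wt P ≤ l) (P : Str n) :
    fullTop gk nk r d P - truncTop gk nk r d l L (L + 1) P =
      ∑ Q, nk 0 Q P * excess gk nk r 0 d (L + 1 - wt P) Q := by
  rw [fullTop, truncTop]
  split_ifs with h
  · rw [← sum_sub_distrib]
    refine sum_congr rfl fun Q _ => ?_
    rw [← mul_sub]
    by_cases hP : P = 0
    · subst hP
      rw [hn]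
      split_ifs with hQ
      · subst hQ
        rw [hf, hb _ _ _ _ (by rw [wt_eq_zero.mpr rfl]; omega),
          excess_zero_right hg hn r _ (by rw [wt_eq_zero.mpr rfl]; omega), sub_self]
      simp
    have := wt_pos hP
    rw [full_sub_budgeted hg hn r hf hb _ _ _ _ _ (by omega)]
  have := mt (hl P) h
  rw [sub_zero]
  refine sum_congr rfl fun Q _ => ?_
  rw [← full_sub_budgeted hg hn r hf hb d 0 (L + 1 - wt P) _ Q le_rfl,
    show L + 1 - wt P = 0 by omega, budgeted_of_budget_zero, sub_zero]

def labelAt (ω : Fin (d + 1) → Label n) (t : ℕ) : Label n := if h : t < d + 1 then ω ⟨t, h⟩ else 0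

theorem labelAt_eq (ω : Fin (d + 1) → Label n) (h : t < d + 1) : labelAt ω t = ω ⟨t, h⟩ := dif_pos h

theorem labelAt_update (ω : Fin (d + 1) → Label n) (i : Fin (d + 1)) (v : Label n)
    (h : t ≠ i) : labelAt (update ω i v) t = labelAt ω t := by
  unfold labelAt
  split_ifs with ht
  · rw [update_of_ne]
    rintro rfl
    exact h rfl
  rfl

def twistG (p : ℕ → Fin n → Fin n) (gk : ℕ → Ker n)
    (ω : Fin (d + 1) → Label n) (t : ℕ) : Ker n :=
  twistK (p t) (gk t) (labelAt ω (t + 1))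

/-- The layers of noise, with directions prescribed on the qubits that belong to gates. -/
def mixN (g : ℝ) (p : ℕ → Fin n → Fin n) (s₀ : ℕ → Fin n → Fin 2)
    (ω : Fin (d + 1) → Label n) : ℕ → Ker n
  | 0 => mixK g id 0 (labelAt ω 0)
  | t + 1 => mixK g (p t) (s₀ (t + 1)) (labelAt ω (t + 1))

theorem excess_congr {gk' nk' : ℕ → Ker n} (r : Vec n) (k : ℕ) :
    ∀ t b, (∀ i, t ≤ i → gk i = gk' i) → (∀ i, t < i → nk i = nk' i) →
      excess gk nk r t k b = excess gk' nk' r t k b := by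
  induction k with
  | zero => intro t b _ _; rfl
  | succ k ih =>
    intro t b h h'
    funext P
    simp only [excess]
    rw [h t le_rfl, h' (t + 1) (by omega)]
    simp only [ih (t + 1) _ (fun i hi => h i (by omega)) (fun i hi => h' i (by omega))]

theorem excess_update (p : ℕ → Fin n → Fin n) (gk : ℕ → Ker n)
    (s₀ : ℕ → Fin n → Fin 2) (r : Vec n) (k : ℕ) (b : ℕ)
    (ω : Fin (d + 1) → Label n) (i : Fin (d + 1)) (hi : (i : ℕ) ≤ t) (v : Label n) :
    excess (twistG p gk (update ω i v)) (mixN g p s₀ (update ω i v)) r t k b =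
      excess (twistG p gk ω) (mixN g p s₀ ω) r t k b := by
  refine excess_congr r k t b (fun j hj => ?_) fun j hj => ?_
  · rw [twistG, labelAt_update _ _ _ (by omega), twistG]
  obtain ⟨j, rfl⟩ : ∃ l, j = l + 1 := ⟨j - 1, by omega⟩
  rw [mixN, labelAt_update _ _ _ (by omega), mixN]

theorem diag_bound (h0 : 0 < g) (h1 : g ≤ 4 / 7)
    (hK : IsLayer q K) (b : ℕ) (P : Str n) (X : Ker n)
    (hX : ∀ R Q, X R Q ≤ ((1 - g / 2) ^ 2) ^ (b - wt R)) :
    ∑ R, K R P ^ 2 * ∑ Q, siteK g univ 0 Q R ^ 2 * X R Q ≤ ((1 - g / 2) ^ 2) ^ b := by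
  have hx0 : (0 : ℝ) ≤ (1 - g / 2) ^ 2 := by positivity
  have hx1 : (1 - g / 2) ^ 2 ≤ 1 := by nlinarith
  have h2 : ∀ R, ∑ Q, siteK g univ 0 Q R ^ 2 * X R Q ≤ ((1 - g / 2) ^ 2) ^ b := by
    intro R
    refine (sum_le_sum fun Q _ =>
      mul_le_mul_of_nonneg_left (hX R Q) (sq_nonneg _)).trans ?_
    rw [← sum_mul]
    refine (mul_le_mul_of_nonneg_right (sum_siteK_sq_le h0 h1 _ _ R) (by positivity)).trans ?_
    rw [pw_univ, ← pow_add]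
    exact pow_le_pow_of_le_one hx0 hx1 (by omega)
  have h3 : ∑ R, K R P ^ 2 = 1 := by
    have := hK.orth P P
    simpa only [← sq, if_true] using this
  refine (sum_le_sum fun R _ => mul_le_mul_of_nonneg_left (h2 R) (sq_nonneg _)).trans ?_
  rw [← sum_mul, h3, one_mul]

theorem avg_excess (h0 : 0 < g) (h1 : g ≤ 4 / 7) (hg : Layers p gk)
    (s₀ : ℕ → Fin n → Fin 2) (k : ℕ) : ∀ t, t + k = d →
    (∀ b b' P P', P ≠ P' → avg (fun ω : Fin (d + 1) → Label n => ∑ Z,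
      excess (twistG p gk ω) (mixN g p s₀ ω) (delta Z) t k b P *
      excess (twistG p gk ω) (mixN g p s₀ ω) (delta Z) t k b' P') = 0) ∧
    ∀ b P, avg (fun ω : Fin (d + 1) → Label n => ∑ Z,
      excess (twistG p gk ω) (mixN g p s₀ ω) (delta Z) t k b P *
      excess (twistG p gk ω) (mixN g p s₀ ω) (delta Z) t k b P) ≤ ((1 - g / 2) ^ 2) ^ b := by
  induction k with
  | zero =>
    intro t _
    constructor
    · intro b b' P P' hP
      simp only [excess, delta]
      have e : ∑ Z, (if b = 0 then if P = Z then (1 : ℝ) else 0 else 0) *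
          (if b' = 0 then if P' = Z then 1 else 0 else 0) = 0 := by
        refine sum_eq_zero fun Z _ => ?_
        by_cases h : P = Z
        · subst h
          simp [Ne.symm hP]
        simp [h]
      rw [e, avg_const]
    intro b P
    have hx0 : (0 : ℝ) ≤ ((1 - g / 2) ^ 2) ^ b := by positivity
    simp only [excess, delta, avg_const]
    by_cases hb : b = 0
    · simp [hb]
    simpa [hb] using hx0
  | succ k ih =>
    intro t ht
    obtain ⟨ih1, ih2⟩ := ih (t + 1) (by omega)
    have hlt : t + 1 < d + 1 := by omega
    have key : ∀ b b' P P', _ := fun b b' P P' => avg_twisted_step (g := g) (hg t) (s₀ (t + 1))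
      ⟨t + 1, hlt⟩
      (fun ω Z R => excess (twistG p gk ω) (mixN g p s₀ ω) (delta Z) (t + 1) k (b - wt R))
      (fun ω Z R => excess (twistG p gk ω) (mixN g p s₀ ω) (delta Z) (t + 1) k (b' - wt R))
      (fun ω v => by
        funext Z R
        exact excess_update p gk s₀ _ k _ ω _ le_rfl v)
      (fun ω v => by
        funext Z R
        exact excess_update p gk s₀ _ k _ ω _ le_rfl v)
      (fun R R' Q Q' hQ => ih1 _ _ Q Q' hQ) P P'
    have e : ∀ (ω : Fin (d + 1) → Label n) b P Z,
        excess (twistG p gk ω) (mixN g p s₀ ω) (delta Z) t (k + 1) b P =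
        ∑ R, twistK (p t) (gk t) (ω ⟨t + 1, hlt⟩) R P *
          ∑ Q, mixK g (p t) (s₀ (t + 1)) (ω ⟨t + 1, hlt⟩) Q R *
          excess (twistG p gk ω) (mixN g p s₀ ω) (delta Z) (t + 1) k (b - wt R) Q := by
      intro ω b P Z
      rw [excess, twistG, mixN, labelAt_eq ω hlt]
    simp only [e]
    constructor
    · intro b b' P P' hP
      rw [key, if_neg hP]
    intro b P
    rw [key, if_pos rfl]
    exact diag_bound h0 h1 (hg t) b P _ fun R Q => ih2 _ Q

theorem qf_eq (h : Ker n) (o : Vec n) :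
    qf h o = ∑ P, ∑ P', (o P * o P') * ∑ Z, h Z P * h Z P' := by
  simp only [qf, sq, sum_mul_sum]
  rw [sum_comm]
  refine sum_congr rfl fun P _ => ?_
  rw [sum_comm]
  refine sum_congr rfl fun P' _ => ?_
  rw [mul_sum]
  exact sum_congr rfl fun Z _ => by ring

theorem avg_random_error (h0 : 0 < g) (h1 : g ≤ 4 / 7) (hg : Layers p gk)
    (s₀ : ℕ → Fin n → Fin 2) (L : ℕ) (o : Vec n) :
    avg (fun ω : Fin (d + 1) → Label n => qf (fun Z P => ∑ Q, mixN g p s₀ ω 0 Q P *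
      excess (twistG p gk ω) (mixN g p s₀ ω) (delta Z) 0 d (L + 1 - wt P) Q) o) ≤
    ((1 - g / 2) ^ 2) ^ (L + 1) * ∑ P, o P ^ 2 := by
  obtain ⟨ih1, ih2⟩ := avg_excess (g := g) h0 h1 hg s₀ d 0 (zero_add d)
  have key : ∀ P P', _ := fun P P' => avg_twisted_step (g := g) one_isLayer (0 : Fin n → Fin 2)
    (0 : Fin (d + 1))
    (fun ω Z R => excess (twistG p gk ω) (mixN g p s₀ ω) (delta Z) 0 d (L + 1 - wt R))
    (fun ω Z R => excess (twistG p gk ω) (mixN g p s₀ ω) (delta Z) 0 d (L + 1 - wt R))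
    (fun ω v => by
      funext Z R
      exact excess_update p gk s₀ _ d _ ω _ le_rfl v)
    (fun ω v => by
      funext Z R
      exact excess_update p gk s₀ _ d _ ω _ le_rfl v)
    (fun R R' Q Q' hQ => ih1 _ _ Q Q' hQ) P P'
  have e : ∀ (ω : Fin (d + 1) → Label n) P Z, ∑ Q, mixN g p s₀ ω 0 Q P *
        excess (twistG p gk ω) (mixN g p s₀ ω) (delta Z) 0 d (L + 1 - wt P) Q =
      ∑ R, twistK id (fun R P => if R = P then 1 else 0) (ω 0) R P * ∑ Q, mixK g id 0 (ω 0) Q R *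
          excess (twistG p gk ω) (mixN g p s₀ ω) (delta Z) 0 d (L + 1 - wt R) Q := by
    intro ω P Z
    simp only [twistK, id, if_true, prod_const_one, mul_one, ite_mul, one_mul, zero_mul,
      sum_ite_eq', mem_univ, mixN, labelAt_eq ω (Nat.succ_pos d)]
    rfl
  simp only [qf_eq, avg_sum, avg_mul_left]
  simp only [← avg_sum, e]
  simp only [key, mul_ite, mul_zero, sum_ite_eq, mem_univ, if_true]
  rw [mul_sum]
  refine sum_le_sum fun P _ => ?_
  rw [← sq, mul_comm]
  exact mul_le_mul_of_nonneg_right (diag_bound h0 h1 one_isLayer (L + 1) P _ fun R Q => ih2 _ Q)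
    (sq_nonneg _)

end

/-! ## Circuits as instances, and the mean over the ensemble -/

/-- Linearity of a functional of the Pauli coefficients of the state. -/
def Lin (F : Vec n → ℝ) : Prop := ∀ r, F r = ∑ Z, r Z * F (delta Z)

section

variable {N : ℕ} {nk : ℕ → Ker n}

theorem Lin.zero : Lin fun _ : Vec n => 0 := fun r => by simp

theorem Lin.eval (P : Str n) : Lin fun r => r P := fun r => by simp [delta]

theorem Lin.sum {ι : Type*} (s : Finset ι) (a : ι → ℝ) {F : ι → Vec n → ℝ}
    (h : ∀ i, Lin (F i)) : Lin fun r => ∑ i ∈ s, a i * F i r := by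
  intro r
  simp only [mul_sum]
  rw [sum_comm]
  refine sum_congr rfl fun i _ => ?_
  rw [h i r, mul_sum]
  exact sum_congr rfl fun Z _ => by ring

theorem full_lin (k : ℕ) : ∀ t P, Lin fun r => full gk nk r t k P := by
  induction k with
  | zero => intro t P; exact Lin.eval P
  | succ k ih => intro t P; exact Lin.sum _ _ fun R => Lin.sum _ _ fun Q => ih _ _

theorem budgeted_lin (k : ℕ) : ∀ t c b P, Lin fun r => budgeted gk nk r t k c b P := by
  induction k with
  | zero =>
    intro t c b P
    simp only [budgeted]
    split_ifs
    exacts [Lin.zero, Lin.eval P]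
  | succ k ih =>
    intro t c b P
    rcases c with _ | c
    · simp only [budgeted]
      split_ifs
      exacts [Lin.zero, Lin.eval 0, Lin.zero]
    exact Lin.sum _ _ fun R => Lin.sum _ _ fun Q => ih _ _ _ _

theorem lowWeight_lin {κ : ℕ} (k : ℕ) : ∀ t P, Lin fun r => lowWeight gk nk r κ t k P := by
  induction k with
  | zero => intro t P; exact Lin.eval P
  | succ k ih =>
    intro t P
    refine Lin.sum _ _ fun R => ?_
    split_ifs
    exacts [Lin.sum _ _ fun Q => ih _ _, Lin.zero]

theorem truncTop_lin (l c b : ℕ) (P : Str n) : Lin fun r => truncTop gk nk r d l c b P := by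
  unfold truncTop
  split_ifs
  exacts [Lin.sum _ _ fun Q => budgeted_lin _ _ _ _ _, Lin.zero]

theorem lowTop_lin (κ : ℕ) (P : Str n) : Lin fun r => lowTop gk nk r d κ P := by
  unfold lowTop
  split_ifs
  exacts [Lin.sum _ _ fun Q => lowWeight_lin _ _ _, Lin.zero]

def Inst.ofCircuit (model : NoiseModel) (A : Architecture n d) (U : Gates n d) (g : ℝ)
    (s : Directions n d) : Inst n where
  d := d
  g := g
  part t j := if h : t < d then A.partner ⟨t, h⟩ j else j
  involutive t := by
    by_cases h : t < d
    · simpa only [h, dif_pos] using A.involutive ⟨t, h⟩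
    intro j
    simp [h]
  dir := dirAt s
  gate t j := if h : t < d then U ⟨t, h⟩ j else 1
  gb := match model with
    | .uniform => false
    | .gateBased => true

variable (model : NoiseModel) (A : Architecture n d) (U : Gates n d) (g : ℝ) (s : Directions n d)

theorem Inst.ofCircuit_part (h : t < d) :
    (Inst.ofCircuit model A U g s).part t = A.partner ⟨t, h⟩ := by
  funext j
  exact dif_pos h

theorem Inst.ofCircuit_gk (h : t < d) : (Inst.ofCircuit model A U g s).kg t = gateK A U ⟨t, h⟩ := by
  funext R P
  simp [Inst.kg, layerK, gateK, Inst.ofCircuit, h]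

theorem Inst.ofCircuit_gk_of_le (h : ¬ t < d) :
    (Inst.ofCircuit model A U g s).kg t = fun R P => if R = P then 1 else 0 := by
  funext R P
  simp [Inst.kg, layerK, Inst.ofCircuit, h, prod_ite_zero, funext_iff]

theorem Inst.ofCircuit_isLayer (t : ℕ) : IsLayer ((Inst.ofCircuit model A U g s).part t)
    ((Inst.ofCircuit model A U g s).kg t) := by
  by_cases h : t < d
  · rw [Inst.ofCircuit_part model A U g s h, Inst.ofCircuit_gk model A U g s h]
    exact gateK_isLayer A U ⟨t, h⟩
  rw [Inst.ofCircuit_gk_of_le model A U g s h]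
  convert one_isLayer (n := n) using 1
  funext j
  exact dif_neg h

theorem Inst.ofCircuit_dir (h : t < d + 1) : (Inst.ofCircuit model A U g s).dir t = s ⟨t, h⟩ := by
  change dirAt s t = _
  exact dif_pos h

theorem Inst.ofCircuit_noisy (t : Fin d) :
    (Inst.ofCircuit model A U g s).noisy (t + 1) = noisyQubits A t model := by
  cases model
  · rfl
  simp [Inst.noisy, noisyQubits, Inst.ofCircuit]

theorem circuit_rep {ρ : QMat n} (hρ : ρ.IsHermitian) :
    Rep (circuit model A U g s ρ) fun P => fullTop (Inst.ofCircuit model A U g s).kg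
      (Inst.ofCircuit model A U g s).nk (expect ρ) d P := by
  set I := Inst.ofCircuit model A U g s with hI
  have key : ∀ k t, t + k = d → Rep (((List.finRange d).drop t).foldr
      (fun t σ => layerUnitary A U t * noise g (noisyQubits A t model) (s t.succ) σ
        * (layerUnitary A U t)ᴴ) ρ) fun P => full I.kg I.nk (expect ρ) t k P := by
    intro k
    induction k with
    | zero =>
      intro t ht
      rw [List.drop_eq_nil_of_le (by simp; omega)]
      exact fun P => (expect_coe hρ P).symm
    | succ k ih =>
      intro t ht
      have h : t < d := by omega
      rw [List.drop_eq_getElem_cons (by simpa using h), List.foldr_cons]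
      have h2 := ((ih (t + 1) (by omega)).noise g (noisyQubits A ⟨t, h⟩ model)
        (s (Fin.succ ⟨t, h⟩))).layer A U ⟨t, h⟩
      simp only [List.getElem_finRange, Fin.cast_mk]
      convert h2 using 2 with P
      rw [full, hI, Inst.ofCircuit_gk model A U g s h]
      refine sum_congr rfl fun R _ => ?_
      congr 1
      refine sum_congr rfl fun Q _ => ?_
      congr 1
      rw [Inst.nk, Inst.ofCircuit_noisy model A U g s ⟨t, h⟩]
      rw [Inst.ofCircuit_dir model A U g s (by omega)]
      rfl
  have h := (key d 0 (zero_add d)).noise g univ (s 0)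
  have e : I.nk 0 = siteK g univ (s 0) := by
    funext Q P
    rw [Inst.nk, Inst.ofCircuit_dir model A U g s (Nat.succ_pos d)]
    rfl
  unfold fullTop
  rw [e]
  exact h

theorem trace_circuit {ρ : QMat n} (hρ : ρ.IsHermitian) (hO : O.IsHermitian) :
    (circuit model A U g s ρ * O).trace = ((∑ P, coef O P *
      fullTop (Inst.ofCircuit model A U g s).kg (Inst.ofCircuit model A U g s).nk
        (expect ρ) d P : ℝ) : ℂ) := by
  have h := circuit_rep model A U g s hρ
  conv_lhs => rw [pauli_expansion_real hO]
  simp only [mul_sum, trace_sum, mul_smul_comm, trace_smul, smul_eq_mul]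
  push_cast
  exact sum_congr rfl fun P _ => by rw [h P]

theorem ensembleError_le {ρ : Fin N → QMat n} {c : ℝ} (hρ : IsLowAverage ρ c)
    (hO : O.IsHermitian) {T : Vec n → Vec n} (hT : ∀ P, Lin fun r => T r P) :
    ensembleError model A U g s O ρ (fun i => ∑ P, coef O P * T (expect (ρ i)) P) ≤
      c * qf (fun Z P => fullTop (Inst.ofCircuit model A U g s).kg
        (Inst.ofCircuit model A U g s).nk (delta Z) d P - T (delta Z) P) (coef O) := by
  set I := Inst.ofCircuit model A U g s
  have hL : Lin fun r => ∑ P, coef O P * (fullTop I.kg I.nk r d P - T r P) :=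
    Lin.sum _ _ fun P r => by
      have h1 : T r P = _ := hT P r
      have h2 : fullTop I.kg I.nk r d P = ∑ Z, r Z * fullTop I.kg I.nk (delta Z) d P :=
        Lin.sum _ _ (fun Q => full_lin d 0 Q) r
      rw [h1, h2, ← sum_sub_distrib]
      exact sum_congr rfl fun Z _ => by ring
  refine le_trans (le_of_eq ?_) (hρ.sum_sq_le _)
  rw [ensembleError]
  congr 1
  refine sum_congr rfl fun i _ => ?_
  rw [trace_circuit model A U g s (hρ.2.1 i).1.1 hO, ← Complex.ofReal_sub, Complex.norm_real,
    norm_eq_abs, sq_abs, ← neg_sq]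
  congr 1
  have := hL (expect (ρ i))
  simp only [mul_comm (expect (ρ i) _)] at this
  rw [← this, neg_sub, ← sum_sub_distrib]
  exact sum_congr rfl fun P _ => by ring

variable (O : QMat n) (w : Fin m → ℝ) (P : Fin m → Str n) (ρ : QMat n)

theorem tables_reads : Reads (tables A U s O w P ρ) (Inst.ofCircuit model A U g s) where
  part t ht j a h0 h1 := by
    have ht' : t < d := ht
    simp [tables, h0, h1, ht', Inst.ofCircuit]
  dir t ht j a h0 h1 := by
    have ht' : t < d + 1 := ht
    rw [Inst.ofCircuit_dir model A U g s ht']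
    simp [tables, h0, h1, Nat.lt_succ_iff.mp ht']
  gates t ht j k x y a h0 h1 h2 h3 h4 h5 := by
    have ht' : t < d := ht
    fin_cases k <;> simp [tables, h0, h1, h2, h3, h4, h5, ht', Inst.ofCircuit, entryVal]

theorem tables_readsTerms : ReadsTerms (tables A U s O w P ρ) n m
    (fun i => if h : i < m then w ⟨i, h⟩ else 0) (fun i => if h : i < m then P ⟨i, h⟩ else 0) where
  letter i hi j a h0 h1 := by simp [tables, h0, h1, hi]
  weight i hi a h0 := by simp [tables, h0, hi]

theorem sum_weights (hO : O = ∑ i, (w i : ℂ) • pauli (P i)) (h : Vec n) :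
    ∑ i, w i * h (P i) = ∑ Q, coef O Q * h Q := by
  have e : ∀ Q, coef O Q = ∑ i, if P i = Q then w i else 0 := by
    intro Q
    rw [coef, hO, sum_mul, trace_sum, sum_div, Complex.re_sum]
    refine sum_congr rfl fun i _ => ?_
    rw [smul_mul_assoc, trace_smul, trace_pauli_mul_pauli]
    split_ifs <;> simp
  simp only [e, sum_mul]
  rw [sum_comm]
  simp

end

/-! ## Twirling random gates -/

theorem sigma_mul_self (a : Fin 4) : sigma a * sigma a = 1 := by
  fin_cases a <;> ext i j <;> fin_cases i <;> fin_cases j <;>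
    simp [sigma, mul_apply, Fin.sum_univ_two]

theorem sigma_conj (a b : Fin 4) : sigma a * sigma b * sigma a = (sg a b : ℂ) • sigma b := by
  fin_cases a <;> fin_cases b <;> ext i j <;> fin_cases i <;> fin_cases j <;>
    simp [sigma, sg, mul_apply, Fin.sum_univ_two]

def pauliGate (a b : Fin 4) : TwoQubitGate := ⟨sigma a ⊗ₖ sigma b, by
    rw [mem_unitaryGroup_iff, star_eq_conjTranspose, kron_sigma_hermitian,
      ← mul_kronecker_mul, sigma_mul_self, sigma_mul_self, one_kronecker_one]⟩

theorem kron_sigma_conj (a b c e : Fin 4) : (sigma a ⊗ₖ sigma b) * (sigma c ⊗ₖ sigma e) *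
    (sigma a ⊗ₖ sigma b) = ((sg a c * sg b e : ℝ) : ℂ) • (sigma c ⊗ₖ sigma e) := by
  rw [← mul_kronecker_mul, ← mul_kronecker_mul, sigma_conj, sigma_conj,
    smul_kronecker, kronecker_smul, smul_smul]
  push_cast
  rfl

theorem ptm_pauliGate (W : TwoQubitGate) (a c b e : Fin 4 × Fin 4) :
    ptm (pauliGate a.1 a.2 * W * pauliGate c.1 c.2) b e =
      sg a.1 e.1 * sg a.2 e.2 * (sg c.1 b.1 * sg c.2 b.2) * ptm W b e := by
  set V := sigma a.1 ⊗ₖ sigma a.2 with hV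
  set V' := sigma c.1 ⊗ₖ sigma c.2 with hV'
  have h1 : ((pauliGate a.1 a.2 * W * pauliGate c.1 c.2 : TwoQubitGate) :
      Mat4) = V * W * V' := rfl
  have h2 : Vᴴ = V := kron_sigma_hermitian _ _
  have h3 : V'ᴴ = V' := kron_sigma_hermitian _ _
  have h4 := kron_sigma_conj a.1 a.2 e.1 e.2
  have h5 := kron_sigma_conj c.1 c.2 b.1 b.2
  rw [← hV] at h4
  rw [← hV'] at h5
  unfold ptm
  rw [h1]
  generalize sigma e.1 ⊗ₖ sigma e.2 = X at *
  generalize sigma b.1 ⊗ₖ sigma b.2 = Y at *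
  generalize (W : Mat4) = M at *
  have h6 : (((V * M * V')ᴴ * X * (V * M * V')) * Y).trace =
      (Mᴴ * (V * X * V) * M * (V' * Y * V')).trace := by
    rw [conjTranspose_mul, conjTranspose_mul, h2, h3]
    simp only [mul_assoc]
    rw [trace_mul_comm]
    simp only [mul_assoc]
  rw [h6, h4, h5]
  simp only [Matrix.mul_smul, Matrix.smul_mul, trace_smul, smul_eq_mul, Complex.re_ofReal_mul]
  ring

section

variable {N : ℕ}

def twirl (A : Architecture n d) (τ : Fin (d + 1) → Fin n → Fin 4 × Fin 4)
    (U : Gates n d) : Gates n d := fun t j =>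
  pauliGate (τ t.succ j).2 (τ t.succ (A.partner t j)).2 * U t j *
    pauliGate (τ t.succ j).1 (τ t.succ (A.partner t j)).1

theorem gateK_twirl (A : Architecture n d) (ω : Fin (d + 1) → Label n) (U : Gates n d)
    (t : Fin d) : gateK A (twirl A (fun t j => (ω t j).2) U) t =
      twistK (A.partner t) (gateK A U t) (ω t.succ) := by
  funext R P
  rw [twistK, prod_eq_prod_pairs (A.involutive t), gateK, gateK, ← prod_mul_distrib]
  refine prod_congr rfl fun j _ => ?_
  rcases lt_trichotomy j (A.partner t j) with h | h | h
  · have hi : A.partner t (A.partner t j) = j := A.involutive t j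
    simp only [h, h.ne, h.ne', hi, if_true, if_false]
    rw [twirl]
    rw [ptm_pauliGate _ ((ω t.succ j).2.2, (ω t.succ (A.partner t j)).2.2)
      ((ω t.succ j).2.1, (ω t.succ (A.partner t j)).2.1)]
    ring
  · simp [← h]
  simp [h.ne, h.not_gt]

theorem measurePreserving_twirl (A : Architecture n d) {ν : Fin d → Fin n → Measure TwoQubitGate}
    [∀ t j, IsProbabilityMeasure (ν t j)] (hν : ∀ t j, IsPauliInvariant (ν t j))
    (τ : Fin (d + 1) → Fin n → Fin 4 × Fin 4) :
    MeasurePreserving (twirl A τ) (gatesLaw ν) (gatesLaw ν) := by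
  refine measurePreserving_pi (fun t => Measure.pi fun j => ν t j)
    (fun t => Measure.pi fun j => ν t j)
    (f := fun t u j => pauliGate (τ t.succ j).2 (τ t.succ (A.partner t j)).2 * u j *
      pauliGate (τ t.succ j).1 (τ t.succ (A.partner t j)).1) (fun t => ?_)
  refine measurePreserving_pi (fun j => ν t j) (fun j => ν t j)
    (f := fun j W => pauliGate (τ t.succ j).2 (τ t.succ (A.partner t j)).2 * W *
      pauliGate (τ t.succ j).1 (τ t.succ (A.partner t j)).1) (fun j => ?_)
  have h1 := (hν t j (pauliGate (τ t.succ j).2 (τ t.succ (A.partner t j)).2) _ _ rfl).1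
  have h2 := (hν t j (pauliGate (τ t.succ j).1 (τ t.succ (A.partner t j)).1) _ _ rfl).2
  have m1 : ∀ V : TwoQubitGate, Measurable fun W : TwoQubitGate => V * W := fun V =>
    (continuous_const.mul continuous_id).measurable
  have m2 : ∀ V : TwoQubitGate, Measurable fun W : TwoQubitGate => W * V := fun V =>
    (continuous_id.mul continuous_const).measurable
  exact MeasurePreserving.comp (g := fun W => W * _) ⟨m2 _, h2⟩ ⟨m1 _, h1⟩

theorem avg_labels (f : (Fin (d + 1) → Fin n → Fin 4 × Fin 4) → Directions n d → ℝ) :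
    avg (fun τ => avg fun s => f τ s) = avg fun ω : Fin (d + 1) → Label n =>
      f (fun t j => (ω t j).2) fun t j => (ω t j).1 := by
  let e : (Fin (d + 1) → Label n) ≃ (Fin (d + 1) → Fin n → Fin 4 × Fin 4) × Directions n d :=
    ⟨fun ω => (fun t j => (ω t j).2, fun t j => (ω t j).1), fun x t j => (x.2 t j, x.1 t j),
      fun _ => rfl, fun _ => rfl⟩
  have h := Fintype.sum_equiv e (fun ω => f (fun t j => (ω t j).2) fun t j => (ω t j).1)
    (fun x => f x.1 x.2) fun _ => rfl
  have hc := Fintype.card_congr e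
  rw [Fintype.card_prod] at hc
  simp only [avg]
  rw [h, hc, Fintype.sum_prod_type, ← mul_sum]
  push_cast
  ring

theorem lintegral_le_of_avg {Ω ι : Type*} [MeasurableSpace Ω] [Fintype ι] [Nonempty ι]
    (μ : Measure Ω) [IsProbabilityMeasure μ] {T : ι → Ω → Ω}
    (hT : ∀ i, MeasurePreserving (T i) μ μ) {F : Ω → ℝ} (hF : ∀ x, 0 ≤ F x) {B : ℝ}
    (h : ∀ x, avg (fun i => F (T i x)) ≤ B) : ∫⁻ x, ENNReal.ofReal (F x) ∂μ ≤ ENNReal.ofReal B := by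
  have hc : (0 : ℝ) < Fintype.card ι := by exact_mod_cast Fintype.card_pos
  have h1 : ∀ s : Finset ι, ∑ _i ∈ s, ∫⁻ x, ENNReal.ofReal (F x) ∂μ ≤
      ∫⁻ x, ∑ i ∈ s, ENNReal.ofReal (F (T i x)) ∂μ := by
    classical
    intro s
    induction s using Finset.induction_on with
    | empty => simp
    | insert a s ha ih =>
      simp only [sum_insert ha]
      refine (add_le_add ?_ ih).trans (le_lintegral_add _ _)
      calc ∫⁻ x, ENNReal.ofReal (F x) ∂μ = ∫⁻ x, ENNReal.ofReal (F x) ∂(μ.map (T a)) := by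
            rw [(hT a).map_eq]
        _ ≤ _ := lintegral_map_le _ _
  have h2 : ∫⁻ x, ∑ i, ENNReal.ofReal (F (T i x)) ∂μ ≤ Fintype.card ι * ENNReal.ofReal B := by
    calc _ ≤ ∫⁻ _, Fintype.card ι * ENNReal.ofReal B ∂μ := by
          refine lintegral_mono fun x => ?_
          rw [← ENNReal.ofReal_sum_of_nonneg fun i _ => hF _, ← ENNReal.ofReal_natCast,
            ← ENNReal.ofReal_mul hc.le]
          refine ENNReal.ofReal_le_ofReal ?_
          have := h x
          rw [avg] at this
          field_simp at this
          linarith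
      _ = _ := by simp
  have h3 := (h1 univ).trans h2
  rw [sum_const, card_univ, nsmul_eq_mul] at h3
  exact (ENNReal.mul_le_mul_iff_right (by simp) (by simp)).mp h3

theorem random_error (A : Architecture n d) {ν : Fin d → Fin n → Measure TwoQubitGate}
    (hp : ∀ t j, IsProbabilityMeasure (ν t j)) (hν : ∀ t j, IsPauliInvariant (ν t j))
    {ε c : ℝ} (h0 : 0 < g) (h1 : g ≤ 4 / 7) (hO : IsNormalizedObservable O)
    {ρ : Fin N → QMat n} (hρ : IsLowAverage ρ c) {l L : ℕ}
    (hl : ∀ P : Str n, wt P ≤ L → wt P ≤ l) (hL : (1 - g / 2) ^ (L + 1) ≤ ε) (s₀ : Directions n d) :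
    ∫⁻ U, ENNReal.ofReal ((1 / (Fintype.card (Directions n d) : ℝ)) *
      ∑ s, ensembleError .uniform A U g (prescribe A s₀ s) O ρ (fun i => ∑ P, coef O P *
        truncTop (Inst.ofCircuit .uniform A U g (prescribe A s₀ s)).kg
          (Inst.ofCircuit .uniform A U g (prescribe A s₀ s)).nk (expect (ρ i)) d l L (L + 1) P))
      ∂(gatesLaw ν) ≤ ENNReal.ofReal ((sqrt c * ε) ^ 2) := by
  have : ∀ t, IsProbabilityMeasure (Measure.pi fun j => ν t j) := fun t => inferInstance
  have : IsProbabilityMeasure (gatesLaw ν) := by unfold gatesLaw; infer_instance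
  refine lintegral_le_of_avg _ (fun τ => measurePreserving_twirl A hν τ) (fun U => ?_) fun U => ?_
  · unfold ensembleError
    positivity
  have e := avg_labels fun τ s => ensembleError .uniform A (twirl A τ U) g (prescribe A s₀ s) O ρ
    (fun i => ∑ P, coef O P * truncTop
      (Inst.ofCircuit .uniform A (twirl A τ U) g (prescribe A s₀ s)).kg
      (Inst.ofCircuit .uniform A (twirl A τ U) g (prescribe A s₀ s)).nk (expect (ρ i)) d l L
        (L + 1) P)
  simp only [avg] at e ⊢
  rw [e]
  set I := Inst.ofCircuit .uniform A U g s₀ with hI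
  have hg : ∀ t, IsLayer (I.part t) (I.kg t) := Inst.ofCircuit_isLayer _ A U g s₀
  refine le_trans (avg_mono (g := fun ω : Fin (d + 1) → Label n => c * qf (fun Z P =>
    ∑ Q, mixN g I.part (dirAt s₀) ω 0 Q P * excess (twistG I.part I.kg ω)
      (mixN g I.part (dirAt s₀) ω) (delta Z) 0 d (L + 1 - wt P) Q) (coef O)) fun ω => ?_) ?_
  · set J := Inst.ofCircuit .uniform A (twirl A (fun t j => (ω t j).2) U) g
      (prescribe A s₀ fun t j => (ω t j).1) with hJ
    have hgJ : ∀ t, IsLayer (J.part t) (J.kg t) := Inst.ofCircuit_isLayer _ A _ g _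
    have e1 : J.kg = twistG I.part I.kg ω := by
      funext t
      rw [twistG]
      by_cases ht : t < d
      · rw [hJ, Inst.ofCircuit_gk _ A _ g _ ht, gateK_twirl, hI, Inst.ofCircuit_gk _ A _ g _ ht,
          Inst.ofCircuit_part _ A _ g _ ht, labelAt_eq ω (by omega)]
        rfl
      rw [hJ, Inst.ofCircuit_gk_of_le _ A _ g _ ht, hI, Inst.ofCircuit_gk_of_le _ A _ g _ ht]
      funext R P
      simp [twistK, Inst.ofCircuit, ht]
    have e2 : J.nk = mixN g I.part (dirAt s₀) ω := by
      funext t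
      rcases t with _ | t
      · funext Q R
        rw [Inst.nk, hJ, Inst.ofCircuit_dir _ A _ g _ (Nat.succ_pos d), mixN, mixK,
          labelAt_eq ω (Nat.succ_pos d)]
        simp [Inst.ofCircuit, Inst.noisy, prescribe]
      funext Q R
      have e3 : J.noisy (t + 1) = univ := rfl
      rw [Inst.nk, e3, mixN, mixK]
      refine congrArg (fun b => siteK g univ b Q R) ?_
      funext j
      by_cases ht : t < d
      · rw [hJ, Inst.ofCircuit_dir _ A _ g _ (by omega), labelAt_eq ω (by omega), hI,
          Inst.ofCircuit_part _ A _ g _ ht, dirAt, dif_pos (by omega)]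
        rfl
      have h2 : ¬ t + 1 < d + 1 := by omega
      simp [hJ, hI, Inst.ofCircuit, dirAt, labelAt, ht]
    refine (ensembleError_le .uniform A _ g _ hρ hO.1 fun P => truncTop_lin l L (L + 1) P).trans
      (le_of_eq ?_)
    rw [← e1, ← e2]
    congr 2
    funext Z P
    exact fullTop_sub_truncTop hgJ (noiseK_zero_right g J.noisy (prescribe A s₀ fun t j => (ω t j).1))
      _ (fun t k => full_zero hgJ J.noisy _ _ k t)
      (fun t k c b hb => budgeted_zero hgJ J.noisy _ _ k hb t c) hl P
  rw [avg_mul_left, mul_pow, sq_sqrt hρ.nonneg]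
  refine mul_le_mul_of_nonneg_left ?_ hρ.nonneg
  refine (avg_random_error h0 h1 hg _ L (coef O)).trans ?_
  rw [sum_coef_sq hO, mul_one, ← pow_mul, mul_comm, pow_mul]
  exact pow_le_pow_left₀ (pow_nonneg (by linarith) _) hL 2

end

/-! ## Parameters and running times -/

theorem exists_least_pow {q a B M : ℝ} (hq : 0 < q) (hq1 : q < 1) (ha : 0 < a) (hB : 0 < B)
    (hM : 0 ≤ M) (h : log a - log B ≤ M) : ∃ k : ℕ, (∀ j < k, B < a * q ^ (j + 1)) ∧
      a * q ^ (k + 1) ≤ B ∧ k * -log q ≤ M := by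
  have hex : ∃ k : ℕ, a * q ^ (k + 1) ≤ B := by
    obtain ⟨k, hk⟩ := exists_pow_lt_of_lt_one (div_pos hB ha) hq1
    refine ⟨k, ?_⟩
    rw [lt_div_iff₀' ha] at hk
    exact (mul_le_mul_of_nonneg_left (pow_le_pow_of_le_one hq.le hq1.le k.le_succ) ha.le).trans
      hk.le
  classical
  refine ⟨Nat.find hex, fun j hj => not_le.mp (Nat.find_min hex hj), Nat.find_spec hex, ?_⟩
  rcases hk : Nat.find hex with _ | j
  · simpa using hM
  have h1 := log_lt_log hB (not_le.mp (Nat.find_min hex (show j < _ by omega)))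
  rw [log_mul ha.ne' (by positivity), log_pow] at h1
  linarith

section

variable {ε : ℝ}

theorem strength_eq (g : ℝ) : strength g = -log (1 - g / 2) := by
  rw [strength, one_div, log_inv]

theorem strength_pos (h0 : 0 < g) (h1 : g ≤ 4 / 7) : 0 < strength g := by
  rw [strength_eq, neg_pos]
  exact log_neg (by linarith) (by linarith)

theorem strength_le (h0 : 0 < g) (h1 : g ≤ 4 / 7) : strength g ≤ 7 / 10 * g := by
  have h := log_le_sub_one_of_pos (x := 1 / (1 - g / 2)) (by
    have : 0 < 1 - g / 2 := by linarith
    positivity)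
  refine h.trans ?_
  rw [div_sub_one (by linarith), div_le_iff₀ (by linarith)]
  nlinarith

theorem log_strength (h0 : 0 < g) (h1 : g ≤ 4 / 7) : strength g ≤ log (1 / strength g) ∧
    log (2 / g) ≤ 2 * log (1 / strength g) := by
  have hp := strength_pos h0 h1
  have hl := strength_le h0 h1
  constructor
  · have := one_sub_inv_le_log_of_pos (one_div_pos.mpr hp)
    rw [one_div, inv_inv] at this
    rw [one_div]
    linarith
  rw [show (2 : ℝ) * log (1 / strength g) = log ((1 / strength g) ^ 2) by
    rw [log_pow]; norm_num]
  refine log_le_log (by positivity) ?_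
  rw [div_pow, div_le_div_iff₀ h0 (by positivity)]
  nlinarith

theorem exists_params (h0 : 0 < g) (h1 : g ≤ 4 / 7) (hε : 0 < ε) (hε1 : ε < 1) :
    ∃ K L l : ℕ, 0 ≤ log (1 / ε) * (log (1 / strength g) / strength g ^ 2) ∧
    (K : ℝ) ≤ 16 * (log (1 / ε) * (log (1 / strength g) / strength g ^ 2)) ∧
    (L : ℝ) ≤ 16 * (log (1 / ε) * (log (1 / strength g) / strength g ^ 2)) ∧
    (l : ℝ) ≤ 16 * (log (1 / ε) * (log (1 / strength g) / strength g ^ 2)) ∧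
    (l : ℝ) ≤ 4 * (log (1 / strength g) / strength g) + log (1 / ε) / strength g ∧
    (∀ Q n d m, Runs Q (.seq (blk setupP) paramsAll) (start n d m ε g) (4 * (K + L + l) + 23)
      (Ready n d m K L l g)) ∧ ∀ {n d : ℕ} {p : ℕ → Fin n → Fin n} {gk : ℕ → Ker n},
      (Layers p gk) → ∀ l', n ≤ l' ∨ l' = l → ∀ o : Vec n,
      avg (fun s : Directions n d => qf (fun Z P =>
        fullTop gk (𝒰 g s) (delta Z) d P
        - truncTop gk (𝒰 g s) (delta Z) d l' K (L + 1) P) o)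
      ≤ ε ^ 2 * ∑ P, o P ^ 2 := by
  have hγ := strength_pos h0 h1
  obtain ⟨hΛ, hg⟩ := log_strength h0 h1
  have hE : 0 < log (1 / ε) := log_pos (by rw [one_div]; exact (one_lt_inv₀ hε).mpr hε1)
  have hq : 0 < 1 - g / 2 := by linarith
  have hq1 : 1 - g / 2 < 1 := by linarith
  have hs := strength_eq g
  have hγ1 : strength g ≤ 1 := by linarith [strength_le h0 h1]
  have hlε : log (1 / ε) = -log ε := by rw [one_div, log_inv]
  generalize log (1 / strength g) = Λ at *
  generalize strength g = γ at *
  generalize log (1 / ε) = E at *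
  have hΛ0 : 0 < Λ := hγ.trans_le hΛ
  by_cases h : 1 - g / 2 ≤ ε
  · refine ⟨0, 0, 0, by positivity, ?_, ?_, ?_, ?_, fun Q n d m => (paramsAll_runs_of_le h).mono (by norm_num)
      fun _ h => h, fun hg l' _ o => (avg_uniform_error_of_budget_one h0 h1 hg _ _ o).trans ?_⟩
    · simp; positivity
    · simp; positivity
    · simp; positivity
    · simp; positivity
    gcongr
  rw [not_le] at h
  have hEγ : γ < E := by
    have := log_lt_log hε h
    linarith
  have h2ε : 0 < 1 - ε := by linarith
  have hη : 0 < ε * (1 - ε) / 2 := by positivity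
  have hlη : -log (ε * (1 - ε) / 2) ≤ E + 4 * Λ := by
    rw [log_div (by positivity) (by norm_num), log_mul hε.ne' h2ε.ne']
    have a1 := log_lt_log (by positivity) (show g / 2 < 1 - ε by linarith)
    have a2 := log_le_log (by norm_num) (show 2 ≤ 2 / g by
      rw [le_div_iff₀ h0]; linarith)
    have a3 : log (g / 2) = -log (2 / g) := by rw [← log_inv, inv_div]
    linarith
  obtain ⟨K, hK, hK', hK1⟩ := exists_least_pow (B := ε ^ 2) (M := 2 * E) hq hq1 one_pos
    (by positivity) (by positivity) (by rw [log_one, log_pow]; push_cast; linarith)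
  obtain ⟨L, hL, hL', hL1⟩ := exists_least_pow (B := (ε * (1 - ε) / 2) ^ 2)
    (a := (2 / g) ^ (K + 1)) (M := (K + 1) * (2 * Λ) + 2 * (E + 4 * Λ)) hq hq1 (by positivity)
    (by positivity) (by positivity) (by
      rw [log_pow, log_pow]
      have := mul_le_mul_of_nonneg_left hg (show (0 : ℝ) ≤ K + 1 by positivity)
      push_cast
      linarith)
  obtain ⟨l, hl, hl', hl1⟩ := exists_least_pow (B := ε * (1 - ε) / 2) (M := E + 4 * Λ) hq hq1
    one_pos hη (by positivity) (by rw [log_one]; linarith)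
  rw [← hs] at hK1 hL1 hl1
  simp only [one_mul] at hK hK' hl hl'
  have b1 : γ * E ≤ Λ * E := mul_le_mul_of_nonneg_right hΛ hE.le
  have b2 : γ * Λ ≤ Λ * E := by nlinarith
  have b3 : γ * (γ * Λ) ≤ Λ * E := (mul_le_of_le_one_left (by positivity) hγ1).trans b2
  refine ⟨K, L, l, by positivity, ?_, ?_, ?_, ?_, fun Q n d m => paramsAll_runs h hK hK' hL hL' hl hl',
    fun hg l' hl'' o => (avg_uniform_error h0 h1 hg (Nat.succ_ne_zero L) (α := ε ^ 2)
      (β := ε * (1 - ε) / 2) (γ := ε * (1 - ε) / 2) (by positivity) hη hη hK' ?_ hL' o).trans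
      (le_of_eq (by ring))⟩
  · rw [← mul_div_assoc, ← mul_div_assoc, le_div_iff₀ (by positivity)]
    nlinarith
  · rw [← mul_div_assoc, ← mul_div_assoc, le_div_iff₀ (by positivity)]
    have b4 := mul_le_mul_of_nonneg_right hL1 hγ.le
    have b5 := mul_le_mul_of_nonneg_right hK1 hΛ0.le
    nlinarith
  · rw [← mul_div_assoc, ← mul_div_assoc, le_div_iff₀ (by positivity)]
    nlinarith
  · rw [← mul_div_assoc, ← add_div, le_div_iff₀ hγ]
    linarith
  rcases hl'' with h5 | rfl
  exacts [.inl h5, .inr hl']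

theorem exists_random_param (h0 : 0 < g) (h1 : g ≤ 4 / 7) (hε : 0 < ε) (hε1 : ε < 1) :
    ∃ L : ℕ, (L : ℝ) ≤ 1 / strength g * log (1 / ε) ∧ (1 - g / 2) ^ (L + 1) ≤ ε ∧
    ∀ Q n d m, Runs Q (.seq (blk setupP) paramsRandom) (start n d m ε g) (4 * L + 13)
      (Ready n d m L L L g) := by
  have hγ := strength_pos h0 h1
  have hlε : log (1 / ε) = -log ε := by rw [one_div, log_inv]
  have hE := log_neg hε hε1
  obtain ⟨L, hL, hL', hL1⟩ := exists_least_pow (q := 1 - g / 2) (B := ε) (M := -log ε)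
    (by linarith) (by linarith) one_pos hε (by linarith) (by rw [log_one]; linarith)
  simp only [one_mul] at hL hL'
  refine ⟨L, ?_, hL', fun Q n d m => paramsRandom_runs hL hL'⟩
  rw [hlε, one_div, inv_mul_eq_div, le_div_iff₀ hγ, strength_eq]
  exact hL1

theorem pow_le_exp {L : ℕ} {Y : ℝ} (h : (L : ℝ) ≤ Y) : (62 : ℝ) ^ L ≤ exp (5 * Y) := by
  have h2 : (62 : ℝ) ≤ exp 5 := by
    have := add_one_le_exp (1 : ℝ)
    have h3 : exp 5 = exp 1 ^ 5 := by rw [← exp_nat_mul]; norm_num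
    have h4 := exp_one_gt_d9
    rw [h3]
    calc (62 : ℝ) ≤ 2.5 ^ 5 := by norm_num
      _ ≤ _ := by gcongr; linarith
  calc (62 : ℝ) ^ L ≤ exp 5 ^ L := by gcongr
    _ = exp (L * 5) := by rw [← exp_nat_mul]
    _ ≤ _ := exp_le_exp.mpr (by linarith)

theorem rpow_inv_eq (hε : 0 < ε) (y : ℝ) : (1 / ε) ^ y = exp (log (1 / ε) * y) :=
  rpow_def_of_pos (by positivity) y

end

section

variable {N : ℕ} {model : NoiseModel} {A : Architecture n d} {U : Gates n d} {ε c : ℝ}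

theorem rms_le {ρ : Fin N → QMat n} (hρ : IsLowAverage ρ c) (hO : IsNormalizedObservable O)
    (hε : 0 < ε) {T : Directions n d → Vec n → Vec n} (hT : ∀ s P, Lin fun r => T s r P)
    (h : avg (fun s => qf (fun Z P => fullTop (Inst.ofCircuit model A U g s).kg
      (Inst.ofCircuit model A U g s).nk (delta Z) d P - T s (delta Z) P) (coef O)) ≤
      ε ^ 2 * ∑ P, coef O P ^ 2) :
    sqrt ((1 / (Fintype.card (Directions n d) : ℝ)) * ∑ s, ensembleError model A U g s O ρ
      fun i => ∑ P, coef O P * T s (expect (ρ i)) P) ≤ sqrt c * ε := by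
  rw [sqrt_le_left (by positivity), mul_pow, sq_sqrt hρ.nonneg]
  refine (avg_mono fun s => ensembleError_le model A U g s hρ hO.1 (hT s)).trans ?_
  rw [avg_mul_left]
  rw [sum_coef_sq hO, mul_one] at h
  exact mul_le_mul_of_nonneg_left h hρ.nonneg

theorem Runs.computes {p : Program} {k : ℕ} {r T : ℝ}
    (h : Runs Q p σ k fun τ => τ.R 0 = r) (hT : (k : ℝ) ≤ T) : Computes p Q σ T r := by
  obtain ⟨τ, k', h1, h2, h3⟩ := h
  exact ⟨τ, k', h1, le_trans (by exact_mod_cast h2) hT, h3⟩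

theorem uniform_nk (s : Directions n d) : (Inst.ofCircuit .uniform A U g s).nk = 𝒰 g s := by
  funext t
  cases t <;> rfl

theorem terms_computes {params : Program} {T₁ K L l : ℕ} {w : Fin m → ℝ} {P : Fin m → Str n}
    {T : ℝ} (s : Directions n d) (ρ : QMat n) (hn : 1 ≤ n) (hO : O = ∑ i, (w i : ℂ) • pauli (P i))
    (h1 : ∀ Q, Runs Q (.seq (blk setupP) params) (start n d m ε g) T₁ (Ready n d m K L l g))
    (hT : (T₁ + ((40 * n * m + 1) + (m * (stepCost * 62 ^ L) + 3)) : ℝ) ≤ T) :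
    Computes (uniformP params pushTermsP) (tables A U s O w P ρ) (start n d m ε g) T
      (∑ R, coef O R * truncTop (Inst.ofCircuit .uniform A U g s).kg
        (Inst.ofCircuit .uniform A U g s).nk (expect ρ) d n K (L + 1) R) := by
  have h := uniformP_runs (l := l) (tables_reads .uniform A U g s O w P ρ) rfl
    (o := coef O) (r := expect ρ) (fun _ => rfl) (fun _ => rfl)
    (fun t k c b hb => budgeted_zero (Inst.ofCircuit_isLayer .uniform A U g s) _ s _ k hb t c)
    (h1 _) fun τ hτ => pushTermsP_runs (tables_readsTerms A U s O w P ρ) hn hτ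
  rw [← sum_weights O w P hO fun R => truncTop (Inst.ofCircuit .uniform A U g s).kg
    (Inst.ofCircuit .uniform A U g s).nk (expect ρ) d n K (L + 1) R]
  refine Runs.computes (h.mono le_rfl fun τ hτ => hτ.trans ?_) (le_trans (by push_cast; rfl) hT)
  rw [sum_range]
  exact sum_congr rfl fun i _ => by simp [Inst.ofCircuit]

theorem enum_computes {params : Program} {T₁ K L l : ℕ} {w : Fin m → ℝ} {P : Fin m → Str n}
    {T : ℝ} (s : Directions n d) (ρ : QMat n) (hn : 1 ≤ n)
    (h1 : ∀ Q, Runs Q (.seq (blk setupP) params) (start n d m ε g) T₁ (Ready n d m K L l g))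
    (hT : (T₁ + (17 + (stepCost * (2 * 62 ^ L * (exp 7 * n ^ l)) + 3)) : ℝ) ≤ T) :
    Computes (uniformP params pushEnumP) (tables A U s O w P ρ) (start n d m ε g) T
      (∑ R, coef O R * truncTop (Inst.ofCircuit .uniform A U g s).kg
        (Inst.ofCircuit .uniform A U g s).nk (expect ρ) d l K (L + 1) R) := by
  have h := uniformP_runs (l := l) (tables_reads .uniform A U g s O w P ρ) rfl
    (o := coef O) (r := expect ρ) (fun _ => rfl) (fun _ => rfl)
    (fun t k c b hb => budgeted_zero (Inst.ofCircuit_isLayer .uniform A U g s) _ s _ k hb t c)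
    (h1 _) fun τ hτ => pushEnumP_runs hτ
  refine h.computes (le_trans ?_ hT)
  have := tail_le 7 hn l
  push_cast at this ⊢
  gcongr

end

section

variable {N : ℕ} {A : Architecture n d} {U : Gates n d} {ε : ℝ}

theorem lowWeight_zero {nk : ℕ → Ker n}
    (hg : Layers p gk) (hn : ∀ t Q, nk t Q 0 = if Q = 0 then 1 else 0)
    (r : Vec n) (κ k : ℕ) : ∀ t, lowWeight gk nk r κ t k 0 = r 0 := by
  induction k with
  | zero => intro t; rfl
  | succ k ih =>
    intro t
    rw [lowWeight, sum_eq_single 0 (fun R _ hR => by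
      rw [(hg t).zero_right, if_neg hR, zero_mul]) (by simp)]
    simp [(hg t).zero_right, hn, (wt_eq_zero.mpr rfl : wt (0 : Str n) = 0), ih]

theorem exists_cap (n d : ℕ) (h0 : 0 < g) (h1 : g ≤ 4 / 7) (hε : 0 < ε) (hε1 : ε < 1) :
    ∃ κ ≤ n, (∀ j < κ, ε ^ 2 < (d + 1) * ((1 - g / 2) ^ 2) ^ (j + 2)) ∧
    (κ = n ∨ (d + 1) * ((1 - g / 2) ^ 2) ^ (κ + 2) ≤ ε ^ 2) ∧
    (0 < κ → (κ : ℝ) ≤ 1 / strength g * log (sqrt (d + 1) / ε) - 1) := by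
  classical
  have hex : ∃ k, n ≤ k ∨ (d + 1) * ((1 - g / 2) ^ 2) ^ (k + 2) ≤ ε ^ 2 := ⟨n, .inl le_rfl⟩
  have hmin : ∀ j < Nat.find hex, ε ^ 2 < (d + 1) * ((1 - g / 2) ^ 2) ^ (j + 2) := fun j hj =>
    not_le.mp fun h => Nat.find_min hex hj (.inr h)
  have hle := Nat.find_min' hex (.inl le_rfl)
  have key : ∀ κ : ℕ, 0 < κ → ε ^ 2 < (d + 1) * ((1 - g / 2) ^ 2) ^ (κ - 1 + 2) →
      (κ : ℝ) ≤ 1 / strength g * log (sqrt (d + 1) / ε) - 1 := by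
    intro κ hp h
    have h2 := log_lt_log (by positivity) h
    have hq : 0 < 1 - g / 2 := by linarith
    have hs : 0 < sqrt (d + 1) := by positivity
    rw [← sq_sqrt (show (0 : ℝ) ≤ d + 1 by positivity), log_mul (by positivity)
      (by positivity), ← pow_mul, log_pow, log_pow, log_pow,
      show 2 * (κ - 1 + 2) = 2 * (κ + 1) by omega] at h2
    rw [le_sub_iff_add_le, one_div, inv_mul_eq_div, le_div_iff₀ (strength_pos h0 h1), strength_eq,
      log_div hs.ne' hε.ne']
    push_cast at h2
    linarith
  exact ⟨Nat.find hex, hle, hmin, (Nat.find_spec hex).imp (le_antisymm hle) id,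
    fun hp => key _ hp (hmin _ (by omega))⟩

theorem one_le_cap_exponent (hd : 1 ≤ d) (h0 : 0 < g) (h1 : g ≤ 4 / 7) (hε : 0 < ε)
    (hε1 : ε < 1) : 1 ≤ 1 / strength g * log (sqrt (d + 1) / ε) := by
  have hq : 0 < 1 - g / 2 := by linarith
  have hd' : (1 : ℝ) ≤ d := by exact_mod_cast hd
  rw [one_div, inv_mul_eq_div, one_le_div (strength_pos h0 h1), strength]
  refine log_le_log (by positivity) ?_
  have h2 : (7 / 5 : ℝ) ≤ sqrt (d + 1) := le_sqrt_of_sq_le (by norm_num; linarith)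
  have h3 : 1 / (1 - g / 2) ≤ 7 / 5 := by
    rw [div_le_iff₀ hq]
    linarith
  exact h3.trans (h2.trans ((le_div_iff₀ hε).mpr (mul_le_of_le_one_right (by positivity) hε1.le)))

theorem table_computes {κ : ℕ} {w : Fin m → ℝ} {P : Fin m → Str n} {T : ℝ} (s : Directions n d)
    {ρ : QMat n} (hρ : ρ.trace = 1) (hn : 1 ≤ n) (hd : 1 ≤ d) (hκ : κ ≤ n)
    (h1 : ∀ j < κ, ε ^ 2 < (d + 1) * ((1 - g / 2) ^ 2) ^ (j + 2))
    (h2 : κ = n ∨ (d + 1) * ((1 - g / 2) ^ 2) ^ (κ + 2) ≤ ε ^ 2)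
    (hT : (if κ = 0 then 18 else 17 * n + 32 +
      (stepCost * (4 * (exp 129796 * n ^ κ)) + 26) * (d + 1) : ℝ) ≤ T) :
    Computes tableP (tables A U s O w P ρ) (start n d m ε g) T
      (∑ R, coef O R * lowTop (Inst.ofCircuit .gateBased A U g s).kg
        (Inst.ofCircuit .gateBased A U g s).nk (expect ρ) d κ R) := by
  set I := Inst.ofCircuit .gateBased A U g s with hI
  have h := tableP_runs (m := m) (tables_reads .gateBased A U g s O w P ρ) rfl
    (o := coef O) (r := expect ρ) (fun _ => rfl) (fun _ => rfl) hn hκ h1 h2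
  refine Runs.computes (h.mono le_rfl fun τ hτ => hτ.trans ?_) (le_trans ?_ hT)
  · split_ifs with h0
    · subst h0
      have hz : ∀ Q, I.nk 0 Q 0 = if Q = 0 then 1 else 0 := noiseK_zero_right g I.noisy s 0
      have hr : expect ρ (0 : Str n) = 1 := by
        have : pauli (0 : Str n) = 1 := by
          ext x y
          simp [pauli, sigma, Matrix.one_apply, prod_ite_zero, funext_iff]
        rw [expect, this, mul_one, hρ, Complex.one_re]
      rw [sum_eq_single 0 (fun R _ hR => by
        rw [lowTop, if_neg (by have := wt_pos hR; omega), mul_zero]) (by simp), lowTop,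
        if_pos (wt_eq_zero.mpr rfl).le]
      simp only [hz, ite_mul, one_mul, zero_mul, sum_ite_eq', mem_univ, if_true]
      rw [lowWeight_zero (gk := I.kg) (nk := I.nk) (Inst.ofCircuit_isLayer .gateBased A U g s)
        (noiseK_zero_right g I.noisy s), hr, mul_one]
    refine (tabs_last hd).trans (sum_congr rfl fun R _ => ?_)
    rw [lowTop]
    split_ifs
    · rfl
    rw [mul_zero]
  have := tail_le 129796 hn κ
  split_ifs
  · norm_num
  push_cast [passCost] at this ⊢
  have e : (((Inst.ofCircuit .gateBased A U g s).d : ℕ) : ℝ) = d := rfl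
  rw [e]
  gcongr

theorem gateBased_error (h0 : 0 < g) (h1 : g ≤ 4 / 7) (hd : 1 ≤ d) {κ : ℕ}
    (h2 : κ = n ∨ (d + 1) * ((1 - g / 2) ^ 2) ^ (κ + 2) ≤ ε ^ 2) (o : Vec n) :
    avg (fun s => qf (fun Z P => fullTop (Inst.ofCircuit .gateBased A U g s).kg
      (Inst.ofCircuit .gateBased A U g s).nk (delta Z) d P -
      lowTop (Inst.ofCircuit .gateBased A U g s).kg
      (Inst.ofCircuit .gateBased A U g s).nk (delta Z) d κ P) o) ≤ ε ^ 2 * ∑ P, o P ^ 2 := by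
  have hn : 0 ≤ ∑ P, o P ^ 2 := sum_nonneg fun _ _ => sq_nonneg _
  rcases h2 with rfl | h2
  · simp only [lowTop_of_le, sub_self]
    simp only [qf, mul_zero, sum_const_zero, ne_eq, OfNat.ofNat_ne_zero, not_false_eq_true,
      zero_pow, avg_const]
    positivity
  set I := Inst.ofCircuit .gateBased A U g 0 with hI
  refine (avg_gateBased_error (S := I.noisy) h0 h1 (Inst.ofCircuit_isLayer .gateBased A U g 0)
    hd (fun t j ht => ?_) rfl κ o).trans (mul_le_mul_of_nonneg_right h2 hn)
  simp [I, Inst.noisy, Inst.ofCircuit, ht]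

end

section

variable {L T₁ : ℕ} {Y : ℝ}

theorem terms_bound (hn : 1 ≤ n) (hm : 1 ≤ m) (hY : 0 ≤ Y) (hT : (T₁ : ℝ) ≤ 192 * Y + 23)
    (hL : (L : ℝ) ≤ 16 * Y) {C : ℝ} (hC : C = 500 + stepCost) :
    (T₁ + ((40 * n * m + 1) + (m * (stepCost * 62 ^ L) + 3)) : ℝ) ≤
      C * ((n : ℝ) * m) ^ C * exp (C * Y) := by
  have hn' : (1 : ℝ) ≤ n := by exact_mod_cast hn
  have hm' : (1 : ℝ) ≤ m := by exact_mod_cast hm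
  have hs : (0 : ℝ) ≤ stepCost := Nat.cast_nonneg _
  have hX := pow_le_exp hL
  have hX1 := add_one_le_exp (5 * (16 * Y))
  have hXC : exp (5 * (16 * Y)) ≤ exp (C * Y) := exp_le_exp.mpr (by nlinarith)
  have hnm : (1 : ℝ) ≤ n * m := one_le_mul_of_one_le_of_one_le hn' hm'
  have hma : (m : ℝ) ≤ n * m := le_mul_of_one_le_left (by positivity) hn'
  have hp : (n * m : ℝ) ≤ (n * m : ℝ) ^ C := self_le_rpow_of_one_le hnm (by linarith)
  generalize exp (5 * (16 * Y)) = X at *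
  have hX0 : 1 ≤ X := by linarith
  have h1 : X ≤ n * m * X := le_mul_of_one_le_left (by linarith) hnm
  have h2 : (n * m : ℝ) ≤ n * m * X := le_mul_of_one_le_right (by positivity) hX0
  have h3 : (m : ℝ) * (stepCost * 62 ^ L) ≤ n * m * (stepCost * X) := by gcongr
  calc _ ≤ C * (n * m * X) := by
        rw [hC]
        linarith
    _ ≤ C * ((n : ℝ) * m) ^ C * exp (C * Y) := by
        rw [mul_assoc C]
        have : 0 ≤ C := by linarith
        gcongr

theorem enum_bound {l : ℕ} {B : ℝ} (hB : (n : ℝ) ^ l ≤ B) (hB1 : 1 ≤ B) (hY : 0 ≤ Y)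
    (hT : (T₁ : ℝ) ≤ 192 * Y + 23) (hL : (L : ℝ) ≤ 16 * Y) {C : ℝ}
    (hC : C = 500 + 2 * stepCost * exp 7) :
    (T₁ + (17 + (stepCost * (2 * 62 ^ L * (exp 7 * n ^ l)) + 3)) : ℝ) ≤ C * B * exp (C * Y) := by
  have hs : (0 : ℝ) ≤ stepCost := Nat.cast_nonneg _
  have hX := pow_le_exp hL
  have hX1 := add_one_le_exp (5 * (16 * Y))
  have h7 : 0 ≤ 2 * stepCost * exp 7 := by positivity
  have hXC : exp (5 * (16 * Y)) ≤ exp (C * Y) := exp_le_exp.mpr (by nlinarith)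
  generalize exp (5 * (16 * Y)) = X at *
  have hX0 : 0 ≤ X := by linarith
  have h1 : X ≤ B * X := le_mul_of_one_le_left (by linarith) hB1
  have h3 : stepCost * (2 * 62 ^ L * (exp 7 * n ^ l)) ≤
      stepCost * (2 * X * (exp 7 * B)) := by gcongr
  calc _ ≤ C * (B * X) := by
        rw [hC]
        linarith
    _ ≤ C * B * exp (C * Y) := by
        rw [mul_assoc C]
        have : 0 ≤ C := by linarith
        gcongr

theorem table_bound {κ : ℕ} {B : ℝ} (hn : 1 ≤ n) (hd : 1 ≤ d) (hB1 : 1 ≤ B)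
    (hB : 0 < κ → (n : ℝ) ^ κ ≤ B) : (if κ = 0 then 18 else 17 * n + 32 +
      (stepCost * (4 * (exp 129796 * n ^ κ)) + 26) * (d + 1) : ℝ) ≤
      (200 + 8 * stepCost * exp 129796) * (d * B) := by
  have hn' : (1 : ℝ) ≤ n := by exact_mod_cast hn
  have hd' : (1 : ℝ) ≤ d := by exact_mod_cast hd
  have hs : 0 ≤ stepCost * exp 129796 := by positivity
  generalize exp 129796 = e at *
  have h1 : B ≤ d * B := le_mul_of_one_le_left (by linarith) hd'
  split_ifs with h
  · nlinarith
  have h2 := hB (by omega)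
  have h3 : (n : ℝ) ≤ n ^ κ := le_self_pow₀ hn' h
  have h4 : (stepCost * (4 * (e * n ^ κ)) + 26) * (d + 1) ≤
      (4 * (stepCost * e) * B + 26 * B) * (2 * d) := by
    have h5 : stepCost * (4 * (e * n ^ κ)) ≤ 4 * (stepCost * e) * B := by
      have := mul_le_mul_of_nonneg_left h2 (show 0 ≤ 4 * (stepCost * e) by linarith)
      linarith
    refine mul_le_mul ?_ ?_ ?_ ?_
    · linarith
    · linarith
    · linarith
    have := mul_nonneg hs (show 0 ≤ B by linarith)
    linarith
  linarith

theorem one_le_terms (hO : IsNormalizedObservable O) {w : Fin m → ℝ}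
    {P : Fin m → Str n} (h : O = ∑ i, (w i : ℂ) • pauli (P i)) : 1 ≤ m := by
  by_contra hm
  obtain rfl : m = 0 := by omega
  have h2 := hO.2
  rw [h] at h2
  simp at h2

theorem uniform_rms_le {N K l : ℕ} {A : Architecture n d} {U : Gates n d} {ε c : ℝ}
    {ρ : Fin N → QMat n} (hρ : IsLowAverage ρ c) (hO : IsNormalizedObservable O)
    (hε : 0 < ε) (h : ∀ {p : ℕ → Fin n → Fin n} {gk : ℕ → Ker n},
      (Layers p gk) → ∀ o : Vec n, avg (fun s : Directions n d => qf (fun Z P =>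
        fullTop gk (𝒰 g s) (delta Z) d P
        - truncTop gk (𝒰 g s) (delta Z) d l K (L + 1) P) o)
      ≤ ε ^ 2 * ∑ P, o P ^ 2) :
    sqrt ((1 / (Fintype.card (Directions n d) : ℝ)) *
      ∑ s, ensembleError .uniform A U g s O ρ fun i => ∑ R, coef O R *
        truncTop (Inst.ofCircuit .uniform A U g s).kg (Inst.ofCircuit .uniform A U g s).nk
          (expect (ρ i)) d l K (L + 1) R) ≤ sqrt c * ε := by
  refine rms_le (T := fun s r => truncTop (Inst.ofCircuit .uniform A U g s).kg
    (Inst.ofCircuit .uniform A U g s).nk r d l K (L + 1)) hρ hO hε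
    (fun s P => truncTop_lin _ _ _ P) ?_
  simp only [uniform_nk]
  exact h (Inst.ofCircuit_isLayer .uniform A U g 0) (coef O)

theorem gateBased_rms_le {N κ : ℕ} {A : Architecture n d} {U : Gates n d} {ε c : ℝ}
    {ρ : Fin N → QMat n} (hρ : IsLowAverage ρ c) (hO : IsNormalizedObservable O)
    (h0 : 0 < g) (h1 : g ≤ 4 / 7) (hd : 1 ≤ d) (hε : 0 < ε)
    (h2 : κ = n ∨ (d + 1) * ((1 - g / 2) ^ 2) ^ (κ + 2) ≤ ε ^ 2) :
    sqrt ((1 / (Fintype.card (Directions n d) : ℝ)) *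
      ∑ s, ensembleError .gateBased A U g s O ρ fun i => ∑ R, coef O R *
        lowTop (Inst.ofCircuit .gateBased A U g s).kg (Inst.ofCircuit .gateBased A U g s).nk
          (expect (ρ i)) d κ R) ≤ sqrt c * ε :=
  rms_le (T := fun s r => lowTop (Inst.ofCircuit .gateBased A U g s).kg
    (Inst.ofCircuit .gateBased A U g s).nk r d κ) hρ hO hε
    (fun _ P => lowTop_lin κ P) (gateBased_error h0 h1 hd h2 _)

end

end

end NoisyCircuit

open NoisyCircuit in
theorem mainTheorem7 :
    -- uniform noise, arbitrary gates, observables given as a sum of `m` weighted Pauli strings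
    (∃ (p : Program) (C : ℝ), 0 < C ∧
      ∀ (n d m N : ℕ) (A : Architecture n d) (U : Gates n d) (g ε c : ℝ) (O : QMat n)
        (w : Fin m → ℝ) (P : Fin m → Fin n → Fin 4) (ρ : Fin N → QMat n),
        1 ≤ n → 0 < g → g ≤ 4 / 7 → 0 < ε → ε < 1 →
        IsNormalizedObservable O → O = ∑ i, (w i : ℂ) • pauli (P i) → IsLowAverage ρ c →
        Solves p .uniform A U g O w P ρ ε
          (C * ((n : ℝ) * m) ^ C *
            (1 / ε) ^ (C * (Real.log (1 / strength g) / strength g ^ 2)))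
          (Real.sqrt c * ε)) ∧
    -- uniform noise, arbitrary gates, arbitrary observables
    (∃ (p : Program) (C : ℝ), 0 < C ∧
      ∀ (n d N : ℕ) (A : Architecture n d) (U : Gates n d) (g ε c : ℝ) (O : QMat n)
        (ρ : Fin N → QMat n),
        1 ≤ n → 0 < g → g ≤ 4 / 7 → 0 < ε → ε < 1 →
        IsNormalizedObservable O → IsLowAverage ρ c →
        Solves p .uniform A U g O (fun i : Fin 0 => i.elim0) (fun i => i.elim0) ρ ε
          (C * (n : ℝ) ^ (C * (Real.log (1 / strength g) / strength g)
              + C * (Real.log (1 / ε) / strength g)) *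
            (1 / ε) ^ (C * (Real.log (1 / strength g) / strength g ^ 2)))
          (Real.sqrt c * ε)) ∧
    -- gate-based noise, arbitrary gates, arbitrary observables
    (∃ (p : Program) (C : ℝ), 0 < C ∧
      ∀ (n d N : ℕ) (A : Architecture n d) (U : Gates n d) (g ε c : ℝ) (O : QMat n)
        (ρ : Fin N → QMat n),
        1 ≤ n → 1 ≤ d → 0 < g → g ≤ 4 / 7 → 0 < ε → ε < 1 →
        IsNormalizedObservable O → IsLowAverage ρ c →
        Solves p .gateBased A U g O (fun i : Fin 0 => i.elim0) (fun i => i.elim0) ρ ε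
          (C * (d * (n : ℝ) ^
            (1 / strength g * Real.log (Real.sqrt (d + 1) / ε) - 1)))
          (Real.sqrt c * ε)) ∧
    -- uniform noise, random gates, observables given as a sum of `m` weighted Pauli strings
    (∃ (p : Program) (C : ℝ), 0 < C ∧
      ∀ (n d m N : ℕ) (A : Architecture n d) (ν : Fin d → Fin n → Measure TwoQubitGate)
        (g ε c : ℝ) (O : QMat n) (w : Fin m → ℝ) (P : Fin m → Fin n → Fin 4)
        (ρ : Fin N → QMat n),
        (∀ t j, IsProbabilityMeasure (ν t j)) → (∀ t j, IsPauliInvariant (ν t j)) →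
        1 ≤ n → 0 < g → g ≤ 4 / 7 → 0 < ε → ε < 1 →
        IsNormalizedObservable O → O = ∑ i, (w i : ℂ) • pauli (P i) → IsLowAverage ρ c →
        SolvesRandom p A ν g O w P ρ ε
          (C * ((n : ℝ) * m) ^ C * (1 / ε) ^ (C / strength g))
          (Real.sqrt c * ε)) ∧
    -- uniform noise, random gates, arbitrary observables
    (∃ (p : Program) (C : ℝ), 0 < C ∧
      ∀ (n d N : ℕ) (A : Architecture n d) (ν : Fin d → Fin n → Measure TwoQubitGate)
        (g ε c : ℝ) (O : QMat n) (ρ : Fin N → QMat n),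
        (∀ t j, IsProbabilityMeasure (ν t j)) → (∀ t j, IsPauliInvariant (ν t j)) →
        1 ≤ n → 0 < g → g ≤ 4 / 7 → 0 < ε → ε < 1 →
        IsNormalizedObservable O → IsLowAverage ρ c →
        SolvesRandom p A ν g O (fun i : Fin 0 => i.elim0) (fun i => i.elim0) ρ ε
          (C * ((n : ℝ) ^ (1 / strength g * Real.log (1 / ε)) *
            (1 / ε) ^ (C / strength g)))
          (Real.sqrt c * ε)) := by
  have hs0 : (0 : ℝ) ≤ stepCost := Nat.cast_nonneg _
  refine ⟨⟨uniformP paramsAll pushTermsP, 500 + stepCost, by positivity, ?_⟩,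
    ⟨uniformP paramsAll pushEnumP, 500 + 2 * stepCost * Real.exp 7, by positivity, ?_⟩,
    ⟨tableP, 200 + 8 * stepCost * Real.exp 129796, by positivity, ?_⟩,
    ⟨uniformP paramsRandom pushTermsP, 500 + stepCost, by positivity, ?_⟩,
    ⟨uniformP paramsRandom pushEnumP, 500 + 2 * stepCost * Real.exp 7, by positivity, ?_⟩⟩
  · intro n d m N A U g ε c O w P ρ hn h0 h1 hε hε1 hO hOw hρ
    obtain ⟨K, L, l, hY, hK, hL, hl, -, hruns, herr⟩ := exists_params h0 h1 hε hε1
    refine ⟨_, fun s i => terms_computes s (ρ i) hn hOw (fun Q => hruns Q n d m) ?_,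
      uniform_rms_le hρ hO hε fun hg => herr hg n (.inl le_rfl)⟩
    refine (terms_bound hn (one_le_terms hO hOw) hY (by push_cast; linarith) hL rfl).trans
      (le_of_eq ?_)
    rw [rpow_inv_eq hε]
    congr 2
    ring
  · intro n d N A U g ε c O ρ hn h0 h1 hε hε1 hO hρ
    obtain ⟨K, L, l, hY, hK, hL, hl, hl', hruns, herr⟩ := exists_params h0 h1 hε hε1
    have hn' : (1 : ℝ) ≤ n := by exact_mod_cast hn
    have h7 : 0 ≤ 2 * stepCost * Real.exp 7 := by positivity
    have hΛ : 0 ≤ Real.log (1 / strength g) / strength g :=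
      div_nonneg ((strength_pos h0 h1).le.trans (log_strength h0 h1).1) (strength_pos h0 h1).le
    have hE : 0 ≤ Real.log (1 / ε) / strength g :=
      div_nonneg (Real.log_nonneg (by rw [one_div]; exact (one_le_inv₀ hε).mpr hε1.le))
        (strength_pos h0 h1).le
    refine ⟨_, fun s i => enum_computes s (ρ i) hn (fun Q => hruns Q n d 0) ?_,
      uniform_rms_le hρ hO hε fun hg => herr hg l (.inr rfl)⟩
    rw [rpow_inv_eq hε, mul_left_comm (Real.log (1 / ε))]
    refine enum_bound ?_ ?_ hY (by push_cast; linarith) hL rfl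
    · rw [← Real.rpow_natCast]
      refine Real.rpow_le_rpow_of_exponent_le hn' (hl'.trans ?_)
      nlinarith
    · exact Real.one_le_rpow hn' (by positivity)
  · intro n d N A U g ε c O ρ hn hd h0 h1 hε hε1 hO hρ
    obtain ⟨κ, hκ, hκ1, hκ2, hκ3⟩ := exists_cap n d h0 h1 hε hε1
    have hn' : (1 : ℝ) ≤ n := by exact_mod_cast hn
    refine ⟨_, fun s i => table_computes s (hρ.2.1 i).2 hn hd hκ hκ1 hκ2 ?_,
      gateBased_rms_le hρ hO h0 h1 hd hε hκ2⟩
    refine table_bound hn hd (Real.one_le_rpow hn' ?_) fun h => ?_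
    · have := one_le_cap_exponent hd h0 h1 hε hε1
      linarith
    · rw [← Real.rpow_natCast]
      exact Real.rpow_le_rpow_of_exponent_le hn' (hκ3 h)
  · intro n d m N A ν g ε c O w P ρ hp hν hn h0 h1 hε hε1 hO hOw hρ
    obtain ⟨L, hL, hL', hruns⟩ := exists_random_param h0 h1 hε hε1
    refine ⟨_, fun U s i => terms_computes s (ρ i) hn hOw (fun Q => hruns Q n d m) ?_,
      fun s₀ => random_error A hp hν h0 h1 hO hρ (fun P _ => wt_le P) hL' s₀⟩
    have hY : 0 ≤ 1 / strength g * Real.log (1 / ε) := le_trans (Nat.cast_nonneg _) hL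
    refine (terms_bound hn (one_le_terms hO hOw) hY (by push_cast; linarith) (by linarith)
      rfl).trans (le_of_eq ?_)
    rw [rpow_inv_eq hε]
    congr 2
    ring
  · intro n d N A ν g ε c O ρ hp hν hn h0 h1 hε hε1 hO hρ
    obtain ⟨L, hL, hL', hruns⟩ := exists_random_param h0 h1 hε hε1
    have hn' : (1 : ℝ) ≤ n := by exact_mod_cast hn
    have hY : 0 ≤ 1 / strength g * Real.log (1 / ε) := le_trans (Nat.cast_nonneg _) hL
    refine ⟨_, fun U s i => enum_computes s (ρ i) hn (fun Q => hruns Q n d 0) ?_,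
      fun s₀ => random_error A hp hν h0 h1 hO hρ (fun P h => h) hL' s₀⟩
    refine (enum_bound (B := (n : ℝ) ^ (1 / strength g * Real.log (1 / ε))) ?_
      (Real.one_le_rpow hn' hY) hY (by push_cast; linarith) (by linarith) rfl).trans (le_of_eq ?_)
    · rw [← Real.rpow_natCast]
      exact Real.rpow_le_rpow_of_exponent_le hn' hL
    · rw [rpow_inv_eq hε, mul_assoc]
      congr 3
      ring
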